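/- Fix physical constants $m_\alpha,T_\alpha,\nu_\alpha>0$ ($\alpha=i,e$), $e>0$, $c>0$, put $q_i=e$, $q_e=-e$, and assume that the cubic $$g(X)=X^3+(\nu_i+\nu_e)X^2+\Big(\nu_i\nu_e+4\pi\big(\tfrac{e^2}{m_i}+\tfrac{e^2}{m_e}\big)\Big)X+4\pi\Big(\tfrac{e^2}{m_i}\nu_e+\tfrac{e^2}{m_e}\nu_i\Big)$$ has non-zero discriminant. For real data $U_0=[\rho_{\alpha0},u_{\alpha0},E_0,B_0]\in L^2(\mathbb R^3)$ satisfying $\nabla\cdot E_0=4\pi\sum_\alpha q_\alpha\rho_{\alpha0}$ and $\nabla\cdot B_0=0$, let $U(t)=e^{tL}U_0=[\rho_\alpha,u_\alpha,E,B](t)\in C([0,\infty);L^2)$ denote the solution, in the sense of tempered distributions, of the linearized two-fluid Euler–Maxwell system $$\begin{aligned}&\partial_t\rho_\alpha+\nabla\cdot u_\alpha=0,\qquad m_\alpha\partial_tu_\alpha+T_\alpha\nabla\rho_\alpha-q_\alpha E+m_\alpha\nu_\alpha u_\alpha=0,\\&\partial_tE-c\nabla\times B+4\pi\sum_{\alpha}q_\alpha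 u_\alpha=0,\qquad\partial_tB+c\nabla\times E=0,\\&\nabla\cdot E=4\pi\sum_\alpha q_\alpha\rho_\alpha,\qquad\nabla\cdot B=0,\end{aligned}$$ with $U(0)=U_0$. Write $f_\alpha=m_\alpha\nu_\alpha$, $F=f_i+f_e$, $\mu_1=\frac{T_i+T_e}{F}$, $\mu_2=\frac{c^2f_if_e}{4\pi e^2F}$, $\kappa_i=\frac{c}{4\pi e}\frac{f_e}{F}$, $\kappa_e=-\frac{c}{4\pi e}\frac{f_i}{F}$, and define, for $t\ge0$, the profile $$\bar\rho(t)=e^{t\mu_1\Delta}\Big(\tfrac{f_i}{F}\rho_{i0}+\tfrac{f_e}{F}\rho_{e0}\Big),\qquad\bar B(t)=e^{t\mu_2\Delta}B_0,$$ $$\bar u_\alpha=-\mu_1\nabla\bar\rho+\kappa_\alpha\nabla\times\bar B,\qquad\bar E=\frac{T_if_e-T_ef_i}{eF}\nabla\bar\rho+\frac{c}{4\pi e^2}\frac{f_if_e}{F}\nabla\times\bar B .$$ For real $\ell\ge0$ put $[\ell+3(\frac1r-\frac1q)]_+=\ell$ if $\ell$ is an integer and $r=q=2$, and $[\ell+3(\frac1r-\frac1q)]_+=\lfloor\ell+3(\frac1r-\frac1q)\rfloor+1$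 otherwise. Put $\theta=\frac32(\frac1p-\frac1q)$. For a tuple of fields, $\|\nabla^k[\cdots]\|_{L^s}$ is the sum of the $L^s$ norms of all distributional partial derivatives of order $k$ of all components, and it is $+\infty$ if one of them is not an $L^s$ function. There is $\lambda>0$, depending only on the physical constants, such that for every integer $m\ge0$, all $1\le p,r\le2\le q\le\infty$ and all real $\ell\ge0$ the following hold. **1. Convergence to the profile.** There is $C=C(m,p,q,r,\ell)$ (also depending on the physical constants) such that for all such $U_0$, all $t\ge0$ and $\alpha=i,e$, with $$\mathcal B_j(t)=(1+t)^{-\theta-\frac{m+j}2}\|U_0\|_{L^p}+e^{-\lambda t}\|U_0\|_{L^p}+(1+t)^{-\frac\ell2}\big\|\nabla^{m+[\ell+3(\frac1r-\frac1q)]_+}U_0\big\|_{L^r},$$ one has $$\|\nabla^m(\rho_\alpha-\bar\rho)(t)\|_{L^q}\le C\Big(\mathcal B_1(t)+e^{-\lambda t}\big\|\nabla^{m+[3(\frac1r-\frac1q)]_+}[\rho_{i0},\rho_{e0}]\big\|_{L^r}\Big),$$ $$\|\nabla^m(u_\alpha-\bar u_\alpha)(t)\|_{L^q}\ \text{and}\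 \|\nabla^m(E-\bar E)(t)\|_{L^q}\ \le\ C\Big(\mathcal B_2(t)+e^{-\lambda t}\big\|\nabla^{m+1+[3(\frac1r-\frac1q)]_+}[\rho_{i0},\rho_{e0},B_0]\big\|_{L^r}\Big),$$ $$\|\nabla^m(B-\bar B)(t)\|_{L^q}\le C\Big(\mathcal B_1(t)+e^{-\lambda t}\big\|\nabla^{m+[3(\frac1r-\frac1q)]_+}B_0\big\|_{L^r}\Big).$$ **2. Decay.** With the same $C$, the quantities $\|\nabla^m\rho_\alpha(t)\|_{L^q}$, $\|\nabla^mu_\alpha(t)\|_{L^q}$, $\|\nabla^mE(t)\|_{L^q}$, $\|\nabla^mB(t)\|_{L^q}$ are bounded by the same respective right-hand sides with, inside the bracket multiplied by $C$, the additional term $$(1+t)^{-\theta-\frac m2}\|[\rho_{i0},\rho_{e0}]\|_{L^p}\ \text{ for }\rho_\alpha,\qquad(1+t)^{-\theta-\frac m2}\|B_0\|_{L^p}\ \text{ for }B,$$ $$(1+t)^{-\theta-\frac{m+1}2}\|[\rho_{i0},\rho_{e0},B_0]\|_{L^p}\ \text{ for }u_\alpha\text{ and }E .$$ **3. Optimality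 of the heat rate for general data.** If $\sigma\in\mathbb R$ and $C'\ge 0$ are such that for one $\alpha\in\{i,e\}$ and for all such $U_0$ and all $t\ge0$ $$\|\nabla^m\rho_\alpha(t)\|_{L^q}\le C'(1+t)^{-\sigma}\Big(\|U_0\|_{L^p}+\big\|\nabla^{m+[\ell+3(\frac1r-\frac1q)]_+}U_0\big\|_{L^r}+\big\|\nabla^{m+[3(\frac1r-\frac1q)]_+}[\rho_{i0},\rho_{e0},B_0]\big\|_{L^r}\Big),$$ then $\sigma\le\theta+\frac m2$. The same holds with $B$ in place of $\rho_\alpha$ on the left-hand side. -/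

import Mathlib

open MeasureTheory SchwartzMap LineDeriv
open scoped ENNReal NNReal

noncomputable section

namespace EulerMaxwell

/-! ## Physical parameters -/

/-- The two species: ions and electrons. -/
inductive Species
  | ion
  | electron

/-- Physical constants: masses `m`, temperatures `T`, collision frequencies `ν` of the two species,
elementary charge `e` and speed of light `c`, all positive. -/
structure Plasma where
  m : Species → ℝ
  T : Species → ℝ
  ν : Species → ℝ
  e : ℝ
  c : ℝ
  m_pos : ∀ a, 0 < m a
  T_pos : ∀ a, 0 < T a
  ν_pos : ∀ a, 0 < ν a
  e_pos : 0 < e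
  c_pos : 0 < c

namespace Plasma

variable (P : Plasma)

/-- The charges `q_i = e` and `q_e = -e`. -/
def q : Species → ℝ
  | .ion => P.e
  | .electron => -P.e

/-- The friction coefficient `m_α ν_α`. -/
def f (a : Species) : ℝ := P.m a * P.ν a

/-- `m_i ν_i + m_e ν_e`. -/
def F : ℝ := P.f .ion + P.f .electron

/-- The ambipolar diffusion coefficient `μ₁`. -/
def μ₁ : ℝ := (P.T .ion + P.T .electron) / P.F

/-- The magnetic diffusion coefficient `μ₂`. -/
def μ₂ : ℝ := P.c ^ 2 * P.f .ion * P.f .electron / (4 * Real.pi * P.e ^ 2 * P.F)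

/-- The coefficient of `curl B̄` in the velocity profile `ū_α`. -/
def κ : Species → ℝ
  | .ion => P.c / (4 * Real.pi * P.e) * (P.f .electron / P.F)
  | .electron => -(P.c / (4 * Real.pi * P.e) * (P.f .ion / P.F))

/-- The discriminant of the cubic polynomial
`g(X) = X³ + (ν_i + ν_e) X² + (ν_i ν_e + 4π (e²/m_i + e²/m_e)) X
  + 4π (e² ν_e / m_i + e² ν_i / m_e)`. -/
def disc : ℝ :=
  let c₂ := P.ν .ion + P.ν .electron
  let c₁ := P.ν .ion * P.ν .electron
    + 4 * Real.pi * (P.e ^ 2 / P.m .ion + P.e ^ 2 / P.m .electron)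
  let c₀ := 4 * Real.pi * (P.e ^ 2 / P.m .ion * P.ν .electron
    + P.e ^ 2 / P.m .electron * P.ν .ion)
  18 * c₂ * c₁ * c₀ - 4 * c₂ ^ 3 * c₀ + c₂ ^ 2 * c₁ ^ 2 - 4 * c₁ ^ 3 - 27 * c₀ ^ 2

end Plasma

/-! ## Fields on `ℝ³` -/

/-- The physical space `ℝ³`. -/
abbrev Space := EuclideanSpace ℝ (Fin 3)

/-- The real space `L²(ℝ³)`. -/
abbrev L2 := Lp ℝ 2 (volume : Measure Space)

/-- Tempered distributions on `ℝ³`. -/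
abbrev Dist := 𝓢'(Space, ℂ)

/-- A real `L²` function as a tempered distribution. -/
def toDist (f : L2) : Dist :=
  Lp.toTemperedDistribution (Complex.ofRealCLM.compLp f : Lp ℂ 2 (volume : Measure Space))

/-- The `j`-th standard unit vector. -/
def basisVec (j : Fin 3) : Space := EuclideanSpace.single j 1

/-- The distributional partial derivative `∂_j`. -/
def pderiv (j : Fin 3) (T : Dist) : Dist := ∂_{basisVec j} T

/-- Divergence of a vector field. -/
def div (v : Fin 3 → Dist) : Dist := ∑ j, pderiv j (v j)

/-- Curl of a vector field (index arithmetic modulo `3`). -/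
def curl (v : Fin 3 → Dist) (j : Fin 3) : Dist :=
  pderiv (j + 1) (v (j + 2)) - pderiv (j + 2) (v (j + 1))

/-- A tuple `[ρ_α, u_α, E, B]` with scalar components in `X`. -/
structure Fields (X : Type) where
  ρ : Species → X
  u : Species → Fin 3 → X
  E : Fin 3 → X
  B : Fin 3 → X

/-- A tuple of `L²` fields as a tuple of tempered distributions. -/
def Fields.toDist (U : Fields L2) : Fields Dist where
  ρ a := EulerMaxwell.toDist (U.ρ a)
  u a j := EulerMaxwell.toDist (U.u a j)
  E j := EulerMaxwell.toDist (U.E j)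
  B j := EulerMaxwell.toDist (U.B j)

/-! ## Norms -/

/-- The `L^s` norm of a tempered distribution; it is `∞` if the distribution is not given by an
`L^s` function. -/
def distNorm (s : ℝ≥0∞) (T : Dist) : ℝ≥0∞ :=
  ⨅ (g : Space → ℂ) (_ : MemLp g s volume ∧ ∀ φ : 𝓢(Space, ℂ), T φ = ∫ x, φ x * g x),
    eLpNorm g s volume

/-- `‖∇ᵏ T‖_{L^s}` of a scalar distribution: the sum of the `L^s` norms of all the
derivatives `∂_{j₁} ⋯ ∂_{j_k} T`. -/
def nablaNorm (k : ℕ) (s : ℝ≥0∞) (T : Dist) : ℝ≥0∞ :=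
  ∑ J : Fin k → Fin 3, distNorm s (∂^{fun i => basisVec (J i)} T)

/-- `‖∇ᵏ v‖_{L^s}` of a vector field. -/
def nablaNormVec (k : ℕ) (s : ℝ≥0∞) (v : Fin 3 → Dist) : ℝ≥0∞ :=
  ∑ j, nablaNorm k s (v j)

/-- `‖∇ᵏ [ρ_i, ρ_e]‖_{L^s}`. -/
def nablaNormRho (k : ℕ) (s : ℝ≥0∞) (V : Fields Dist) : ℝ≥0∞ :=
  nablaNorm k s (V.ρ .ion) + nablaNorm k s (V.ρ .electron)

/-- `‖∇ᵏ [ρ_i, ρ_e, B]‖_{L^s}`. -/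
def nablaNormRhoB (k : ℕ) (s : ℝ≥0∞) (V : Fields Dist) : ℝ≥0∞ :=
  nablaNormRho k s V + nablaNormVec k s V.B

/-- `‖∇ᵏ [ρ_i, ρ_e, u_i, u_e, E, B]‖_{L^s}`. -/
def nablaNormAll (k : ℕ) (s : ℝ≥0∞) (V : Fields Dist) : ℝ≥0∞ :=
  nablaNormRho k s V + nablaNormVec k s (V.u .ion) + nablaNormVec k s (V.u .electron)
    + nablaNormVec k s V.E + nablaNormVec k s V.B

open Classical in
/-- The index `[ℓ + 3(1/r - 1/q)]₊`: it is `ℓ` if `ℓ` is an integer and `r = q = 2`, and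
one plus the integer part of `ℓ + 3(1/r - 1/q)` otherwise. -/
def plusIndex (ℓ : ℝ) (r q : ℝ≥0∞) : ℕ :=
  if (∃ n : ℕ, (n : ℝ) = ℓ) ∧ r = 2 ∧ q = 2 then ⌊ℓ⌋₊
  else ⌊ℓ + 3 * ((r⁻¹).toReal - (q⁻¹).toReal)⌋₊ + 1

/-- The exponent `(3/2)(1/p - 1/q)`. -/
def heatExp (p q : ℝ≥0∞) : ℝ := 3 / 2 * ((p⁻¹).toReal - (q⁻¹).toReal)

/-- The weight `(1 + t)^{-s}`. -/
def algDecay (t s : ℝ) : ℝ≥0∞ := ENNReal.ofReal ((1 + t) ^ (-s))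

/-- The weight `exp(-lam t)`. -/
def expDecay (lam t : ℝ) : ℝ≥0∞ := ENNReal.ofReal (Real.exp (-(lam * t)))

/-! ## The linearized system -/

/-- `∂_t F = F'` on `[0, ∞)` in the sense of tempered distributions (one-sided at `t = 0`). -/
def HasTimeDeriv (F F' : ℝ → Dist) : Prop :=
  ∀ φ : 𝓢(Space, ℂ), ∀ t : ℝ, 0 ≤ t →
    HasDerivWithinAt (fun s => F s φ) (F' t φ) (Set.Ici 0) t

/-- The constraints `div E = 4π ∑ q_α ρ_α` and `div B = 0`. -/
def Compatible (P : Plasma) (V : Fields Dist) : Prop :=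
  div V.E = (4 * Real.pi) • (P.q .ion • V.ρ .ion + P.q .electron • V.ρ .electron) ∧
    div V.B = 0

/-- `U(t) = e^{tL} U₀`: `U` is the solution in `C([0, ∞); L²)` of the Cauchy problem of the
linearized homogeneous Euler-Maxwell system with compatible initial data `U₀`. -/
structure IsSolution (P : Plasma) (U₀ : Fields L2) (U : ℝ → Fields L2) : Prop where
  cont_ρ : ∀ a, ContinuousOn (fun t => (U t).ρ a) (Set.Ici 0)
  cont_u : ∀ a j, ContinuousOn (fun t => (U t).u a j) (Set.Ici 0)
  cont_E : ∀ j, ContinuousOn (fun t => (U t).E j) (Set.Ici 0)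
  cont_B : ∀ j, ContinuousOn (fun t => (U t).B j) (Set.Ici 0)
  init : U 0 = U₀
  compatible : ∀ t, 0 ≤ t → Compatible P (U t).toDist
  eq_ρ : ∀ a, HasTimeDeriv (fun t => (U t).toDist.ρ a) (fun t => -div ((U t).toDist.u a))
  eq_u : ∀ a j, HasTimeDeriv (fun t => P.m a • (U t).toDist.u a j)
    (fun t => -(P.T a • pderiv j ((U t).toDist.ρ a)) + P.q a • (U t).toDist.E j
      - (P.m a * P.ν a) • (U t).toDist.u a j)
  eq_E : ∀ j, HasTimeDeriv (fun t => (U t).toDist.E j)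
    (fun t => P.c • curl (U t).toDist.B j
      - (4 * Real.pi) • (P.q .ion • (U t).toDist.u .ion j
        + P.q .electron • (U t).toDist.u .electron j))
  eq_B : ∀ j, HasTimeDeriv (fun t => (U t).toDist.B j)
    (fun t => -(P.c • curl (U t).toDist.E j))

/-! ## The diffusive profile -/

/-- The heat semigroup `e^{t μ Δ}`, i.e. multiplication of the Fourier transform by
`exp(-μ |ξ|² t)`; the frequency variable of Mathlib's Fourier transform is `k = ξ / 2π`. -/
def heat (μ t : ℝ) (T : Dist) : Dist :=
  TemperedDistribution.fourierMultiplierCLM ℂ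
    (fun k : Space => ((Real.exp (-(μ * (2 * Real.pi * ‖k‖) ^ 2 * t)) : ℝ) : ℂ)) T

/-- The density profile `ρ̄(t)`: the diffusion wave with coefficient `μ₁` that starts from
`(m_i ν_i ρ_{i0} + m_e ν_e ρ_{e0}) / (m_i ν_i + m_e ν_e)`. -/
def rhoBar (P : Plasma) (V₀ : Fields Dist) (t : ℝ) : Dist :=
  heat P.μ₁ t ((P.f .ion / P.F) • V₀.ρ .ion + (P.f .electron / P.F) • V₀.ρ .electron)

/-- The magnetic profile `B̄(t)`: the diffusion wave with coefficient `μ₂` that starts from `B₀`. -/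
def BBar (P : Plasma) (V₀ : Fields Dist) (t : ℝ) (j : Fin 3) : Dist :=
  heat P.μ₂ t (V₀.B j)

/-- The velocity profile `ū_α(t) = -μ₁ ∇ρ̄(t) + κ_α ∇ × B̄(t)`. -/
def uBar (P : Plasma) (V₀ : Fields Dist) (a : Species) (t : ℝ) (j : Fin 3) : Dist :=
  -(P.μ₁ • pderiv j (rhoBar P V₀ t)) + P.κ a • curl (BBar P V₀ t) j

/-- The electric profile `Ē(t)`. -/
def EBar (P : Plasma) (V₀ : Fields Dist) (t : ℝ) (j : Fin 3) : Dist :=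
  ((P.T .ion * P.f .electron - P.T .electron * P.f .ion) / (P.e * P.F)) •
      pderiv j (rhoBar P V₀ t)
    + (P.c / (4 * Real.pi * P.e ^ 2) * (P.f .ion * P.f .electron / P.F)) •
      curl (BBar P V₀ t) j

/-- The part common to all the estimates:
`(1+t)^{-(3/2)(1/p-1/q)-k/2} ‖U₀‖_p + e^{-lam t} ‖U₀‖_p + (1+t)^{-ℓ/2} ‖∇^{m+[ℓ+3(1/r-1/q)]₊} U₀‖_r`. -/
def baseBound (lam : ℝ) (m : ℕ) (p q r : ℝ≥0∞) (ℓ : ℝ) (k : ℕ) (V₀ : Fields Dist) (t : ℝ) :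
    ℝ≥0∞ :=
  algDecay t (heatExp p q + k / 2) * nablaNormAll 0 p V₀
    + expDecay lam t * nablaNormAll 0 p V₀
    + algDecay t (ℓ / 2) * nablaNormAll (m + plusIndex ℓ r q) r V₀

/-- The norm `‖U₀‖_p + ‖∇^{m+[ℓ+3(1/r-1/q)]₊} U₀‖_r + ‖∇^{m+[3(1/r-1/q)]₊} [ρ_{i0}, ρ_{e0}, B₀]‖_r`
of the initial data. -/
def dataNorm (m : ℕ) (p q r : ℝ≥0∞) (ℓ : ℝ) (V₀ : Fields Dist) : ℝ≥0∞ :=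
  nablaNormAll 0 p V₀ + nablaNormAll (m + plusIndex ℓ r q) r V₀
    + nablaNormRhoB (m + plusIndex 0 r q) r V₀

end EulerMaxwell

end

/-! ### Tempered distributions whose Fourier transform is a function -/

section

open MeasureTheory SchwartzMap LineDeriv
open scoped ENNReal NNReal
open FourierTransform

namespace EulerMaxwell

/-! After a Fourier transform the system becomes, at each frequency ξ, a linear ODE for finitely
many complex amplitudes. The Hausdorff–Young inequality passes from data in `L^p` to `L^{p'}` in
frequency and back from `L^{q'}` to `L^q`. Hölder's inequality with explicit weights does the rest,
so everything reduces to pointwise bounds on the amplitudes. These bounds come from energy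
arguments; the symbol is never diagonalised.

The energy dissipates only the velocities. Three correctors, coupling density to velocity, velocity
to electric field and electric to magnetic field, transfer the dissipation to all components. The
resulting functional decays like `exp(-c |ξ|² t / (1 + |ξ|²)²)` (`energy_decay`). For `|ξ| ≥ 1` the
rate is only `t / |ξ|²`, and the exponential is at most a constant times `(1+t)^(-ℓ/2) |ξ|^ℓ`: decay
is bought with derivatives of the data (`high_freq_le`).

For `|ξ| ≤ 1` slow and fast variables are separated. Gauss's law makes the two densities agree up to
`O(|ξ|)`. Small corrections turn the equations of the friction weighted density and of the magnetic
field into heat equations with coefficients `μ₁` and `μ₂`, up to higher order terms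
(`Orbit.density_slow_deriv`, `Orbit.magnetic_slow_deriv`). The coefficients of the velocity and
electric profiles are those for which the lowest order terms balance. The deviations from the
instantaneous profiles therefore solve a damped plasma oscillation with forcing `O(|ξ|²)`; up to an
exponentially small remainder they are of second order (`forced_decay`). Comparing the slow
variables with the exact heat flow gives `Orbit.low_le`, one power of `|ξ|` better than the size of
the profile itself. This gain is the extra half power of `1 + t` in the convergence estimates.

Solutions are given only in the sense of distributions, so it must be shown that their Fourier
transforms follow the ODE at almost every frequency. This is a duality argument with a cut-off
exponential of the symbol (`weak_evolution`).

For optimality, data with Fourier transform `w(k/ε)` are observed at time `ε⁻²`. The profile then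
scales exactly like `ε^(m+3-3/q)`, the convergence estimate with `ℓ = 1` makes the error smaller by
a factor `ε`, and the data norm is `O(ε^(3-3/p))`. Comparison of powers of `ε` bounds σ (`rate_le`).
The solutions needed here are built from the same cut-off exponential (`exists_isSolution`). -/

/-- The Fourier transform of the tempered distribution `T` is given by the function `h`. -/
structure HasFT (T : Dist) (h : Space → ℂ) : Prop where
  integrable : ∀ φ : 𝓢(Space, ℂ), Integrable (fun k => φ k * h k)
  apply_fourier : ∀ φ : 𝓢(Space, ℂ), T (𝓕 φ) = ∫ k, φ k * h k

/-- The symbol `2πi k_j` of `∂_j`. -/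
noncomputable def ik (j : Fin 3) (k : Space) : ℂ := (2 * Real.pi * Complex.I) * (k j : ℂ)

/-- The Fourier transform of a real `L²` function. -/
noncomputable def hat (f : L2) : Lp ℂ 2 (volume : Measure Space) :=
  𝓕 (Complex.ofRealCLM.compLp f : Lp ℂ 2 (volume : Measure Space))

theorem hasFT_Lp (f : Lp ℂ 2 (volume : Measure Space)) :
    HasFT (Lp.toTemperedDistribution f) (𝓕 f : Lp ℂ 2 (volume : Measure Space)) where
  integrable φ := by
    have := (φ.memLp 2 (volume : Measure Space)).integrable_mul (Lp.memLp (𝓕 f))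
    exact this
  apply_fourier φ := by
    rw [← TemperedDistribution.fourier_apply, Lp.fourier_toTemperedDistribution_eq]
    simp

theorem hasFT_toDist (f : L2) : HasFT (toDist f) (hat f) := hasFT_Lp _

namespace HasFT

variable {T S : Dist} {h g : Space → ℂ}

theorem congr (hT : HasFT T h) (hg : h =ᵐ[volume] g) : HasFT T g where
  integrable φ := (hT.integrable φ).congr (by filter_upwards [hg] with k hk; rw [hk])
  apply_fourier φ := by
    rw [hT.apply_fourier]
    exact integral_congr_ae (by filter_upwards [hg] with k hk; rw [hk])

theorem add (hT : HasFT T h) (hS : HasFT S g) : HasFT (T + S) (fun k => h k + g k) where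
  integrable φ := by
    simpa only [mul_add] using! (hT.integrable φ).add (hS.integrable φ)
  apply_fourier φ := by
    simp only [mul_add]
    rw [integral_add (hT.integrable φ) (hS.integrable φ), ← hT.apply_fourier, ← hS.apply_fourier]
    rfl

theorem smul (c : ℂ) (hT : HasFT T h) : HasFT (c • T) (fun k => c * h k) where
  integrable φ := by
    simpa only [mul_left_comm] using! (hT.integrable φ).const_mul c
  apply_fourier φ := by
    simp only [mul_left_comm]
    rw [integral_const_mul, ← hT.apply_fourier]
    rfl

theorem rsmul (c : ℝ) (hT : HasFT T h) : HasFT (c • T) (fun k => (c : ℂ) * h k) := by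
  have : c • T = (c : ℂ) • T := by ext φ; simp
  rw [this]; exact hT.smul c

theorem neg (hT : HasFT T h) : HasFT (-T) (fun k => -h k) := by
  have := hT.smul (-1)
  have e : (-1 : ℂ) • T = -T := by ext φ; simp
  rw [e] at this
  simpa using this

theorem sub (hT : HasFT T h) (hS : HasFT S g) : HasFT (T - S) (fun k => h k - g k) := by
  simpa only [sub_eq_add_neg] using hT.add hS.neg

theorem zero : HasFT 0 (fun _ => 0) where
  integrable φ := by simp
  apply_fourier φ := by simp

theorem sum {ι : Type*} (s : Finset ι) {T : ι → Dist} {h : ι → Space → ℂ}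
    (hT : ∀ i ∈ s, HasFT (T i) (h i)) : HasFT (∑ i ∈ s, T i) (fun k => ∑ i ∈ s, h i k) := by
  classical
  induction s using Finset.induction_on with
  | empty => simpa using HasFT.zero
  | insert a s ha ih =>
    simp only [Finset.sum_insert ha]
    exact (hT a (by simp)).add (ih fun i hi => hT i (by simp [hi]))

theorem multiplier {m : Space → ℂ} (hm : m.HasTemperateGrowth) (hT : HasFT T h) :
    HasFT (TemperedDistribution.fourierMultiplierCLM ℂ m T) (fun k => m k * h k) where
  integrable φ := by
    have := hT.integrable (SchwartzMap.smulLeftCLM ℂ m φ)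
    simp only [SchwartzMap.smulLeftCLM_apply_apply hm, smul_eq_mul] at this
    simpa only [mul_assoc, mul_left_comm] using this
  apply_fourier φ := by
    rw [TemperedDistribution.fourierMultiplierCLM_apply_apply]
    simp only [fourierInv_fourier_eq]
    rw [hT.apply_fourier]
    simp only [SchwartzMap.smulLeftCLM_apply_apply hm, smul_eq_mul]
    congr 1; ext k; ring

theorem pderiv (j : Fin 3) (hT : HasFT T h) :
    HasFT (EulerMaxwell.pderiv j T) (fun k => ik j k * h k) := by
  have hm : (fun k : Space => ((inner ℝ k (basisVec j) : ℝ) : ℂ)).HasTemperateGrowth := by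
    fun_prop
  have := (hT.multiplier hm).smul (2 * Real.pi * Complex.I)
  rw [EulerMaxwell.pderiv, TemperedDistribution.lineDeriv_eq_fourierMultiplierCLM]
  refine this.congr (.of_forall fun k => ?_)
  simp [ik, basisVec, EuclideanSpace.inner_single_right]
  ring

theorem iterated {n : ℕ} (J : Fin n → Fin 3) (hT : HasFT T h) :
    HasFT (∂^{fun i => basisVec (J i)} T) (fun k => (∏ i, ik (J i) k) * h k) := by
  induction n with
  | zero => simpa using hT
  | succ n ih =>
    rw [iteratedLineDerivOp_succ_left]
    have := (ih (fun i => J i.succ)).pderiv (J 0)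
    refine this.congr (.of_forall fun k => ?_)
    simp only [Fin.prod_univ_succ]; ring

theorem div {v : Fin 3 → Dist} {h : Fin 3 → Space → ℂ} (hv : ∀ j, HasFT (v j) (h j)) :
    HasFT (EulerMaxwell.div v) (fun k => ∑ j, ik j k * h j k) :=
  HasFT.sum _ fun j _ => (hv j).pderiv j

theorem curl {v : Fin 3 → Dist} {h : Fin 3 → Space → ℂ} (hv : ∀ j, HasFT (v j) (h j)) (j : Fin 3) :
    HasFT (EulerMaxwell.curl v j)
      (fun k => ik (j + 1) k * h (j + 2) k - ik (j + 2) k * h (j + 1) k) :=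
  ((hv _).pderiv _).sub ((hv _).pderiv _)

/-- A bump function equal to one near a point is Schwartz, so integrability against all Schwartz
functions contains local integrability. -/
theorem locallyIntegrable (hT : HasFT T h) : LocallyIntegrable h := by
  intro x
  let f : ContDiffBump x := ⟨1, 2, one_pos, one_lt_two⟩
  have h1 : HasCompactSupport (Complex.ofRealCLM ∘ f) := f.hasCompactSupport.comp_left rfl
  have h2 : ContDiff ℝ (⊤ : ℕ∞) (Complex.ofRealCLM ∘ f) := Complex.ofRealCLM.contDiff.comp f.contDiff
  have := hT.integrable (h1.toSchwartzMap h2)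
  refine ⟨Metric.closedBall x 1, Metric.closedBall_mem_nhds x one_pos, ?_⟩
  refine (this.integrableOn (s := Metric.closedBall x 1)).congr_fun (fun k hk => ?_)
    measurableSet_closedBall
  simp [f.one_of_mem_closedBall hk]

theorem aestronglyMeasurable (hT : HasFT T h) : AEStronglyMeasurable h :=
  hT.locallyIntegrable.aestronglyMeasurable

/-- Real test functions of compact support are Schwartz and already separate locally integrable
functions. -/
theorem unique (hT : HasFT T h) (hT' : HasFT T g) : h =ᵐ[volume] g := by
  refine ae_eq_of_integral_contDiff_smul_eq hT.locallyIntegrable hT'.locallyIntegrable ?_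
  intro f hf hfc
  have h1 : HasCompactSupport (Complex.ofRealCLM ∘ f) := hfc.comp_left rfl
  have h2 : ContDiff ℝ (⊤ : ℕ∞) (Complex.ofRealCLM ∘ f) := Complex.ofRealCLM.contDiff.comp hf
  have e := (hT.apply_fourier (h1.toSchwartzMap h2)).symm.trans
    (hT'.apply_fourier (h1.toSchwartzMap h2))
  simpa using e

theorem dist_eq (hT : HasFT T h) (hS : HasFT S h) : T = S := by
  ext φ
  have e := (hT.apply_fourier (𝓕⁻ φ)).trans (hS.apply_fourier (𝓕⁻ φ)).symm
  simpa using e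

end HasFT

/-- The Gaussian is `exp(-x)` composed with a nonnegative polynomial. Since `exp(-x)` has bounded
derivatives only on `[0, ∞)`, the composition rule is used relative to that set. Temperate growth is
what makes the heat multiplier act on tempered distributions. -/
theorem hasTemperateGrowth_gaussian {a : ℝ} (ha : 0 ≤ a) :
    (fun k : Space => ((Real.exp (-(a * ‖k‖ ^ 2)) : ℝ) : ℂ)).HasTemperateGrowth := by
  have h0 : (fun k : Space => Real.exp (-(a * ‖k‖ ^ 2))).HasTemperateGrowth := by
    have hf : (fun k : Space => a * ‖k‖ ^ 2).HasTemperateGrowth := by fun_prop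
    have := hf.comp' (g := fun x : ℝ => Real.exp (-x)) (t := Set.Ici 0) ?_ (uniqueDiffOn_Ici 0)
      (by fun_prop) ?_
    · exact this
    · rintro _ ⟨k, rfl⟩; exact Set.mem_Ici.2 (by positivity)
    · intro N
      refine ⟨0, 1, zero_le_one, fun n _ x hx => ?_⟩
      have hcd : ContDiff ℝ n (fun x : ℝ => Real.exp (-x)) := by fun_prop
      rw [norm_iteratedFDerivWithin_eq_norm_iteratedDerivWithin,
        iteratedDerivWithin_eq_iteratedDeriv (uniqueDiffOn_Ici 0) hcd.contDiffAt hx]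
      have : iteratedDeriv n (fun x : ℝ => Real.exp (-x)) x = (-1) ^ n * Real.exp (-x) := by
        have := iteratedDeriv_comp_neg n Real.exp x
        simpa [iteratedDeriv_eq_iterate, Real.iter_deriv_exp] using this
      rw [this]
      simpa using hx
  exact Function.HasTemperateGrowth.comp (g := Complex.ofReal) Function.Complex.hasTemperateGrowth_ofReal h0

theorem HasFT.heat {T : Dist} {h : Space → ℂ} {μ t : ℝ} (hμ : 0 ≤ μ) (ht : 0 ≤ t)
    (hT : HasFT T h) : HasFT (heat μ t T)
      (fun k => ((Real.exp (-(μ * (2 * Real.pi * ‖k‖) ^ 2 * t)) : ℝ) : ℂ) * h k) := by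
  refine HasFT.multiplier ?_ hT
  have := hasTemperateGrowth_gaussian (a := μ * (2 * Real.pi) ^ 2 * t) (by positivity)
  convert this using 5
  ring

end EulerMaxwell

end

/-! ### The Hausdorff–Young inequality -/

section

open MeasureTheory SchwartzMap LineDeriv
open scoped ENNReal NNReal
open FourierTransform

namespace EulerMaxwell

/-- The function `G` is the Fourier transform of the function `g` in the sense of tempered
distributions. -/
structure WeakFT (g G : Space → ℂ) : Prop where
  integrable : ∀ φ : 𝓢(Space, ℂ), Integrable (fun k => φ k * g k)
  integrable_ft : ∀ φ : 𝓢(Space, ℂ), Integrable (fun k => φ k * G k)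
  eq : ∀ φ : 𝓢(Space, ℂ), ∫ k, 𝓕 φ k * g k = ∫ k, φ k * G k

namespace WeakFT

variable {f F g G : Space → ℂ}

theorem hasFT (h : WeakFT g G) {T : Dist} (hT : ∀ φ : 𝓢(Space, ℂ), T φ = ∫ x, φ x * g x) :
    HasFT T G := ⟨h.integrable_ft, fun φ => by rw [hT, h.eq]⟩

theorem add (h : WeakFT g G) (h' : WeakFT f F) :
    WeakFT (fun k => g k + f k) (fun k => G k + F k) where
  integrable φ := by simpa only [mul_add] using! (h.integrable φ).add (h'.integrable φ)
  integrable_ft φ := by simpa only [mul_add] using! (h.integrable_ft φ).add (h'.integrable_ft φ)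
  eq φ := by
    simp only [mul_add]
    rw [integral_add (h.integrable _) (h'.integrable _), integral_add (h.integrable_ft _)
      (h'.integrable_ft _), h.eq, h'.eq]

theorem smul (c : ℂ) (h : WeakFT g G) : WeakFT (fun k => c * g k) (fun k => c * G k) where
  integrable φ := by simpa only [mul_left_comm] using! (h.integrable φ).const_mul c
  integrable_ft φ := by simpa only [mul_left_comm] using! (h.integrable_ft φ).const_mul c
  eq φ := by
    simp only [mul_left_comm _ c]
    rw [integral_const_mul, integral_const_mul, h.eq]

theorem congr (h : WeakFT g G) (hg : g =ᵐ[volume] f) : WeakFT f G where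
  integrable φ := (h.integrable φ).congr (by filter_upwards [hg] with k hk; rw [hk])
  integrable_ft := h.integrable_ft
  eq φ := by
    rw [← h.eq]
    exact integral_congr_ae (by filter_upwards [hg] with k hk; rw [hk])

theorem unique (h : WeakFT g G) (h' : WeakFT g F) : G =ᵐ[volume] F := by
  have loc : ∀ {H}, WeakFT g H → LocallyIntegrable H := by
    intro H h x
    let f : ContDiffBump x := ⟨1, 2, one_pos, one_lt_two⟩
    have h1 : HasCompactSupport (Complex.ofRealCLM ∘ f) := f.hasCompactSupport.comp_left rfl
    have h2 : ContDiff ℝ (⊤ : ℕ∞) (Complex.ofRealCLM ∘ f) :=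
      Complex.ofRealCLM.contDiff.comp f.contDiff
    have := h.integrable_ft (h1.toSchwartzMap h2)
    refine ⟨Metric.closedBall x 1, Metric.closedBall_mem_nhds x one_pos, ?_⟩
    refine (this.integrableOn (s := Metric.closedBall x 1)).congr_fun (fun k hk => ?_)
      measurableSet_closedBall
    simp [f.one_of_mem_closedBall hk]
  refine ae_eq_of_integral_contDiff_smul_eq (loc h) (loc h') ?_
  intro f hf hfc
  have h1 : HasCompactSupport (Complex.ofRealCLM ∘ f) := hfc.comp_left rfl
  have h2 : ContDiff ℝ (⊤ : ℕ∞) (Complex.ofRealCLM ∘ f) := Complex.ofRealCLM.contDiff.comp hf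
  have e := (h.eq (h1.toSchwartzMap h2)).symm.trans (h'.eq (h1.toSchwartzMap h2))
  simpa using e

end WeakFT

theorem memLp_integrable {p : ℝ≥0∞} (hp : 1 ≤ p) {g : Space → ℂ} (hg : MemLp g p volume)
    (φ : 𝓢(Space, ℂ)) : Integrable (fun k => φ k * g k) := by
  have := ENNReal.HolderConjugate.inv_one_sub_inv' hp
  have h := (hg.integrable_mul (φ.memLp (1 - p⁻¹)⁻¹ (volume : Measure Space)))
  exact h.congr (.of_forall fun k => mul_comm _ _)

/-- Plancherel: the `L²` endpoint of the interpolation. -/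
theorem weakFT_two {g : Space → ℂ} (hg : MemLp g 2 volume) :
    ∃ G, WeakFT g G ∧ MemLp G 2 volume ∧ eLpNorm G 2 volume = eLpNorm g 2 volume := by
  refine ⟨(𝓕 (hg.toLp g) : Lp ℂ 2 (volume : Measure Space)),
    ⟨memLp_integrable one_le_two hg,
    memLp_integrable one_le_two (Lp.memLp _), fun φ => ?_⟩, Lp.memLp _, ?_⟩
  · have := (hasFT_Lp (hg.toLp g)).apply_fourier φ
    rw [← this]
    simp only [Lp.toTemperedDistribution_apply, smul_eq_mul]
    exact integral_congr_ae (by filter_upwards [hg.coeFn_toLp] with k hk; rw [hk])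
  · have := Lp.norm_fourier_eq (hg.toLp g)
    rw [Lp.norm_def, Lp.norm_def, ENNReal.toReal_eq_toReal_iff' (Lp.eLpNorm_ne_top _)
      (Lp.eLpNorm_ne_top _)] at this
    rw [this, eLpNorm_congr_ae hg.coeFn_toLp]

/-- The `L¹` endpoint: the transform is an honest integral, and the multiplication formula
identifies it with the distributional one. -/
theorem weakFT_one {g : Space → ℂ} (hg : Integrable g) :
    WeakFT g (𝓕 g) ∧ (∀ k, ‖𝓕 g k‖ ≤ ∫ x, ‖g x‖) ∧ MemLp (𝓕 g) ∞ volume := by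
  have hb : ∀ k, ‖𝓕 g k‖ ≤ ∫ x, ‖g x‖ := fun k =>
    VectorFourier.norm_fourierIntegral_le_integral_norm _ _ _ _ _
  have hc : Continuous (𝓕 g) :=
    VectorFourier.fourierIntegral_continuous Real.continuous_fourierChar continuous_inner hg
  have hm : MemLp (𝓕 g) ∞ volume := memLp_top_of_bound hc.aestronglyMeasurable _ (.of_forall hb)
  refine ⟨⟨memLp_integrable le_rfl (memLp_one_iff_integrable.2 hg),
    memLp_integrable le_top hm, fun φ => ?_⟩, hb, hm⟩
  have := VectorFourier.integral_fourierIntegral_smul_eq_flip (L := innerₗ Space) (f := φ) (g := g)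
    Real.continuous_fourierChar continuous_inner (φ.integrable (μ := volume)) hg
  rw [flip_innerₗ] at this
  exact this


/-! ### Real interpolation between `L¹` and `L²` -/

section Interpolation

variable {p P : ℝ}

/-- The part of `g` below the level `s` is in `L²`, the part above is integrable. -/
theorem split_level (hp1 : 1 < p) (hp2 : p < 2) {g : Space → ℂ} (hm : Measurable g)
    (hg : ∫⁻ x, ENNReal.ofReal (‖g x‖ ^ p) = 1) {s : ℝ} (hs : 0 < s) :
    MemLp (fun x => if ‖g x‖ ≤ s then g x else 0) 2 volume ∧
    Integrable (fun x => if ‖g x‖ ≤ s then 0 else g x) ∧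
    ∫ x, ‖(if ‖g x‖ ≤ s then 0 else g x : ℂ)‖ ≤ s ^ (1 - p) := by
  have hS : MeasurableSet {x | ‖g x‖ ≤ s} := measurableSet_le hm.norm measurable_const
  have hm1 : Measurable (fun x => if ‖g x‖ ≤ s then g x else 0) :=
    Measurable.ite hS hm measurable_const
  have hm2 : Measurable (fun x => if ‖g x‖ ≤ s then 0 else g x) :=
    Measurable.ite hS measurable_const hm
  have key : ∫⁻ x, ‖(if ‖g x‖ ≤ s then 0 else g x : ℂ)‖ₑ ≤ ENNReal.ofReal (s ^ (1 - p)) := by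
    calc ∫⁻ x, ‖(if ‖g x‖ ≤ s then 0 else g x : ℂ)‖ₑ
        ≤ ∫⁻ x, ENNReal.ofReal (s ^ (1 - p)) * ENNReal.ofReal (‖g x‖ ^ p) := by
          refine lintegral_mono fun x => ?_
          dsimp only
          split_ifs with hx
          · simp
          · push Not at hx
            rw [← ENNReal.ofReal_mul (by positivity), ← ofReal_norm]
            refine ENNReal.ofReal_le_ofReal ?_
            have hpos : 0 < ‖g x‖ := hs.trans hx
            calc ‖g x‖ = ‖g x‖ ^ (1 - p) * ‖g x‖ ^ p := by
                  rw [← Real.rpow_add hpos]; simp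
              _ ≤ s ^ (1 - p) * ‖g x‖ ^ p := by
                  exact mul_le_mul_of_nonneg_right
                    (Real.rpow_le_rpow_of_nonpos hs hx.le (by linarith)) (by positivity)
      _ = ENNReal.ofReal (s ^ (1 - p)) := by
          rw [lintegral_const_mul' _ _ ENNReal.ofReal_ne_top, hg, mul_one]
  refine ⟨⟨hm1.aestronglyMeasurable, ?_⟩, ⟨hm2.aestronglyMeasurable, ?_⟩, ?_⟩
  · rw [eLpNorm_lt_top_iff_lintegral_rpow_enorm_lt_top (by norm_num) (by norm_num)]
    calc ∫⁻ x, ‖(if ‖g x‖ ≤ s then g x else 0 : ℂ)‖ₑ ^ (2 : ℝ≥0∞).toReal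
        ≤ ∫⁻ x, ENNReal.ofReal (s ^ (2 - p)) * ENNReal.ofReal (‖g x‖ ^ p) := by
          refine lintegral_mono fun x => ?_
          dsimp only
          split_ifs with hx
          · rw [← ENNReal.ofReal_mul (by positivity), ← ofReal_norm,
              ENNReal.ofReal_rpow_of_nonneg (norm_nonneg _) (by norm_num)]
            refine ENNReal.ofReal_le_ofReal ?_
            rcases (norm_nonneg (g x)).eq_or_lt with h0 | hpos
            · rw [← h0]; simp; positivity
            calc ‖g x‖ ^ (2 : ℝ≥0∞).toReal = ‖g x‖ ^ (2 - p) * ‖g x‖ ^ p := by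
                  rw [← Real.rpow_add hpos]; simp
              _ ≤ s ^ (2 - p) * ‖g x‖ ^ p := by
                  gcongr
          · simp
      _ < ∞ := by
          rw [lintegral_const_mul' _ _ ENNReal.ofReal_ne_top, hg, mul_one]
          exact ENNReal.ofReal_lt_top
  · exact key.trans_lt ENNReal.ofReal_lt_top
  · rw [integral_norm_eq_lintegral_enorm hm2.aestronglyMeasurable]
    exact ENNReal.toReal_le_of_le_ofReal (by positivity) key

/-- The truncation of `g` at height `s` is transformed by Plancherel, which preserves its norm; the
rest is integrable with norm at most `s^(1-p)`, which becomes a uniform bound on its transform. -/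
theorem weakFT_split (hp1 : 1 < p) (hp2 : p < 2) {g : Space → ℂ} (hm : Measurable g)
    (hg : ∫⁻ x, ENNReal.ofReal (‖g x‖ ^ p) = 1) {s : ℝ} (hs : 0 < s) :
    ∃ G1 G2 : Space → ℂ, WeakFT g (fun k => G1 k + G2 k) ∧ AEStronglyMeasurable (fun k => G1 k + G2 k) ∧
      AEStronglyMeasurable G1 ∧
      ∫⁻ k, ‖G1 k‖ₑ ^ (2 : ℝ) = ∫⁻ k, ‖(if ‖g k‖ ≤ s then g k else 0 : ℂ)‖ₑ ^ (2 : ℝ) ∧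
      ∀ k, ‖G2 k‖ ≤ s ^ (1 - p) := by
  obtain ⟨h1, h2, h3⟩ := split_level hp1 hp2 hm hg hs
  obtain ⟨G1, hG1, hG1m, hG1n⟩ := weakFT_two h1
  obtain ⟨hG2, hb, hG2m⟩ := weakFT_one h2
  refine ⟨G1, _, (hG1.add hG2).congr (.of_forall fun k => ?_), hG1m.1.add hG2m.1, hG1m.1, ?_,
    fun k => (hb k).trans h3⟩
  · dsimp only; split_ifs <;> simp
  · rw [eLpNorm_eq_lintegral_rpow_enorm_toReal (by norm_num) (by norm_num),
      eLpNorm_eq_lintegral_rpow_enorm_toReal (by norm_num) (by norm_num)] at hG1n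
    exact ENNReal.rpow_left_injective (by norm_num) hG1n

/-- The height `s = (r/2)^(-1/(p-1))` is the one for which `s^(1-p) = r/2`. Where `|G| > r` the `L²`
part must then be at least `r/2`, and Chebyshev's inequality with Plancherel gives the bound with `4
r⁻² = (r/2)⁻²`. -/
theorem meas_weakFT_le (hp1 : 1 < p) (hp2 : p < 2) {g G : Space → ℂ} (hm : Measurable g)
    (hg : ∫⁻ x, ENNReal.ofReal (‖g x‖ ^ p) = 1) (hG : WeakFT g G) {r : ℝ} (hr : 0 < r) :
    volume {k | r < ‖G k‖} ≤ ENNReal.ofReal (4 * r ^ (-2 : ℝ)) *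
      ∫⁻ x, if ‖g x‖ ≤ (r / 2) ^ (-(1 / (p - 1))) then ENNReal.ofReal (‖g x‖ ^ (2 : ℝ)) else 0 := by
  obtain ⟨G1, G2, hw, -, hG1m, hG1, hG2⟩ := weakFT_split hp1 hp2 hm hg
    (Real.rpow_pos_of_pos (half_pos hr) (-(1 / (p - 1))))
  rw [← Real.rpow_mul (by positivity)] at hG2
  have e1 : -(1 / (p - 1)) * (1 - p) = 1 := by
    have : p - 1 ≠ 0 := by linarith
    field_simp; ring
  rw [e1, Real.rpow_one] at hG2
  have hsub : volume {k | r < ‖G k‖} ≤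
      volume {k | ENNReal.ofReal ((r / 2) ^ (2 : ℝ)) ≤ ‖G1 k‖ₑ ^ (2 : ℝ)} := by
    refine measure_mono_ae ?_
    filter_upwards [hw.unique hG] with k hk hk'
    have hk2 : r < ‖G k‖ := hk'
    change _ ≤ _
    rw [← ofReal_norm, ENNReal.ofReal_rpow_of_nonneg (norm_nonneg _) (by norm_num)]
    refine ENNReal.ofReal_le_ofReal (Real.rpow_le_rpow (by positivity) ?_ (by norm_num))
    have := norm_add_le (G1 k) (G2 k)
    rw [hk] at this
    linarith [hG2 k]
  have hpos : 0 < (r / 2) ^ (2 : ℝ) := by positivity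
  refine hsub.trans ((meas_ge_le_lintegral_div (hG1m.enorm.pow_const _)
    (ENNReal.ofReal_pos.2 hpos).ne' ENNReal.ofReal_ne_top).trans ?_)
  rw [hG1, ENNReal.div_eq_inv_mul, ← ENNReal.ofReal_inv_of_pos hpos]
  refine mul_le_mul' (ENNReal.ofReal_le_ofReal (le_of_eq ?_)) (lintegral_mono fun x => ?_)
  · rw [Real.rpow_neg hr.le, Real.div_rpow hr.le (by norm_num), inv_div]
    norm_num; field_simp
  · dsimp only
    split_ifs
    · rw [← ofReal_norm, ENNReal.ofReal_rpow_of_nonneg (norm_nonneg _) (by norm_num)]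
    · simp

/-- With `P = p/(p-1)`, the condition on `r` says `r ≤ 2 y^(-(p-1))`, and `r^(P-3)` is integrable at
zero because `p < 2` means `P > 2`. The powers of `y` combine to `2 - (p-1)(P-2) = p`. -/
theorem layer_integral {p : ℝ} (hp1 : 1 < p) (hp2 : p < 2) {y : ℝ} (hy : 0 ≤ y) :
    ∫⁻ r in Set.Ioi (0 : ℝ), (if y ≤ (r / 2) ^ (-(1 / (p - 1))) then
      ENNReal.ofReal (y ^ (2 : ℝ)) else 0) * ENNReal.ofReal (r ^ (p / (p - 1) - 3))
      ≤ ENNReal.ofReal (2 ^ (p / (p - 1) - 2) / (p / (p - 1) - 2)) * ENNReal.ofReal (y ^ p) := by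
  have hp0 : 0 < p - 1 := by linarith
  have hP : 0 < p / (p - 1) - 2 := by
    rw [sub_pos, lt_div_iff₀ hp0]; linarith
  rcases hy.eq_or_lt with rfl | hy
  · simp [show p ≠ 0 by linarith]
  set a := 2 * y ^ (-(p - 1)) with ha
  have ha0 : 0 < a := by positivity
  calc _ ≤ ∫⁻ r in Set.Ioi (0 : ℝ), (Set.Ioc 0 a).indicator
        (fun r => ENNReal.ofReal (y ^ (2 : ℝ)) * ENNReal.ofReal (r ^ (p / (p - 1) - 3))) r := by
        refine setLIntegral_mono' measurableSet_Ioi fun r hr => ?_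
        have hr0 : 0 < r := hr
        split_ifs with h
        · rw [Set.indicator_of_mem]
          refine ⟨hr0, ?_⟩
          have h2 := Real.rpow_le_rpow_of_nonpos hy h (show -(p - 1) ≤ 0 by linarith)
          rw [← Real.rpow_mul (by positivity), show -(1 / (p - 1)) * -(p - 1) = 1 by field_simp,
            Real.rpow_one] at h2
          rw [ha]; linarith
        · simp
    _ = ENNReal.ofReal (y ^ (2 : ℝ)) * ∫⁻ r in Set.Ioc 0 a,
          ENNReal.ofReal (r ^ (p / (p - 1) - 3)) := by
        rw [lintegral_indicator measurableSet_Ioc, lintegral_const_mul' _ _ ENNReal.ofReal_ne_top,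
          Measure.restrict_restrict measurableSet_Ioc]
        congr 3
        exact Set.inter_eq_left.2 fun r hr => hr.1
    _ = ENNReal.ofReal (y ^ (2 : ℝ)) * ENNReal.ofReal (a ^ (p / (p - 1) - 2) /
          (p / (p - 1) - 2)) := by
        have hint : IntervalIntegrable (fun r : ℝ => r ^ (p / (p - 1) - 3)) volume 0 a :=
          intervalIntegral.intervalIntegrable_rpow' (by linarith)
        rw [← ofReal_integral_eq_lintegral_ofReal, ← intervalIntegral.integral_of_le ha0.le,
          integral_rpow (Or.inl (by linarith))]
        · rw [show p / (p - 1) - 3 + 1 = p / (p - 1) - 2 by ring, Real.zero_rpow hP.ne', sub_zero]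
        · exact (intervalIntegrable_iff_integrableOn_Ioc_of_le ha0.le).1 hint
        · exact (ae_restrict_iff' measurableSet_Ioc).2 (.of_forall fun r hr =>
            Real.rpow_nonneg hr.1.le _)
    _ = _ := by
        rw [← ENNReal.ofReal_mul (by positivity), ← ENNReal.ofReal_mul (by positivity), ha,
          Real.mul_rpow (by norm_num) (by positivity), ← Real.rpow_mul hy.le]
        congr 1
        have : y ^ (2 : ℝ) * y ^ (-(p - 1) * (p / (p - 1) - 2)) = y ^ p := by
          rw [← Real.rpow_add hy]
          congr 1; field_simp; ring
        rw [← this]; ring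

/-- The Hausdorff-Young inequality (up to a constant) for normalized functions. -/
theorem hausdorff_young_normalized (hp1 : 1 < p) (hp2 : p < 2) {g : Space → ℂ} (hm : Measurable g)
    (hg : ∫⁻ x, ENNReal.ofReal (‖g x‖ ^ p) = 1) :
    ∃ G, WeakFT g G ∧ AEStronglyMeasurable G ∧
      ∫⁻ k, ENNReal.ofReal (‖G k‖ ^ (p / (p - 1))) ≤ ENNReal.ofReal (p / (p - 1)) *
        (4 * ENNReal.ofReal (2 ^ (p / (p - 1) - 2) / (p / (p - 1) - 2))) := by
  -- The level one serves only to produce a transform. By uniqueness, the splittings at all other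
  -- levels describe the same function almost everywhere.
  obtain ⟨G1, G2, hw, hGm, -⟩ := weakFT_split hp1 hp2 hm hg one_pos
  refine ⟨_, hw, hGm, ?_⟩
  set G := fun k => G1 k + G2 k
  have hp0 : 0 < p - 1 := by linarith
  have hP : 0 < p / (p - 1) := by positivity
  -- Layer cake formula: the integral of `|G|^P` through the measures of its superlevel sets.
  rw [lintegral_rpow_eq_lintegral_meas_lt_mul volume (.of_forall fun _ => norm_nonneg _)
    hGm.norm.aemeasurable hP]
  refine mul_le_mul_right ?_ _
  have hmeas : Measurable (fun z : ℝ × Space => (if ‖g z.2‖ ≤ (z.1 / 2) ^ (-(1 / (p - 1))) then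
      ENNReal.ofReal (‖g z.2‖ ^ (2 : ℝ)) else 0) * ENNReal.ofReal (z.1 ^ (p / (p - 1) - 3))) := by
    refine Measurable.mul (Measurable.ite (measurableSet_le ?_ ?_) ?_ measurable_const) ?_ <;>
      fun_prop
  calc ∫⁻ r in Set.Ioi (0 : ℝ), volume {k | r < ‖G k‖} * ENNReal.ofReal (r ^ (p / (p - 1) - 1))
      ≤ ∫⁻ r in Set.Ioi (0 : ℝ), 4 * ∫⁻ x, (if ‖g x‖ ≤ (r / 2) ^ (-(1 / (p - 1))) then
          ENNReal.ofReal (‖g x‖ ^ (2 : ℝ)) else 0) * ENNReal.ofReal (r ^ (p / (p - 1) - 3)) := by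
        refine setLIntegral_mono' measurableSet_Ioi fun r hr => ?_
        have hr0 : 0 < r := hr
        refine (mul_le_mul_left (meas_weakFT_le hp1 hp2 hm hg hw hr0) _).trans (le_of_eq ?_)
        rw [lintegral_mul_const' _ _ ENNReal.ofReal_ne_top,
          show p / (p - 1) - 3 = -2 + (p / (p - 1) - 1) by ring, Real.rpow_add hr0,
          ENNReal.ofReal_mul (by positivity), ENNReal.ofReal_mul (by positivity)]
        norm_num
        ring
    _ = 4 * ∫⁻ x, ∫⁻ r in Set.Ioi (0 : ℝ), (if ‖g x‖ ≤ (r / 2) ^ (-(1 / (p - 1))) then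
          ENNReal.ofReal (‖g x‖ ^ (2 : ℝ)) else 0) * ENNReal.ofReal (r ^ (p / (p - 1) - 3)) := by
        rw [lintegral_const_mul' _ _ (by norm_num), lintegral_lintegral_swap hmeas.aemeasurable]
    _ ≤ 4 * ∫⁻ x, ENNReal.ofReal (2 ^ (p / (p - 1) - 2) / (p / (p - 1) - 2)) *
          ENNReal.ofReal (‖g x‖ ^ p) := by
        gcongr with x
        exact layer_integral hp1 hp2 (norm_nonneg _)
    _ = _ := by
        rw [lintegral_const_mul' _ _ ENNReal.ofReal_ne_top, hg, mul_one]

end Interpolation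

/-- The conjugate exponent. -/
noncomputable def cj (p : ℝ≥0∞) : ℝ≥0∞ := (1 - p⁻¹)⁻¹

theorem cj_inv (p : ℝ≥0∞) : (cj p)⁻¹ = 1 - p⁻¹ := inv_inv _

theorem cj_cj {p : ℝ≥0∞} (hp : 1 ≤ p) : cj (cj p) = p := by
  rw [cj, cj_inv, ENNReal.sub_sub_cancel (by norm_num) (ENNReal.inv_le_one.2 hp), inv_inv]

theorem one_le_cj (p : ℝ≥0∞) : 1 ≤ cj p := by
  rw [cj, ENNReal.one_le_inv]; exact tsub_le_self

theorem inv_two_sub : (1 : ℝ≥0∞) - 2⁻¹ = 2⁻¹ := ENNReal.one_sub_inv_two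

theorem cj_le_two {q : ℝ≥0∞} (hq : 2 ≤ q) : cj q ≤ 2 := by
  rw [cj, ENNReal.inv_le_iff_inv_le, ← inv_two_sub]
  exact tsub_le_tsub_left (ENNReal.inv_le_inv.2 hq) _

theorem ofReal_conj {p : ℝ} (hp1 : 1 < p) : cj (ENNReal.ofReal p) = ENNReal.ofReal (p / (p - 1)) := by
  have h0 : 0 < p := by linarith
  have h1 : 0 < p - 1 := by linarith
  rw [cj, ← ENNReal.ofReal_inv_of_pos h0, ← ENNReal.ofReal_one, ← ENNReal.ofReal_sub _ (by positivity),
    ← ENNReal.ofReal_inv_of_pos]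
  · congr 1; field_simp
  · rw [sub_pos]; exact inv_lt_one_of_one_lt₀ hp1

theorem eLpNorm_ofReal {p : ℝ} (hp : 0 < p) (g : Space → ℂ) :
    eLpNorm g (ENNReal.ofReal p) volume = (∫⁻ x, ENNReal.ofReal (‖g x‖ ^ p)) ^ (1 / p) := by
  rw [eLpNorm_eq_lintegral_rpow_enorm_toReal (by simpa using hp) ENNReal.ofReal_ne_top,
    ENNReal.toReal_ofReal hp.le]
  congr 2
  ext x
  rw [← ofReal_norm, ENNReal.ofReal_rpow_of_nonneg (norm_nonneg _) hp.le]

theorem WeakFT.zero : WeakFT (fun _ => 0) (fun _ => 0) := ⟨by simp, by simp, by simp⟩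

/-- The Hausdorff-Young inequality, up to a constant. -/
theorem hausdorff_young {p : ℝ≥0∞} (hp1 : 1 ≤ p) (hp2 : p ≤ 2) :
    ∃ C : ℝ≥0, ∀ g : Space → ℂ, MemLp g p volume →
      ∃ G, WeakFT g G ∧ AEStronglyMeasurable G ∧
        eLpNorm G (cj p) volume ≤ C * eLpNorm g p volume := by
  -- The interpolation constant contains `1/(p-1)` and `1/(P-2)` and blows up at both endpoints, so
  -- `p = 1` and `p = 2` are treated directly.
  rcases hp1.eq_or_lt with rfl | hp1
  · refine ⟨1, fun g hg => ?_⟩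
    obtain ⟨h1, h2, h3⟩ := weakFT_one (memLp_one_iff_integrable.1 hg)
    refine ⟨_, h1, h3.1, ?_⟩
    have : cj 1 = ∞ := by simp [cj]
    rw [this, ENNReal.coe_one, one_mul, eLpNorm_exponent_top]
    refine (eLpNormEssSup_le_of_ae_bound (.of_forall h2)).trans ?_
    rw [eLpNorm_one_eq_lintegral_enorm, integral_norm_eq_lintegral_enorm hg.1]
    exact ENNReal.ofReal_toReal_le
  rcases hp2.eq_or_lt with rfl | hp2
  · refine ⟨1, fun g hg => ?_⟩
    obtain ⟨G, h1, h2, h3⟩ := weakFT_two hg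
    refine ⟨_, h1, h2.1, ?_⟩
    rw [cj, inv_two_sub, inv_inv, h3]; simp
  lift p to ℝ≥0 using (hp2.trans (by norm_num)).ne with p0
  have hp : ENNReal.ofReal (p0 : ℝ) = p0 := ENNReal.ofReal_coe_nnreal
  have h1 : (1 : ℝ) < p0 := by exact_mod_cast hp1
  have h2 : (p0 : ℝ) < 2 := by exact_mod_cast hp2
  rw [← hp, ofReal_conj h1]
  generalize (p0 : ℝ) = p at h1 h2
  set P := p / (p - 1) with hP
  have hp0 : 0 < p - 1 := by linarith
  have hP0 : 0 < P := by positivity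
  set K : ℝ≥0∞ := (ENNReal.ofReal P * (4 * ENNReal.ofReal (2 ^ (P - 2) / (P - 2)))) ^ (1 / P)
    with hK
  have hKt : K ≠ ∞ := by
    refine ENNReal.rpow_ne_top_of_nonneg (by positivity) ?_
    exact ENNReal.mul_ne_top ENNReal.ofReal_ne_top
      (ENNReal.mul_ne_top (by norm_num) ENNReal.ofReal_ne_top)
  refine ⟨K.toNNReal, fun g hg => ?_⟩
  rw [ENNReal.coe_toNNReal hKt]
  -- The weak-type bound is not homogeneous in `g`; dividing by the norm reduces to the normalized
  -- case.
  set N := eLpNorm g (ENNReal.ofReal p) volume with hN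
  by_cases hN0 : N = 0
  · have : g =ᵐ[volume] 0 := (eLpNorm_eq_zero_iff hg.1 (ENNReal.ofReal_pos.2 (by linarith)).ne').1 hN0
    refine ⟨fun _ => 0, WeakFT.zero.congr this.symm, aestronglyMeasurable_const, ?_⟩
    simp
  have hNt : N ≠ ∞ := hg.2.ne
  have hNr : 0 < N.toReal := ENNReal.toReal_pos hN0 hNt
  set g1 : Space → ℂ := fun x => ((N.toReal⁻¹ : ℝ) : ℂ) * hg.1.mk g x with hg1
  have hm : Measurable g1 := hg.1.stronglyMeasurable_mk.measurable.const_mul _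
  have hae : g =ᵐ[volume] fun x => (N.toReal : ℂ) * g1 x := by
    filter_upwards [hg.1.ae_eq_mk] with x hx
    rw [hx, hg1, ← mul_assoc, ← Complex.ofReal_mul, mul_inv_cancel₀ hNr.ne']
    simp
  have hn1 : eLpNorm g1 (ENNReal.ofReal p) volume = 1 := by
    have := eLpNorm_congr_ae (p := ENNReal.ofReal p) hae
    rw [← hN] at this
    have e := eLpNorm_const_smul (N.toReal : ℂ) g1 (ENNReal.ofReal p) volume
    have e2 : (N.toReal : ℂ) • g1 = fun x => (N.toReal : ℂ) * g1 x := rfl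
    rw [e2, ← this] at e
    have e3 : ‖(N.toReal : ℂ)‖ₑ = N := by
      rw [← ofReal_norm, Complex.norm_real, Real.norm_of_nonneg hNr.le, ENNReal.ofReal_toReal hNt]
    rw [e3] at e
    exact (ENNReal.mul_right_inj hN0 hNt).1 (by rw [← e, mul_one])
  have hn2 : ∫⁻ x, ENNReal.ofReal (‖g1 x‖ ^ p) = 1 := by
    rw [eLpNorm_ofReal (by linarith)] at hn1
    have : (1 : ℝ≥0∞) = 1 ^ (1 / p) := by simp
    rw [this] at hn1
    exact ENNReal.rpow_left_injective (by positivity) hn1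
  obtain ⟨G, hG, hGm, hGb⟩ := hausdorff_young_normalized h1 h2 hm hn2
  refine ⟨_, (hG.smul (N.toReal : ℂ)).congr hae.symm, hGm.const_mul _, ?_⟩
  have e := eLpNorm_const_smul (N.toReal : ℂ) G (ENNReal.ofReal P) volume
  have e2 : (N.toReal : ℂ) • G = fun x => (N.toReal : ℂ) * G x := rfl
  rw [e2] at e
  have e3 : ‖(N.toReal : ℂ)‖ₑ = N := by
    rw [← ofReal_norm, Complex.norm_real, Real.norm_of_nonneg hNr.le, ENNReal.ofReal_toReal hNt]
  rw [e, e3, mul_comm K]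
  refine mul_le_mul_right ?_ _
  rw [eLpNorm_ofReal hP0, hK]
  exact ENNReal.rpow_le_rpow hGb (by positivity)

/-- The Fourier transform of an `L^p` function. -/
theorem HasFT.eLpNorm_le {p : ℝ≥0∞} (hp1 : 1 ≤ p) (hp2 : p ≤ 2) :
    ∃ C : ℝ≥0, ∀ T h, HasFT T h → eLpNorm h (cj p) volume ≤ C * distNorm p T := by
  obtain ⟨C, hC⟩ := hausdorff_young hp1 hp2
  -- A nonzero constant is needed to move it inside the infimum, which is `∞` if no `L^p` function
  -- represents the distribution.
  refine ⟨C + 1, fun T h hT => ?_⟩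
  rw [distNorm, ENNReal.mul_iInf_of_ne (by simp) ENNReal.coe_ne_top]
  refine le_iInf fun g => ?_
  rw [ENNReal.mul_iInf_of_ne (by simp) ENNReal.coe_ne_top]
  refine le_iInf fun ⟨hg, hTg⟩ => ?_
  obtain ⟨G, hG, -, hb⟩ := hC g hg
  rw [eLpNorm_congr_ae (hT.unique (hG.hasFT hTg))]
  refine hb.trans (mul_le_mul_left ?_ _)
  push_cast
  exact le_self_add

/-- A tempered distribution whose Fourier transform is an `L^{q'}` function, `q ≥ 2`. -/
theorem HasFT.distNorm_le {q : ℝ≥0∞} (hq : 2 ≤ q) :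
    ∃ C : ℝ≥0, ∀ T h, HasFT T h → distNorm q T ≤ C * eLpNorm h (cj q) volume := by
  obtain ⟨C, hC⟩ := hausdorff_young (one_le_cj q) (cj_le_two hq)
  rw [cj_cj (one_le_two.trans hq)] at hC
  refine ⟨C + 1, fun T h hT => ?_⟩
  by_cases hfin : eLpNorm h (cj q) volume = ∞
  · rw [hfin, ENNReal.mul_top (by simp)]; exact le_top
  -- The inverse transform of `h` is the transform of its reflection, so the inequality for the
  -- forward transform applies.
  have hmp := Measure.measurePreserving_neg (volume : Measure Space)
  have hh : MemLp (fun k => h (-k)) (cj q) volume :=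
    MemLp.comp_measurePreserving ⟨hT.aestronglyMeasurable, lt_top_iff_ne_top.2 hfin⟩ hmp
  have hn : eLpNorm (fun k => h (-k)) (cj q) volume = eLpNorm h (cj q) volume :=
    eLpNorm_comp_measurePreserving hT.aestronglyMeasurable hmp
  obtain ⟨G, hG, hGm, hb⟩ := hC _ hh
  rw [hn] at hb
  have hb' : eLpNorm G q volume ≤ ((C + 1 : ℝ≥0) : ℝ≥0∞) * eLpNorm h (cj q) volume := by
    refine hb.trans (mul_le_mul_left ?_ _)
    push_cast
    exact le_self_add
  refine (iInf₂_le G ⟨⟨hGm, hb'.trans_lt ?_⟩, fun φ => ?_⟩).trans hb'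
  · exact ENNReal.mul_lt_top ENNReal.coe_lt_top (lt_top_iff_ne_top.2 hfin)
  · rw [← hG.eq]
    have e := hT.apply_fourier (𝓕⁻ φ)
    rw [fourier_fourierInv_eq] at e
    rw [e, ← integral_neg_eq_self]
    refine integral_congr_ae (.of_forall fun k => ?_)
    dsimp only
    rw [SchwartzMap.fourierInv_coe, SchwartzMap.fourier_coe, Real.fourierInv_eq_fourier_neg, neg_neg]

end EulerMaxwell

end

/-! ### Weights in frequency: heat decay and regularity loss -/

section

open MeasureTheory SchwartzMap LineDeriv
open scoped ENNReal NNReal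
open FourierTransform

namespace EulerMaxwell

/-- The modulus `|ξ| = 2π|k|` of the frequency. -/
noncomputable def freq (k : Space) : ℝ := 2 * Real.pi * ‖k‖

theorem freq_nonneg (k : Space) : 0 ≤ freq k := by unfold freq; positivity

@[fun_prop]
theorem continuous_freq : Continuous freq := by unfold freq; fun_prop

theorem norm_ik (j : Fin 3) (k : Space) : ‖ik j k‖ = 2 * Real.pi * |k j| := by
  simp [ik, abs_of_pos Real.pi_pos]

theorem norm_ik_le (j : Fin 3) (k : Space) : ‖ik j k‖ ≤ freq k := by
  rw [norm_ik, freq]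
  gcongr
  exact PiLp.norm_apply_le k j

theorem freq_le_sum (k : Space) : freq k ≤ ∑ j, ‖ik j k‖ := by
  simp only [norm_ik, freq, ← Finset.mul_sum]
  gcongr
  have h : k = ∑ j, (k j) • (EuclideanSpace.single j (1 : ℝ) : Space) := by
    ext i; simp [Pi.single_apply]
  conv_lhs => rw [h]
  refine (norm_sum_le _ _).trans (Finset.sum_le_sum fun j _ => ?_)
  simp [norm_smul]

@[fun_prop]
theorem continuous_ik (j : Fin 3) : Continuous (ik j) := by unfold ik; fun_prop

/-- Expanding `|ξ|^N ≤ (∑ |ξ_j|)^N` gives the sum of the moduli of the symbols of all derivatives of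
order `N`; Hausdorff–Young applies to each of them. -/
theorem HasFT.weighted_le {r : ℝ≥0∞} (hr1 : 1 ≤ r) (hr2 : r ≤ 2) (N : ℕ) :
    ∃ C : ℝ≥0, ∀ T h, HasFT T h →
      eLpNorm (fun k => freq k ^ N * ‖h k‖) (cj r) volume ≤ C * nablaNorm N r T := by
  obtain ⟨C, hC⟩ := HasFT.eLpNorm_le hr1 hr2
  refine ⟨C, fun T h hT => ?_⟩
  have hm := hT.aestronglyMeasurable
  calc eLpNorm (fun k => freq k ^ N * ‖h k‖) (cj r) volume
      ≤ eLpNorm (∑ J : Fin N → Fin 3, fun k => ‖(∏ i, ik (J i) k) * h k‖) (cj r) volume := by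
        refine eLpNorm_mono_real fun k => ?_
        rw [Finset.sum_apply, Real.norm_of_nonneg (by have := freq_nonneg k; positivity)]
        simp only [norm_mul, norm_prod, ← Finset.sum_mul]
        gcongr
        refine (pow_le_pow_left₀ (freq_nonneg k) (freq_le_sum k) N).trans (le_of_eq ?_)
        exact Fintype.sum_pow _ _
    _ ≤ ∑ J : Fin N → Fin 3, eLpNorm (fun k => ‖(∏ i, ik (J i) k) * h k‖) (cj r) volume := by
        refine eLpNorm_sum_le (fun J _ => ?_) (one_le_cj r)
        exact ((continuous_finsetProd _ fun i _ => continuous_ik _).aestronglyMeasurable.mul hm).norm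
    _ ≤ ∑ J : Fin N → Fin 3, C * distNorm r (∂^{fun i => basisVec (J i)} T) := by
        refine Finset.sum_le_sum fun J _ => ?_
        rw [eLpNorm_norm]
        exact hC _ _ (hT.iterated J)
    _ = C * nablaNorm N r T := by rw [nablaNorm, Finset.mul_sum]

theorem HasFT.nablaNorm_le {q : ℝ≥0∞} (hq : 2 ≤ q) (m : ℕ) :
    ∃ C : ℝ≥0, ∀ T h, HasFT T h →
      nablaNorm m q T ≤ C * eLpNorm (fun k => freq k ^ m * ‖h k‖) (cj q) volume := by
  obtain ⟨C, hC⟩ := HasFT.distNorm_le hq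
  refine ⟨Fintype.card (Fin m → Fin 3) * C, fun T h hT => ?_⟩
  calc nablaNorm m q T
      ≤ ∑ _J : Fin m → Fin 3, C * eLpNorm (fun k => freq k ^ m * ‖h k‖) (cj q) volume := by
        refine Finset.sum_le_sum fun J _ => (hC _ _ (hT.iterated J)).trans ?_
        refine mul_le_mul_right (eLpNorm_mono_real fun k => ?_) _
        rw [norm_mul, norm_prod]
        gcongr
        calc ∏ i, ‖ik (J i) k‖ ≤ ∏ _i : Fin m, freq k :=
              Finset.prod_le_prod (fun _ _ => norm_nonneg _) fun _ _ => norm_ik_le _ _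
          _ = freq k ^ m := by simp
    _ = _ := by
        rw [Finset.sum_const, Finset.card_univ, nsmul_eq_mul]
        push_cast
        ring

theorem rpow_le_exp (s : ℝ) {κ : ℝ} (hκ : 0 < κ) :
    ∃ C : ℝ, 0 ≤ C ∧ ∀ x : ℝ, 0 ≤ x → (1 + x) ^ s ≤ C * Real.exp (κ * x) := by
  set n := ⌈s⌉₊
  refine ⟨(κ ^ n)⁻¹ * (n.factorial * Real.exp κ), by positivity, fun x hx => ?_⟩
  have h1 : (1 + x) ^ s ≤ (1 + x) ^ n := by
    rw [← Real.rpow_natCast]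
    exact Real.rpow_le_rpow_of_exponent_le (by linarith) (Nat.le_ceil s)
  have h2 := Real.pow_div_factorial_le_exp (x := κ * (1 + x)) (by positivity) n
  rw [div_le_iff₀ (by positivity), mul_pow, mul_add, mul_one, Real.exp_add] at h2
  refine h1.trans ?_
  rw [mul_assoc, ← div_eq_inv_mul, le_div_iff₀ (by positivity)]
  linarith

theorem sub_add_one_sub {x y : ℝ≥0∞} (h1 : y ≤ x) (h2 : x ≤ 1) : (x - y) + (1 - x) = 1 - y := by
  have h3 : x ≠ ∞ := (h2.trans_lt ENNReal.one_lt_top).ne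
  have h4 : y ≠ ∞ := (h1.trans_lt (lt_top_iff_ne_top.2 h3)).ne
  have h5 : (x - y) + (1 - x) + y = 1 - y + y := by
    rw [tsub_add_cancel_of_le (h1.trans h2), add_right_comm, tsub_add_cancel_of_le h1,
      add_tsub_cancel_of_le h2]
  exact (ENNReal.add_left_inj h4).1 h5

/-- A weight that maps `L^{p'}` to `L^{q'}` must lie in `L^a` with `1/a = 1/p - 1/q`; for `p = q`
this is `a = ∞`. -/
theorem holderTriple {p q : ℝ≥0∞} (hp1 : 1 ≤ p) (hpq : p ≤ q) :
    ENNReal.HolderTriple (p⁻¹ - q⁻¹)⁻¹ (cj p) (cj q) := by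
  refine ⟨?_⟩
  rw [inv_inv, cj_inv, cj_inv]
  exact sub_add_one_sub (ENNReal.inv_le_inv.2 hpq) (ENNReal.inv_le_one.2 hp1)

theorem toReal_sub {p q : ℝ≥0∞} (hp1 : 1 ≤ p) (hpq : p ≤ q) :
    (p⁻¹ - q⁻¹).toReal = (p⁻¹).toReal - (q⁻¹).toReal := by
  refine ENNReal.toReal_sub_of_le (ENNReal.inv_le_inv.2 hpq) ?_
  exact ((ENNReal.inv_le_one.2 hp1).trans_lt ENNReal.one_lt_top).ne

theorem holder_weight {p q : ℝ≥0∞} (hp1 : 1 ≤ p) (hpq : p ≤ q) {W Y : Space → ℝ}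
    (hW : AEStronglyMeasurable W) (hY : AEStronglyMeasurable Y) :
    eLpNorm (fun k => W k * Y k) (cj q) volume
      ≤ eLpNorm W (p⁻¹ - q⁻¹)⁻¹ volume * eLpNorm Y (cj p) volume := by
  have := holderTriple hp1 hpq
  have h := eLpNorm_smul_le_mul_eLpNorm (p := (p⁻¹ - q⁻¹)⁻¹) (q := cj p) (r := cj q) hY hW
  rw [show W • Y = fun k => W k * Y k from rfl] at h
  exact h

/-- Here β is the reciprocal exponent. The Gaussian integral in dimension three scales like
`τ^(-3/2)`, and the norm takes its power β; for `β = 0` only the bound by one remains. -/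
theorem eLpNorm_gaussian_le {β : ℝ≥0∞} (hβ : β ≠ ∞) {κ : ℝ} (hκ : 0 < κ) :
    ∃ C : ℝ≥0, ∀ τ : ℝ, 0 < τ → eLpNorm (fun k => Real.exp (-(κ * freq k ^ 2 * τ))) β⁻¹ volume
      ≤ C * ENNReal.ofReal (τ ^ (-(3 / 2 * β.toReal))) := by
  rcases eq_or_ne β 0 with rfl | h0
  · refine ⟨1, fun τ hτ => ?_⟩
    rw [ENNReal.inv_zero, eLpNorm_exponent_top]
    refine (eLpNormEssSup_le_of_ae_bound (C := 1) (.of_forall fun k => ?_)).trans (by simp)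
    rw [Real.norm_of_nonneg (Real.exp_nonneg _), Real.exp_le_one_iff]
    have := freq_nonneg k
    simp only [Left.neg_nonpos_iff]; positivity
  have hb : 0 < β.toReal := ENNReal.toReal_pos h0 hβ
  set c : ℝ := Real.pi / (β.toReal⁻¹ * κ * (2 * Real.pi) ^ 2) with hc
  have hc0 : 0 < c := by positivity
  refine ⟨Real.toNNReal ((c ^ (3 / 2 : ℝ)) ^ β.toReal), fun τ hτ => ?_⟩
  rw [eLpNorm_eq_lintegral_rpow_enorm_toReal (ENNReal.inv_ne_zero.2 hβ) (ENNReal.inv_ne_top.2 h0)]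
  have e1 : ∀ k : Space, ‖Real.exp (-(κ * freq k ^ 2 * τ))‖ₑ ^ (β⁻¹).toReal =
      ENNReal.ofReal (Real.exp (-(β.toReal⁻¹ * κ * (2 * Real.pi) ^ 2 * τ) * ‖k‖ ^ 2)) := by
    intro k
    rw [← ofReal_norm, Real.norm_of_nonneg (Real.exp_nonneg _), ENNReal.toReal_inv,
      ENNReal.ofReal_rpow_of_nonneg (Real.exp_nonneg _) (by positivity), ← Real.exp_mul, freq]
    congr 2; ring
  simp only [e1]
  have hpos : 0 < β.toReal⁻¹ * κ * (2 * Real.pi) ^ 2 * τ := by positivity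
  have hI := GaussianFourier.integral_rexp_neg_mul_sq_norm (V := Space) hpos
  have hint : Integrable (fun k : Space =>
      Real.exp (-(β.toReal⁻¹ * κ * (2 * Real.pi) ^ 2 * τ) * ‖k‖ ^ 2)) := by
    -- A nonintegrable function has integral zero by convention, whereas the value of the Gaussian
    -- integral is positive.
    by_contra hcon
    rw [integral_undef hcon] at hI
    have : 0 < (Real.pi / (β.toReal⁻¹ * κ * (2 * Real.pi) ^ 2 * τ)) ^
      (Module.finrank ℝ Space / 2 : ℝ) := by positivity
    linarith
  rw [← ofReal_integral_eq_lintegral_ofReal hint (.of_forall fun _ => Real.exp_nonneg _), hI,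
    ENNReal.toReal_inv, one_div, inv_inv, ENNReal.ofReal_rpow_of_nonneg (by positivity) hb.le]
  rw [← ENNReal.ofReal_coe_nnreal, Real.coe_toNNReal _ (by positivity),
    ← ENNReal.ofReal_mul (by positivity)]
  refine ENNReal.ofReal_le_ofReal (le_of_eq ?_)
  rw [finrank_euclideanSpace, Fintype.card_fin, ← Real.rpow_mul (by positivity),
    ← Real.rpow_mul hc0.le, ← div_div, ← hc, Real.div_rpow hc0.le hτ.le,
    Real.rpow_neg hτ.le, div_eq_mul_inv]
  norm_num

/-- Low frequencies: decay of the heat flow. -/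
theorem low_freq_le {p q : ℝ≥0∞} (hp1 : 1 ≤ p) (hpq : p ≤ q) (a : ℕ) {κ : ℝ} (hκ : 0 < κ) :
    ∃ C : ℝ≥0, ∀ t : ℝ, 0 ≤ t → ∀ Y : Space → ℝ, AEStronglyMeasurable Y → (∀ k, 0 ≤ Y k) →
      eLpNorm (fun k => if freq k ≤ 1 then freq k ^ a * Real.exp (-(κ * freq k ^ 2 * t)) * Y k
        else 0) (cj q) volume
      ≤ C * (algDecay t (heatExp p q + a / 2) * eLpNorm Y (cj p) volume) := by
  obtain ⟨C1, hC1, hx⟩ := rpow_le_exp (a / 2 : ℝ) (half_pos hκ)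
  have hβ : p⁻¹ - q⁻¹ ≠ ∞ :=
    (tsub_le_self.trans_lt ((ENNReal.inv_le_one.2 hp1).trans_lt ENNReal.one_lt_top)).ne
  obtain ⟨C2, hC2⟩ := eLpNorm_gaussian_le hβ (half_pos hκ)
  refine ⟨Real.toNNReal (C1 * Real.exp κ) * C2, fun t ht Y hY hY0 => ?_⟩
  have h1t : 0 < 1 + t := by linarith
  set c : ℝ := C1 * Real.exp κ * (1 + t) ^ (-(a / 2 : ℝ)) with hc
  have hpt : ∀ k, ‖(if freq k ≤ 1 then freq k ^ a * Real.exp (-(κ * freq k ^ 2 * t)) * Y k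
      else 0 : ℝ)‖ ≤ (c * Real.exp (-(κ / 2 * freq k ^ 2 * (1 + t)))) * Y k := by
    intro k
    have hf := freq_nonneg k
    have hYk := hY0 k
    split_ifs with h
    · rw [Real.norm_of_nonneg (by positivity)]
      refine mul_le_mul_of_nonneg_right ?_ hYk
      -- Half of the Gaussian absorbs `(|ξ|²(1+t))^(a/2)`; the other half is kept as the Hölder
      -- weight.
      have e1 : freq k ^ a = (freq k ^ 2 * (1 + t)) ^ (a / 2 : ℝ) * (1 + t) ^ (-(a / 2 : ℝ)) := by
        rw [Real.mul_rpow (by positivity) h1t.le, mul_assoc, ← Real.rpow_add h1t, ← Real.rpow_natCast,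
          ← Real.rpow_natCast, ← Real.rpow_mul hf]
        simp [mul_div_cancel₀]
      have e2 : (freq k ^ 2 * (1 + t)) ^ (a / 2 : ℝ) ≤
          C1 * Real.exp (κ / 2 * (freq k ^ 2 * (1 + t))) := by
        refine (Real.rpow_le_rpow (by positivity) (by linarith) (by positivity)).trans
          (hx _ (by positivity))
      -- Replacing `t` by `1 + t` costs only the factor `e^κ`, because `|ξ| ≤ 1`.
      have e3 : Real.exp (-(κ * freq k ^ 2 * t)) ≤
          Real.exp κ * Real.exp (-(κ * (freq k ^ 2 * (1 + t)))) := by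
        rw [← Real.exp_add, Real.exp_le_exp]
        have : freq k ^ 2 ≤ 1 := pow_le_one₀ hf h
        nlinarith
      calc freq k ^ a * Real.exp (-(κ * freq k ^ 2 * t))
          ≤ (C1 * Real.exp (κ / 2 * (freq k ^ 2 * (1 + t))) * (1 + t) ^ (-(a / 2 : ℝ))) *
            (Real.exp κ * Real.exp (-(κ * (freq k ^ 2 * (1 + t))))) := by
            rw [e1]; gcongr
        _ = c * (Real.exp (κ / 2 * (freq k ^ 2 * (1 + t))) *
              Real.exp (-(κ * (freq k ^ 2 * (1 + t))))) := by rw [hc]; ring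
        _ = c * Real.exp (-(κ / 2 * freq k ^ 2 * (1 + t))) := by
            rw [← Real.exp_add]; congr 2; ring
    · simp only [norm_zero]; positivity
  refine (eLpNorm_mono_real hpt).trans ((holder_weight hp1 hpq ?_ hY).trans ?_)
  · exact Continuous.aestronglyMeasurable (by fun_prop)
  rw [← mul_assoc]
  refine mul_le_mul_left ?_ _
  have := eLpNorm_const_smul c (fun k => Real.exp (-(κ / 2 * freq k ^ 2 * (1 + t))))
    (p⁻¹ - q⁻¹)⁻¹ volume
  change eLpNorm (fun k => c * Real.exp (-(κ / 2 * freq k ^ 2 * (1 + t)))) _ _ = _ at this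
  rw [this]
  have hc0 : 0 ≤ c := by positivity
  calc ‖c‖ₑ * eLpNorm (fun k => Real.exp (-(κ / 2 * freq k ^ 2 * (1 + t)))) (p⁻¹ - q⁻¹)⁻¹ volume
      ≤ ENNReal.ofReal c * (C2 * ENNReal.ofReal ((1 + t) ^ (-(3 / 2 * (p⁻¹ - q⁻¹).toReal)))) := by
        rw [← ofReal_norm, Real.norm_of_nonneg hc0]
        exact mul_le_mul_right (hC2 _ h1t) _
    _ = _ := by
        have e1 : ENNReal.ofReal c = ENNReal.ofReal (C1 * Real.exp κ) *
            ENNReal.ofReal ((1 + t) ^ (-(a / 2 : ℝ))) := ENNReal.ofReal_mul (by positivity)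
        have e2 : algDecay t (heatExp p q + a / 2) =
            ENNReal.ofReal ((1 + t) ^ (-(3 / 2 * (p⁻¹ - q⁻¹).toReal))) *
              ENNReal.ofReal ((1 + t) ^ (-(a / 2 : ℝ))) := by
          rw [algDecay, heatExp, toReal_sub hp1 hpq, neg_add, Real.rpow_add h1t,
            ENNReal.ofReal_mul (by positivity)]
        rw [e1, e2, ENNReal.coe_mul]
        change _ = ENNReal.ofReal (C1 * Real.exp κ) * _ * _
        ring

/-- These are the two properties of the index used at high frequencies. The strict inequality makes
the surplus weight integrable at infinity; if `r = q` no integrability is needed and `ℓ` derivatives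
suffice. -/
theorem plusIndex_spec {r q : ℝ≥0∞} (hr1 : 1 ≤ r) (hr2 : r ≤ 2) (hq : 2 ≤ q) {ℓ : ℝ} (hℓ : 0 ≤ ℓ) :
    ℓ ≤ plusIndex ℓ r q ∧
      (r⁻¹ - q⁻¹ ≠ 0 → ℓ + 3 * (r⁻¹ - q⁻¹).toReal < plusIndex ℓ r q) := by
  have hβ : 0 ≤ (r⁻¹ - q⁻¹).toReal := ENNReal.toReal_nonneg
  rw [plusIndex, ← toReal_sub hr1 (hr2.trans hq)]
  split_ifs with h
  · obtain ⟨⟨n, rfl⟩, rfl, rfl⟩ := h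
    simp
  · have := Nat.lt_floor_add_one (ℓ + 3 * (r⁻¹ - q⁻¹).toReal)
    push_cast
    exact ⟨by linarith, fun _ => this⟩

/-- The norm involves the integral of `|ξ|^(-γ/β)` over the exterior of a ball, which converges in
dimension three when `γ > 3β`; for `β = 0` boundedness is enough. -/
theorem eLpNorm_high_weight {β : ℝ≥0∞} (hβ : β ≠ ∞) {γ : ℝ} (hγ : 0 ≤ γ)
    (h : β ≠ 0 → 3 * β.toReal < γ) :
    eLpNorm (fun k => if freq k ≤ 1 then 0 else freq k ^ (-γ)) β⁻¹ volume < ∞ := by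
  rcases eq_or_ne β 0 with rfl | h0
  · rw [ENNReal.inv_zero, eLpNorm_exponent_top]
    refine (eLpNormEssSup_le_of_ae_bound (C := 1) (.of_forall fun k => ?_)).trans_lt (by simp)
    split_ifs with hk
    · simp
    · push Not at hk
      rw [Real.norm_of_nonneg (Real.rpow_nonneg (freq_nonneg k) _)]
      exact Real.rpow_le_one_of_one_le_of_nonpos hk.le (by linarith)
  have hb : 0 < β.toReal := ENNReal.toReal_pos h0 hβ
  rw [eLpNorm_lt_top_iff_lintegral_rpow_enorm_lt_top (ENNReal.inv_ne_zero.2 hβ)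
    (ENNReal.inv_ne_top.2 h0)]
  have hfr : (Module.finrank ℝ Space : ℝ) < γ * β.toReal⁻¹ := by
    rw [finrank_euclideanSpace, Fintype.card_fin, ← div_eq_mul_inv, lt_div_iff₀ hb]
    simpa using h h0
  refine lt_of_le_of_lt ?_ (ENNReal.mul_lt_top (a := ENNReal.ofReal (2 ^ (γ * β.toReal⁻¹)))
    ENNReal.ofReal_lt_top (finite_integral_one_add_norm (μ := (volume : Measure Space)) hfr))
  rw [← lintegral_const_mul' _ _ ENNReal.ofReal_ne_top]
  refine lintegral_mono fun k => ?_
  dsimp only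
  split_ifs with hk
  · rw [enorm_zero, ENNReal.zero_rpow_of_pos]
    · simp
    · rw [ENNReal.toReal_inv]; positivity
  · push Not at hk
    have hf := freq_nonneg k
    rw [← ofReal_norm, Real.norm_of_nonneg (Real.rpow_nonneg hf _), ENNReal.toReal_inv,
      ENNReal.ofReal_rpow_of_nonneg (Real.rpow_nonneg hf _) (by positivity),
      ← ENNReal.ofReal_mul (by positivity)]
    refine ENNReal.ofReal_le_ofReal ?_
    rw [← Real.rpow_mul hf, neg_mul]
    set δ := γ * β.toReal⁻¹
    have hδ : 0 ≤ δ := by positivity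
    have h1 : (1 + ‖k‖) / 2 ≤ freq k := by
      have : ‖k‖ ≤ freq k := by
        rw [freq]
        nlinarith [norm_nonneg k, Real.pi_gt_three]
      linarith
    calc freq k ^ (-δ) ≤ ((1 + ‖k‖) / 2) ^ (-δ) :=
          Real.rpow_le_rpow_of_nonpos (by positivity) h1 (by linarith)
      _ = 2 ^ δ * (1 + ‖k‖) ^ (-δ) := by
          rw [Real.div_rpow (by positivity) (by norm_num), Real.rpow_neg (x := 2) (by norm_num),
            div_inv_eq_mul, mul_comm]

/-- High frequencies: decay with loss of regularity. -/
theorem high_freq_le {r q : ℝ≥0∞} (hr1 : 1 ≤ r) (hr2 : r ≤ 2) (hq : 2 ≤ q) (m : ℕ) {ℓ κ : ℝ}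
    (hℓ : 0 ≤ ℓ) (hκ : 0 < κ) :
    ∃ C : ℝ≥0, ∀ t : ℝ, 0 ≤ t → ∀ Y : Space → ℝ, AEStronglyMeasurable Y → (∀ k, 0 ≤ Y k) →
      eLpNorm (fun k => if freq k ≤ 1 then 0 else
        freq k ^ m * Real.exp (-(κ * t / freq k ^ 2)) * Y k) (cj q) volume
      ≤ C * (algDecay t (ℓ / 2) *
        eLpNorm (fun k => freq k ^ (m + plusIndex ℓ r q) * Y k) (cj r) volume) := by
  obtain ⟨C1, hC1, hx⟩ := rpow_le_exp (ℓ / 2) hκ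
  have hβ : r⁻¹ - q⁻¹ ≠ ∞ :=
    (tsub_le_self.trans_lt ((ENNReal.inv_le_one.2 hr1).trans_lt ENNReal.one_lt_top)).ne
  obtain ⟨hN1, hN2⟩ := plusIndex_spec hr1 hr2 hq hℓ
  set N := plusIndex ℓ r q
  have hW := eLpNorm_high_weight hβ (sub_nonneg.2 hN1) (fun h => by have := hN2 h; linarith)
  -- Of the `N` derivatives of the data, ℓ pay for time decay. The remaining `N - ℓ` form the Hölder
  -- weight between `L^{r'}` and `L^{q'}`.
  set W : Space → ℝ := fun k => if freq k ≤ 1 then 0 else freq k ^ (-(N - ℓ)) with hWdef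
  have hWm : AEStronglyMeasurable W := by
    refine Measurable.aestronglyMeasurable (Measurable.ite (measurableSet_le ?_ ?_) ?_ ?_)
    all_goals have := continuous_freq.measurable; fun_prop
  refine ⟨Real.toNNReal C1 * (eLpNorm W (r⁻¹ - q⁻¹)⁻¹ volume).toNNReal, fun t ht Y hY hY0 => ?_⟩
  have h1t : 0 < 1 + t := by linarith
  set c : ℝ := C1 * (1 + t) ^ (-(ℓ / 2)) with hc
  have hc0 : 0 ≤ c := by positivity
  have hpt : ∀ k, ‖(if freq k ≤ 1 then 0 else
      freq k ^ m * Real.exp (-(κ * t / freq k ^ 2)) * Y k : ℝ)‖ ≤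
      (c * W k) * (freq k ^ (m + N) * Y k) := by
    intro k
    have hf := freq_nonneg k
    have hYk := hY0 k
    simp only [hWdef]
    split_ifs with h
    · simp
    · push Not at h
      have hf0 : 0 < freq k := by linarith
      rw [Real.norm_of_nonneg (by positivity), ← mul_assoc]
      refine mul_le_mul_of_nonneg_right ?_ hYk
      -- The trade of regularity for decay: `exp(-κx)` is bounded by a multiple of `(1+x)^(-ℓ/2)`
      -- with `x = t/|ξ|²`, and `1 + x ≥ (1+t)/|ξ|²` because `|ξ| ≥ 1`.
      have e1 : Real.exp (-(κ * t / freq k ^ 2)) ≤ c * freq k ^ ℓ := by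
        have h2 := hx (t / freq k ^ 2) (by positivity)
        have h3 : ((1 + t) / freq k ^ 2) ^ (ℓ / 2) ≤ (1 + t / freq k ^ 2) ^ (ℓ / 2) := by
          refine Real.rpow_le_rpow (by positivity) ?_ (by positivity)
          rw [add_div]
          have : 1 / freq k ^ 2 ≤ 1 := by
            rw [div_le_one (by positivity)]; exact one_le_pow₀ h.le
          linarith
        have h4 : (1 + t) ^ (ℓ / 2) ≤ freq k ^ ℓ * (C1 * Real.exp (κ * (t / freq k ^ 2))) := by
          have h5 := h3.trans h2
          rw [Real.div_rpow h1t.le (by positivity), div_le_iff₀ (by positivity),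
            ← Real.rpow_natCast, ← Real.rpow_mul hf] at h5
          have h6 : ((2 : ℕ) : ℝ) * (ℓ / 2) = ℓ := by push_cast; ring
          rw [h6] at h5
          simp only [Real.rpow_natCast] at h5
          linarith
        rw [Real.exp_neg, hc, Real.rpow_neg h1t.le, inv_le_iff_one_le_mul₀ (Real.exp_pos _),
          show κ * t / freq k ^ 2 = κ * (t / freq k ^ 2) by ring]
        calc (1 : ℝ) = ((1 + t) ^ (ℓ / 2))⁻¹ * (1 + t) ^ (ℓ / 2) := by
              rw [inv_mul_cancel₀ (by positivity)]
          _ ≤ ((1 + t) ^ (ℓ / 2))⁻¹ *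
              (freq k ^ ℓ * (C1 * Real.exp (κ * (t / freq k ^ 2)))) := by gcongr
          _ = _ := by ring
      calc freq k ^ m * Real.exp (-(κ * t / freq k ^ 2)) ≤ freq k ^ m * (c * freq k ^ ℓ) := by gcongr
        _ = c * freq k ^ (-(N - ℓ)) * freq k ^ (m + N) := by
          rw [pow_add, ← Real.rpow_natCast _ N]
          have : freq k ^ ℓ = freq k ^ (-(N - ℓ)) * freq k ^ (N : ℝ) := by
            rw [← Real.rpow_add hf0]; congr 1; ring
          rw [this]; ring
  refine (eLpNorm_mono_real hpt).trans ((holder_weight hr1 (hr2.trans hq) (hWm.const_mul c) ?_).trans ?_)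
  · exact (Continuous.aestronglyMeasurable (by fun_prop)).mul hY
  rw [← mul_assoc]
  refine mul_le_mul_left (le_of_eq ?_) _
  have := eLpNorm_const_smul c W (r⁻¹ - q⁻¹)⁻¹ volume
  change eLpNorm (fun k => c * W k) _ _ = _ at this
  rw [this, ← ofReal_norm, Real.norm_of_nonneg hc0, hc, ENNReal.ofReal_mul hC1, algDecay,
    ENNReal.coe_mul, ENNReal.coe_toNNReal hW.ne, ENNReal.ofReal]
  ring

end EulerMaxwell

end

/-! ### The system at one frequency: energy and correctors -/

section

open MeasureTheory SchwartzMap LineDeriv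
open scoped ENNReal NNReal RealInnerProductSpace

namespace EulerMaxwell

/-- The symbols `X = iξ·`, `G = iξ`, `K = iξ×` of divergence, gradient and curl at a frequency of
modulus `s`. -/
structure Symbols (S H : Type*) [NormedAddCommGroup S] [InnerProductSpace ℝ S]
    [NormedAddCommGroup H] [InnerProductSpace ℝ H] (s : ℝ) where
  X : H →L[ℝ] S
  G : S →L[ℝ] H
  K : H →L[ℝ] H
  s_nonneg : 0 ≤ s
  inner_G : ∀ z v, ⟪G z, v⟫ = -⟪z, X v⟫
  inner_K : ∀ v w, ⟪K v, w⟫ = ⟪v, K w⟫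
  norm_G : ∀ z, ‖G z‖ = s * ‖z‖
  norm_KX : ∀ v, ‖K v‖ ^ 2 + ‖X v‖ ^ 2 = s ^ 2 * ‖v‖ ^ 2
  KG : ∀ z, K (G z) = 0
  XG : ∀ z, X (G z) = -(s ^ 2 • z)
  KK : ∀ v, K (K v) = s ^ 2 • v + G (X v)

section Pointwise

variable {S H : Type*} [NormedAddCommGroup S] [InnerProductSpace ℝ S]
  [NormedAddCommGroup H] [InnerProductSpace ℝ H] {s : ℝ}

namespace Symbols

variable (y : Symbols S H s)

theorem inner_G' (z : S) (v : H) : ⟪v, y.G z⟫ = -⟪z, y.X v⟫ := by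
  rw [real_inner_comm, y.inner_G]

theorem norm_K_le (v : H) : ‖y.K v‖ ≤ s * ‖v‖ := by
  refine abs_le_of_sq_le_sq' ?_ (mul_nonneg y.s_nonneg (norm_nonneg v)) |>.2
  have := y.norm_KX v
  nlinarith [sq_nonneg ‖y.X v‖]

theorem norm_X_le (v : H) : ‖y.X v‖ ≤ s * ‖v‖ := by
  refine abs_le_of_sq_le_sq' ?_ (mul_nonneg y.s_nonneg (norm_nonneg v)) |>.2
  have := y.norm_KX v
  nlinarith [sq_nonneg ‖y.K v‖]

end Symbols

/-- A solution of the linearized system at one frequency. -/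
structure Orbit (P : Plasma) (y : Symbols S H s) (ρ : Species → ℝ → S) (u : Species → ℝ → H)
    (E B : ℝ → H) : Prop where
  hρ : ∀ a t, HasDerivAt (ρ a) (-(y.X (u a t))) t
  hu : ∀ a t, HasDerivAt (u a)
    ((P.m a)⁻¹ • (-(P.T a • y.G (ρ a t)) + P.q a • E t - P.f a • u a t)) t
  hE : ∀ t, HasDerivAt E (P.c • y.K (B t) - (4 * Real.pi * P.e) • (u .ion t - u .electron t)) t
  hB : ∀ t, HasDerivAt B (-(P.c • y.K (E t))) t
  divE : ∀ t, y.X (E t) = (4 * Real.pi * P.e) • (ρ .ion t - ρ .electron t)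
  divB : ∀ t, y.X (B t) = 0

/-- The dissipation of `U`, `R`, `E`, `B` has orders `1, δ, δ², δ³`. Young's inequality splits each
mixed term into a quarter of one dissipative term and a multiple of another that carries an extra
factor δ, so a small δ absorbs everything. -/
theorem absorb {κ C : ℝ} (hκ : 0 < κ) (hC : 0 < C) : ∃ δ₀ : ℝ, 0 < δ₀ ∧ δ₀ ≤ 1 ∧
    ∀ δ, 0 < δ → δ ≤ δ₀ → ∀ U R E B : ℝ,
      -κ * U ^ 2 + δ * (C * U ^ 2 + C * (U * R) - κ * R ^ 2)
        + δ ^ 2 * (-κ * E ^ 2 + C * (R * E + U * E + U * B + U ^ 2))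
        + δ ^ 3 * (-κ * B ^ 2 + C * (U * B) + C * E ^ 2)
      ≤ -(κ / 4 * δ ^ 3 * (U ^ 2 + R ^ 2 + E ^ 2 + B ^ 2)) := by
  set D := C ^ 2 / κ with hD
  have hD0 : 0 < D := by positivity
  refine ⟨min 1 (κ / (4 * C + 8 * D)), lt_min one_pos (by positivity), min_le_left _ _, ?_⟩
  intro δ hδ hδ0 U R E B
  have h1 : δ ≤ 1 := hδ0.trans (min_le_left _ _)
  have h2 : δ * (4 * C + 8 * D) ≤ κ := by
    rw [← le_div_iff₀ (by positivity)]; exact hδ0.trans (min_le_right _ _)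
  have young : ∀ x y : ℝ, C * (x * y) ≤ κ / 4 * y ^ 2 + D * x ^ 2 := by
    intro x y
    have : κ / 4 * y ^ 2 + D * x ^ 2 - C * (x * y) = κ * (y / 2 - C / κ * x) ^ 2 := by
      rw [hD]; field_simp; ring
    linarith [mul_nonneg hκ.le (sq_nonneg (y / 2 - C / κ * x))]
  have a1 := mul_le_mul_of_nonneg_left (young U R) hδ.le
  have a2 := mul_le_mul_of_nonneg_left (young R E) (sq_nonneg δ)
  have a3 := mul_le_mul_of_nonneg_left (young U E) (sq_nonneg δ)
  -- The critical term `δ² U B` is split as `δ · U · (δB)`: its `B` part then has order `δ³`,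
  -- matching the weak dissipation of `B`.
  have a4 := mul_le_mul_of_nonneg_left (young U (δ * B)) hδ.le
  have a5 := mul_le_mul_of_nonneg_left (young U B) (pow_nonneg hδ.le 3)
  have hU := sq_nonneg U
  have hR := sq_nonneg R
  have hE := sq_nonneg E
  have hB := sq_nonneg B
  have d2 : δ ^ 2 ≤ δ := pow_le_of_le_one hδ.le h1 two_ne_zero
  have d3 : δ ^ 3 ≤ δ ^ 2 := pow_le_pow_of_le_one hδ.le h1 (by norm_num)
  have hδC : 0 < δ * C := by positivity
  have hδD : 0 < δ * D := by positivity
  have b1 : (-κ + δ * C + δ * D + δ ^ 2 * D + δ ^ 2 * C + δ * D + δ ^ 3 * D) * U ^ 2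
      ≤ -(κ / 4 * δ ^ 3) * U ^ 2 := by
    refine mul_le_mul_of_nonneg_right ?_ hU
    have e1 : δ ^ 2 * D ≤ δ * D := by gcongr
    have e2 : δ ^ 2 * C ≤ δ * C := by gcongr
    have e3 : δ ^ 3 * D ≤ δ * D := by gcongr; linarith
    have e4 : κ / 4 * δ ^ 3 ≤ κ / 4 := by
      exact mul_le_of_le_one_right (by positivity) (pow_le_one₀ hδ.le h1)
    linarith
  have b2 : (-(3 / 4 * (δ * κ)) + δ ^ 2 * D) * R ^ 2 ≤ -(κ / 4 * δ ^ 3) * R ^ 2 := by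
    refine mul_le_mul_of_nonneg_right ?_ hR
    have e1 := mul_le_mul_of_nonneg_left (show δ * D ≤ κ / 8 by linarith) hδ.le
    have e2 : κ / 4 * δ ^ 3 ≤ κ / 4 * δ := by gcongr; linarith
    have e3 : 0 < δ * κ := by positivity
    linarith
  have b3 : (-(κ / 2 * δ ^ 2) + δ ^ 3 * C) * E ^ 2 ≤ -(κ / 4 * δ ^ 3) * E ^ 2 := by
    refine mul_le_mul_of_nonneg_right ?_ hE
    have e1 := mul_le_mul_of_nonneg_left (show δ * C ≤ κ / 4 by linarith) (sq_nonneg δ)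
    have e2 : κ / 4 * δ ^ 3 ≤ κ / 4 * δ ^ 2 := by gcongr
    linarith
  have b4 : -(κ / 2 * δ ^ 3) * B ^ 2 ≤ -(κ / 4 * δ ^ 3) * B ^ 2 := by
    refine mul_le_mul_of_nonneg_right ?_ hB
    have : 0 < κ * δ ^ 3 := by positivity
    linarith
  linarith

variable (P : Plasma) {y : Symbols S H s} {ρ : Species → ℝ → S} {u : Species → ℝ → H} {E B : ℝ → H}

/-- The energy. -/
noncomputable def energy (P : Plasma) (ρ : Species → ℝ → S) (u : Species → ℝ → H) (E B : ℝ → H) (t : ℝ) : ℝ :=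
  4 * Real.pi * (P.T .ion * ‖ρ .ion t‖ ^ 2 + P.T .electron * ‖ρ .electron t‖ ^ 2
    + P.m .ion * ‖u .ion t‖ ^ 2 + P.m .electron * ‖u .electron t‖ ^ 2) + ‖E t‖ ^ 2 + ‖B t‖ ^ 2

variable {P}

/-- Gradient and divergence are skew adjoint, curl is symmetric, and the work of the electric field
on the two species cancels against the current in Ampère's law. Only friction remains. -/
theorem Orbit.energy_deriv (o : Orbit P y ρ u E B) (t : ℝ) :
    HasDerivAt (energy P ρ u E B)
      (-(8 * Real.pi * (P.f .ion * ‖u .ion t‖ ^ 2 + P.f .electron * ‖u .electron t‖ ^ 2))) t := by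
  have h := ((((((o.hρ .ion t).norm_sq.const_mul (P.T .ion)).add
    ((o.hρ .electron t).norm_sq.const_mul (P.T .electron))).add
    ((o.hu .ion t).norm_sq.const_mul (P.m .ion))).add
    ((o.hu .electron t).norm_sq.const_mul (P.m .electron))).const_mul (4 * Real.pi)).add
    (o.hE t).norm_sq |>.add (o.hB t).norm_sq
  convert! h using 1
  have hm1 := (P.m_pos .ion).ne'
  have hm2 := (P.m_pos .electron).ne'
  simp only [inner_neg_right, inner_smul_right, inner_add_right, inner_sub_right, y.inner_G',
    ← y.inner_K (B t) (E t), real_inner_self_eq_norm_sq, Plasma.q, real_inner_comm (E t) (y.K (B t)),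
    real_inner_comm (E t) (u _ t)]
  field_simp
  ring

/-- The corrector for the densities: the pressure force yields `-T s²|ρ|²`. By Gauss's law the
electric force contributes with a favourable sign, through the square of the charge. -/
theorem Orbit.deriv₁ (o : Orbit P y ρ u E B) (t : ℝ) :
    HasDerivAt (fun t => P.m .ion * ⟪y.G (ρ .ion t), u .ion t⟫
        + P.m .electron * ⟪y.G (ρ .electron t), u .electron t⟫)
      (P.m .ion * ‖y.X (u .ion t)‖ ^ 2 + P.m .electron * ‖y.X (u .electron t)‖ ^ 2
        - P.T .ion * (s ^ 2 * ‖ρ .ion t‖ ^ 2) - P.T .electron * (s ^ 2 * ‖ρ .electron t‖ ^ 2)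
        - P.f .ion * ⟪y.G (ρ .ion t), u .ion t⟫
        - P.f .electron * ⟪y.G (ρ .electron t), u .electron t⟫
        - 4 * Real.pi * P.e ^ 2 * ‖ρ .ion t - ρ .electron t‖ ^ 2) t := by
  have h1 := ((y.G.hasFDerivAt.comp_hasDerivAt t (o.hρ .ion t)).inner ℝ
    (o.hu .ion t)).const_mul (P.m .ion)
  have h2 := ((y.G.hasFDerivAt.comp_hasDerivAt t (o.hρ .electron t)).inner ℝ
    (o.hu .electron t)).const_mul (P.m .electron)
  convert! h1.add h2 using 1
  have hm1 := (P.m_pos .ion).ne'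
  have hm2 := (P.m_pos .electron).ne'
  have hG : ∀ z, ⟪y.G z, y.G z⟫ = s ^ 2 * ‖z‖ ^ 2 := fun z => by
    rw [real_inner_self_eq_norm_sq, y.norm_G, mul_pow]
  have hd := o.divE t
  have hd1 : ⟪y.G (ρ .ion t - ρ .electron t), E t⟫
      = -(4 * Real.pi * P.e * ‖ρ .ion t - ρ .electron t‖ ^ 2) := by
    rw [y.inner_G, hd, inner_smul_right, real_inner_self_eq_norm_sq]
  rw [map_sub, inner_sub_left] at hd1
  simp only [Function.comp_apply, inner_neg_right, inner_smul_right, inner_add_right,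
    inner_sub_right, hG, map_neg, inner_neg_left, Plasma.q, y.inner_G (y.X _),
    real_inner_self_eq_norm_sq]
  field_simp
  linear_combination (-P.e) * hd1

/-- The corrector for the electric field, which drives the two velocities in opposite directions. -/
theorem Orbit.deriv₂ (o : Orbit P y ρ u E B) (t : ℝ) :
    HasDerivAt (fun t => -⟪u .ion t - u .electron t, E t⟫)
      (-((P.e / P.m .ion + P.e / P.m .electron) * ‖E t‖ ^ 2)
        + P.T .ion / P.m .ion * ⟪y.G (ρ .ion t), E t⟫
        - P.T .electron / P.m .electron * ⟪y.G (ρ .electron t), E t⟫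
        + P.f .ion / P.m .ion * ⟪u .ion t, E t⟫
        - P.f .electron / P.m .electron * ⟪u .electron t, E t⟫
        - P.c * ⟪u .ion t - u .electron t, y.K (B t)⟫
        + 4 * Real.pi * P.e * ‖u .ion t - u .electron t‖ ^ 2) t := by
  have h := (((o.hu .ion t).sub (o.hu .electron t)).inner ℝ (o.hE t)).neg
  convert! h using 1
  have hm1 := (P.m_pos .ion).ne'
  have hm2 := (P.m_pos .electron).ne'
  rw [inner_sub_right, inner_smul_right, inner_smul_right]
  simp only [Pi.sub_apply]
  rw [real_inner_self_eq_norm_sq, inner_sub_left (_ • _)]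
  simp only [real_inner_smul_left, inner_add_left, inner_sub_left (_ + _), inner_neg_left,
    real_inner_self_eq_norm_sq, Plasma.q]
  field_simp
  ring

/-- The corrector for the magnetic field: Ampère's law yields `-c |curl B|²`, Faraday's law the
harmful `c |curl E|²`, which is left to the dissipation of `E`. -/
theorem Orbit.deriv₃ (o : Orbit P y ρ u E B) (t : ℝ) :
    HasDerivAt (fun t => -⟪E t, y.K (B t)⟫)
      (-(P.c * ‖y.K (B t)‖ ^ 2) + 4 * Real.pi * P.e * ⟪u .ion t - u .electron t, y.K (B t)⟫
        + P.c * ‖y.K (E t)‖ ^ 2) t := by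
  have h := ((o.hE t).inner ℝ (y.K.hasFDerivAt.comp_hasDerivAt t (o.hB t))).neg
  convert! h using 1
  simp only [Function.comp_apply, map_neg, map_smul, inner_neg_right, inner_smul_right]
  rw [← y.inner_K (E t) (y.K (E t)), real_inner_self_eq_norm_sq, inner_sub_left (P.c • _), real_inner_smul_left,
    real_inner_smul_left, real_inner_self_eq_norm_sq]
  ring

end Pointwise

end EulerMaxwell

end

/-! ### Dissipation estimates uniform in the frequency -/

section

open MeasureTheory SchwartzMap LineDeriv
open scoped ENNReal NNReal RealInnerProductSpace

namespace EulerMaxwell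

theorem exists_le_of_pos (l : List ℝ) (h : ∀ x ∈ l, 0 < x) : ∃ κ : ℝ, 0 < κ ∧ ∀ x ∈ l, κ ≤ x := by
  induction l with
  | nil => exact ⟨1, one_pos, by simp⟩
  | cons a l ih =>
    obtain ⟨κ, hκ, hl⟩ := ih fun x hx => h x (List.mem_cons_of_mem _ hx)
    refine ⟨min a κ, lt_min (h a (by simp)) hκ, fun x hx => ?_⟩
    rcases List.mem_cons.1 hx with rfl | hx
    · exact min_le_left _ _
    · exact (min_le_right _ _).trans (hl x hx)

theorem exists_ge_pos (l : List ℝ) : ∃ C : ℝ, 0 < C ∧ ∀ x ∈ l, x ≤ C := by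
  induction l with
  | nil => exact ⟨1, one_pos, by simp⟩
  | cons a l ih =>
    obtain ⟨κ, hκ, hl⟩ := ih
    refine ⟨max a κ, lt_max_of_lt_right hκ, fun x hx => ?_⟩
    rcases List.mem_cons.1 hx with rfl | hx
    · exact le_max_left _ _
    · exact (hl x hx).trans (le_max_right _ _)

theorem Plasma.f_pos (P : Plasma) (a : Species) : 0 < P.f a := mul_pos (P.m_pos a) (P.ν_pos a)

theorem Plasma.F_pos (P : Plasma) : 0 < P.F := add_pos (P.f_pos _) (P.f_pos _)

/-- Differential inequality `L' ≤ -γ L`. -/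
theorem le_exp_of_deriv_le {L L' : ℝ → ℝ} {γ : ℝ} (hL : ∀ t, HasDerivAt L (L' t) t)
    (h : ∀ t, L' t ≤ -γ * L t) {t : ℝ} (ht : 0 ≤ t) : L t ≤ Real.exp (-(γ * t)) * L 0 := by
  have hd : ∀ x, HasDerivAt (fun x => Real.exp (γ * x) * L x)
      (Real.exp (γ * x) * (γ * L x + L' x)) x := fun x => by
    have h1 : HasDerivAt (fun x => Real.exp (γ * x)) (Real.exp (γ * x) * (γ * 1)) x :=
      ((hasDerivAt_id x).const_mul γ).exp
    convert! h1.mul (hL x) using 1; ring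
  have ha : Antitone (fun x => Real.exp (γ * x) * L x) := by
    refine antitone_of_deriv_nonpos (fun x => (hd x).differentiableAt) fun x => ?_
    rw [(hd x).deriv]
    exact mul_nonpos_of_nonneg_of_nonpos (Real.exp_nonneg _) (by linarith [h x])
  have := ha ht
  simp only [mul_zero, Real.exp_zero, one_mul] at this
  rw [Real.exp_neg, ← div_eq_inv_mul, le_div_iff₀ (Real.exp_pos _)]
  linarith

section Pointwise

variable {S H : Type*} [NormedAddCommGroup S] [InnerProductSpace ℝ S]
  [NormedAddCommGroup H] [InnerProductSpace ℝ H]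

theorem abs_inner_G_le {s : ℝ} (y : Symbols S H s) (z : S) (v : H) :
    |⟪y.G z, v⟫| ≤ s * ‖z‖ * ‖v‖ := by
  simpa [y.norm_G] using abs_real_inner_le_norm (y.G z) v

theorem abs_inner_K_le {s : ℝ} (y : Symbols S H s) (v w : H) :
    |⟪v, y.K w⟫| ≤ ‖v‖ * (s * ‖w‖) :=
  (abs_real_inner_le_norm _ _).trans (mul_le_mul_of_nonneg_left (y.norm_K_le w) (norm_nonneg v))

/-- The correctors carry the weights `v²`, `v²`, `v⁴`, and all physical constants are replaced by
one lower bound κ and one upper bound `C`. The right-hand sides are written in the variables of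
`absorb`: `U = |u_i| + |u_e|`, `R = v s (|ρ_i| + |ρ_e|)`, `v|E|` and `v² s |B|`. The condition `v s
≤ 1` tames every term in which a derivative falls on `u` or `E`. -/
theorem dissipation_bounds (P : Plasma) : ∃ κ C : ℝ, 0 < κ ∧ 0 < C ∧
    ∀ (s : ℝ) (y : Symbols S H s) (v : ℝ), 0 < v → v ≤ 1 → v * s ≤ 1 →
    ∀ (ρi ρe : S) (ui ue E B : H), y.X B = 0 →
    -(8 * Real.pi * (P.f .ion * ‖ui‖ ^ 2 + P.f .electron * ‖ue‖ ^ 2)) ≤ -κ * (‖ui‖ + ‖ue‖) ^ 2 ∧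
    v ^ 2 * (P.m .ion * ‖y.X ui‖ ^ 2 + P.m .electron * ‖y.X ue‖ ^ 2
        - P.T .ion * (s ^ 2 * ‖ρi‖ ^ 2) - P.T .electron * (s ^ 2 * ‖ρe‖ ^ 2)
        - P.f .ion * ⟪y.G ρi, ui⟫ - P.f .electron * ⟪y.G ρe, ue⟫
        - 4 * Real.pi * P.e ^ 2 * ‖ρi - ρe‖ ^ 2) ≤
      C * (‖ui‖ + ‖ue‖) ^ 2 + C * ((‖ui‖ + ‖ue‖) * (v * s * (‖ρi‖ + ‖ρe‖)))
        - κ * (v * s * (‖ρi‖ + ‖ρe‖)) ^ 2 ∧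
    v ^ 2 * (-((P.e / P.m .ion + P.e / P.m .electron) * ‖E‖ ^ 2)
        + P.T .ion / P.m .ion * ⟪y.G ρi, E⟫ - P.T .electron / P.m .electron * ⟪y.G ρe, E⟫
        + P.f .ion / P.m .ion * ⟪ui, E⟫ - P.f .electron / P.m .electron * ⟪ue, E⟫
        - P.c * ⟪ui - ue, y.K B⟫ + 4 * Real.pi * P.e * ‖ui - ue‖ ^ 2) ≤
      -κ * (v * ‖E‖) ^ 2 + C * ((v * s * (‖ρi‖ + ‖ρe‖)) * (v * ‖E‖) + (‖ui‖ + ‖ue‖) * (v * ‖E‖)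
        + (‖ui‖ + ‖ue‖) * (v ^ 2 * s * ‖B‖) + (‖ui‖ + ‖ue‖) ^ 2) ∧
    v ^ 4 * (-(P.c * ‖y.K B‖ ^ 2) + 4 * Real.pi * P.e * ⟪ui - ue, y.K B⟫ + P.c * ‖y.K E‖ ^ 2) ≤
      -κ * (v ^ 2 * s * ‖B‖) ^ 2 + C * ((‖ui‖ + ‖ue‖) * (v ^ 2 * s * ‖B‖)) + C * (v * ‖E‖) ^ 2 := by
  have hmi := P.m_pos .ion
  have hme := P.m_pos .electron
  have hfi := P.f_pos .ion
  have hfe := P.f_pos .electron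
  have hTi := P.T_pos .ion
  have hTe := P.T_pos .electron
  have he := P.e_pos
  have hc := P.c_pos
  have hpi := Real.pi_pos
  -- The friction and temperature constants are halved because `(a+b)² ≤ 2a² + 2b²`.
  obtain ⟨κ, hκ, hκl⟩ := exists_le_of_pos [4 * Real.pi * P.f .ion, 4 * Real.pi * P.f .electron,
    P.T .ion / 2, P.T .electron / 2, P.e / P.m .ion + P.e / P.m .electron, P.c]
    (by simp only [List.mem_cons, List.not_mem_nil, or_false]; rintro x (rfl|rfl|rfl|rfl|rfl|rfl)
        <;> positivity)
  obtain ⟨C, hC, hCl⟩ := exists_ge_pos [P.m .ion, P.m .electron, P.f .ion, P.f .electron,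
    P.T .ion / P.m .ion, P.T .electron / P.m .electron, P.f .ion / P.m .ion,
    P.f .electron / P.m .electron, P.c, 4 * Real.pi * P.e]
  simp only [List.mem_cons, List.not_mem_nil, or_false, forall_eq_or_imp, forall_eq] at hκl hCl
  obtain ⟨k1, k2, k3, k4, k5, k6⟩ := hκl
  obtain ⟨c1, c2, c3, c4, c5, c6, c7, c8, c9, c10⟩ := hCl
  refine ⟨κ, C, hκ, hC, fun s y v hv hv1 hvs ρi ρe ui ue E B hB => ?_⟩
  have hs := y.s_nonneg
  have hvs0 : 0 ≤ v * s := by positivity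
  have na := norm_nonneg ui
  have nb := norm_nonneg ue
  have nr := norm_nonneg ρi
  have nq := norm_nonneg ρe
  have nE := norm_nonneg E
  have nB := norm_nonneg B
  have ndiff : ‖ui - ue‖ ≤ ‖ui‖ + ‖ue‖ := norm_sub_le _ _
  have hvs2 : (v * s) ^ 2 ≤ 1 := pow_le_one₀ hvs0 hvs
  have hv2 : v ^ 2 ≤ 1 := pow_le_one₀ hv.le hv1
  have iK : |⟪ui - ue, y.K B⟫| ≤ (‖ui‖ + ‖ue‖) * (s * ‖B‖) :=
    (abs_inner_K_le y _ _).trans (mul_le_mul_of_nonneg_right ndiff (by positivity))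
  refine ⟨?_, ?_, ?_, ?_⟩
  · have h1 := mul_le_mul_of_nonneg_right k1 (sq_nonneg ‖ui‖)
    have h2 := mul_le_mul_of_nonneg_right k2 (sq_nonneg ‖ue‖)
    have h3 := mul_nonneg hκ.le (sq_nonneg (‖ui‖ - ‖ue‖))
    linarith
  · have x1 : P.m .ion * ((v * ‖y.X ui‖) ^ 2) ≤ C * ‖ui‖ ^ 2 := by
      have : v * ‖y.X ui‖ ≤ ‖ui‖ := by
        calc v * ‖y.X ui‖ ≤ v * (s * ‖ui‖) := by gcongr; exact y.norm_X_le _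
          _ = v * s * ‖ui‖ := by ring
          _ ≤ _ := mul_le_of_le_one_left na hvs
      gcongr
    have x2 : P.m .electron * ((v * ‖y.X ue‖) ^ 2) ≤ C * ‖ue‖ ^ 2 := by
      have : v * ‖y.X ue‖ ≤ ‖ue‖ := by
        calc v * ‖y.X ue‖ ≤ v * (s * ‖ue‖) := by gcongr; exact y.norm_X_le _
          _ = v * s * ‖ue‖ := by ring
          _ ≤ _ := mul_le_of_le_one_left nb hvs
      gcongr
    have x3 := mul_le_mul_of_nonneg_right k3 (sq_nonneg (v * s * ‖ρi‖))
    have x4 := mul_le_mul_of_nonneg_right k4 (sq_nonneg (v * s * ‖ρe‖))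
    have x5 := mul_nonneg hκ.le (sq_nonneg (v * s * ‖ρi‖ - v * s * ‖ρe‖))
    have g : ∀ (f : ℝ) (z : S) (w : H), 0 < f → f ≤ C →
        v ^ 2 * (-(f * ⟪y.G z, w⟫)) ≤ C * (‖w‖ * (v * s * ‖z‖)) := by
      intro f z w hf hfC
      calc v ^ 2 * (-(f * ⟪y.G z, w⟫)) = v ^ 2 * f * (-⟪y.G z, w⟫) := by ring
        _ ≤ v * C * (s * ‖z‖ * ‖w‖) := by
          have h1 : v ^ 2 * f ≤ v * C := by
            rw [sq]; gcongr; exact mul_le_of_le_one_left hv.le hv1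
          have h2 := (neg_le_abs _).trans (abs_inner_G_le y z w)
          calc _ ≤ v ^ 2 * f * (s * ‖z‖ * ‖w‖) := by gcongr
            _ ≤ _ := by gcongr
        _ = _ := by ring
    have x6 := g (P.f .ion) ρi ui hfi c3
    have x7 := g (P.f .electron) ρe ue hfe c4
    have x8 : 0 ≤ v ^ 2 * (4 * Real.pi * P.e ^ 2 * ‖ρi - ρe‖ ^ 2) := by positivity
    have x9 : 0 ≤ C * (‖ui‖ * ‖ue‖) := by positivity
    have x10 : 0 ≤ C * (‖ui‖ * (v * s * ‖ρe‖)) := by positivity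
    have x11 : 0 ≤ C * (‖ue‖ * (v * s * ‖ρi‖)) := by positivity
    linarith
  · have x1 := mul_le_mul_of_nonneg_right k5 (sq_nonneg (v * ‖E‖))
    have g : ∀ (f : ℝ) (z : S), 0 < f → f ≤ C →
        |v ^ 2 * (f * ⟪y.G z, E⟫)| ≤ C * ((v * s * ‖z‖) * (v * ‖E‖)) := by
      intro f z hf hfC
      rw [abs_mul, abs_mul, abs_of_pos hf, abs_of_nonneg (sq_nonneg v)]
      calc _ ≤ v ^ 2 * (C * (s * ‖z‖ * ‖E‖)) := by gcongr; exact abs_inner_G_le y z E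
        _ = _ := by ring
    have g' : ∀ (f : ℝ) (w : H), 0 < f → f ≤ C →
        |v ^ 2 * (f * ⟪w, E⟫)| ≤ C * (‖w‖ * (v * ‖E‖)) := by
      intro f w hf hfC
      rw [abs_mul, abs_mul, abs_of_pos hf, abs_of_nonneg (sq_nonneg v)]
      calc _ ≤ v * (C * (‖w‖ * ‖E‖)) := by
            have h1 : v ^ 2 ≤ v := by rw [sq]; exact mul_le_of_le_one_left hv.le hv1
            gcongr; exact abs_real_inner_le_norm _ _
        _ = _ := by ring
    have x2 := (abs_le.1 (g _ ρi (div_pos hTi hmi) c5)).2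
    have x3 := (abs_le.1 (g _ ρe (div_pos hTe hme) c6)).1
    have x4 := (abs_le.1 (g' _ ui (div_pos hfi hmi) c7)).2
    have x5 := (abs_le.1 (g' _ ue (div_pos hfe hme) c8)).1
    have x6 : -(v ^ 2 * (P.c * ⟪ui - ue, y.K B⟫)) ≤ C * ((‖ui‖ + ‖ue‖) * (v ^ 2 * s * ‖B‖)) := by
      calc _ = v ^ 2 * (P.c * -⟪ui - ue, y.K B⟫) := by ring
        _ ≤ v ^ 2 * (C * ((‖ui‖ + ‖ue‖) * (s * ‖B‖))) := by
          have h2 := (neg_le_abs _).trans iK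
          calc _ ≤ v ^ 2 * (P.c * ((‖ui‖ + ‖ue‖) * (s * ‖B‖))) := by gcongr
            _ ≤ _ := by gcongr
        _ = _ := by ring
    have x7 : v ^ 2 * (4 * Real.pi * P.e * ‖ui - ue‖ ^ 2) ≤ C * (‖ui‖ + ‖ue‖) ^ 2 := by
      calc _ ≤ 1 * (C * (‖ui‖ + ‖ue‖) ^ 2) := by gcongr
        _ = _ := one_mul _
    linarith
  -- The constraint `div B = 0` enters here: the curl alone then controls all of `B`.
  · have hK : ‖y.K B‖ ^ 2 = s ^ 2 * ‖B‖ ^ 2 := by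
      have := y.norm_KX B
      rw [hB, norm_zero] at this
      linarith
    have x1 := mul_le_mul_of_nonneg_right k6 (sq_nonneg (v ^ 2 * s * ‖B‖))
    have x2 : v ^ 4 * (4 * Real.pi * P.e * ⟪ui - ue, y.K B⟫) ≤
        C * ((‖ui‖ + ‖ue‖) * (v ^ 2 * s * ‖B‖)) := by
      calc _ ≤ v ^ 4 * (4 * Real.pi * P.e * ((‖ui‖ + ‖ue‖) * (s * ‖B‖))) := by
            gcongr; exact (le_abs_self _).trans iK
        _ ≤ v ^ 2 * (C * ((‖ui‖ + ‖ue‖) * (s * ‖B‖))) := by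
          gcongr ?_ * (?_ * _)
          exact pow_le_pow_of_le_one hv.le hv1 (by norm_num)
        _ = _ := by ring
    have x3 : v ^ 4 * (P.c * ‖y.K E‖ ^ 2) ≤ C * (v * ‖E‖) ^ 2 := by
      have h1 : v * ‖y.K E‖ ≤ ‖E‖ := by
        calc v * ‖y.K E‖ ≤ v * (s * ‖E‖) := by gcongr; exact y.norm_K_le _
          _ = v * s * ‖E‖ := by ring
          _ ≤ _ := mul_le_of_le_one_left nE hvs
      calc _ = P.c * (v * (v * ‖y.K E‖)) ^ 2 := by ring
        _ ≤ C * (v * ‖E‖) ^ 2 := by gcongr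
    rw [hK]
    linarith

end Pointwise

end EulerMaxwell

end

/-! ### Decay of the energy at every frequency -/

section

open MeasureTheory SchwartzMap LineDeriv
open scoped ENNReal NNReal RealInnerProductSpace

namespace EulerMaxwell

section Pointwise

variable {S H : Type*} [NormedAddCommGroup S] [InnerProductSpace ℝ S]
  [NormedAddCommGroup H] [InnerProductSpace ℝ H]

/-- The sum of the squared norms of all components. -/
def sqSize (ρ : Species → ℝ → S) (u : Species → ℝ → H) (E B : ℝ → H) (t : ℝ) : ℝ :=
  ‖ρ .ion t‖ ^ 2 + ‖ρ .electron t‖ ^ 2 + ‖u .ion t‖ ^ 2 + ‖u .electron t‖ ^ 2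
    + ‖E t‖ ^ 2 + ‖B t‖ ^ 2

/-- The sum of the norms of all components. -/
def size (ρ : Species → ℝ → S) (u : Species → ℝ → H) (E B : ℝ → H) (t : ℝ) : ℝ :=
  ‖ρ .ion t‖ + ‖ρ .electron t‖ + ‖u .ion t‖ + ‖u .electron t‖ + ‖E t‖ + ‖B t‖

variable {ρ : Species → ℝ → S} {u : Species → ℝ → H} {E B : ℝ → H}

theorem size_nonneg (t : ℝ) : 0 ≤ size ρ u E B t := by unfold size; positivity

theorem sqSize_le (t : ℝ) : sqSize ρ u E B t ≤ size ρ u E B t ^ 2 := by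
  unfold sqSize size
  have h : ∀ a b : ℝ, 0 ≤ a → 0 ≤ b → a ^ 2 + b ^ 2 ≤ (a + b) ^ 2 := fun a b ha hb => by
    nlinarith [mul_nonneg ha hb]
  have h1 := h ‖ρ .ion t‖ ‖ρ .electron t‖ (by positivity) (by positivity)
  have h2 := h (‖ρ .ion t‖ + ‖ρ .electron t‖) ‖u .ion t‖ (by positivity) (by positivity)
  have h3 := h (‖ρ .ion t‖ + ‖ρ .electron t‖ + ‖u .ion t‖) ‖u .electron t‖
    (by positivity) (by positivity)
  have h4 := h (‖ρ .ion t‖ + ‖ρ .electron t‖ + ‖u .ion t‖ + ‖u .electron t‖) ‖E t‖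
    (by positivity) (by positivity)
  have h5 := h (‖ρ .ion t‖ + ‖ρ .electron t‖ + ‖u .ion t‖ + ‖u .electron t‖ + ‖E t‖) ‖B t‖
    (by positivity) (by positivity)
  linarith

theorem size_le (t : ℝ) : size ρ u E B t ^ 2 ≤ 6 * sqSize ρ u E B t := by
  unfold sqSize size
  have h := fun a b : ℝ => sq_nonneg (a - b)
  generalize ‖ρ .ion t‖ = a
  generalize ‖ρ .electron t‖ = b
  generalize ‖u .ion t‖ = c
  generalize ‖u .electron t‖ = d
  generalize ‖E t‖ = e
  generalize ‖B t‖ = f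
  linarith [h a b, h a c, h a d, h a e, h a f, h b c, h b d, h b e, h b f, h c d, h c e, h c f,
    h d e, h d f, h e f]

theorem energy_equiv (P : Plasma) : ∃ k K : ℝ, 0 < k ∧ 0 < K ∧
    ∀ (ρ : Species → ℝ → S) (u : Species → ℝ → H) (E B : ℝ → H) (t : ℝ),
      k * sqSize ρ u E B t ≤ energy P ρ u E B t ∧ energy P ρ u E B t ≤ K * sqSize ρ u E B t := by
  have hmi := P.m_pos .ion
  have hme := P.m_pos .electron
  have hTi := P.T_pos .ion
  have hTe := P.T_pos .electron
  have hpi := Real.pi_pos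
  obtain ⟨k, hk, hkl⟩ := exists_le_of_pos [4 * Real.pi * P.T .ion, 4 * Real.pi * P.T .electron,
    4 * Real.pi * P.m .ion, 4 * Real.pi * P.m .electron, 1]
    (by simp only [List.mem_cons, List.not_mem_nil, or_false]; rintro x (rfl|rfl|rfl|rfl|rfl)
        <;> positivity)
  obtain ⟨K, hK, hKl⟩ := exists_ge_pos [4 * Real.pi * P.T .ion, 4 * Real.pi * P.T .electron,
    4 * Real.pi * P.m .ion, 4 * Real.pi * P.m .electron, 1]
  simp only [List.mem_cons, List.not_mem_nil, or_false, forall_eq_or_imp, forall_eq] at hkl hKl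
  obtain ⟨k1, k2, k3, k4, k5⟩ := hkl
  obtain ⟨K1, K2, K3, K4, K5⟩ := hKl
  refine ⟨k, K, hk, hK, fun ρ u E B t => ⟨?_, ?_⟩⟩
  all_goals
    unfold sqSize energy
    have a1 := sq_nonneg ‖ρ .ion t‖
    have a2 := sq_nonneg ‖ρ .electron t‖
    have a3 := sq_nonneg ‖u .ion t‖
    have a4 := sq_nonneg ‖u .electron t‖
    have a5 := sq_nonneg ‖E t‖
    have a6 := sq_nonneg ‖B t‖
  · linarith [mul_le_mul_of_nonneg_right k1 a1, mul_le_mul_of_nonneg_right k2 a2,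
      mul_le_mul_of_nonneg_right k3 a3, mul_le_mul_of_nonneg_right k4 a4,
      mul_le_mul_of_nonneg_right k5 a5, mul_le_mul_of_nonneg_right k5 a6]
  · linarith [mul_le_mul_of_nonneg_right K1 a1, mul_le_mul_of_nonneg_right K2 a2,
      mul_le_mul_of_nonneg_right K3 a3, mul_le_mul_of_nonneg_right K4 a4,
      mul_le_mul_of_nonneg_right K5 a5, mul_le_mul_of_nonneg_right K5 a6]

/-- The energy plus `δv²`, `δ²v²` and `δ³v⁴` times the three correctors, with `v = (1+s²)^(-1/2)`,
is comparable to the energy, and its derivative controls `v⁴s² = s²/(1+s²)²` times all components.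
The rate is like `s²` at low frequencies, giving heat decay, and like `s⁻²` at high ones, giving
regularity loss. -/
theorem energy_decay (P : Plasma) : ∃ c : ℝ, 0 < c ∧ ∀ (s : ℝ) (y : Symbols S H s)
    (ρ : Species → ℝ → S) (u : Species → ℝ → H) (E B : ℝ → H), Orbit P y ρ u E B →
    ∀ t, 0 ≤ t → energy P ρ u E B t ≤
      3 * (Real.exp (-(c * (s ^ 2 / (1 + s ^ 2) ^ 2) * t)) * energy P ρ u E B 0) := by
  obtain ⟨κ, C, hκ, hC, hdiss⟩ := dissipation_bounds (S := S) (H := H) P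
  obtain ⟨k, K, hk, hK, heq⟩ := energy_equiv (S := S) (H := H) P
  obtain ⟨δ₀, hδ₀, hδ₀1, habs⟩ := absorb hκ hC
  obtain ⟨M, hM, hMl⟩ := exists_ge_pos [P.m .ion, P.m .electron, 1]
  simp only [List.mem_cons, List.not_mem_nil, or_false, forall_eq_or_imp, forall_eq] at hMl
  obtain ⟨M1, M2, M3⟩ := hMl
  -- The second bound keeps the sum of the correctors, which is at most `3 δ M` times the squared
  -- size, below half of the energy.
  obtain ⟨δ, hδ, hδl⟩ := exists_le_of_pos [δ₀, k / (6 * M)]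
    (by simp only [List.mem_cons, List.not_mem_nil, or_false]; rintro x (rfl|rfl) <;> positivity)
  simp only [List.mem_cons, List.not_mem_nil, or_false, forall_eq_or_imp, forall_eq] at hδl
  obtain ⟨hδ1, hδ2⟩ := hδl
  rw [le_div_iff₀ (by positivity)] at hδ2
  have hδ3 : δ ≤ 1 := hδ1.trans hδ₀1
  refine ⟨κ * δ ^ 3 / (6 * K), by positivity, fun s y ρ u E B o t ht => ?_⟩
  have hs := y.s_nonneg
  set v : ℝ := (√(1 + s ^ 2))⁻¹ with hvdef
  have hsq : √(1 + s ^ 2) ^ 2 = 1 + s ^ 2 := Real.sq_sqrt (by positivity)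
  have hsq1 : 0 < √(1 + s ^ 2) := by positivity
  have hv : 0 < v := by positivity
  have hv1 : v ≤ 1 := by
    refine inv_le_one_of_one_le₀ (Real.one_le_sqrt.2 ?_)
    nlinarith
  have hvs : v * s ≤ 1 := by
    rw [hvdef, ← div_eq_inv_mul, div_le_one hsq1]
    exact Real.le_sqrt_of_sq_le (by linarith)
  have hv4 : v ^ 4 * s ^ 2 = s ^ 2 / (1 + s ^ 2) ^ 2 := by
    rw [hvdef, inv_pow, show √(1 + s ^ 2) ^ 4 = (√(1 + s ^ 2) ^ 2) ^ 2 by ring, hsq, div_eq_inv_mul]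
  set L : ℝ → ℝ := fun t => energy P ρ u E B t
    + δ * v ^ 2 * (P.m .ion * ⟪y.G (ρ .ion t), u .ion t⟫
        + P.m .electron * ⟪y.G (ρ .electron t), u .electron t⟫)
    + δ ^ 2 * v ^ 2 * (-⟪u .ion t - u .electron t, E t⟫)
    + δ ^ 3 * v ^ 4 * (-⟪E t, y.K (B t)⟫) with hL
  have hLd := fun t => (((o.energy_deriv t).add ((o.deriv₁ t).const_mul (δ * v ^ 2))).add
    ((o.deriv₂ t).const_mul (δ ^ 2 * v ^ 2))).add ((o.deriv₃ t).const_mul (δ ^ 3 * v ^ 4))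
  have hclose : ∀ t, |L t - energy P ρ u E B t| ≤ energy P ρ u E B t / 2 := by
    intro t
    have hk1 := (heq ρ u E B t).1
    have r1 := norm_nonneg (ρ .ion t)
    have r2 := norm_nonneg (ρ .electron t)
    have a1 := norm_nonneg (u .ion t)
    have a2 := norm_nonneg (u .electron t)
    have nE := norm_nonneg (E t)
    have nB := norm_nonneg (B t)
    have hvvs : v ^ 2 * s ≤ 1 := by
      calc v ^ 2 * s = v * (v * s) := by ring
        _ ≤ 1 := mul_le_one₀ hv1 (by positivity) hvs
    have hv4s : v ^ 4 * s ≤ 1 := by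
      calc v ^ 4 * s = v ^ 2 * (v ^ 2 * s) := by ring
        _ ≤ 1 := mul_le_one₀ (pow_le_one₀ hv.le hv1) (by positivity) hvvs
    have g : ∀ (m : ℝ) (z : S) (w : H), 0 < m → m ≤ M →
        |δ * v ^ 2 * (m * ⟪y.G z, w⟫)| ≤ δ * M * (‖z‖ * ‖w‖) := by
      intro m z w hm hmM
      rw [abs_mul, abs_mul m, abs_of_pos hm, abs_of_nonneg (by positivity : 0 ≤ δ * v ^ 2)]
      calc _ ≤ δ * v ^ 2 * (M * (s * ‖z‖ * ‖w‖)) := by gcongr; exact abs_inner_G_le y z w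
        _ = δ * M * (‖z‖ * ‖w‖) * (v ^ 2 * s) := by ring
        _ ≤ _ := mul_le_of_le_one_right (by positivity) hvvs
    have x1 := g _ (ρ .ion t) (u .ion t) (P.m_pos _) M1
    have x2 := g _ (ρ .electron t) (u .electron t) (P.m_pos _) M2
    have x3 : |δ ^ 2 * v ^ 2 * (-⟪u .ion t - u .electron t, E t⟫)| ≤
        δ * M * ((‖u .ion t‖ + ‖u .electron t‖) * ‖E t‖) := by
      rw [abs_mul, abs_neg, abs_of_nonneg (by positivity : 0 ≤ δ ^ 2 * v ^ 2)]
      have h1 : δ ^ 2 * v ^ 2 ≤ δ * M := by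
        calc δ ^ 2 * v ^ 2 ≤ δ ^ 2 * 1 := by gcongr; exact pow_le_one₀ hv.le hv1
          _ = δ * δ := by ring
          _ ≤ _ := by gcongr; linarith
      gcongr
      exact (abs_real_inner_le_norm _ _).trans (by gcongr; exact norm_sub_le _ _)
    have x4 : |δ ^ 3 * v ^ 4 * (-⟪E t, y.K (B t)⟫)| ≤ δ * M * (‖E t‖ * ‖B t‖) := by
      rw [abs_mul, abs_neg, abs_of_nonneg (by positivity : 0 ≤ δ ^ 3 * v ^ 4)]
      calc _ ≤ δ ^ 3 * v ^ 4 * (‖E t‖ * (s * ‖B t‖)) := by gcongr; exact abs_inner_K_le y _ _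
        _ = δ ^ 3 * (‖E t‖ * ‖B t‖) * (v ^ 4 * s) := by ring
        _ ≤ δ ^ 3 * (‖E t‖ * ‖B t‖) := mul_le_of_le_one_right (by positivity) hv4s
        _ ≤ _ := by
          have : δ ^ 3 ≤ δ * M := by
            calc δ ^ 3 ≤ δ := pow_le_of_le_one hδ.le hδ3 (by norm_num)
              _ ≤ δ * M := le_mul_of_one_le_right hδ.le M3
          gcongr
    have hsum : ‖ρ .ion t‖ * ‖u .ion t‖ + ‖ρ .electron t‖ * ‖u .electron t‖
        + (‖u .ion t‖ + ‖u .electron t‖) * ‖E t‖ + ‖E t‖ * ‖B t‖ ≤ 3 * sqSize ρ u E B t := by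
      unfold sqSize
      linarith [sq_nonneg (‖ρ .ion t‖ - ‖u .ion t‖), sq_nonneg (‖ρ .electron t‖ - ‖u .electron t‖),
        sq_nonneg (‖u .ion t‖ - ‖E t‖), sq_nonneg (‖u .electron t‖ - ‖E t‖),
        sq_nonneg (‖E t‖ - ‖B t‖), sq_nonneg ‖ρ .ion t‖, sq_nonneg ‖ρ .electron t‖,
        sq_nonneg ‖u .ion t‖, sq_nonneg ‖u .electron t‖, sq_nonneg ‖E t‖, sq_nonneg ‖B t‖]
    have hsum2 := mul_le_mul_of_nonneg_left hsum (by positivity : 0 ≤ δ * M)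
    have hN : 0 ≤ sqSize ρ u E B t := by unfold sqSize; positivity
    have hsum3 := mul_le_mul_of_nonneg_right hδ2 hN
    have e : L t - energy P ρ u E B t = δ * v ^ 2 * (P.m .ion * ⟪y.G (ρ .ion t), u .ion t⟫)
        + δ * v ^ 2 * (P.m .electron * ⟪y.G (ρ .electron t), u .electron t⟫)
        + δ ^ 2 * v ^ 2 * (-⟪u .ion t - u .electron t, E t⟫)
        + δ ^ 3 * v ^ 4 * (-⟪E t, y.K (B t)⟫) := by simp only [hL]; ring
    rw [e, abs_le]
    rw [abs_le] at x1 x2 x3 x4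
    constructor <;> linarith [x1.1, x1.2, x2.1, x2.2, x3.1, x3.2, x4.1, x4.2]
  have key := le_exp_of_deriv_le (γ := κ * δ ^ 3 / (6 * K) * (s ^ 2 / (1 + s ^ 2) ^ 2)) hLd
    (fun t => ?_) ht
  -- The functional lies between one half and three halves of the energy, whence the factor three.
  · have h0 := abs_le.1 (hclose 0)
    have h1 := abs_le.1 (hclose t)
    change L t ≤ _ * L 0 at key
    have he := Real.exp_pos (-(κ * δ ^ 3 / (6 * K) * (s ^ 2 / (1 + s ^ 2) ^ 2) * t))
    have := mul_le_mul_of_nonneg_left (show L 0 ≤ 3 / 2 * energy P ρ u E B 0 by linarith) he.le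
    linarith
  · obtain ⟨d0, d1, d2, d3⟩ := hdiss s y v hv hv1 hvs (ρ .ion t) (ρ .electron t) (u .ion t)
      (u .electron t) (E t) (B t) (o.divB t)
    have d1' := mul_le_mul_of_nonneg_left d1 hδ.le
    have d2' := mul_le_mul_of_nonneg_left d2 (sq_nonneg δ)
    have d3' := mul_le_mul_of_nonneg_left d3 (pow_nonneg hδ.le 3)
    have ha := habs δ hδ hδ1 (‖u .ion t‖ + ‖u .electron t‖)
      (v * s * (‖ρ .ion t‖ + ‖ρ .electron t‖)) (v * ‖E t‖) (v ^ 2 * s * ‖B t‖)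
    -- The weight `v⁴s²` of the magnetic field is the smallest of the four and fixes the rate.
    have hq : v ^ 4 * s ^ 2 * sqSize ρ u E B t ≤ (‖u .ion t‖ + ‖u .electron t‖) ^ 2
        + (v * s * (‖ρ .ion t‖ + ‖ρ .electron t‖)) ^ 2 + (v * ‖E t‖) ^ 2
        + (v ^ 2 * s * ‖B t‖) ^ 2 := by
      have p1 : (v * (v * s)) ^ 2 ≤ 1 :=
        pow_le_one₀ (by positivity) (mul_le_one₀ hv1 (by positivity) hvs)
      have p2 : v ^ 2 ≤ 1 := pow_le_one₀ hv.le hv1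
      have p3 : (v * s) ^ 2 ≤ 1 := pow_le_one₀ (by positivity) hvs
      have r1 := norm_nonneg (ρ .ion t)
      have r2 := norm_nonneg (ρ .electron t)
      have a1 := norm_nonneg (u .ion t)
      have a2 := norm_nonneg (u .electron t)
      have q1 := mul_le_mul_of_nonneg_right p1 (by positivity :
        0 ≤ ‖u .ion t‖ ^ 2 + ‖u .electron t‖ ^ 2)
      have q2 := mul_le_mul_of_nonneg_right p2 (by positivity :
        0 ≤ (v * s) ^ 2 * (‖ρ .ion t‖ ^ 2 + ‖ρ .electron t‖ ^ 2))
      have q3 := mul_le_mul_of_nonneg_right p3 (by positivity : 0 ≤ v ^ 2 * ‖E t‖ ^ 2)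
      have q4 := mul_nonneg a1 a2
      have q5 := mul_nonneg (sq_nonneg (v * s)) (mul_nonneg r1 r2)
      unfold sqSize
      linarith
    have hE := (heq ρ u E B t).2
    have hcl := (abs_le.1 (hclose t)).2
    have h6 : κ * δ ^ 3 / (6 * K) * (s ^ 2 / (1 + s ^ 2) ^ 2) * L t ≤
        κ / 4 * δ ^ 3 * (v ^ 4 * s ^ 2 * sqSize ρ u E B t) := by
      rw [← hv4]
      calc κ * δ ^ 3 / (6 * K) * (v ^ 4 * s ^ 2) * L t
          ≤ κ * δ ^ 3 / (6 * K) * (v ^ 4 * s ^ 2) * (3 / 2 * (K * sqSize ρ u E B t)) := by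
            gcongr; linarith
        _ = _ := by field_simp; ring
    have h7 := mul_le_mul_of_nonneg_left hq (by positivity : 0 ≤ κ / 4 * δ ^ 3)
    rw [neg_mul]
    change _ ≤ -(_ * L t)
    linarith

theorem size_decay (P : Plasma) : ∃ c C : ℝ, 0 < c ∧ 0 < C ∧ ∀ (s : ℝ) (y : Symbols S H s)
    (ρ : Species → ℝ → S) (u : Species → ℝ → H) (E B : ℝ → H), Orbit P y ρ u E B →
    ∀ t, 0 ≤ t → size ρ u E B t ≤
      C * (Real.exp (-(c * (s ^ 2 / (1 + s ^ 2) ^ 2) * t)) * size ρ u E B 0) := by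
  obtain ⟨c, hc, h⟩ := energy_decay (S := S) (H := H) P
  obtain ⟨k, K, hk, hK, heq⟩ := energy_equiv (S := S) (H := H) P
  refine ⟨c / 2, √(18 * K / k), by positivity, by positivity, fun s y ρ u E B o t ht => ?_⟩
  have h1 := h s y ρ u E B o t ht
  have h2 := (heq ρ u E B t).1
  have h3 := (heq ρ u E B 0).2
  have h0 := size_nonneg (ρ := ρ) (u := u) (E := E) (B := B) 0
  refine abs_le_of_sq_le_sq' ?_ (by positivity) |>.2
  rw [mul_pow, Real.sq_sqrt (by positivity), mul_pow, ← Real.exp_nat_mul]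
  have e : ((2 : ℕ) : ℝ) * -(c / 2 * (s ^ 2 / (1 + s ^ 2) ^ 2) * t) =
    -(c * (s ^ 2 / (1 + s ^ 2) ^ 2) * t) := by push_cast; ring
  rw [e]
  set x := Real.exp (-(c * (s ^ 2 / (1 + s ^ 2) ^ 2) * t))
  have hx : 0 < x := Real.exp_pos _
  calc size ρ u E B t ^ 2 ≤ 6 * sqSize ρ u E B t := size_le t
    _ ≤ 6 * (3 * (x * (K * size ρ u E B 0 ^ 2)) / k) := by
      gcongr
      rw [le_div_iff₀ hk]
      calc sqSize ρ u E B t * k ≤ energy P ρ u E B t := by linarith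
        _ ≤ 3 * (x * (K * sqSize ρ u E B 0)) := h1.trans (by gcongr)
        _ ≤ _ := by gcongr; exact sqSize_le 0
    _ = _ := by ring

end Pointwise

end EulerMaxwell

end

/-! ### Scalar comparison principles for slow and fast variables -/

section

open MeasureTheory SchwartzMap LineDeriv
open scoped ENNReal NNReal RealInnerProductSpace

namespace EulerMaxwell

/-- Multiply by `e^{at}` and apply the mean value inequality. The factor `t`, instead of `1/(a-b)`,
keeps the bound uniform up to `a = b`. -/
theorem duhamel {V : Type*} [NormedAddCommGroup V] [NormedSpace ℝ V] {x g : ℝ → V} {a b M : ℝ}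
    (hx : ∀ t, HasDerivAt x (-(a • x t) + g t) t) (hM : 0 ≤ M)
    (hg : ∀ t, 0 ≤ t → ‖g t‖ ≤ M * Real.exp (-(b * t))) (hba : b ≤ a) {t : ℝ} (ht : 0 ≤ t) :
    ‖x t - Real.exp (-(a * t)) • x 0‖ ≤ M * t * Real.exp (-(b * t)) := by
  have hd : ∀ r, HasDerivAt (fun r => Real.exp (a * r) • x r) (Real.exp (a * r) • g r) r := by
    intro r
    have h1 : HasDerivAt (fun r => Real.exp (a * r)) (Real.exp (a * r) * (a * 1)) r :=
      ((hasDerivAt_id r).const_mul a).exp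
    convert! h1.smul (hx r) using 1
    module
  have hb : ∀ r ∈ Set.Icc 0 t, ‖Real.exp (a * r) • g r‖ ≤ M * Real.exp ((a - b) * t) := by
    rintro r ⟨h0, h1⟩
    rw [norm_smul, Real.norm_of_nonneg (Real.exp_nonneg _)]
    calc _ ≤ Real.exp (a * r) * (M * Real.exp (-(b * r))) := by gcongr; exact hg r h0
      _ = M * Real.exp ((a - b) * r) := by
        rw [mul_left_comm, ← Real.exp_add]; congr 2; ring
      _ ≤ _ := by gcongr
  have := (convex_Icc (0 : ℝ) t).norm_image_sub_le_of_norm_hasDerivWithin_le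
    (fun r _ => (hd r).hasDerivWithinAt) hb (Set.left_mem_Icc.2 ht) (Set.right_mem_Icc.2 ht)
  simp only [mul_zero, Real.exp_zero, one_smul, sub_zero, Real.norm_of_nonneg ht] at this
  have e : x t - Real.exp (-(a * t)) • x 0 =
      Real.exp (-(a * t)) • (Real.exp (a * t) • x t - x 0) := by
    rw [smul_sub, smul_smul, ← Real.exp_add]; simp
  rw [e, norm_smul, Real.norm_of_nonneg (Real.exp_nonneg _)]
  calc _ ≤ Real.exp (-(a * t)) * (M * Real.exp ((a - b) * t) * t) := by gcongr
    _ = M * t * (Real.exp (-(a * t)) * Real.exp ((a - b) * t)) := by ring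
    _ = _ := by rw [← Real.exp_add]; congr 2; ring

theorem mul_exp_neg_le {b x : ℝ} (hb : 0 < b) :
    x * Real.exp (-(b * x)) ≤ 2 / b * Real.exp (-(b / 2 * x)) := by
  have h1 : b / 2 * x ≤ Real.exp (b / 2 * x) := by linarith [Real.add_one_le_exp (b / 2 * x)]
  have h2 : x ≤ 2 / b * Real.exp (b / 2 * x) := by
    rw [div_mul_eq_mul_div, le_div_iff₀ hb]; linarith
  calc _ ≤ 2 / b * Real.exp (b / 2 * x) * Real.exp (-(b * x)) := by gcongr
    _ = _ := by rw [mul_assoc, ← Real.exp_add]; congr 2; ring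

/-- A slow variable follows the heat flow up to a higher order error. -/
theorem slow_variable {V : Type*} [NormedAddCommGroup V] [NormedSpace ℝ V] {x r h : ℝ → V}
    {μ b s A Y : ℝ} (hb : 0 < b) (hbμ : b ≤ μ) (hs : 0 ≤ s) (hA : 0 ≤ A) (hY : 0 ≤ Y)
    (hx : ∀ t, HasDerivAt (fun t => x t + r t) (-((μ * s ^ 2) • x t) + h t) t)
    (hr : ∀ t, 0 ≤ t → ‖r t‖ ≤ A * s * Real.exp (-(b * s ^ 2 * t)) * Y)
    (hh : ∀ t, 0 ≤ t → ‖h t‖ ≤ A * s ^ 3 * Real.exp (-(b * s ^ 2 * t)) * Y) {t : ℝ} (ht : 0 ≤ t) :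
    ‖x t - Real.exp (-(μ * s ^ 2 * t)) • x 0‖ ≤
      A * ((μ + 1) * (2 / b) + 2) * s * Real.exp (-(b / 2 * s ^ 2 * t)) * Y := by
  have hμ : 0 < μ := hb.trans_le hbμ
  -- In terms of `x + r` the forcing is `μ s² r + h`, of third order in `s`. Two of these powers
  -- combine with the factor `t` of Duhamel's formula and are absorbed by half of the decay, so an
  -- error of first order remains.
  have h1 := duhamel (x := fun t => x t + r t) (g := fun t => (μ * s ^ 2) • r t + h t)
    (a := μ * s ^ 2) (b := b * s ^ 2) (M := (μ + 1) * A * s ^ 3 * Y)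
    (fun t => by convert! hx t using 1; module) (by positivity) (fun t ht => ?_) (by gcongr) ht
  · have e1 : Real.exp (-(μ * s ^ 2 * t)) ≤ Real.exp (-(b / 2 * s ^ 2 * t)) := by
      rw [Real.exp_le_exp, neg_le_neg_iff]; gcongr; linarith
    have e2 : Real.exp (-(b * s ^ 2 * t)) ≤ Real.exp (-(b / 2 * s ^ 2 * t)) := by
      rw [Real.exp_le_exp, neg_le_neg_iff]; gcongr; linarith
    have e3 := mul_exp_neg_le (b := b) (x := s ^ 2 * t) hb
    have r0 := hr 0 le_rfl
    rw [mul_zero, neg_zero, Real.exp_zero, mul_one] at r0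
    have rt := hr t ht
    set y := Real.exp (-(b / 2 * s ^ 2 * t))
    have e : x t - Real.exp (-(μ * s ^ 2 * t)) • x 0 =
        (x t + r t - Real.exp (-(μ * s ^ 2 * t)) • (x 0 + r 0)) - r t
          + Real.exp (-(μ * s ^ 2 * t)) • r 0 := by module
    rw [e]
    calc _ ≤ ‖x t + r t - Real.exp (-(μ * s ^ 2 * t)) • (x 0 + r 0)‖ + ‖r t‖
          + ‖Real.exp (-(μ * s ^ 2 * t)) • r 0‖ :=
          (norm_add_le _ _).trans (by gcongr; exact norm_sub_le _ _)
      _ ≤ (μ + 1) * A * s ^ 3 * Y * t * Real.exp (-(b * s ^ 2 * t)) +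
          A * s * Real.exp (-(b * s ^ 2 * t)) * Y + Real.exp (-(μ * s ^ 2 * t)) * (A * s * Y) := by
          rw [norm_smul, Real.norm_of_nonneg (Real.exp_nonneg _)]
          gcongr
      _ = (μ + 1) * A * s * Y * (s ^ 2 * t * Real.exp (-(b * (s ^ 2 * t)))) +
          A * s * Real.exp (-(b * s ^ 2 * t)) * Y + Real.exp (-(μ * s ^ 2 * t)) * (A * s * Y) := by
          rw [mul_assoc b]; ring
      _ ≤ (μ + 1) * A * s * Y * (2 / b * Real.exp (-(b / 2 * (s ^ 2 * t)))) +
          A * s * y * Y + y * (A * s * Y) := by gcongr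
      _ = _ := by rw [← mul_assoc (b / 2)]; ring
  · calc ‖(μ * s ^ 2) • r t + h t‖ ≤ μ * s ^ 2 * (A * s * Real.exp (-(b * s ^ 2 * t)) * Y)
          + A * s ^ 3 * Real.exp (-(b * s ^ 2 * t)) * Y := by
          refine (norm_add_le _ _).trans ?_
          rw [norm_smul, Real.norm_of_nonneg (by positivity)]
          gcongr
          · exact hr t ht
          · exact hh t ht
      _ = _ := by ring

/-- Subtracting an explicit primitive of the forcing from `e^{2γt} M` leaves a decreasing function.
Since `b ≤ γ/2`, the denominator `2γ - 2b` is at least γ. -/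
theorem lyapunov_forced {M M' : ℝ → ℝ} {γ Q b : ℝ} (hM : ∀ t, HasDerivAt M (M' t) t) (hγ : 0 < γ)
    (hb : b ≤ γ / 2) (hQ : 0 ≤ Q)
    (h : ∀ t, 0 ≤ t → M' t ≤ -(2 * γ) * M t + Q * Real.exp (-(b * t)) ^ 2) {t : ℝ} (ht : 0 ≤ t) :
    M t ≤ Real.exp (-(γ * t)) ^ 2 * M 0 + Q / γ * Real.exp (-(b * t)) ^ 2 := by
  have hexp : ∀ c r : ℝ, HasDerivAt (fun r => Real.exp (c * r)) (Real.exp (c * r) * (c * 1)) r :=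
    fun c r => ((hasDerivAt_id r).const_mul c).exp
  have hd : ∀ r, HasDerivAt (fun r => Real.exp (2 * γ * r) * M r
      - Q / (2 * γ - 2 * b) * Real.exp ((2 * γ - 2 * b) * r))
      (Real.exp (2 * γ * r) * (2 * γ * M r + M' r) - Q * Real.exp ((2 * γ - 2 * b) * r)) r := by
    intro r
    have h0 : 2 * γ - 2 * b ≠ 0 := by linarith
    convert! ((hexp (2 * γ) r).mul (hM r)).sub
      ((hexp (2 * γ - 2 * b) r).const_mul (Q / (2 * γ - 2 * b))) using 1
    have e := div_mul_cancel₀ Q h0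
    linear_combination Real.exp ((2 * γ - 2 * b) * r) * e
  have ha : AntitoneOn (fun r => Real.exp (2 * γ * r) * M r
      - Q / (2 * γ - 2 * b) * Real.exp ((2 * γ - 2 * b) * r)) (Set.Ici 0) := by
    refine antitoneOn_of_deriv_nonpos (convex_Ici 0)
      (fun r _ => (hd r).continuousAt.continuousWithinAt)
      (fun r _ => (hd r).differentiableAt.differentiableWithinAt) fun r hr => ?_
    rw [interior_Ici] at hr
    rw [(hd r).deriv]
    have h1 := mul_le_mul_of_nonneg_left (h r (le_of_lt hr)) (Real.exp_nonneg (2 * γ * r))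
    have h2 : Real.exp (2 * γ * r) * Real.exp (-(b * r)) ^ 2 = Real.exp ((2 * γ - 2 * b) * r) := by
      rw [← Real.exp_nat_mul, ← Real.exp_add]; congr 1; push_cast; ring
    rw [← h2]
    linarith
  have h1 := ha (Set.mem_Ici.2 le_rfl) (Set.mem_Ici.2 ht) ht
  simp only [mul_zero, Real.exp_zero, one_mul, mul_one] at h1
  have hq : 0 ≤ Q / (2 * γ - 2 * b) := div_nonneg hQ (by linarith)
  have h2 : Real.exp (2 * γ * t) * M t ≤
      M 0 + Q / (2 * γ - 2 * b) * Real.exp ((2 * γ - 2 * b) * t) := by linarith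
  have e1 : Real.exp (-(γ * t)) ^ 2 * Real.exp (2 * γ * t) = 1 := by
    rw [← Real.exp_nat_mul, ← Real.exp_add, Real.exp_eq_one_iff]; push_cast; ring
  have e2 : Real.exp (-(γ * t)) ^ 2 * Real.exp ((2 * γ - 2 * b) * t) = Real.exp (-(b * t)) ^ 2 := by
    rw [← Real.exp_nat_mul, ← Real.exp_nat_mul, ← Real.exp_add]; congr 1; push_cast; ring
  calc M t = Real.exp (-(γ * t)) ^ 2 * (Real.exp (2 * γ * t) * M t) := by
        rw [← mul_assoc, e1, one_mul]
    _ ≤ Real.exp (-(γ * t)) ^ 2 * (M 0 + Q / (2 * γ - 2 * b) * Real.exp ((2 * γ - 2 * b) * t)) := by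
        gcongr
    _ = Real.exp (-(γ * t)) ^ 2 * M 0 + Q / (2 * γ - 2 * b) * Real.exp (-(b * t)) ^ 2 := by
        rw [← e2]; ring
    _ ≤ _ := by
        gcongr
        linarith

/-- As in `absorb`, with two dissipative variables of orders `1` and η and a forcing `G`. The
product `E G` can only use the dissipation `η E²`, which is why `Q` contains `D/η`. -/
theorem absorb_forced {κ C : ℝ} (hκ : 0 < κ) (hC : 0 < C) : ∃ η₀ : ℝ, 0 < η₀ ∧ η₀ ≤ 1 ∧
    ∀ η, 0 < η → η ≤ η₀ → ∃ Q : ℝ, 0 ≤ Q ∧ ∀ U E G : ℝ, 0 ≤ U → 0 ≤ E → 0 ≤ G →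
      -κ * U ^ 2 + C * (U * G) + C * (E * G)
        + η * (-κ * E ^ 2 + C * (U * E + U ^ 2 + G * E + U * G))
      ≤ -(κ / 4 * η * (U ^ 2 + E ^ 2)) + Q * G ^ 2 := by
  set D := C ^ 2 / κ with hD
  have hD0 : 0 < D := by positivity
  refine ⟨min 1 (κ / (4 * (C + D))), lt_min one_pos (by positivity), min_le_left _ _, ?_⟩
  intro η hη hη0
  have h1 : η ≤ 1 := hη0.trans (min_le_left _ _)
  have h2 : η * (4 * (C + D)) ≤ κ := by
    rw [← le_div_iff₀ (by positivity)]; exact hη0.trans (min_le_right _ _)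
  refine ⟨3 * D + D / η, by positivity, fun U E G hU hE hG => ?_⟩
  have young : ∀ x y : ℝ, C * (x * y) ≤ κ / 4 * y ^ 2 + D * x ^ 2 := by
    intro x y
    have : κ / 4 * y ^ 2 + D * x ^ 2 - C * (x * y) = κ * (y / 2 - C / κ * x) ^ 2 := by
      rw [hD]; field_simp; ring
    linarith [mul_nonneg hκ.le (sq_nonneg (y / 2 - C / κ * x))]
  have a1 := mul_le_mul_of_nonneg_left (young U E) hη.le
  have a2 : C * (E * G) ≤ η * (κ / 4 * E ^ 2) + D / η * G ^ 2 := by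
    have := mul_le_mul_of_nonneg_left (young (G / η) E) hη.le
    calc C * (E * G) = η * (C * (G / η * E)) := by field_simp
      _ ≤ _ := this
      _ = _ := by field_simp
  have a3 := young G U
  have a4 := mul_le_mul_of_nonneg_left (young G E) hη.le
  have a5 : η * (C * (U * G)) ≤ C * (U * G) := mul_le_of_le_one_left (by positivity) h1
  have a6 : η * D * G ^ 2 ≤ D * G ^ 2 := by
    gcongr; exact mul_le_of_le_one_left hD0.le h1
  have a7 := mul_le_mul_of_nonneg_right h2 (sq_nonneg U)
  have a8 : κ * η * U ^ 2 ≤ κ * U ^ 2 := by gcongr; exact mul_le_of_le_one_right hκ.le h1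
  linarith

end EulerMaxwell

end

/-! ### The forced damped plasma oscillation -/

section

open MeasureTheory SchwartzMap LineDeriv
open scoped ENNReal NNReal RealInnerProductSpace

namespace EulerMaxwell

/-- The energy damps only `v` and `w`; the corrector `-η⟪v - w, E⟫` adds damping of `E`, by the
mechanism of `Orbit.deriv₂`. -/
theorem forced_deriv {H : Type*} [NormedAddCommGroup H] [InnerProductSpace ℝ H] (P : Plasma)
    (η : ℝ) {v w E g h k : ℝ → H} {t : ℝ}
    (hv : HasDerivAt v ((P.m .ion)⁻¹ • (P.e • E t - P.f .ion • v t + g t)) t)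
    (hw : HasDerivAt w ((P.m .electron)⁻¹ • (-(P.e • E t) - P.f .electron • w t + h t)) t)
    (hE : HasDerivAt E (-((4 * Real.pi * P.e) • (v t - w t)) + k t) t) :
    HasDerivAt (fun t => 4 * Real.pi * (P.m .ion * ‖v t‖ ^ 2 + P.m .electron * ‖w t‖ ^ 2)
        + ‖E t‖ ^ 2 - η * ⟪v t - w t, E t⟫)
      (-(8 * Real.pi * P.f .ion * ‖v t‖ ^ 2)
      - 8 * Real.pi * P.f .electron * ‖w t‖ ^ 2 + 8 * Real.pi * ⟪v t, g t⟫
      + 8 * Real.pi * ⟪w t, h t⟫ + 2 * ⟪E t, k t⟫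
      + η * (-((P.e / P.m .ion + P.e / P.m .electron) * ‖E t‖ ^ 2)
        + P.f .ion / P.m .ion * ⟪v t, E t⟫ - P.f .electron / P.m .electron * ⟪w t, E t⟫
        - (P.m .ion)⁻¹ * ⟪g t, E t⟫ + (P.m .electron)⁻¹ * ⟪h t, E t⟫
        + 4 * Real.pi * P.e * ‖v t - w t‖ ^ 2 - ⟪v t - w t, k t⟫)) t := by
  have hmi := (P.m_pos .ion).ne'
  have hme := (P.m_pos .electron).ne'
  have h1 := (((hv.norm_sq.const_mul (P.m .ion)).add
    (hw.norm_sq.const_mul (P.m .electron))).const_mul (4 * Real.pi)).add hE.norm_sq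
  have h2 := ((hv.sub hw).inner ℝ hE).const_mul η
  convert! h1.sub h2 using 1
  simp only [Pi.sub_apply]
  rw [inner_add_right (v t - w t), inner_neg_right (v t - w t), inner_smul_right (v t - w t),
    real_inner_self_eq_norm_sq]
  simp only [inner_sub_left, real_inner_smul_left, inner_add_left, inner_neg_left,
    inner_add_right, inner_sub_right, inner_smul_right, inner_neg_right,
    real_inner_self_eq_norm_sq, real_inner_comm (E t) (v t), real_inner_comm (E t) (w t)]
  field_simp
  ring

set_option maxHeartbeats 1000000 in
/-- Exponential decay of the forced damped oscillation of the velocities and the electric field. -/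
theorem forced_decay {H : Type*} [NormedAddCommGroup H] [InnerProductSpace ℝ H] (P : Plasma) :
    ∃ γ C : ℝ, 0 < γ ∧ 0 < C ∧ ∀ (v w E g h k : ℝ → H),
      (∀ t, HasDerivAt v ((P.m .ion)⁻¹ • (P.e • E t - P.f .ion • v t + g t)) t) →
      (∀ t, HasDerivAt w
        ((P.m .electron)⁻¹ • (-(P.e • E t) - P.f .electron • w t + h t)) t) →
      (∀ t, HasDerivAt E (-((4 * Real.pi * P.e) • (v t - w t)) + k t) t) →
      ∀ b Q : ℝ, b ≤ γ / 2 → 0 ≤ Q →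
      (∀ t, 0 ≤ t → ‖g t‖ + ‖h t‖ + ‖k t‖ ≤ Q * Real.exp (-(b * t))) → ∀ t, 0 ≤ t →
      ‖v t‖ + ‖w t‖ + ‖E t‖ ≤ C * (Real.exp (-(γ * t)) * (‖v 0‖ + ‖w 0‖ + ‖E 0‖)
        + Q * Real.exp (-(b * t))) := by
  have hmi := P.m_pos .ion
  have hme := P.m_pos .electron
  have hfi := P.f_pos .ion
  have hfe := P.f_pos .electron
  have he := P.e_pos
  have hpi := Real.pi_pos
  obtain ⟨κ, hκ, hκl⟩ := exists_le_of_pos [4 * Real.pi * P.f .ion, 4 * Real.pi * P.f .electron,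
    P.e / P.m .ion + P.e / P.m .electron, 2 * Real.pi * P.m .ion, 2 * Real.pi * P.m .electron, 1 / 2]
    (by
      simp only [List.mem_cons, List.not_mem_nil, or_false, forall_eq_or_imp, forall_eq]
      refine ⟨?_, ?_, ?_, ?_, ?_, ?_⟩ <;> positivity)
  obtain ⟨C, hC, hCl⟩ := exists_ge_pos [8 * Real.pi, 2, P.f .ion / P.m .ion,
    P.f .electron / P.m .electron, (P.m .ion)⁻¹, (P.m .electron)⁻¹, 4 * Real.pi * P.e, 1,
    8 * Real.pi * P.m .ion, 8 * Real.pi * P.m .electron]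
  simp only [List.mem_cons, List.not_mem_nil, or_false, forall_eq_or_imp, forall_eq] at hκl hCl
  obtain ⟨k1, k2, k3, k4, k5, k6⟩ := hκl
  obtain ⟨c1, c2, c3, c4, c5, c6, c7, c8, c9, c10⟩ := hCl
  obtain ⟨η₀, hη₀, hη1, habs⟩ := absorb_forced hκ hC
  -- The corrector is at most `η (|v|² + |w|² + |E|²)`, so `η ≤ κ` keeps the functional coercive: κ
  -- was chosen with `2κ ≤ 4πm` for both masses and `2κ ≤ 1`.
  set η := min η₀ κ with hηd
  have hη : 0 < η := lt_min hη₀ hκ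
  have hηκ : η ≤ κ := min_le_right _ _
  have hη1' : η ≤ 1 := (min_le_left _ _).trans hη1
  obtain ⟨Q₀, hQ₀, hab⟩ := habs η hη (min_le_left _ _)
  -- The functional is at most `2C` times the squared norms, and `2γ · 2C = κη/4` is exactly the
  -- available dissipation.
  set γ := κ * η / (16 * C) with hγ
  have hγ0 : 0 < γ := by positivity
  refine ⟨γ, √(12 * (2 * C + Q₀ / γ) / κ), hγ0, by positivity, ?_⟩
  intro v w E g h k hv hw hE b Q hb hQ hg t ht
  set M : ℝ → ℝ := fun t => 4 * Real.pi * (P.m .ion * ‖v t‖ ^ 2 + P.m .electron * ‖w t‖ ^ 2)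
    + ‖E t‖ ^ 2 - η * ⟪v t - w t, E t⟫ with hM
  have hin : ∀ t, |⟪v t - w t, E t⟫| ≤ (‖v t‖ ^ 2 + ‖w t‖ ^ 2 + ‖E t‖ ^ 2) := fun t => by
    refine (abs_real_inner_le_norm _ _).trans ?_
    calc _ ≤ (‖v t‖ + ‖w t‖) * ‖E t‖ := by gcongr; exact norm_sub_le _ _
      _ ≤ _ := by
        linarith [sq_nonneg (‖v t‖ - ‖E t‖), sq_nonneg (‖w t‖ - ‖E t‖), sq_nonneg ‖v t‖,
          sq_nonneg ‖w t‖]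
  have hMlow : ∀ t, κ * (‖v t‖ ^ 2 + ‖w t‖ ^ 2 + ‖E t‖ ^ 2) ≤ M t := fun t => by
    have h1 := (abs_le.1 (hin t)).2
    have h2 := mul_le_mul_of_nonneg_left h1 hη.le
    have h3 := mul_le_mul_of_nonneg_right hηκ
      (by positivity : 0 ≤ ‖v t‖ ^ 2 + ‖w t‖ ^ 2 + ‖E t‖ ^ 2)
    have h4 := mul_le_mul_of_nonneg_right k4 (sq_nonneg ‖v t‖)
    have h5 := mul_le_mul_of_nonneg_right k5 (sq_nonneg ‖w t‖)
    have h6 := mul_le_mul_of_nonneg_right k6 (sq_nonneg ‖E t‖)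
    simp only [hM]
    linarith
  have hMup : ∀ t, M t ≤ 2 * C * (‖v t‖ ^ 2 + ‖w t‖ ^ 2 + ‖E t‖ ^ 2) := fun t => by
    have h1 := (abs_le.1 (hin t)).1
    have h2 := mul_le_mul_of_nonneg_left h1 hη.le
    have h3 := mul_le_mul_of_nonneg_right hη1'
      (by positivity : 0 ≤ ‖v t‖ ^ 2 + ‖w t‖ ^ 2 + ‖E t‖ ^ 2)
    have h4 := mul_le_mul_of_nonneg_right c9 (sq_nonneg ‖v t‖)
    have h5 := mul_le_mul_of_nonneg_right c10 (sq_nonneg ‖w t‖)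
    have h6 := mul_le_mul_of_nonneg_right c8
      (by positivity : 0 ≤ ‖v t‖ ^ 2 + ‖w t‖ ^ 2 + ‖E t‖ ^ 2)
    have h7 := mul_nonneg hpi.le (mul_nonneg hmi.le (sq_nonneg ‖v t‖))
    have h8 := mul_nonneg hpi.le (mul_nonneg hme.le (sq_nonneg ‖w t‖))
    have h9 : 1 ≤ C := c8
    have h10 := mul_le_mul_of_nonneg_right c8 (sq_nonneg ‖E t‖)
    have h11 := mul_nonneg hC.le (sq_nonneg ‖v t‖)
    have h12 := mul_nonneg hC.le (sq_nonneg ‖w t‖)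
    simp only [hM]
    linarith
  have hMd := fun t => forced_deriv P η (hv t) (hw t) (hE t)
  have hdec := lyapunov_forced (Q := Q₀ * Q ^ 2) hMd hγ0 hb (by positivity) (fun t ht => ?_) ht
  · set x := ‖v t‖ ^ 2 + ‖w t‖ ^ 2 + ‖E t‖ ^ 2
    have hY : ‖v 0‖ ^ 2 + ‖w 0‖ ^ 2 + ‖E 0‖ ^ 2 ≤ (‖v 0‖ + ‖w 0‖ + ‖E 0‖) ^ 2 := by
      linarith [mul_nonneg (norm_nonneg (v 0)) (norm_nonneg (w 0)),
        mul_nonneg (norm_nonneg (v 0)) (norm_nonneg (E 0)),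
        mul_nonneg (norm_nonneg (w 0)) (norm_nonneg (E 0))]
    set Y := ‖v 0‖ + ‖w 0‖ + ‖E 0‖ with hYd
    have hY0 : 0 ≤ Y := by positivity
    have hx : (‖v t‖ + ‖w t‖ + ‖E t‖) ^ 2 ≤ 3 * x := by
      linarith [sq_nonneg (‖v t‖ - ‖w t‖), sq_nonneg (‖v t‖ - ‖E t‖), sq_nonneg (‖w t‖ - ‖E t‖)]
    refine abs_le_of_sq_le_sq' ?_ (by positivity) |>.2
    rw [mul_pow, Real.sq_sqrt (by positivity)]
    set a := Real.exp (-(γ * t))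
    set d := Real.exp (-(b * t))
    have ha : 0 < a := Real.exp_pos _
    have hd : 0 < d := Real.exp_pos _
    calc _ ≤ 3 * x := hx
      _ ≤ 3 * ((a ^ 2 * (2 * C * Y ^ 2) + Q₀ * Q ^ 2 / γ * d ^ 2) / κ) := by
        gcongr
        rw [le_div_iff₀ hκ, mul_comm]
        refine (hMlow t).trans (hdec.trans ?_)
        gcongr
        exact (hMup 0).trans (by gcongr)
      _ = 3 * (2 * C) / κ * (a * Y) ^ 2 + 3 * (Q₀ / γ) / κ * (Q * d) ^ 2 := by field_simp
      _ ≤ 12 * (2 * C + Q₀ / γ) / κ * (a * Y) ^ 2 + 12 * (2 * C + Q₀ / γ) / κ * (Q * d) ^ 2 := by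
        have hq : 0 ≤ Q₀ / γ := by positivity
        gcongr ?_ / _ * _ + ?_ / _ * _ <;> linarith
      _ ≤ _ := by
        rw [← mul_add]
        gcongr
        linarith [mul_nonneg (mul_nonneg ha.le hY0) (mul_nonneg hQ hd.le)]
  · have h0 := hg t ht
    set G := ‖g t‖ + ‖h t‖ + ‖k t‖ with hG
    have nv := norm_nonneg (v t)
    have nw := norm_nonneg (w t)
    have nE := norm_nonneg (E t)
    have ng := norm_nonneg (g t)
    have nh := norm_nonneg (h t)
    have nk := norm_nonneg (k t)
    have hab' := hab (‖v t‖ + ‖w t‖) ‖E t‖ G (by positivity) nE (by positivity)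
    have bd : ∀ (c : ℝ) (x z : H), 0 ≤ c → c ≤ C → |c * ⟪x, z⟫| ≤ C * (‖x‖ * ‖z‖) := by
      intro c x z hc hcC
      rw [abs_mul, abs_of_nonneg hc]
      gcongr
      exact abs_real_inner_le_norm _ _
    have b1 := (abs_le.1 (bd (8 * Real.pi) (v t) (g t) (by positivity) c1)).2
    have b2 := (abs_le.1 (bd (8 * Real.pi) (w t) (h t) (by positivity) c1)).2
    have b3 := (abs_le.1 (bd 2 (E t) (k t) (by positivity) c2)).2
    have b4 := (abs_le.1 (bd _ (v t) (E t) (by positivity) c3)).2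
    have b5 := (abs_le.1 (bd _ (w t) (E t) (by positivity) c4)).1
    have b6 := (abs_le.1 (bd _ (g t) (E t) (by positivity) c5)).1
    have b7 := (abs_le.1 (bd _ (h t) (E t) (by positivity) c6)).2
    have b8 : 4 * Real.pi * P.e * ‖v t - w t‖ ^ 2 ≤ C * (‖v t‖ + ‖w t‖) ^ 2 := by
      gcongr; exact norm_sub_le _ _
    have b9 : -⟪v t - w t, k t⟫ ≤ C * ((‖v t‖ + ‖w t‖) * ‖k t‖) := by
      refine (neg_le_abs _).trans ((abs_real_inner_le_norm _ _).trans ?_)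
      calc _ ≤ 1 * ((‖v t‖ + ‖w t‖) * ‖k t‖) := by rw [one_mul]; gcongr; exact norm_sub_le _ _
        _ ≤ _ := by gcongr
    have b10 := mul_le_mul_of_nonneg_right k1 (sq_nonneg ‖v t‖)
    have b11 := mul_le_mul_of_nonneg_right k2 (sq_nonneg ‖w t‖)
    have b12 := mul_le_mul_of_nonneg_right k3 (sq_nonneg ‖E t‖)
    have b13 : κ * (‖v t‖ + ‖w t‖) ^ 2 ≤ 2 * (κ * ‖v t‖ ^ 2) + 2 * (κ * ‖w t‖ ^ 2) := by
      linarith [mul_nonneg hκ.le (sq_nonneg (‖v t‖ - ‖w t‖))]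
    have p1 : C * (‖v t‖ * ‖g t‖) + C * (‖w t‖ * ‖h t‖) ≤ C * ((‖v t‖ + ‖w t‖) * G) := by
      rw [← mul_add]
      gcongr
      calc ‖v t‖ * ‖g t‖ + ‖w t‖ * ‖h t‖ ≤ ‖v t‖ * G + ‖w t‖ * G := by gcongr <;> linarith
        _ = _ := by ring
    have p2 : C * (‖E t‖ * ‖k t‖) ≤ C * (‖E t‖ * G) := by gcongr; linarith
    have p3 : C * (‖g t‖ * ‖E t‖) + C * (‖h t‖ * ‖E t‖) ≤ C * (G * ‖E t‖) := by
      rw [← mul_add, ← add_mul]; gcongr; linarith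
    have p4 : C * ((‖v t‖ + ‖w t‖) * ‖k t‖) ≤ C * ((‖v t‖ + ‖w t‖) * G) := by gcongr; linarith
    have hη2 : η * (-((P.e / P.m .ion + P.e / P.m .electron) * ‖E t‖ ^ 2)
        + P.f .ion / P.m .ion * ⟪v t, E t⟫ - P.f .electron / P.m .electron * ⟪w t, E t⟫
        - (P.m .ion)⁻¹ * ⟪g t, E t⟫ + (P.m .electron)⁻¹ * ⟪h t, E t⟫
        + 4 * Real.pi * P.e * ‖v t - w t‖ ^ 2 - ⟪v t - w t, k t⟫) ≤
        η * (-κ * ‖E t‖ ^ 2 + C * ((‖v t‖ + ‖w t‖) * ‖E t‖ + (‖v t‖ + ‖w t‖) ^ 2 + G * ‖E t‖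
          + (‖v t‖ + ‖w t‖) * G)) := by
      gcongr
      linarith
    have hMt := hMup t
    have hq : κ / 4 * η * (‖v t‖ ^ 2 + ‖w t‖ ^ 2 + ‖E t‖ ^ 2) ≤
        κ / 4 * η * ((‖v t‖ + ‖w t‖) ^ 2 + ‖E t‖ ^ 2) := by
      gcongr
      linarith [mul_nonneg nv nw]
    have hM2 : 2 * γ * M t ≤ κ / 4 * η * (‖v t‖ ^ 2 + ‖w t‖ ^ 2 + ‖E t‖ ^ 2) := by
      calc 2 * γ * M t ≤ 2 * γ * (2 * C * (‖v t‖ ^ 2 + ‖w t‖ ^ 2 + ‖E t‖ ^ 2)) := by gcongr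
        _ = _ := by rw [hγ]; field_simp; ring
    have hG2 : Q₀ * G ^ 2 ≤ Q₀ * Q ^ 2 * Real.exp (-(b * t)) ^ 2 := by
      rw [mul_assoc, ← mul_pow]; gcongr
    linarith

end EulerMaxwell

end

/-! ### Slow and fast variables: exact identities -/

section

open MeasureTheory SchwartzMap LineDeriv
open scoped ENNReal NNReal RealInnerProductSpace

namespace EulerMaxwell

namespace Plasma

variable (P : Plasma)

/-- The coefficient of `∇ρ̄` in the electric profile. -/
noncomputable def γ₁ : ℝ :=
  (P.T .ion * P.f .electron - P.T .electron * P.f .ion) / (P.e * P.F)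

/-- The coefficient of `curl B̄` in the electric profile. -/
noncomputable def γ₂ : ℝ :=
  P.c / (4 * Real.pi * P.e ^ 2) * (P.f .ion * P.f .electron / P.F)

theorem μ₁_pos : 0 < P.μ₁ := div_pos (add_pos (P.T_pos _) (P.T_pos _)) P.F_pos

theorem μ₂_pos : 0 < P.μ₂ := by
  have := P.c_pos; have := P.f_pos .ion; have := P.f_pos .electron; have := P.e_pos
  have := P.F_pos; have := Real.pi_pos
  unfold μ₂; positivity

end Plasma

section Pointwise

variable {S H : Type*} [NormedAddCommGroup S] [InnerProductSpace ℝ S]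
  [NormedAddCommGroup H] [InnerProductSpace ℝ H] {s : ℝ} {P : Plasma} {y : Symbols S H s}
  {ρ : Species → ℝ → S} {u : Species → ℝ → H} {E B : ℝ → H}

/-- The friction weighted density. -/
noncomputable def meanDensity (P : Plasma) (ρ : Species → ℝ → S) (t : ℝ) : S :=
  P.F⁻¹ • (P.f .ion • ρ .ion t + P.f .electron • ρ .electron t)

namespace Orbit

theorem meanDensity_deriv (o : Orbit P y ρ u E B) (t : ℝ) :
    HasDerivAt (meanDensity P ρ)
      (-(P.F⁻¹ • y.X (P.f .ion • u .ion t + P.f .electron • u .electron t))) t := by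
  convert! (((o.hρ .ion t).const_smul (P.f .ion)).add
    ((o.hρ .electron t).const_smul (P.f .electron))).const_smul P.F⁻¹ using 1
  simp only [map_add, map_smul]
  module

/-- Gauss's law read as quasineutrality: the density difference is a derivative of the electric
field, hence small at low frequency. -/
theorem density_sub (o : Orbit P y ρ u E B) (t : ℝ) :
    ρ .ion t - ρ .electron t = (4 * Real.pi * P.e)⁻¹ • y.X (E t) := by
  have h : 4 * Real.pi * P.e ≠ 0 := by have := P.e_pos; have := Real.pi_pos; positivity
  rw [o.divE, inv_smul_smul₀ h]

theorem ion_sub_meanDensity (o : Orbit P y ρ u E B) (t : ℝ) :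
    ρ .ion t - meanDensity P ρ t = (P.f .electron / P.F * (4 * Real.pi * P.e)⁻¹) • y.X (E t) := by
  have h := P.F_pos.ne'
  rw [mul_smul, ← o.density_sub, meanDensity]
  match_scalars
  · have : P.F = P.f .ion + P.f .electron := rfl
    field_simp; rw [this]; ring
  · field_simp

theorem electron_sub_meanDensity (o : Orbit P y ρ u E B) (t : ℝ) :
    ρ .electron t - meanDensity P ρ t =
      (-(P.f .ion / P.F * (4 * Real.pi * P.e)⁻¹)) • y.X (E t) := by
  have h := P.F_pos.ne'
  rw [neg_smul, mul_smul, ← o.density_sub, meanDensity]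
  match_scalars
  · have : P.F = P.f .ion + P.f .electron := rfl
    field_simp; rw [this]; ring
  · field_simp

/-- Adding the two momentum equations cancels the electric forces and expresses the flux `f_i u_i +
f_e u_e` through pressure gradients and a time derivative. The time derivative is moved into the
corrected variable. The pressures combine to `T_i + T_e` times the mean density plus a multiple of
the charge, which is of higher order by Gauss's law. -/
theorem density_slow_deriv (o : Orbit P y ρ u E B) (t : ℝ) :
    HasDerivAt (fun t => meanDensity P ρ t +
        (-P.F⁻¹) • y.X (P.m .ion • u .ion t + P.m .electron • u .electron t))
      (-((P.μ₁ * s ^ 2) • meanDensity P ρ t) +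
        (-(s ^ 2 * P.e * P.γ₁ / P.F * (4 * Real.pi * P.e)⁻¹)) • y.X (E t)) t := by
  have hF := P.F_pos.ne'
  have he := P.e_pos.ne'
  have hmi := (P.m_pos .ion).ne'
  have hme := (P.m_pos .electron).ne'
  have h := (y.X.hasFDerivAt.comp_hasDerivAt t (((o.hu .ion t).const_smul (P.m .ion)).add
    ((o.hu .electron t).const_smul (P.m .electron)))).const_smul (-P.F⁻¹)
  convert! (o.meanDensity_deriv t).add h using 1
  rw [neg_mul_eq_neg_mul, mul_smul (-(s ^ 2 * P.e * P.γ₁ / P.F)), ← o.density_sub]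
  simp only [smul_inv_smul₀ hmi, smul_inv_smul₀ hme, map_add, map_sub, map_neg, map_smul, y.XG,
    Plasma.q, meanDensity, Plasma.μ₁, Plasma.γ₁]
  have : P.F = P.f .ion + P.f .electron := rfl
  match_scalars <;> field_simp <;> rw [this] <;> ring

/-- Weighting the momentum equations with `f_e` and `-f_i` leaves `eF E` against friction on the
current `u_i - u_e`, which Ampère's law converts into `curl B` and a time derivative of `E`. The
curl removes the pressures, and `curl curl B` has symbol `s²` because `div B = 0`. The corrected
equation is an exact identity without remainder. -/
theorem magnetic_slow_deriv (o : Orbit P y ρ u E B) (t : ℝ) :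
    HasDerivAt (fun t => B t + (P.c / (P.e * P.F)) • y.K ((P.f .electron * P.m .ion) • u .ion t
        - (P.f .ion * P.m .electron) • u .electron t
        - (P.f .ion * P.f .electron / (4 * Real.pi * P.e)) • E t))
      (-((P.μ₂ * s ^ 2) • B t) + 0) t := by
  have hF := P.F_pos.ne'
  have he := P.e_pos.ne'
  have hmi := (P.m_pos .ion).ne'
  have hme := (P.m_pos .electron).ne'
  have hpi := Real.pi_pos.ne'
  have h := (y.K.hasFDerivAt.comp_hasDerivAt t
    ((((o.hu .ion t).const_smul (P.f .electron * P.m .ion)).sub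
    ((o.hu .electron t).const_smul (P.f .ion * P.m .electron))).sub
      ((o.hE t).const_smul (P.f .ion * P.f .electron / (4 * Real.pi * P.e))))).const_smul
        (P.c / (P.e * P.F))
  convert! (o.hB t).add h using 1
  simp only [mul_smul _ (P.m _), smul_inv_smul₀ hmi, smul_inv_smul₀ hme, map_add, map_sub, map_neg,
    map_smul, y.KG, y.KK, o.divB, map_zero, add_zero, Plasma.q, Plasma.μ₂, smul_zero]
  have : P.F = P.f .ion + P.f .electron := rfl
  match_scalars <;> field_simp <;> try rw [this]
  all_goals ring

/-- The time derivative of the profile part `μ₁ ∇n - κ_α ∇ × B`. -/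
theorem velocity_fast_deriv (o : Orbit P y ρ u E B) (t : ℝ) (α : Species) (n' : S)
    (hn : HasDerivAt (meanDensity P ρ) n' t) :
    HasDerivAt (fun t => u α t + P.μ₁ • y.G (meanDensity P ρ t) - P.κ α • y.K (B t))
      ((P.m α)⁻¹ • (P.q α • (E t - P.γ₁ • y.G (meanDensity P ρ t) - P.γ₂ • y.K (B t))
        - P.f α • (u α t + P.μ₁ • y.G (meanDensity P ρ t) - P.κ α • y.K (B t))
        + (-(P.T α • y.G (ρ α t - meanDensity P ρ t)) +
          P.m α • (P.μ₁ • y.G n' - P.κ α • y.K (-(P.c • y.K (E t))))))) t := by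
  have hF := P.F_pos.ne'
  have he := P.e_pos.ne'
  have hm := (P.m_pos α).ne'
  have hpi := Real.pi_pos.ne'
  have hf := (P.f_pos α).ne'
  convert! ((o.hu α t).add ((y.G.hasFDerivAt.comp_hasDerivAt t hn).const_smul P.μ₁)).sub
    ((y.K.hasFDerivAt.comp_hasDerivAt t (o.hB t)).const_smul (P.κ α)) using 1
  have : P.F = P.f .ion + P.f .electron := rfl
  simp only [map_sub, map_neg, map_smul]
  -- Behind the cancellation are the balances `q_α γ₁ + f_α μ₁ = T_α` and `q_α γ₂ = f_α κ_α`, which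
  -- determine the coefficients of the profile.
  cases α <;> simp only [Plasma.q, Plasma.γ₁, Plasma.γ₂, Plasma.μ₁, Plasma.κ] <;>
  match_scalars <;> field_simp <;> try rw [this]
  all_goals ring

/-- The identity `4πe (κ_i - κ_e) = c` makes the current of the profile balance `c curl B`, and the
gradient part is the same for both species. Only time derivatives of the slow variables remain as
forcing; they are of second order in the frequency. -/
theorem electric_fast_deriv (o : Orbit P y ρ u E B) (t : ℝ) (n' : S)
    (hn : HasDerivAt (meanDensity P ρ) n' t) :
    HasDerivAt (fun t => E t - P.γ₁ • y.G (meanDensity P ρ t) - P.γ₂ • y.K (B t))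
      (-((4 * Real.pi * P.e) •
        ((u .ion t + P.μ₁ • y.G (meanDensity P ρ t) - P.κ .ion • y.K (B t)) -
          (u .electron t + P.μ₁ • y.G (meanDensity P ρ t) - P.κ .electron • y.K (B t))))
        + (-(P.γ₁ • y.G n') - P.γ₂ • y.K (-(P.c • y.K (E t))))) t := by
  have hF := P.F_pos.ne'
  have he := P.e_pos.ne'
  have hpi := Real.pi_pos.ne'
  convert! ((o.hE t).sub ((y.G.hasFDerivAt.comp_hasDerivAt t hn).const_smul P.γ₁)).sub
    ((y.K.hasFDerivAt.comp_hasDerivAt t (o.hB t)).const_smul P.γ₂) using 1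
  have : P.F = P.f .ion + P.f .electron := rfl
  simp only [map_neg, map_smul, Plasma.κ]
  match_scalars <;> field_simp <;> try rw [this]
  all_goals ring

end Orbit

end Pointwise

end EulerMaxwell

end

/-! ### Estimates of the slow and of the fast variables -/

section

open MeasureTheory SchwartzMap LineDeriv
open scoped ENNReal NNReal RealInnerProductSpace

namespace EulerMaxwell

theorem norm_smul_le_abs {V : Type*} [NormedAddCommGroup V] [NormedSpace ℝ V] (c : ℝ) {x : V}
    {a : ℝ} (h : ‖x‖ ≤ a) : ‖c • x‖ ≤ |c| * a := by
  rw [norm_smul, Real.norm_eq_abs]; gcongr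

section Norms

variable {S H : Type*} [NormedAddCommGroup S] [NormedAddCommGroup H]
  {ρ : Species → ℝ → S} {u : Species → ℝ → H} {E B : ℝ → H}

theorem norm_ρ_le_size (α : Species) (t : ℝ) : ‖ρ α t‖ ≤ size ρ u E B t := by
  unfold size
  have := norm_nonneg (ρ .ion t); have := norm_nonneg (ρ .electron t)
  have := norm_nonneg (u .ion t); have := norm_nonneg (u .electron t)
  have := norm_nonneg (E t); have := norm_nonneg (B t)
  cases α <;> linarith

theorem norm_u_le_size (α : Species) (t : ℝ) : ‖u α t‖ ≤ size ρ u E B t := by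
  unfold size
  have := norm_nonneg (ρ .ion t); have := norm_nonneg (ρ .electron t)
  have := norm_nonneg (u .ion t); have := norm_nonneg (u .electron t)
  have := norm_nonneg (E t); have := norm_nonneg (B t)
  cases α <;> linarith

theorem norm_E_le_size (t : ℝ) : ‖E t‖ ≤ size ρ u E B t := by
  unfold size
  have := norm_nonneg (ρ .ion t); have := norm_nonneg (ρ .electron t)
  have := norm_nonneg (u .ion t); have := norm_nonneg (u .electron t)
  have := norm_nonneg (E t); have := norm_nonneg (B t)
  linarith

theorem norm_B_le_size (t : ℝ) : ‖B t‖ ≤ size ρ u E B t := by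
  unfold size
  have := norm_nonneg (ρ .ion t); have := norm_nonneg (ρ .electron t)
  have := norm_nonneg (u .ion t); have := norm_nonneg (u .electron t)
  have := norm_nonneg (E t); have := norm_nonneg (B t)
  linarith

end Norms

theorem norm_meanDensity_le {S : Type*} [NormedAddCommGroup S] [InnerProductSpace ℝ S]
    {ρ : Species → ℝ → S} (P : Plasma) (t : ℝ) :
    ‖meanDensity P ρ t‖ ≤ ‖ρ .ion t‖ + ‖ρ .electron t‖ := by
  have hF := P.F_pos
  have hi := P.f_pos .ion
  have he := P.f_pos .electron
  have : P.F = P.f .ion + P.f .electron := rfl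
  rw [meanDensity, norm_smul, Real.norm_of_nonneg (inv_pos.2 hF).le, inv_mul_le_iff₀ hF]
  refine (norm_add_le _ _).trans ?_
  rw [norm_smul, norm_smul, Real.norm_of_nonneg hi.le, Real.norm_of_nonneg he.le, this]
  nlinarith [norm_nonneg (ρ .ion t), norm_nonneg (ρ .electron t),
    mul_nonneg hi.le (norm_nonneg (ρ .electron t)), mul_nonneg he.le (norm_nonneg (ρ .ion t))]

theorem norm_meanDensity_le_size {S H : Type*} [NormedAddCommGroup S] [InnerProductSpace ℝ S]
    [NormedAddCommGroup H] {ρ : Species → ℝ → S} {u : Species → ℝ → H} {E B : ℝ → H} (P : Plasma) (t : ℝ) :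
    ‖meanDensity P ρ t‖ ≤ size ρ u E B t := by
  refine (norm_meanDensity_le P t).trans ?_
  unfold size
  linarith [norm_nonneg (u .ion t), norm_nonneg (u .electron t), norm_nonneg (E t),
    norm_nonneg (B t)]

section Pointwise

variable {S H : Type*} [NormedAddCommGroup S] [InnerProductSpace ℝ S]
  [NormedAddCommGroup H] [InnerProductSpace ℝ H] {s : ℝ} {P : Plasma} {y : Symbols S H s}
  {ρ : Species → ℝ → S} {u : Species → ℝ → H} {E B : ℝ → H}

theorem Orbit.norm_sub_meanDensity_le (P : Plasma) : ∃ A, 0 < A ∧ ∀ (s : ℝ) (y : Symbols S H s)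
    (ρ : Species → ℝ → S) (u : Species → ℝ → H) (E B : ℝ → H), Orbit P y ρ u E B → ∀ α t,
      ‖ρ α t - meanDensity P ρ t‖ ≤ A * (s * size ρ u E B t) := by
  obtain ⟨A, hA, h⟩ := exists_ge_pos [|P.f .electron / P.F * (4 * Real.pi * P.e)⁻¹|,
    |-(P.f .ion / P.F * (4 * Real.pi * P.e)⁻¹)|]
  simp only [List.mem_cons, List.not_mem_nil, or_false, forall_eq_or_imp, forall_eq] at h
  refine ⟨A, hA, fun s y ρ u E B o α t => ?_⟩
  have hs := y.s_nonneg
  have hX : ‖y.X (E t)‖ ≤ s * size ρ u E B t :=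
    (y.norm_X_le _).trans (by gcongr; exact norm_E_le_size t)
  have h0 := size_nonneg (ρ := ρ) (u := u) (E := E) (B := B) t
  cases α
  · rw [o.ion_sub_meanDensity]
    exact (norm_smul_le_abs _ hX).trans (by gcongr; exact h.1)
  · rw [o.electron_sub_meanDensity]
    exact (norm_smul_le_abs _ hX).trans (by gcongr; exact h.2)

/-- The slow variables follow the heat flow up to a first order error. -/
theorem Orbit.slow_le (P : Plasma) : ∃ A, 0 < A ∧ ∀ (b Z : ℝ) (s : ℝ) (y : Symbols S H s)
    (ρ : Species → ℝ → S) (u : Species → ℝ → H) (E B : ℝ → H), Orbit P y ρ u E B →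
      0 < b → b ≤ P.μ₁ → b ≤ P.μ₂ → 0 ≤ Z →
      (∀ t, 0 ≤ t → size ρ u E B t ≤ Real.exp (-(b * s ^ 2 * t)) * Z) → ∀ t, 0 ≤ t →
      ‖meanDensity P ρ t - Real.exp (-(P.μ₁ * s ^ 2 * t)) • meanDensity P ρ 0‖ ≤
        A * ((P.μ₁ + 1) * (2 / b) + 2) * s * Real.exp (-(b / 2 * s ^ 2 * t)) * Z ∧
      ‖B t - Real.exp (-(P.μ₂ * s ^ 2 * t)) • B 0‖ ≤
        A * ((P.μ₂ + 1) * (2 / b) + 2) * s * Real.exp (-(b / 2 * s ^ 2 * t)) * Z := by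
  -- The three entries bound the correction of the density, its forcing, and the correction of the
  -- magnetic field.
  obtain ⟨A, hA, h⟩ := exists_ge_pos [|-P.F⁻¹| * (|P.m .ion| + |P.m .electron|),
    |(P.e * P.γ₁ / P.F * (4 * Real.pi * P.e)⁻¹)|, |P.c / (P.e * P.F)| * (|P.f .electron * P.m .ion|
      + |P.f .ion * P.m .electron| + |P.f .ion * P.f .electron / (4 * Real.pi * P.e)|)]
  simp only [List.mem_cons, List.not_mem_nil, or_false, forall_eq_or_imp, forall_eq] at h
  obtain ⟨h1, h2, h3⟩ := h
  refine ⟨A, hA, fun b Z s y ρ u E B o hb hb1 hb2 hZ hN t ht => ?_⟩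
  have hs := y.s_nonneg
  have h0 := size_nonneg (ρ := ρ) (u := u) (E := E) (B := B)
  constructor
  · refine slow_variable hb hb1 hs hA.le hZ o.density_slow_deriv (fun t ht => ?_) (fun t ht => ?_) ht
    · calc _ ≤ |-P.F⁻¹| * (s * ((|P.m .ion| + |P.m .electron|) * size ρ u E B t)) := by
            refine norm_smul_le_abs _ ((y.norm_X_le _).trans ?_)
            gcongr
            rw [add_mul]
            exact (norm_add_le _ _).trans (add_le_add
              (norm_smul_le_abs _ (norm_u_le_size _ t)) (norm_smul_le_abs _ (norm_u_le_size _ t)))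
        _ = |-P.F⁻¹| * (|P.m .ion| + |P.m .electron|) * s * size ρ u E B t := by ring
        _ ≤ A * s * (Real.exp (-(b * s ^ 2 * t)) * Z) := by
          gcongr
          · exact h0 t
          · exact hN t ht
        _ = _ := by ring
    · calc _ ≤ |-(s ^ 2 * P.e * P.γ₁ / P.F * (4 * Real.pi * P.e)⁻¹)| *
            (s * size ρ u E B t) := by
            refine norm_smul_le_abs _ ((y.norm_X_le _).trans ?_)
            gcongr
            exact norm_E_le_size t
        _ = |(P.e * P.γ₁ / P.F * (4 * Real.pi * P.e)⁻¹)| * s ^ 3 * size ρ u E B t := by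
          have : -(s ^ 2 * P.e * P.γ₁ / P.F * (4 * Real.pi * P.e)⁻¹) =
            s ^ 2 * -(P.e * P.γ₁ / P.F * (4 * Real.pi * P.e)⁻¹) := by ring
          rw [this, abs_mul, abs_neg, abs_of_nonneg (sq_nonneg s)]; ring
        _ ≤ A * s ^ 3 * (Real.exp (-(b * s ^ 2 * t)) * Z) := by
          gcongr
          · exact h0 t
          · exact hN t ht
        _ = _ := by ring
  · refine slow_variable hb hb2 hs hA.le hZ o.magnetic_slow_deriv (fun t ht => ?_) (fun t ht => ?_) ht
    · calc _ ≤ |P.c / (P.e * P.F)| * (s * ((|P.f .electron * P.m .ion|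
      + |P.f .ion * P.m .electron| + |P.f .ion * P.f .electron / (4 * Real.pi * P.e)|)
        * size ρ u E B t)) := by
            refine norm_smul_le_abs _ ((y.norm_K_le _).trans ?_)
            gcongr
            rw [add_mul, add_mul]
            refine (norm_sub_le _ _).trans (add_le_add ((norm_sub_le _ _).trans (add_le_add
              (norm_smul_le_abs _ (norm_u_le_size _ t)) (norm_smul_le_abs _ (norm_u_le_size _ t))))
              (norm_smul_le_abs _ (norm_E_le_size t)))
        _ = |P.c / (P.e * P.F)| * (|P.f .electron * P.m .ion| + |P.f .ion * P.m .electron| +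
            |P.f .ion * P.f .electron / (4 * Real.pi * P.e)|) * s * size ρ u E B t := by ring
        _ ≤ A * s * (Real.exp (-(b * s ^ 2 * t)) * Z) := by
          gcongr
          · exact h0 t
          · exact hN t ht
        _ = _ := by ring
    · rw [norm_zero]; positivity

/-- The fast variables decay exponentially up to a second order error. -/
theorem Orbit.fast_le (P : Plasma) : ∃ γ A, 0 < γ ∧ 0 < A ∧ ∀ (b Z : ℝ) (s : ℝ)
    (y : Symbols S H s)
    (ρ : Species → ℝ → S) (u : Species → ℝ → H) (E B : ℝ → H), Orbit P y ρ u E B →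
      0 < b → b ≤ γ / 2 → s ≤ 1 → 0 ≤ Z →
      (∀ t, 0 ≤ t → size ρ u E B t ≤ Real.exp (-(b * s ^ 2 * t)) * Z) → ∀ t, 0 ≤ t →
      (∀ α, ‖u α t + P.μ₁ • y.G (meanDensity P ρ t) - P.κ α • y.K (B t)‖ ≤
        A * (s ^ 2 * Real.exp (-(b * s ^ 2 * t)) + Real.exp (-(γ * t))) * Z) ∧
      ‖E t - P.γ₁ • y.G (meanDensity P ρ t) - P.γ₂ • y.K (B t)‖ ≤
        A * (s ^ 2 * Real.exp (-(b * s ^ 2 * t)) + Real.exp (-(γ * t))) * Z := by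
  obtain ⟨γ, C, hγ, hC, H0⟩ := forced_decay (H := H) P
  obtain ⟨A₀, hA₀, hsub⟩ := Orbit.norm_sub_meanDensity_le (S := S) (H := H) P
  -- In units of `s²` times the size, `n₁` bounds the gradient of the time derivative of the mean
  -- density, `g₀` the forcing of the velocities and `k₀` that of the electric field; `i₀` bounds
  -- the initial fast variables.
  set n₁ : ℝ := |-P.F⁻¹| * (|P.f .ion| + |P.f .electron|) with hn₁
  set g₀ : Species → ℝ := fun α => |P.T α| * A₀ + |P.m α| * (|P.μ₁| * n₁ + |P.κ α| * |P.c|) with hg₀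
  set k₀ : ℝ := |P.γ₁| * n₁ + |P.γ₂| * |P.c| with hk₀
  set i₀ : ℝ := 3 + 2 * |P.μ₁| + |P.κ .ion| + |P.κ .electron| + |P.γ₁| + |P.γ₂| with hi₀
  have hn0 : 0 ≤ n₁ := by positivity
  have hi0 : 0 < i₀ := by positivity
  have hq0 : 0 ≤ g₀ .ion + g₀ .electron + k₀ := by positivity
  refine ⟨γ, C * (i₀ + (g₀ .ion + g₀ .electron + k₀)), hγ, by positivity, ?_⟩
  intro b Z s y ρ u E B o hb hbγ hs1 hZ hN
  have hs := y.s_nonneg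
  have h0 := size_nonneg (ρ := ρ) (u := u) (E := E) (B := B)
  set n' : ℝ → S := fun t => -(P.F⁻¹ • y.X (P.f .ion • u .ion t + P.f .electron • u .electron t))
  have hn' : ∀ t, ‖y.G (n' t)‖ ≤ n₁ * (s ^ 2 * size ρ u E B t) := fun t => by
    rw [y.norm_G]
    calc s * ‖n' t‖ ≤ s * (|-P.F⁻¹| * (s * ((|P.f .ion| + |P.f .electron|) * size ρ u E B t))) := by
          gcongr
          simp only [n', ← neg_smul]
          refine norm_smul_le_abs _ ((y.norm_X_le _).trans ?_)
          gcongr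
          rw [add_mul]
          exact (norm_add_le _ _).trans (add_le_add
              (norm_smul_le_abs _ (norm_u_le_size _ t)) (norm_smul_le_abs _ (norm_u_le_size _ t)))
      _ = _ := by ring
  have hK' : ∀ t, ‖y.K (-(P.c • y.K (E t)))‖ ≤ |P.c| * (s ^ 2 * size ρ u E B t) := fun t => by
    calc _ ≤ s * ‖-(P.c • y.K (E t))‖ := y.norm_K_le _
      _ ≤ s * (|P.c| * (s * size ρ u E B t)) := by
        rw [norm_neg]
        gcongr
        refine norm_smul_le_abs _ ((y.norm_K_le _).trans ?_)
        gcongr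
        exact norm_E_le_size t
      _ = _ := by ring
  have hg : ∀ α t, ‖-(P.T α • y.G (ρ α t - meanDensity P ρ t)) +
      P.m α • (P.μ₁ • y.G (n' t) - P.κ α • y.K (-(P.c • y.K (E t))))‖ ≤
      g₀ α * (s ^ 2 * size ρ u E B t) := fun α t => by
    calc _ ≤ |P.T α| * (A₀ * (s ^ 2 * size ρ u E B t)) + |P.m α| * (|P.μ₁| *
          (n₁ * (s ^ 2 * size ρ u E B t)) + |P.κ α| * (|P.c| * (s ^ 2 * size ρ u E B t))) := by
          refine (norm_add_le _ _).trans (add_le_add ?_ (norm_smul_le_abs _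
            ((norm_sub_le _ _).trans (add_le_add (norm_smul_le_abs _ (hn' t))
              (norm_smul_le_abs _ (hK' t))))))
          rw [norm_neg]
          refine norm_smul_le_abs _ ?_
          rw [y.norm_G]
          calc _ ≤ s * (A₀ * (s * size ρ u E B t)) := by gcongr; exact hsub s y ρ u E B o α t
            _ = _ := by ring
      _ = _ := by simp only [hg₀]; ring
  have hk : ∀ t, ‖-(P.γ₁ • y.G (n' t)) - P.γ₂ • y.K (-(P.c • y.K (E t)))‖ ≤
      k₀ * (s ^ 2 * size ρ u E B t) := fun t => by
    calc _ ≤ |P.γ₁| * (n₁ * (s ^ 2 * size ρ u E B t)) + |P.γ₂| *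
          (|P.c| * (s ^ 2 * size ρ u E B t)) := by
          refine (norm_sub_le _ _).trans (add_le_add ?_ (norm_smul_le_abs _ (hK' t)))
          rw [norm_neg]
          exact norm_smul_le_abs _ (hn' t)
      _ = _ := by rw [hk₀]; ring
  have key := fun t ht => H0 _ _ _ _ _ _
    (fun t => o.velocity_fast_deriv t .ion (n' t) (o.meanDensity_deriv t))
    (fun t => by
      have := o.velocity_fast_deriv t .electron (n' t) (o.meanDensity_deriv t)
      simp only [Plasma.q, neg_smul] at this
      exact this)
    (fun t => o.electric_fast_deriv t (n' t) (o.meanDensity_deriv t))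
    -- The forcing decays at the diffusive rate `b s²`, which is below half of the fast rate γ since
    -- `s ≤ 1`.
    (b * s ^ 2) ((g₀ .ion + g₀ .electron + k₀) * (s ^ 2 * Z))
    (by
      have : b * s ^ 2 ≤ b := mul_le_of_le_one_right hb.le (pow_le_one₀ hs hs1)
      linarith) (by positivity)
    (fun t ht => by
      have h1 : g₀ .ion * (s ^ 2 * size ρ u E B t) + g₀ .electron * (s ^ 2 * size ρ u E B t)
          + k₀ * (s ^ 2 * size ρ u E B t) ≤
          (g₀ .ion + g₀ .electron + k₀) * (s ^ 2 * Z) * Real.exp (-(b * s ^ 2 * t)) := by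
        calc _ = (g₀ .ion + g₀ .electron + k₀) * (s ^ 2 * size ρ u E B t) := by ring
          _ ≤ (g₀ .ion + g₀ .electron + k₀) * (s ^ 2 * (Real.exp (-(b * s ^ 2 * t)) * Z)) := by
            gcongr; exact hN t ht
          _ = _ := by ring
      exact (add_le_add (add_le_add (hg .ion t) (hg .electron t)) (hk t)).trans h1) t ht
  have hG0 : ‖y.G (meanDensity P ρ 0)‖ ≤ size ρ u E B 0 := by
    rw [y.norm_G]
    exact (mul_le_of_le_one_left (norm_nonneg _) hs1).trans (norm_meanDensity_le_size P 0)
  have hK0 : ‖y.K (B 0)‖ ≤ size ρ u E B 0 :=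
    (y.norm_K_le _).trans ((mul_le_of_le_one_left (norm_nonneg _) hs1).trans (norm_B_le_size 0))
  have hZ0 : size ρ u E B 0 ≤ Z := by simpa using hN 0 le_rfl
  have hu0 : ∀ α, ‖u α 0 + P.μ₁ • y.G (meanDensity P ρ 0) - P.κ α • y.K (B 0)‖ ≤
      (1 + |P.μ₁| + |P.κ α|) * Z := fun α => by
    calc _ ≤ size ρ u E B 0 + |P.μ₁| * size ρ u E B 0 + |P.κ α| * size ρ u E B 0 :=
          (norm_sub_le _ _).trans (add_le_add ((norm_add_le _ _).trans (add_le_add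
            (norm_u_le_size _ 0) (norm_smul_le_abs _ hG0))) (norm_smul_le_abs _ hK0))
      _ = (1 + |P.μ₁| + |P.κ α|) * size ρ u E B 0 := by ring
      _ ≤ _ := by gcongr
  have hE0 : ‖E 0 - P.γ₁ • y.G (meanDensity P ρ 0) - P.γ₂ • y.K (B 0)‖ ≤
      (1 + |P.γ₁| + |P.γ₂|) * Z := by
    calc _ ≤ size ρ u E B 0 + |P.γ₁| * size ρ u E B 0 + |P.γ₂| * size ρ u E B 0 :=
          (norm_sub_le _ _).trans (add_le_add ((norm_sub_le _ _).trans (add_le_add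
            (norm_E_le_size 0) (norm_smul_le_abs _ hG0))) (norm_smul_le_abs _ hK0))
      _ = (1 + |P.γ₁| + |P.γ₂|) * size ρ u E B 0 := by ring
      _ ≤ _ := by gcongr
  have hfin : ∀ t, 0 ≤ t → ‖u .ion t + P.μ₁ • y.G (meanDensity P ρ t) - P.κ .ion • y.K (B t)‖
      + ‖u .electron t + P.μ₁ • y.G (meanDensity P ρ t) - P.κ .electron • y.K (B t)‖
      + ‖E t - P.γ₁ • y.G (meanDensity P ρ t) - P.γ₂ • y.K (B t)‖ ≤
      C * (i₀ + (g₀ .ion + g₀ .electron + k₀)) *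
        (s ^ 2 * Real.exp (-(b * s ^ 2 * t)) + Real.exp (-(γ * t))) * Z := fun t ht => by
    refine (key t ht).trans ?_
    have e1 := Real.exp_pos (-(b * s ^ 2 * t))
    have e2 := Real.exp_pos (-(γ * t))
    calc _ ≤ C * (Real.exp (-(γ * t)) * ((1 + |P.μ₁| + |P.κ .ion|) * Z +
          (1 + |P.μ₁| + |P.κ .electron|) * Z + (1 + |P.γ₁| + |P.γ₂|) * Z) +
          (g₀ .ion + g₀ .electron + k₀) * (s ^ 2 * Z) * Real.exp (-(b * s ^ 2 * t))) := by
          gcongr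
          · exact hu0 .ion
          · exact hu0 .electron
      _ = C * (i₀ * (Real.exp (-(γ * t)) * Z) +
          (g₀ .ion + g₀ .electron + k₀) * (s ^ 2 * Real.exp (-(b * s ^ 2 * t)) * Z)) := by
          rw [hi₀]; ring
      _ ≤ C * ((i₀ + (g₀ .ion + g₀ .electron + k₀)) * (Real.exp (-(γ * t)) * Z) +
          (i₀ + (g₀ .ion + g₀ .electron + k₀)) * (s ^ 2 * Real.exp (-(b * s ^ 2 * t)) * Z)) := by
          gcongr C * (?_ * _ + ?_ * _)
          · linarith
          · linarith
      _ = _ := by ring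
  intro t ht
  have hf := hfin t ht
  have a1 := norm_nonneg (u .ion t + P.μ₁ • y.G (meanDensity P ρ t) - P.κ .ion • y.K (B t))
  have a2 := norm_nonneg (u .electron t + P.μ₁ • y.G (meanDensity P ρ t) - P.κ .electron • y.K (B t))
  have a3 := norm_nonneg (E t - P.γ₁ • y.G (meanDensity P ρ t) - P.γ₂ • y.K (B t))
  refine ⟨fun α => ?_, by linarith⟩
  cases α <;> linarith

end Pointwise

end EulerMaxwell

end

/-! ### Pointwise bounds at high and at low frequency -/

section

open MeasureTheory SchwartzMap LineDeriv
open scoped ENNReal NNReal RealInnerProductSpace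

namespace EulerMaxwell

section Pointwise

variable {S H : Type*} [NormedAddCommGroup S] [InnerProductSpace ℝ S]
  [NormedAddCommGroup H] [InnerProductSpace ℝ H]

/-- For `s ≥ 1` the general rate `s²/(1+s²)²` is at least `1/(4s²)`. -/
theorem Orbit.high_le (P : Plasma) : ∃ c C : ℝ, 0 < c ∧ 0 < C ∧ ∀ (s : ℝ) (y : Symbols S H s)
    (ρ : Species → ℝ → S) (u : Species → ℝ → H) (E B : ℝ → H), Orbit P y ρ u E B → 1 ≤ s →
    ∀ t, 0 ≤ t → size ρ u E B t ≤ C * (Real.exp (-(c * t / s ^ 2)) * size ρ u E B 0) := by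
  obtain ⟨c, C, hc, hC, h⟩ := size_decay (S := S) (H := H) P
  refine ⟨c / 4, C, by positivity, hC, fun s y ρ u E B o hs t ht => (h s y ρ u E B o t ht).trans ?_⟩
  have h0 := size_nonneg (ρ := ρ) (u := u) (E := E) (B := B) 0
  gcongr
  have h1 : (s ^ 2)⁻¹ / 4 ≤ s ^ 2 / (1 + s ^ 2) ^ 2 := by
    have h2 : 1 ≤ s ^ 2 := one_le_pow₀ hs
    rw [le_div_iff₀ (by positivity), div_mul_eq_mul_div, inv_mul_eq_div, div_div,
      div_le_iff₀ (by positivity)]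
    nlinarith
  calc c / 4 * t / s ^ 2 = c * ((s ^ 2)⁻¹ / 4) * t := by rw [div_eq_mul_inv _ (s ^ 2)]; ring
    _ ≤ _ := by gcongr

/-- Low frequency comparison with the diffusive profile. -/
theorem Orbit.low_le (P : Plasma) : ∃ c C : ℝ, 0 < c ∧ 0 < C ∧ ∀ (s : ℝ) (y : Symbols S H s)
    (ρ : Species → ℝ → S) (u : Species → ℝ → H) (E B : ℝ → H), Orbit P y ρ u E B → s ≤ 1 →
    ∀ t, 0 ≤ t →
    (∀ α, ‖ρ α t - Real.exp (-(P.μ₁ * s ^ 2 * t)) • meanDensity P ρ 0‖ ≤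
      C * (s * Real.exp (-(c * s ^ 2 * t))) * size ρ u E B 0) ∧
    (∀ α, ‖u α t - (-(P.μ₁ • y.G (Real.exp (-(P.μ₁ * s ^ 2 * t)) • meanDensity P ρ 0))
        + P.κ α • y.K (Real.exp (-(P.μ₂ * s ^ 2 * t)) • B 0))‖ ≤
      C * (s ^ 2 * Real.exp (-(c * s ^ 2 * t)) + Real.exp (-(c * t))) * size ρ u E B 0) ∧
    (‖E t - (P.γ₁ • y.G (Real.exp (-(P.μ₁ * s ^ 2 * t)) • meanDensity P ρ 0)
        + P.γ₂ • y.K (Real.exp (-(P.μ₂ * s ^ 2 * t)) • B 0))‖ ≤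
      C * (s ^ 2 * Real.exp (-(c * s ^ 2 * t)) + Real.exp (-(c * t))) * size ρ u E B 0) ∧
    ‖B t - Real.exp (-(P.μ₂ * s ^ 2 * t)) • B 0‖ ≤
      C * (s * Real.exp (-(c * s ^ 2 * t))) * size ρ u E B 0 := by
  obtain ⟨c₀, C₀, hc₀, hC₀, hsize⟩ := size_decay (S := S) (H := H) P
  obtain ⟨A₁, hA₁, hsub⟩ := Orbit.norm_sub_meanDensity_le (S := S) (H := H) P
  obtain ⟨A₂, hA₂, hslow⟩ := Orbit.slow_le (S := S) (H := H) P
  obtain ⟨γ, A₃, hγ, hA₃, hfast⟩ := Orbit.fast_le (S := S) (H := H) P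
  have hμ₁ := P.μ₁_pos
  have hμ₂ := P.μ₂_pos
  -- The entry `c₀/4` comes from `s²/(1+s²)² ≥ s²/4` for `s ≤ 1`. The others make `b` admissible in
  -- the slow and in the fast estimate.
  obtain ⟨b, hb, hbl⟩ := exists_le_of_pos [c₀ / 4, P.μ₁, P.μ₂, γ / 2] (by
    simp only [List.mem_cons, List.not_mem_nil, or_false, forall_eq_or_imp, forall_eq]
    refine ⟨?_, ?_, ?_, ?_⟩ <;> positivity)
  simp only [List.mem_cons, List.not_mem_nil, or_false, forall_eq_or_imp, forall_eq] at hbl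
  obtain ⟨b1, b2, b3, b4⟩ := hbl
  set D : ℝ := A₂ * ((P.μ₁ + 1) * (2 / b) + 2) + A₂ * ((P.μ₂ + 1) * (2 / b) + 2) with hD
  have hD1 : A₂ * ((P.μ₁ + 1) * (2 / b) + 2) ≤ D := by rw [hD]; apply le_add_of_nonneg_right; positivity
  have hD2 : A₂ * ((P.μ₂ + 1) * (2 / b) + 2) ≤ D := by rw [hD]; apply le_add_of_nonneg_left; positivity
  have hD0 : 0 < D := by positivity
  obtain ⟨C, hC, hCl⟩ := exists_ge_pos [(A₁ + D) * C₀, D * C₀,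
    (A₃ + (|P.μ₁| + |P.κ .ion|) * D) * C₀, (A₃ + (|P.μ₁| + |P.κ .electron|) * D) * C₀,
    (A₃ + (|P.γ₁| + |P.γ₂|) * D) * C₀]
  simp only [List.mem_cons, List.not_mem_nil, or_false, forall_eq_or_imp, forall_eq] at hCl
  obtain ⟨c1, c2, c3, c4, c5⟩ := hCl
  refine ⟨b / 2, C, by positivity, hC, fun s y ρ u E B o hs1 t ht => ?_⟩
  have hs := y.s_nonneg
  have h0 := size_nonneg (ρ := ρ) (u := u) (E := E) (B := B) 0
  set Z := size ρ u E B 0 with hZ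
  have hN : ∀ t, 0 ≤ t → size ρ u E B t ≤ Real.exp (-(b * s ^ 2 * t)) * (C₀ * Z) := fun t ht => by
    refine (hsize s y ρ u E B o t ht).trans ?_
    rw [mul_left_comm]
    refine mul_le_mul_of_nonneg_right (Real.exp_le_exp.2 (neg_le_neg
      (mul_le_mul_of_nonneg_right ?_ ht))) (by positivity)
    have h1 : s ^ 2 / 4 ≤ s ^ 2 / (1 + s ^ 2) ^ 2 := by
      have : s ^ 2 ≤ 1 := pow_le_one₀ hs hs1
      gcongr
      nlinarith [sq_nonneg s]
    calc b * s ^ 2 ≤ c₀ / 4 * s ^ 2 := by gcongr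
      _ = c₀ * (s ^ 2 / 4) := by ring
      _ ≤ _ := by gcongr
  have hZ' : 0 ≤ C₀ * Z := by positivity
  obtain ⟨s1, s2⟩ := hslow b (C₀ * Z) s y ρ u E B o hb b2 b3 hZ' hN t ht
  obtain ⟨f1, f2⟩ := hfast b (C₀ * Z) s y ρ u E B o hb b4 hs1 hZ' hN t ht
  have hn : ‖meanDensity P ρ t - Real.exp (-(P.μ₁ * s ^ 2 * t)) • meanDensity P ρ 0‖ ≤
      D * (s * Real.exp (-(b / 2 * s ^ 2 * t))) * (C₀ * Z) := by
    refine s1.trans ?_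
    rw [mul_assoc _ s]
    gcongr
  have hB : ‖B t - Real.exp (-(P.μ₂ * s ^ 2 * t)) • B 0‖ ≤
      D * (s * Real.exp (-(b / 2 * s ^ 2 * t))) * (C₀ * Z) := by
    refine s2.trans ?_
    rw [mul_assoc _ s]
    gcongr
  have he1 : Real.exp (-(b * s ^ 2 * t)) ≤ Real.exp (-(b / 2 * s ^ 2 * t)) := by
    gcongr; linarith
  have he2 : Real.exp (-(γ * t)) ≤ Real.exp (-(b / 2 * t)) := by
    gcongr; linarith
  set x := Real.exp (-(b / 2 * s ^ 2 * t))
  set x' := Real.exp (-(b / 2 * t))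
  have hx : 0 < x := Real.exp_pos _
  have hx' : 0 < x' := Real.exp_pos _
  have hGn : ‖y.G (meanDensity P ρ t - Real.exp (-(P.μ₁ * s ^ 2 * t)) • meanDensity P ρ 0)‖ ≤
      D * (s ^ 2 * x) * (C₀ * Z) := by
    rw [y.norm_G]
    calc _ ≤ s * (D * (s * x) * (C₀ * Z)) := by gcongr
      _ = _ := by ring
  have hKB : ‖y.K (B t - Real.exp (-(P.μ₂ * s ^ 2 * t)) • B 0)‖ ≤ D * (s ^ 2 * x) * (C₀ * Z) := by
    refine (y.norm_K_le _).trans ?_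
    calc _ ≤ s * (D * (s * x) * (C₀ * Z)) := by gcongr
      _ = _ := by ring
  -- The deviation from the heat profile is the fast variable `w` plus the gradient and curl of the
  -- slow errors; the additional derivative raises these first order errors to second order.
  have comb : ∀ (w : H) (p q : ℝ), ‖w‖ ≤ A₃ * (s ^ 2 * x + x') * (C₀ * Z) →
      (A₃ + (|p| + |q|) * D) * C₀ ≤ C →
      ‖w + p • y.G (meanDensity P ρ t - Real.exp (-(P.μ₁ * s ^ 2 * t)) • meanDensity P ρ 0)
        + q • y.K (B t - Real.exp (-(P.μ₂ * s ^ 2 * t)) • B 0)‖ ≤ C * (s ^ 2 * x + x') * Z := by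
    intro w p q hw hpq
    calc _ ≤ A₃ * (s ^ 2 * x + x') * (C₀ * Z) + |p| * (D * (s ^ 2 * x) * (C₀ * Z))
          + |q| * (D * (s ^ 2 * x) * (C₀ * Z)) :=
          (norm_add_le _ _).trans (add_le_add ((norm_add_le _ _).trans (add_le_add hw
            (norm_smul_le_abs _ hGn))) (norm_smul_le_abs _ hKB))
      _ ≤ A₃ * (s ^ 2 * x + x') * (C₀ * Z) + |p| * (D * (s ^ 2 * x + x') * (C₀ * Z))
          + |q| * (D * (s ^ 2 * x + x') * (C₀ * Z)) := by gcongr <;> linarith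
      _ = (A₃ + (|p| + |q|) * D) * C₀ * (s ^ 2 * x + x') * Z := by ring
      _ ≤ _ := by gcongr
  have hw : ∀ w : H, ‖w‖ ≤ A₃ * (s ^ 2 * Real.exp (-(b * s ^ 2 * t)) + Real.exp (-(γ * t))) * (C₀ * Z)
      → ‖w‖ ≤ A₃ * (s ^ 2 * x + x') * (C₀ * Z) := fun w hw => hw.trans (by gcongr)
  refine ⟨fun α => ?_, fun α => ?_, ?_, ?_⟩
  · have h1 : ‖ρ α t - meanDensity P ρ t‖ ≤ A₁ * (s * x) * (C₀ * Z) := by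
      calc _ ≤ A₁ * (s * size ρ u E B t) := hsub s y ρ u E B o α t
        _ ≤ A₁ * (s * (x * (C₀ * Z))) := by
          gcongr; exact (hN t ht).trans (by gcongr)
        _ = _ := by ring
    calc _ ≤ A₁ * (s * x) * (C₀ * Z) + D * (s * x) * (C₀ * Z) := by
          rw [← sub_add_sub_cancel _ (meanDensity P ρ t)]
          exact (norm_add_le _ _).trans (add_le_add h1 hn)
      _ = (A₁ + D) * C₀ * (s * x) * Z := by ring
      _ ≤ _ := by gcongr
  · have hc : (A₃ + (|-P.μ₁| + |P.κ α|) * D) * C₀ ≤ C := by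
      rw [abs_neg]; cases α <;> assumption
    convert! comb _ (-P.μ₁) (P.κ α) (hw _ (f1 α)) hc using 2
    simp only [map_sub]
    module
  · convert! comb _ P.γ₁ P.γ₂ (hw _ f2) c5 using 2
    simp only [map_sub]
    module
  · calc _ ≤ D * (s * x) * (C₀ * Z) := hB
      _ = D * C₀ * (s * x) * Z := by ring
      _ ≤ _ := by gcongr

end Pointwise

end EulerMaxwell

end

/-! ### Multipliers on `L²` and exponentials of matrix families -/

section

open MeasureTheory SchwartzMap LineDeriv
open scoped ENNReal NNReal BoundedContinuousFunction

namespace EulerMaxwell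

/-- Complex `L²` on frequency space. -/
noncomputable abbrev CL2 := Lp ℂ 2 (volume : Measure Space)

theorem memLp_bcf_mul (a : Space →ᵇ ℂ) (f : CL2) : MemLp (fun k => a k * f k) 2 volume :=
  MemLp.of_le_mul (c := ‖a‖) (Lp.memLp f)
    (a.continuous.aestronglyMeasurable.mul (Lp.aestronglyMeasurable f))
    (.of_forall fun k => by rw [norm_mul]; gcongr; exact a.norm_coe_le_norm k)

/-- Multiplication of `L²` functions by bounded continuous functions. -/
noncomputable def bcfMul : (Space →ᵇ ℂ) →L[ℂ] CL2 →L[ℂ] CL2 :=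
  LinearMap.mkContinuous₂
    (LinearMap.mk₂ ℂ (fun a f => (memLp_bcf_mul a f).toLp)
      (fun a b f => by
        rw [← MemLp.toLp_add]
        exact MemLp.toLp_congr _ _ (.of_forall fun k => by simp [add_mul]))
      (fun c a f => by
        rw [← MemLp.toLp_const_smul]
        exact MemLp.toLp_congr _ _ (.of_forall fun k => by simp [mul_assoc]))
      (fun a f g => by
        rw [← MemLp.toLp_add]
        refine MemLp.toLp_congr _ _ ?_
        filter_upwards [Lp.coeFn_add f g] with k hk
        exact (congrArg (a k * ·) hk).trans (mul_add _ _ _))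
      (fun c a f => by
        rw [← MemLp.toLp_const_smul]
        refine MemLp.toLp_congr _ _ ?_
        filter_upwards [Lp.coeFn_smul c f] with k hk
        exact (congrArg (a k * ·) hk).trans (mul_left_comm _ _ _)))
    1 (fun a f => by
      rw [one_mul, LinearMap.mk₂_apply]
      refine Lp.norm_le_mul_norm_of_ae_le_mul ?_
      filter_upwards [(memLp_bcf_mul a f).coeFn_toLp] with k hk
      rw [hk, norm_mul]; gcongr; exact a.norm_coe_le_norm k)

theorem coeFn_bcfMul (a : Space →ᵇ ℂ) (f : CL2) :
    (bcfMul a f : Space → ℂ) =ᵐ[volume] fun k => a k * f k := (memLp_bcf_mul a f).coeFn_toLp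

/-- Integration against a Schwartz function. -/
noncomputable def schwartzPairing (φ : 𝓢(Space, ℂ)) : CL2 →L[ℂ] ℂ :=
  innerSL ℂ ((φ.memLp 2 (volume : Measure Space)).star.toLp)

theorem schwartzPairing_apply (φ : 𝓢(Space, ℂ)) (f : CL2) :
    schwartzPairing φ f = ∫ k, φ k * f k := by
  rw [schwartzPairing, innerSL_apply_apply, L2.inner_def]
  refine integral_congr_ae ?_
  filter_upwards [((φ.memLp 2 (volume : Measure Space)).star).coeFn_toLp] with k hk
  rw [hk]
  simp [mul_comm]

theorem schwartz_integrable (φ : 𝓢(Space, ℂ)) (f : CL2) : Integrable (fun k => φ k * f k) :=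
  (φ.memLp 2 (volume : Measure Space)).integrable_mul (Lp.memLp f)

section Evolution

variable {ι : Type} [Fintype ι]

/-- The entry `(b, c)` of a bounded continuous family of matrices. -/
noncomputable def entry [DecidableEq ι] (b c : ι) :
    (Space →ᵇ ((ι → ℂ) →L[ℂ] (ι → ℂ))) →L[ℂ] (Space →ᵇ ℂ) :=
  ContinuousLinearMap.compLeftContinuousBounded Space
    ((ContinuousLinearMap.proj b : (ι → ℂ) →L[ℂ] ℂ).comp
      (ContinuousLinearMap.apply ℂ (ι → ℂ) (Pi.single c 1)))

theorem entry_apply [DecidableEq ι] (b c : ι) (M : Space →ᵇ ((ι → ℂ) →L[ℂ] (ι → ℂ))) (k : Space) :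
    entry b c M k = M k (Pi.single c 1) b := rfl

theorem sum_entry [DecidableEq ι] (b : ι) (M : (ι → ℂ) →L[ℂ] (ι → ℂ)) (v : ι → ℂ) :
    ∑ c, M (Pi.single c 1) b * v c = M v b := by
  conv_rhs => rw [pi_eq_sum_univ' v]
  simp [mul_comm, Finset.sum_apply]

end Evolution

/-- The exponential is taken in the Banach algebra of bounded continuous functions, where it is
differentiable in time in the supremum norm; evaluation at a point is a continuous ring homomorphism
and so commutes with it. -/
theorem exists_exp_bcf {R : Type} [NormedRing R] [NormedAlgebra ℂ R] [CompleteSpace R]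
    (A : Space →ᵇ R) : ∃ M N : ℝ → (Space →ᵇ R),
      (∀ t k, M t k = NormedSpace.exp ((t : ℂ) • A k)) ∧
      (∀ t k, N t k = NormedSpace.exp ((t : ℂ) • A k) * A k) ∧ ∀ t, HasDerivAt M (N t) t := by
  let : NormedAlgebra ℚ R := .restrictScalars ℚ ℂ R
  let : NormedAlgebra ℚ (Space →ᵇ R) := .restrictScalars ℚ ℂ _
  have e : ∀ (t : ℝ) k, (NormedSpace.exp ((t : ℂ) • A) : Space →ᵇ R) k =
      NormedSpace.exp ((t : ℂ) • A k) := fun t k => by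
    let ev : (Space →ᵇ R) →+* R :=
      { toFun := fun f => f k, map_one' := rfl, map_mul' := fun _ _ => rfl, map_zero' := rfl,
        map_add' := fun _ _ => rfl }
    exact NormedSpace.map_exp ev (continuous_eval_const k) ((t : ℂ) • A)
  refine ⟨fun t => NormedSpace.exp ((t : ℂ) • A), fun t => NormedSpace.exp ((t : ℂ) • A) * A,
    e, fun t k => ?_, fun t => ?_⟩
  · rw [BoundedContinuousFunction.mul_apply, e]
  · simpa using! (hasDerivAt_exp_smul_const A (t : ℂ)).scomp t Complex.ofRealCLM.hasDerivAt

end EulerMaxwell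

end

/-! ### The weak evolution equation in frequency space -/

section

open MeasureTheory SchwartzMap LineDeriv
open scoped ENNReal NNReal BoundedContinuousFunction

namespace EulerMaxwell

/-- A product rule for a curve `x` that is only continuous and has a derivative only after pairing
with the frozen value `m s`. The difference quotient is the slope of `m` paired with `x r`, which
converges by joint continuity, plus the slope of that frozen pairing. -/
theorem hasDerivWithinAt_pairing {E F : Type*} [NormedAddCommGroup E] [NormedSpace ℂ E]
    [NormedAddCommGroup F] [NormedSpace ℂ F] (L : E →L[ℂ] F →L[ℂ] ℂ) {m : ℝ → E} {m' : E}
    {x : ℝ → F} {d : ℂ} {S : Set ℝ} {s : ℝ} (hm : HasDerivAt m m' s)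
    (hx : ContinuousWithinAt x S s) (hd : HasDerivWithinAt (fun r => L (m s) (x r)) d S s) :
    HasDerivWithinAt (fun r => L (m r) (x r)) (L m' (x s) + d) S s := by
  rw [hasDerivWithinAt_iff_tendsto_slope] at hd ⊢
  have h1 := (hasDerivWithinAt_iff_tendsto_slope.1 (hm.hasDerivWithinAt (s := S)))
  have h2 : Filter.Tendsto x (nhdsWithin s (S \ {s})) (nhds (x s)) :=
    hx.mono_left (nhdsWithin_mono _ Set.sdiff_subset)
  have h3 := ((L.continuous₂.tendsto (m', x s)).comp (h1.prodMk_nhds h2)).add hd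
  refine h3.congr fun r => ?_
  simp only [slope, vsub_eq_sub, Function.comp_apply, Function.uncurry_apply_pair]
  have : ((r - s)⁻¹ • (m r - m s) : E) = (((r - s)⁻¹ : ℝ) : ℂ) • (m r - m s) :=
    (Complex.coe_smul _ _).symm
  rw [this]
  simp only [map_smul, map_sub, smul_apply, sub_apply,
    Complex.real_smul, smul_eq_mul]
  ring

theorem contDiff_exp_smul {R : Type*} [NormedRing R] [NormedAlgebra ℂ R] [CompleteSpace R]
    {A : Space → R} (hA : ContDiff ℝ (⊤ : ℕ∞) A) (τ : ℂ) :
    ContDiff ℝ (⊤ : ℕ∞) (fun k => NormedSpace.exp (τ • A k)) := by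
  have h : ContDiff ℂ (⊤ : ℕ∞) (NormedSpace.exp : R → R) :=
    contDiff_iff_contDiffAt.2 fun x => (NormedSpace.exp_analytic (𝕂 := ℂ) x).contDiffAt
  exact (h.restrict_scalars ℝ).comp (hA.const_smul τ)

theorem exists_schwartz {g : Space → ℂ} (hg : ContDiff ℝ (⊤ : ℕ∞) g) (hgc : HasCompactSupport g) :
    ∃ φ : 𝓢(Space, ℂ), ∀ k, φ k = g k := ⟨hgc.toSchwartzMap hg, fun _ => rfl⟩

theorem exists_bcf {R : Type*} [NormedAddCommGroup R] {A : Space → R} (hA : Continuous A)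
    (hAc : HasCompactSupport A) : ∃ A₁ : Space →ᵇ R, ∀ k, A₁ k = A k := by
  obtain ⟨C, hC⟩ := hAc.exists_bound_of_continuous hA
  exact ⟨.ofNormedAddCommGroup A hA C hC, fun _ => rfl⟩

theorem exists_weighted_pairing (φ : 𝓢(Space, ℂ)) : ∃ L : (Space →ᵇ ℂ) →L[ℂ] CL2 →L[ℂ] ℂ,
    ∀ a x, L a x = ∫ k, φ k * (a k * x k) := by
  refine ⟨(ContinuousLinearMap.compL ℂ CL2 CL2 ℂ (schwartzPairing φ)).comp bcfMul, fun a x => ?_⟩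
  change schwartzPairing φ (bcfMul a x) = _
  rw [schwartzPairing_apply]
  refine integral_congr_ae ?_
  filter_upwards [coeFn_bcfMul a x] with k hk
  rw [hk]

theorem integrable_schwartz_bcf (φ : 𝓢(Space, ℂ)) (a : Space →ᵇ ℂ) (x : CL2) :
    Integrable fun k => φ k * (a k * x k) := by
  refine (schwartz_integrable φ (bcfMul a x)).congr ?_
  filter_upwards [coeFn_bcfMul a x] with k hk
  rw [hk]

/-- A cutoff of a smooth matrix family, together with its exponentials. -/
theorem exists_cutoff_exp {R : Type} [NormedRing R] [NormedAlgebra ℂ R] [CompleteSpace R]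
    {A : Space → R} (hA : ContDiff ℝ (⊤ : ℕ∞) A) {s : Set Space} (hs : IsCompact s) :
    ∃ (A₁ : Space →ᵇ R) (M N : ℝ → (Space →ᵇ R)), (∀ k ∈ s, A₁ k = A k) ∧
      (∀ t k, M t k = NormedSpace.exp ((t : ℂ) • A₁ k)) ∧
      (∀ t k, N t k = NormedSpace.exp ((t : ℂ) • A₁ k) * A₁ k) ∧
      (∀ t, HasDerivAt M (N t) t) ∧ ∀ t, ContDiff ℝ (⊤ : ℕ∞) fun k => M t k := by
  obtain ⟨r, hr⟩ := hs.isBounded.subset_closedBall (0 : Space)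
  obtain ⟨χ, hχ⟩ : ∃ χ : ContDiffBump (0 : Space), ∀ k ∈ s, χ k = 1 :=
    ⟨⟨max r 1, max r 1 + 1, by positivity, by linarith⟩, fun k hk =>
      ContDiffBump.one_of_mem_closedBall _
        (Metric.closedBall_subset_closedBall (le_max_left r 1) (hr hk))⟩
  have hA's : ContDiff ℝ (⊤ : ℕ∞) fun k => χ k • A k := χ.contDiff.smul hA
  obtain ⟨A₁, hA₁⟩ := exists_bcf hA's.continuous χ.hasCompactSupport.smul_right
  obtain ⟨M, N, hM, hN, hMN⟩ := exists_exp_bcf A₁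
  refine ⟨A₁, M, N, fun k hk => by rw [hA₁, hχ k hk, one_smul], hM, hN, hMN, fun t => ?_⟩
  simp only [hM, hA₁]
  exact contDiff_exp_smul hA's _

theorem exp_zero_smul {R : Type*} [NormedRing R] [NormedAlgebra ℂ R] [CompleteSpace R] (a : R) :
    NormedSpace.exp (((0 : ℝ) : ℂ) • a) = 1 := by simp

section Evolution

variable {ι : Type} [Fintype ι]

theorem contDiff_entry [DecidableEq ι] {M : Space → (ι → ℂ) →L[ℂ] (ι → ℂ)}
    (hM : ContDiff ℝ (⊤ : ℕ∞) M) (b c : ι) :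
    ContDiff ℝ (⊤ : ℕ∞) fun k => M k (Pi.single c 1) b :=
  let ev : ((ι → ℂ) →L[ℂ] (ι → ℂ)) →L[ℂ] ℂ := (ContinuousLinearMap.proj b : (ι → ℂ) →L[ℂ] ℂ).comp
    (ContinuousLinearMap.apply ℂ (ι → ℂ) (Pi.single c 1))
  (ev.restrictScalars ℝ).contDiff.comp hM

/-- Uniqueness for the weak evolution equation `∂_t f = A(k) f` in frequency space. -/
theorem weak_evolution {A : Space → (ι → ℂ) →L[ℂ] (ι → ℂ)} (hA : ContDiff ℝ (⊤ : ℕ∞) A)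
    {f : ℝ → ι → CL2} (hc : ∀ b, ContinuousOn (fun t => f t b) (Set.Ici 0))
    (hd : ∀ b (φ : 𝓢(Space, ℂ)) t, 0 ≤ t → HasDerivWithinAt (fun s => ∫ k, φ k * f s b k)
      (∫ k, φ k * A k (fun c => f t c k) b) (Set.Ici 0) t) {T : ℝ} (hT : 0 ≤ T) :
    ∀ᵐ k, (fun c => f T c k) = NormedSpace.exp ((T : ℂ) • A k) (fun c => f 0 c k) := by
  classical
  suffices h : ∀ b, ∀ᵐ k, f T b k = NormedSpace.exp ((T : ℂ) • A k) (fun c => f 0 c k) b by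
    filter_upwards [ae_all_iff.2 h] with k hk
    exact funext hk
  intro b
  have hloc : ∀ g : CL2, LocallyIntegrable (g : Space → ℂ) := fun g =>
    (Lp.memLp g).locallyIntegrable one_le_two
  refine ae_eq_of_integral_contDiff_smul_eq (hloc _) ?_ fun g hg hgc => ?_
  · have hsum : (fun k => NormedSpace.exp ((T : ℂ) • A k) (fun c => f 0 c k) b) = fun k =>
        ∑ c, NormedSpace.exp ((T : ℂ) • A k) (Pi.single c 1) b * f 0 c k :=
      funext fun k => (sum_entry b _ _).symm
    rw [hsum]
    refine locallyIntegrable_finsetSum _ fun c _ => ?_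
    have hcont : Continuous fun k => NormedSpace.exp ((T : ℂ) • A k) (Pi.single c 1) b :=
      (continuous_apply b).comp
        ((contDiff_exp_smul hA (T : ℂ)).continuous.clm_apply continuous_const)
    rw [← locallyIntegrableOn_univ]
    exact ((locallyIntegrableOn_univ.2 (hloc (f 0 c))).continuousOn_mul hcont.continuousOn
      isOpen_univ.isLocallyClosed)
  have hgs : ∀ k, g k ≠ 0 → k ∈ tsupport g := fun k hk => subset_tsupport g hk
  -- The symbol is unbounded. Cutting it off outside the support of the test function makes its
  -- exponential a bounded multiplier and changes nothing where the test function lives.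
  obtain ⟨A₁, M, N, h1, hM, hN, hMN, hMs⟩ := exists_cutoff_exp hA hgc.isCompact
  have hA₁ : ∀ k, g k ≠ 0 → A₁ k = A k := fun k hk => h1 k (hgs k hk)
  have hg' : ContDiff ℝ (⊤ : ℕ∞) (fun k => (g k : ℂ)) := Complex.ofRealCLM.contDiff.comp hg
  have hgc' : HasCompactSupport (fun k => (g k : ℂ)) := hgc.comp_left (g := Complex.ofRealCLM) rfl
  obtain ⟨φ, hφ⟩ := exists_schwartz hg' hgc'
  have hθ : ∀ s c, ∃ θ : 𝓢(Space, ℂ), ∀ k, θ k = (g k : ℂ) * M s k (Pi.single c 1) b :=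
    fun s c => exists_schwartz (hg'.mul (contDiff_entry (hMs s) b c)) hgc'.mul_right
  choose θ hθ using hθ
  obtain ⟨L, hL⟩ := exists_weighted_pairing φ
  have hLi := integrable_schwartz_bcf φ
  have hsum : ∀ (K : Space →ᵇ ((ι → ℂ) →L[ℂ] (ι → ℂ))) (x : ι → CL2),
      ∑ c, L (entry b c K) (x c) = ∫ k, φ k * K k (fun c => x c k) b := fun K x => by
    simp only [hL]
    rw [← integral_finsetSum _ fun c _ => hLi _ _]
    refine integral_congr_ae (.of_forall fun k => ?_)
    simp only [entry_apply, ← Finset.mul_sum, sum_entry]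
  have hθA : ∀ s c (x : ι → CL2), Integrable fun k => θ s c k * A k (fun c => x c k) c := by
    intro s c x
    have h : (fun k => θ s c k * A k (fun c => x c k) c) =
        fun k => ∑ d, θ s c k * (entry c d A₁ k * x d k) := by
      ext k
      rw [← Finset.mul_sum]
      simp only [entry_apply, sum_entry]
      rcases eq_or_ne (g k) 0 with h0 | h0
      · simp [hθ, h0]
      · rw [hA₁ k h0]
    rw [h]
    refine integrable_finsetSum _ fun d _ => ?_
    exact integrable_schwartz_bcf _ _ _
  -- Duality: `e^{(T-s)A} f(s)`, tested against `g`, is constant in `s`. At `s = T` it is `f(T)`, at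
  -- `s = 0` it is `e^{TA} f(0)`.
  have hG : ∀ s ∈ Set.Icc 0 T, HasDerivWithinAt
      (fun s => ∑ c, L (entry b c (M (T - s))) (f s c)) 0 (Set.Icc 0 T) s := by
    intro s hs
    have h1 : ∀ c, HasDerivWithinAt (fun s => L (entry b c (M (T - s))) (f s c))
        (L (entry b c (-N (T - s))) (f s c) + ∫ k, θ (T - s) c k * A k (fun c => f s c k) c)
        (Set.Ici 0) s := by
      intro c
      refine hasDerivWithinAt_pairing L (m := fun s => entry b c (M (T - s))) ?_ (hc c s hs.1) ?_
      · have h2 : HasDerivAt (fun s => M (T - s)) (-N (T - s)) s := by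
          have h3 := (hMN (T - s)).scomp s ((hasDerivAt_id s).const_sub T)
          simpa using! h3
        exact ((entry b c).restrictScalars ℝ).hasFDerivAt.comp_hasDerivAt s h2
      · refine (hd c (θ (T - s) c) s hs.1).congr_of_eventuallyEq
          (Filter.Eventually.of_forall fun r => ?_) ?_ <;>
        · simp only [hL, hθ, hφ, entry_apply, mul_assoc]
    have h4 := (HasDerivWithinAt.fun_sum fun c (_ : c ∈ Finset.univ) => h1 c).mono
      (t := Set.Ici 0) (s := Set.Icc 0 T) Set.Icc_subset_Ici_self
    convert! h4 using 1
    rw [Finset.sum_add_distrib, hsum, ← integral_finsetSum _ fun c _ => hθA _ _ _,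
      ← integral_add]
    · symm
      refine integral_eq_zero_of_ae (.of_forall fun k => ?_)
      simp only [hθ, hφ, mul_assoc, ← Finset.mul_sum, sum_entry, Pi.zero_apply,
        BoundedContinuousFunction.neg_apply, hN, hM]
      rcases eq_or_ne (g k) 0 with h0 | h0
      · simp [h0]
      · rw [hA₁ k h0]; simp
    · have : (fun k => φ k * (-N (T - s)) k (fun c => f s c k) b) = fun k =>
          ∑ c, φ k * (entry b c (-N (T - s)) k * f s c k) := by
        ext k
        simp only [entry_apply, ← Finset.mul_sum, sum_entry]
      rw [this]
      exact integrable_finsetSum _ fun c _ => hLi _ _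
    · exact integrable_finsetSum _ fun c _ => hθA _ _ _
  have hconst := (convex_Icc (0 : ℝ) T).norm_image_sub_le_of_norm_hasDerivWithin_le (C := 0) hG
    (fun s _ => by simp) (Set.left_mem_Icc.2 hT) (Set.right_mem_Icc.2 hT)
  rw [zero_mul, norm_le_zero_iff, sub_eq_zero] at hconst
  simp only [hsum, hφ, sub_self, sub_zero] at hconst
  have hM0 : ∀ k, M 0 k = 1 := fun k => (hM 0 k).trans (exp_zero_smul _)
  simp only [Complex.real_smul]
  calc ∫ k, (g k : ℂ) * f T b k = ∫ k, (g k : ℂ) * M 0 k (fun c => f T c k) b := by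
        simp only [hM0]; rfl
    _ = ∫ k, (g k : ℂ) * M T k (fun c => f 0 c k) b := hconst
    _ = _ := by
      refine integral_congr_ae (.of_forall fun k => ?_)
      rcases eq_or_ne (g k) 0 with h0 | h0
      · simp [h0]
      · simp only [hM, hA₁ k h0]

end Evolution

end EulerMaxwell

end

/-! ### The symbol of the linearized system -/

section

open MeasureTheory SchwartzMap LineDeriv
open scoped ENNReal NNReal RealInnerProductSpace

namespace EulerMaxwell

/-- The scalar components of the unknown. -/
inductive Comp
  | ρ (a : Species)
  | u (a : Species) (j : Fin 3)
  | E (j : Fin 3)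
  | B (j : Fin 3)

instance : Finite Species := Finite.of_surjective (fun b : Bool => if b then .ion else .electron) <| by
  rintro (_ | _)
  exacts [⟨true, rfl⟩, ⟨false, rfl⟩]

instance : Finite Comp :=
  Finite.of_surjective (α := Species ⊕ (Species × Fin 3) ⊕ Fin 3 ⊕ Fin 3)
    (Sum.elim .ρ (Sum.elim (fun x => .u x.1 x.2) (Sum.elim .E .B))) <| by
  rintro (a | ⟨a, j⟩ | j | j)
  exacts [⟨.inl a, rfl⟩, ⟨.inr (.inl (a, j)), rfl⟩, ⟨.inr (.inr (.inl j)), rfl⟩,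
    ⟨.inr (.inr (.inr j)), rfl⟩]

noncomputable instance : Fintype Comp := Fintype.ofFinite Comp

/-- The expansion in elementary matrices reduces smoothness of an operator family to smoothness of
its scalar entries. -/
theorem clm_eq_sum {ι : Type} [Fintype ι] [DecidableEq ι] (M : (ι → ℂ) →L[ℂ] (ι → ℂ)) :
    M = ∑ b, ∑ c, M (Pi.single c 1) b •
      (ContinuousLinearMap.proj c : (ι → ℂ) →L[ℂ] ℂ).smulRight (Pi.single b (1 : ℂ)) := by
  ext v i
  rw [← sum_entry i M v]
  symm
  simp only [sum_apply, smul_apply, ContinuousLinearMap.smulRight_apply, ContinuousLinearMap.proj_apply,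
    Finset.sum_apply, Pi.smul_apply, Pi.single_apply, smul_eq_mul]
  rw [Finset.sum_eq_single i]
  · simp
  · intro b _ hb
    simp [hb.symm]
  · simp

variable (P : Plasma)

/-- The symbol of the linearized system, as a map. -/
noncomputable def symbolFun (k : Space) (y : Comp → ℂ) : Comp → ℂ
  | .ρ a => -∑ j, ik j k * y (.u a j)
  | .u a j => ((P.m a)⁻¹ : ℝ) * (-((P.T a : ℝ) * (ik j k * y (.ρ a))) + (P.q a : ℝ) * y (.E j)
      - (P.f a : ℝ) * y (.u a j))
  | .E j => (P.c : ℝ) * (ik (j + 1) k * y (.B (j + 2)) - ik (j + 2) k * y (.B (j + 1)))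
      - ((4 * Real.pi : ℝ) : ℂ) * ((P.q .ion : ℝ) * y (.u .ion j)
        + (P.q .electron : ℝ) * y (.u .electron j))
  | .B j => -((P.c : ℝ) * (ik (j + 1) k * y (.E (j + 2)) - ik (j + 2) k * y (.E (j + 1))))

/-- The symbol of the linearized system. -/
noncomputable def symbol (k : Space) : (Comp → ℂ) →L[ℂ] (Comp → ℂ) :=
  LinearMap.toContinuousLinearMap
    { toFun := symbolFun P k
      map_add' := fun x y => by
        ext (a | ⟨a, j⟩ | j | j) <;>
          simp only [symbolFun, Pi.add_apply, mul_add, Finset.sum_add_distrib] <;> ring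
      map_smul' := fun c x => by
        ext (a | ⟨a, j⟩ | j | j) <;>
          simp only [symbolFun, Pi.smul_apply, smul_eq_mul, RingHom.id_apply, mul_left_comm _ c,
            ← Finset.mul_sum] <;> ring }

theorem symbol_apply (k : Space) (y : Comp → ℂ) : symbol P k y = symbolFun P k y := rfl

theorem contDiff_ik (j : Fin 3) : ContDiff ℝ (⊤ : ℕ∞) (ik j) := by
  unfold ik
  have : ContDiff ℝ (⊤ : ℕ∞) (fun k : Space => ((k j : ℝ) : ℂ)) :=
    Complex.ofRealCLM.contDiff.comp (EuclideanSpace.proj (𝕜 := ℝ) j).contDiff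
  exact contDiff_const.mul this

theorem contDiff_smul_const {R : Type*} [NormedAddCommGroup R] [NormedSpace ℂ R] {a : Space → ℂ}
    (ha : ContDiff ℝ (⊤ : ℕ∞) a) (x : R) : ContDiff ℝ (⊤ : ℕ∞) (fun k => a k • x) :=
  ((ContinuousLinearMap.toSpanSingleton ℂ x).restrictScalars ℝ).contDiff.comp ha

theorem contDiff_symbolFun (y : Comp → ℂ) (b : Comp) :
    ContDiff ℝ (⊤ : ℕ∞) (fun k => symbolFun P k y b) := by
  have h : ∀ j c, ContDiff ℝ (⊤ : ℕ∞) (fun k => ik j k * y c) := fun j c =>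
    (contDiff_ik j).mul contDiff_const
  rcases b with a | ⟨a, j⟩ | j | j <;> simp only [symbolFun]
  · exact (ContDiff.sum fun j _ => h j _).neg
  · exact contDiff_const.mul (((contDiff_const.mul (h _ _)).neg.add contDiff_const).sub
      contDiff_const)
  · exact (contDiff_const.mul ((h _ _).sub (h _ _))).sub contDiff_const
  · exact (contDiff_const.mul ((h _ _).sub (h _ _))).neg

theorem contDiff_symbol : ContDiff ℝ (⊤ : ℕ∞) (symbol P) := by
  classical
  have h : symbol P = fun k => ∑ b, ∑ c, symbolFun P k (Pi.single c 1) b •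
      (ContinuousLinearMap.proj c : (Comp → ℂ) →L[ℂ] ℂ).smulRight (Pi.single b (1 : ℂ)) :=
    funext fun k => clm_eq_sum _
  rw [h]
  refine ContDiff.sum fun b _ => ContDiff.sum fun c _ => contDiff_smul_const ?_ _
  exact contDiff_symbolFun P _ b

/-- The complex vectors. -/
abbrev CVec := EuclideanSpace ℂ (Fin 3)

/-- Collects three components to a vector. -/
noncomputable def collect (e : Fin 3 → Comp) : (Comp → ℂ) →L[ℝ] CVec :=
  LinearMap.toContinuousLinearMap
    { toFun := fun y => WithLp.toLp 2 fun j => y (e j)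
      map_add' := fun _ _ => rfl
      map_smul' := fun _ _ => rfl }

theorem collect_apply (e : Fin 3 → Comp) (y : Comp → ℂ) (j : Fin 3) : collect e y j = y (e j) := rfl

theorem ik_eq (j : Fin 3) (k : Space) : ik j k = (((2 * Real.pi * k j : ℝ)) : ℂ) * Complex.I := by
  simp [ik]; ring

theorem freq_sq (k : Space) : freq k ^ 2 =
    (2 * Real.pi * k 0) ^ 2 + (2 * Real.pi * k 1) ^ 2 + (2 * Real.pi * k 2) ^ 2 := by
  rw [freq, mul_pow, EuclideanSpace.norm_sq_eq, Fin.sum_univ_three]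
  simp only [Real.norm_eq_abs, sq_abs]
  ring

theorem cvec_inner (v w : CVec) : ⟪v, w⟫ = ∑ j, ((v j).re * (w j).re + (v j).im * (w j).im) := by
  rw [PiLp.inner_apply]
  simp [Complex.inner, mul_comm]

/-- The Fourier symbols of divergence, gradient and curl. -/
noncomputable def symbols (k : Space) : Symbols ℂ CVec (freq k) where
  X := LinearMap.toContinuousLinearMap
    { toFun := fun v => ∑ j, ik j k * v j
      map_add' := fun v w => by simp [mul_add, Finset.sum_add_distrib]
      map_smul' := fun c v => by simp [Finset.mul_sum, mul_left_comm] }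
  G := LinearMap.toContinuousLinearMap
    { toFun := fun z => WithLp.toLp 2 fun j => ik j k * z
      map_add' := fun v w => by ext j; simp [mul_add]
      map_smul' := fun c v => by ext j; simp [mul_left_comm] }
  K := LinearMap.toContinuousLinearMap
    { toFun := fun v => WithLp.toLp 2 fun j => ik (j + 1) k * v (j + 2) - ik (j + 2) k * v (j + 1)
      map_add' := fun v w => by ext j; simp; ring
      map_smul' := fun c v => by ext j; simp; ring }
  s_nonneg := freq_nonneg k
  inner_G z v := by
    rw [cvec_inner]
    simp [Complex.inner, Fin.sum_univ_three, ik_eq]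
    ring
  inner_K v w := by
    rw [cvec_inner, cvec_inner]
    simp [Fin.sum_univ_three, ik_eq]
    ring
  norm_G z := by
    refine (sq_eq_sq₀ (norm_nonneg _) (mul_nonneg (freq_nonneg k) (norm_nonneg _))).1 ?_
    rw [mul_pow, freq_sq, EuclideanSpace.norm_sq_eq]
    simp [Fin.sum_univ_three, ik_eq, mul_pow]
    ring
  norm_KX v := by
    rw [freq_sq, EuclideanSpace.norm_sq_eq, EuclideanSpace.norm_sq_eq]
    simp [Fin.sum_univ_three, ik_eq, Complex.sq_norm, Complex.normSq_apply]
    ring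
  KG z := by
    ext j
    simp
    ring
  XG z := by
    simp only [Complex.real_smul, freq_sq]
    simp [Fin.sum_univ_three, ik_eq]
    linear_combination (z * (2 * Real.pi)^2 * ((k 0)^2 + (k 1)^2+(k 2)^2)) * Complex.I_sq
  KK v := by
    ext j
    simp only [freq_sq]
    fin_cases j <;> simp [Fin.sum_univ_three, ik_eq]
    · linear_combination (-((2 * Real.pi) ^ 2 * ((k 0) ^ 2 + (k 1) ^ 2 + (k 2) ^ 2) * v 0))
        * Complex.I_sq
    · linear_combination (-((2 * Real.pi) ^ 2 * ((k 0) ^ 2 + (k 1) ^ 2 + (k 2) ^ 2) * v 1))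
        * Complex.I_sq
    · linear_combination (-((2 * Real.pi) ^ 2 * ((k 0) ^ 2 + (k 1) ^ 2 + (k 2) ^ 2) * v 2))
        * Complex.I_sq

end EulerMaxwell

end

/-! ### Fourier representation of solutions -/

section

open MeasureTheory SchwartzMap LineDeriv
open scoped ENNReal NNReal RealInnerProductSpace

namespace EulerMaxwell

theorem symbols_X (k : Space) (v : CVec) : (symbols k).X v = ∑ j, ik j k * v j := rfl

theorem symbols_G (k : Space) (z : ℂ) (j : Fin 3) : (symbols k).G z j = ik j k * z := rfl

theorem symbols_K (k : Space) (v : CVec) (j : Fin 3) :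
    (symbols k).K v j = ik (j + 1) k * v (j + 2) - ik (j + 2) k * v (j + 1) := rfl

/-- `div curl = 0` is the adjoint of `curl grad = 0`, by the adjointness relations in `Symbols`. -/
theorem Symbols.XK {S H : Type*} [NormedAddCommGroup S] [InnerProductSpace ℝ S]
    [NormedAddCommGroup H] [InnerProductSpace ℝ H] {s : ℝ} (y : Symbols S H s) (v : H) :
    y.X (y.K v) = 0 := by
  rw [← inner_self_eq_zero (𝕜 := ℝ)]
  have h := y.inner_G (y.X (y.K v)) (y.K v)
  rw [← y.inner_K, y.KG, inner_zero_left] at h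
  linarith

theorem hasDerivAt_exp_smul_apply {ι : Type} [Fintype ι] (A : (ι → ℂ) →L[ℂ] (ι → ℂ)) (v : ι → ℂ)
    (t : ℝ) : HasDerivAt (fun t : ℝ => NormedSpace.exp ((t : ℂ) • A) v)
      (A (NormedSpace.exp ((t : ℂ) • A) v)) t := by
  have h1 := (hasDerivAt_exp_smul_const' A (t : ℂ)).scomp t Complex.ofRealCLM.hasDerivAt
  have h2 := ((ContinuousLinearMap.apply ℂ (ι → ℂ) v).restrictScalars ℝ).hasFDerivAt.comp_hasDerivAt
    t h1
  convert! h2 using 1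
  simp
  rfl

variable {P : Plasma}

/-- Every solution of `y' = A(k) y` whose initial value satisfies the constraints is an orbit. -/
theorem orbit_of_symbol {k : Space} {y : ℝ → Comp → ℂ}
    (hy : ∀ t, HasDerivAt y (symbolFun P k (y t)) t)
    (hE : ∑ j, ik j k * y 0 (.E j) = ((4 * Real.pi * P.e : ℝ) : ℂ) *
      (y 0 (.ρ .ion) - y 0 (.ρ .electron)))
    (hB : ∑ j, ik j k * y 0 (.B j) = 0) :
    Orbit P (symbols k) (fun a t => y t (.ρ a)) (fun a t => collect (.u a) (y t))
      (fun t => collect .E (y t)) (fun t => collect .B (y t)) := by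
  have hρ : ∀ a t, HasDerivAt (fun t => y t (.ρ a)) (-((symbols k).X (collect (.u a) (y t)))) t :=
    fun a t => hasDerivAt_pi.1 (hy t) (.ρ a)
  have hc : ∀ e t, HasDerivAt (fun t => collect e (y t)) (collect e (symbolFun P k (y t))) t :=
    fun e t => (collect e).hasFDerivAt.comp_hasDerivAt t (hy t)
  have hu : ∀ a t, HasDerivAt (fun t => collect (.u a) (y t)) ((P.m a)⁻¹ •
      (-(P.T a • (symbols k).G (y t (.ρ a))) + P.q a • collect .E (y t)
        - P.f a • collect (.u a) (y t))) t := by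
    intro a t
    exact hc (.u a) t
  have hE' : ∀ t, HasDerivAt (fun t => collect .E (y t)) (P.c • (symbols k).K (collect .B (y t))
      - (4 * Real.pi * P.e) • (collect (.u .ion) (y t) - collect (.u .electron) (y t))) t := by
    intro t
    convert! hc .E t using 1
    ext j
    simp [collect_apply, symbolFun, symbols_K, Plasma.q]
    ring
  have hB' : ∀ t, HasDerivAt (fun t => collect .B (y t))
      (-(P.c • (symbols k).K (collect .E (y t)))) t := by
    intro t
    exact hc .B t
  refine ⟨hρ, hu, hE', hB', fun t => ?_, fun t => ?_⟩
  -- The constraints propagate: the divergence of Ampère's law together with the continuity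
  -- equations shows that the defect in Gauss's law is constant in time.
  · have hd : ∀ t, HasDerivAt (fun t => (symbols k).X (collect .E (y t)) - (4 * Real.pi * P.e) •
        (y t (.ρ .ion) - y t (.ρ .electron))) 0 t := by
      intro t
      convert! ((symbols k).X.hasFDerivAt.comp_hasDerivAt t (hE' t)).sub
        (((hρ .ion t).sub (hρ .electron t)).const_smul (4 * Real.pi * P.e)) using 1
      simp only [map_sub, map_smul, Symbols.XK]
      module
    have h := is_const_of_deriv_eq_zero (fun t => (hd t).differentiableAt)
      (fun t => (hd t).deriv) t 0
    rw [← sub_eq_zero, h]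
    simp only [symbols_X, collect_apply, hE, Complex.real_smul, sub_self]
  · have hd : ∀ t, HasDerivAt (fun t => (symbols k).X (collect .B (y t))) 0 t := by
      intro t
      convert! ((symbols k).X.hasFDerivAt.comp_hasDerivAt t (hB' t)) using 1
      simp only [map_neg, map_smul, Symbols.XK, smul_zero, neg_zero]
    have h := is_const_of_deriv_eq_zero (fun t => (hd t).differentiableAt)
      (fun t => (hd t).deriv) t 0
    rw [h]
    simpa [symbols_X, collect_apply] using hB

/-- The Fourier transforms of the components of a tuple of fields. -/
noncomputable def hats (V : Fields L2) : Comp → CL2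
  | .ρ a => hat (V.ρ a)
  | .u a j => hat (V.u a j)
  | .E j => hat (V.E j)
  | .B j => hat (V.B j)

/-- The components of a tuple of distributions. -/
def comps (V : Fields Dist) : Comp → Dist
  | .ρ a => V.ρ a
  | .u a j => V.u a j
  | .E j => V.E j
  | .B j => V.B j

theorem hasFT_comps (V : Fields L2) (b : Comp) : HasFT (comps V.toDist b) (hats V b) := by
  cases b <;> exact hasFT_toDist _

theorem continuous_hat : Continuous hat := by
  have h1 : Continuous fun f : L2 => (Complex.ofRealCLM.compLp f : CL2) :=
    (Complex.ofRealCLM.compLpL 2 (volume : Measure Space)).continuous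
  have h2 : Continuous fun f : CL2 => (FourierTransform.fourier f : CL2) :=
    (Lp.fourierTransformₗᵢ Space ℂ).continuous
  exact h2.comp h1

theorem compatible_hats {V : Fields L2} (h : Compatible P V.toDist) : ∀ᵐ k,
    (∑ j, ik j k * hats V (.E j) k = ((4 * Real.pi * P.e : ℝ) : ℂ) *
      (hats V (.ρ .ion) k - hats V (.ρ .electron) k)) ∧ ∑ j, ik j k * hats V (.B j) k = 0 := by
  have hf := hasFT_comps V
  have h1 := HasFT.div (fun j => hf (.E j))
  have h2 := HasFT.div (fun j => hf (.B j))
  have h3 := (((hf (.ρ .ion)).rsmul (P.q .ion)).add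
    ((hf (.ρ .electron)).rsmul (P.q .electron))).rsmul (4 * Real.pi)
  have e1 : HasFT (div V.toDist.E) _ := h.1 ▸ h3
  have e2 : HasFT (div V.toDist.B) _ := h.2 ▸ HasFT.zero
  filter_upwards [h1.unique e1, h2.unique e2] with k k1 k2
  refine ⟨k1.trans ?_, k2⟩
  simp [Plasma.q]
  ring

theorem integrable_weak {V : Fields L2} (b : Comp) (φ : 𝓢(Space, ℂ)) :
    comps V.toDist b (FourierTransform.fourier φ) = ∫ k, φ k * hats V b k :=
  (hasFT_comps V b).apply_fourier φ

/-- Fourier representation of solutions. -/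
theorem IsSolution.hats_eq {U₀ : Fields L2} {U : ℝ → Fields L2} (h : IsSolution P U₀ U) {T : ℝ}
    (hT : 0 ≤ T) : ∀ᵐ k, (fun b => hats (U T) b k) =
      NormedSpace.exp ((T : ℂ) • symbol P k) (fun b => hats U₀ b k) := by
  rw [← h.init]
  refine weak_evolution (contDiff_symbol P) (f := fun t => hats (U t)) ?_ ?_ hT
  · rintro (a | ⟨a, j⟩ | j | j)
    · exact continuous_hat.comp_continuousOn (h.cont_ρ a)
    · exact continuous_hat.comp_continuousOn (h.cont_u a j)
    · exact continuous_hat.comp_continuousOn (h.cont_E j)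
    · exact continuous_hat.comp_continuousOn (h.cont_B j)
  · intro b φ t ht
    have hf := fun t => hasFT_comps (U t)
    simp only [symbol_apply, ← integrable_weak]
    rcases b with a | ⟨a, j⟩ | j | j
    · have := h.eq_ρ a (FourierTransform.fourier φ) t ht
      convert! this using 1
      exact (((HasFT.div fun j => hf t (.u a j)).neg).apply_fourier φ).symm
    · have h1 := (h.eq_u a j (FourierTransform.fourier φ) t ht).const_smul (P.m a)⁻¹
      have hm := (P.m_pos a).ne'
      have h2 := (((((hf t (.ρ a)).pderiv j).rsmul (P.T a)).neg.add
        ((hf t (.E j)).rsmul (P.q a))).sub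
          ((hf t (.u a j)).rsmul (P.m a * P.ν a))).rsmul (P.m a)⁻¹
      convert! h1 using 1
      · ext s
        exact (inv_smul_smul₀ hm _).symm
      · exact (h2.apply_fourier φ).symm
    · have h1 := h.eq_E j (FourierTransform.fourier φ) t ht
      have h2 := ((HasFT.curl (fun j => hf t (.B j)) j).rsmul P.c).sub
        ((((hf t (.u .ion j)).rsmul (P.q .ion)).add
          ((hf t (.u .electron j)).rsmul (P.q .electron))).rsmul (4 * Real.pi))
      convert! h1 using 1
      exact (h2.apply_fourier φ).symm
    · have h1 := h.eq_B j (FourierTransform.fourier φ) t ht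
      have h2 := ((HasFT.curl (fun j => hf t (.E j)) j).rsmul P.c).neg
      convert! h1 using 1
      exact (h2.apply_fourier φ).symm

end EulerMaxwell

end

/-! ### Fourier transforms of the profiles and pointwise comparison -/

section

open MeasureTheory SchwartzMap LineDeriv
open scoped ENNReal NNReal RealInnerProductSpace

namespace EulerMaxwell

theorem exp_zero_smul_clm {ι : Type} [Fintype ι] (A : (ι → ℂ) →L[ℂ] (ι → ℂ)) :
    NormedSpace.exp (((0 : ℝ) : ℂ) • A) = 1 :=
  have := exp_zero_smul (R := (ι → ℂ) →L[ℂ] (ι → ℂ)) A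
  this

variable (P : Plasma)

/-- The Fourier transform of `ρ̄(t)`. -/
noncomputable def rhoBarFT (V : Fields L2) (t : ℝ) (k : Space) : ℂ :=
  ((Real.exp (-(P.μ₁ * (2 * Real.pi * ‖k‖) ^ 2 * t)) : ℝ) : ℂ) *
    (((P.f .ion / P.F : ℝ) : ℂ) * hats V (.ρ .ion) k
      + ((P.f .electron / P.F : ℝ) : ℂ) * hats V (.ρ .electron) k)

/-- The Fourier transform of `B̄(t)`. -/
noncomputable def BBarFT (V : Fields L2) (t : ℝ) (j : Fin 3) (k : Space) : ℂ :=
  ((Real.exp (-(P.μ₂ * (2 * Real.pi * ‖k‖) ^ 2 * t)) : ℝ) : ℂ) * hats V (.B j) k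

/-- The Fourier transform of a combination `p ∇ρ̄ + q curl B̄`. -/
noncomputable def gradCurlFT (p q : ℝ) (V : Fields L2) (t : ℝ) (j : Fin 3) (k : Space) : ℂ :=
  (p : ℂ) * (ik j k * rhoBarFT P V t k) + (q : ℂ) *
    (ik (j + 1) k * BBarFT P V t (j + 2) k - ik (j + 2) k * BBarFT P V t (j + 1) k)

variable {P}

theorem hasFT_rhoBar (V : Fields L2) {t : ℝ} (ht : 0 ≤ t) :
    HasFT (rhoBar P V.toDist t) (rhoBarFT P V t) :=
  ((((hasFT_comps V (.ρ .ion)).rsmul _).add ((hasFT_comps V (.ρ .electron)).rsmul _)).heat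
    P.μ₁_pos.le ht)

theorem hasFT_BBar (V : Fields L2) {t : ℝ} (ht : 0 ≤ t) (j : Fin 3) :
    HasFT (BBar P V.toDist t j) (BBarFT P V t j) :=
  (hasFT_comps V (.B j)).heat P.μ₂_pos.le ht

theorem hasFT_uBar (V : Fields L2) {t : ℝ} (ht : 0 ≤ t) (a : Species) (j : Fin 3) :
    HasFT (uBar P V.toDist a t j) (gradCurlFT P (-P.μ₁) (P.κ a) V t j) := by
  refine (((((hasFT_rhoBar V ht).pderiv j).rsmul P.μ₁).neg).add
    ((HasFT.curl (hasFT_BBar V ht) j).rsmul (P.κ a))).congr (.of_forall fun k => ?_)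
  simp [gradCurlFT]

theorem hasFT_EBar (V : Fields L2) {t : ℝ} (ht : 0 ≤ t) (j : Fin 3) :
    HasFT (EBar P V.toDist t j) (gradCurlFT P P.γ₁ P.γ₂ V t j) :=
  (((hasFT_rhoBar V ht).pderiv j).rsmul P.γ₁).add
    ((HasFT.curl (hasFT_BBar V ht) j).rsmul P.γ₂)

/-- The sum of the moduli of the Fourier transforms of all components. -/
noncomputable def allAbs (V : Fields L2) (k : Space) : ℝ := ∑ b, ‖hats V b k‖

theorem norm_cvec_le (v : CVec) : ‖v‖ ≤ ∑ j, ‖v j‖ := by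
  have h : v = ∑ j, EuclideanSpace.single j (v j) := by
    ext i; simp
  conv_lhs => rw [h]
  exact (norm_sum_le _ _).trans (by simp)

/-- The enumeration of `Comp` is noncomputable, so the sum is transported along an explicit
bijection. -/
theorem sum_comp {M : Type*} [AddCommMonoid M] (f : Comp → M) : ∑ b, f b =
    (f (.ρ .ion) + f (.ρ .electron)) + ((∑ j, f (.u .ion j) + ∑ j, f (.u .electron j)) +
      (∑ j, f (.E j) + ∑ j, f (.B j))) := by
  have h : ∑ b, f b = ∑ x : Fin 2 ⊕ (Fin 3 ⊕ Fin 3) ⊕ Fin 3 ⊕ Fin 3, f (Sum.elim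
      ![.ρ .ion, .ρ .electron] (Sum.elim (Sum.elim (.u .ion) (.u .electron)) (Sum.elim .E .B)) x) := by
    symm
    refine Fintype.sum_bijective _ ⟨?_, ?_⟩ _ _ fun _ => rfl
    · rintro (a | (a | a) | a | a) (b | (b | b) | b | b) h <;>
        fin_cases a <;> fin_cases b <;> simp at h ⊢
    · rintro ((_ | _) | ⟨_ | _, j⟩ | j | j)
      exacts [⟨.inl 0, rfl⟩, ⟨.inl 1, rfl⟩, ⟨.inr (.inl (.inl j)), rfl⟩,
        ⟨.inr (.inl (.inr j)), rfl⟩, ⟨.inr (.inr (.inl j)), rfl⟩, ⟨.inr (.inr (.inr j)), rfl⟩]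
  rw [h]
  simp only [Fintype.sum_sum_type, Sum.elim_inl, Sum.elim_inr, Fin.sum_univ_two,
    Matrix.cons_val_zero, Matrix.cons_val_one]

theorem size_le_allAbs (y : Comp → ℂ) :
    ‖y (.ρ .ion)‖ + ‖y (.ρ .electron)‖ + ‖collect (.u .ion) y‖ + ‖collect (.u .electron) y‖
      + ‖collect .E y‖ + ‖collect .B y‖ ≤ ∑ b, ‖y b‖ := by
  rw [sum_comp]
  have := fun e => norm_cvec_le (collect e y)
  simp only [collect_apply] at this
  have h1 := this (.u .ion)
  have h2 := this (.u .electron)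
  have h3 := this .E
  have h4 := this .B
  linarith

/-- Pointwise bounds for the Fourier transform of a solution. -/
theorem IsSolution.pointwise (P : Plasma) : ∃ c C : ℝ, 0 < c ∧ 0 < C ∧ c ≤ P.μ₁ ∧ c ≤ P.μ₂ ∧
    ∀ (U₀ : Fields L2) (U : ℝ → Fields L2), IsSolution P U₀ U → ∀ t, 0 ≤ t → ∀ᵐ k,
    (freq k ≤ 1 →
      (∀ a, ‖hats (U t) (.ρ a) k - rhoBarFT P U₀ t k‖ ≤
        C * (freq k * Real.exp (-(c * freq k ^ 2 * t))) * allAbs U₀ k) ∧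
      (∀ a j, ‖hats (U t) (.u a j) k - gradCurlFT P (-P.μ₁) (P.κ a) U₀ t j k‖ ≤
        C * (freq k ^ 2 * Real.exp (-(c * freq k ^ 2 * t)) + Real.exp (-(c * t))) * allAbs U₀ k) ∧
      (∀ j, ‖hats (U t) (.E j) k - gradCurlFT P P.γ₁ P.γ₂ U₀ t j k‖ ≤
        C * (freq k ^ 2 * Real.exp (-(c * freq k ^ 2 * t)) + Real.exp (-(c * t))) * allAbs U₀ k) ∧
      ∀ j, ‖hats (U t) (.B j) k - BBarFT P U₀ t j k‖ ≤
        C * (freq k * Real.exp (-(c * freq k ^ 2 * t))) * allAbs U₀ k) ∧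
    (1 ≤ freq k → ∀ b, ‖hats (U t) b k‖ ≤
      C * (Real.exp (-(c * t / freq k ^ 2)) * allAbs U₀ k)) := by
  obtain ⟨c₁, C₁, hc₁, hC₁, hlow⟩ := Orbit.low_le (S := ℂ) (H := CVec) P
  obtain ⟨c₂, C₂, hc₂, hC₂, hhigh⟩ := Orbit.high_le (S := ℂ) (H := CVec) P
  have hμ₁ := P.μ₁_pos
  have hμ₂ := P.μ₂_pos
  obtain ⟨c, hc, hcl⟩ := exists_le_of_pos [c₁, c₂, P.μ₁, P.μ₂] (by
    simp only [List.mem_cons, List.not_mem_nil, or_false, forall_eq_or_imp, forall_eq]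
    exact ⟨hc₁, hc₂, hμ₁, hμ₂⟩)
  simp only [List.mem_cons, List.not_mem_nil, or_false, forall_eq_or_imp, forall_eq] at hcl
  obtain ⟨l1, l2, l3, l4⟩ := hcl
  refine ⟨c, max C₁ C₂, hc, by positivity, l3, l4, fun U₀ U h t ht => ?_⟩
  have h0 := h.compatible 0 le_rfl
  rw [h.init] at h0
  filter_upwards [h.hats_eq ht, compatible_hats h0] with k hk hcomp
  set y : ℝ → Comp → ℂ := fun t => NormedSpace.exp ((t : ℂ) • symbol P k) (fun b => hats U₀ b k)
    with hy
  have hy0 : y 0 = fun b => hats U₀ b k := by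
    simp only [hy]
    rw [exp_zero_smul_clm]
    rfl
  have hyt : ∀ b, hats (U t) b k = y t b := fun b => congrFun hk b
  -- At almost every frequency the exponential applied to the transformed data is an orbit, so the
  -- abstract estimates apply with `S = ℂ` and `H = ℂ³` as real inner product spaces.
  have o : Orbit P (symbols k) _ _ _ _ := orbit_of_symbol
    (fun t => hasDerivAt_exp_smul_apply (symbol P k) (fun b => hats U₀ b k) t)
    (by rw [exp_zero_smul_clm]; exact hcomp.1) (by rw [exp_zero_smul_clm]; exact hcomp.2)
  have hs0 : size (fun a t => y t (.ρ a)) (fun a t => collect (.u a) (y t))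
      (fun t => collect .E (y t)) (fun t => collect .B (y t)) 0 ≤ allAbs U₀ k := by
    refine (size_le_allAbs (y 0)).trans ?_
    rw [hy0]; rfl
  have hs0' := size_nonneg (ρ := fun a t => y t (.ρ a)) (u := fun a t => collect (.u a) (y t))
      (E := fun t => collect .E (y t)) (B := fun t => collect .B (y t)) 0
  have hZ : 0 ≤ allAbs U₀ k := Finset.sum_nonneg fun _ _ => norm_nonneg _
  have hfr := freq_nonneg k
  have hn0 : meanDensity P (fun a t => y t (.ρ a)) 0 = ((P.f .ion / P.F : ℝ) : ℂ) *
      hats U₀ (.ρ .ion) k + ((P.f .electron / P.F : ℝ) : ℂ) * hats U₀ (.ρ .electron) k := by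
    simp only [meanDensity, hy0, Complex.real_smul]
    push_cast
    ring
  have hrho : Real.exp (-(P.μ₁ * freq k ^ 2 * t)) • meanDensity P (fun a t => y t (.ρ a)) 0 =
      rhoBarFT P U₀ t k := by
    rw [hn0, Complex.real_smul]; rfl
  have hB : ∀ j, (Real.exp (-(P.μ₂ * freq k ^ 2 * t)) • collect .B (y 0)) j = BBarFT P U₀ t j k := by
    intro j
    rw [hy0, PiLp.smul_apply, Complex.real_smul]; rfl
  have he1 : Real.exp (-(c₁ * freq k ^ 2 * t)) ≤ Real.exp (-(c * freq k ^ 2 * t)) := by gcongr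
  have he2 : Real.exp (-(c₁ * t)) ≤ Real.exp (-(c * t)) := by gcongr
  have he3 : Real.exp (-(c₂ * t / freq k ^ 2)) ≤ Real.exp (-(c * t / freq k ^ 2)) := by gcongr
  refine ⟨fun hs => ?_, fun hs b => ?_⟩
  · obtain ⟨o1, o2, o3, o4⟩ := hlow _ _ _ _ _ _ o hs t ht
    refine ⟨fun a => ?_, fun a j => ?_, fun j => ?_, fun j => ?_⟩
    · rw [hyt, ← hrho]
      refine (o1 a).trans ?_
      gcongr
      exact le_max_left _ _
    · have h1 := (PiLp.norm_apply_le _ j).trans (o2 a)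
      have e : ∀ w : CVec, (w - (-(P.μ₁ • (symbols k).G (rhoBarFT P U₀ t k)) + P.κ a • (symbols k).K
          (Real.exp (-(P.μ₂ * freq k ^ 2 * t)) • collect .B (y 0)))) j =
          w j - gradCurlFT P (-P.μ₁) (P.κ a) U₀ t j k := by
        intro w
        simp only [PiLp.sub_apply, PiLp.add_apply, PiLp.neg_apply, PiLp.smul_apply, symbols_G,
          symbols_K, hB, gradCurlFT, Complex.real_smul, Complex.ofReal_neg, neg_mul]
      rw [hyt]
      rw [hrho] at h1
      refine (e _ ▸ h1).trans ?_
      gcongr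
      exact le_max_left _ _
    · have h1 := (PiLp.norm_apply_le _ j).trans o3
      have e : ∀ w : CVec, (w - (P.γ₁ • (symbols k).G (rhoBarFT P U₀ t k) + P.γ₂ • (symbols k).K
          (Real.exp (-(P.μ₂ * freq k ^ 2 * t)) • collect .B (y 0)))) j =
          w j - gradCurlFT P P.γ₁ P.γ₂ U₀ t j k := by
        intro w
        simp only [PiLp.sub_apply, PiLp.add_apply, PiLp.smul_apply, symbols_G,
          symbols_K, hB, gradCurlFT, Complex.real_smul]
      rw [hyt]
      rw [hrho] at h1
      refine (e _ ▸ h1).trans ?_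
      gcongr
      exact le_max_left _ _
    · have h1 := (PiLp.norm_apply_le _ j).trans o4
      rw [PiLp.sub_apply, hB] at h1
      rw [hyt]
      refine h1.trans ?_
      gcongr
      exact le_max_left _ _
  · have h1 := hhigh _ _ _ _ _ _ o hs t ht
    have h2 : ‖y t b‖ ≤ size (fun a t => y t (.ρ a)) (fun a t => collect (.u a) (y t))
      (fun t => collect .E (y t)) (fun t => collect .B (y t)) t := by
      rcases b with a | ⟨a, j⟩ | j | j
      · exact norm_ρ_le_size (ρ := fun a t => y t (.ρ a)) a t
      · exact (PiLp.norm_apply_le (collect (.u a) (y t)) j).trans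
          (norm_u_le_size (u := fun a t => collect (.u a) (y t)) a t)
      · exact (PiLp.norm_apply_le (collect .E (y t)) j).trans
          (norm_E_le_size (E := fun t => collect .E (y t)) t)
      · exact (PiLp.norm_apply_le (collect .B (y t)) j).trans
          (norm_B_le_size (B := fun t => collect .B (y t)) t)
    rw [hyt]
    refine (h2.trans h1).trans ?_
    gcongr
    exact le_max_right _ _

end EulerMaxwell

end

/-! ### From frequency bounds to `L^q` estimates -/

section

open MeasureTheory SchwartzMap LineDeriv
open scoped ENNReal NNReal

namespace EulerMaxwell

theorem measurableSet_freq_le : MeasurableSet {k : Space | freq k ≤ 1} :=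
  measurableSet_le continuous_freq.measurable measurable_const

theorem aestronglyMeasurable_low {f : Space → ℝ} (hf : AEStronglyMeasurable f) :
    AEStronglyMeasurable (fun k => if freq k ≤ 1 then f k else 0) :=
  (hf.indicator measurableSet_freq_le).congr
    (.of_forall fun k => by simp [Set.indicator_apply])

theorem aestronglyMeasurable_high {f : Space → ℝ} (hf : AEStronglyMeasurable f) :
    AEStronglyMeasurable (fun k => if freq k ≤ 1 then 0 else f k) :=
  (hf.indicator measurableSet_freq_le.compl).congr
    (.of_forall fun k => by
      by_cases h : freq k ≤ 1 <;> simp [h])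

/-- Estimates of a distribution whose Fourier transform obeys low and high frequency bounds. -/
theorem HasFT.frequency_le {p q r : ℝ≥0∞} {ℓ c C₀ : ℝ} (hp1 : 1 ≤ p) (hp2 : p ≤ 2) (hr1 : 1 ≤ r)
    (hr2 : r ≤ 2) (hq : 2 ≤ q) (hℓ : 0 ≤ ℓ) (hc : 0 < c) (hC₀ : 0 ≤ C₀) (m b : ℕ) :
    ∃ C : ℝ≥0, ∀ t : ℝ, 0 ≤ t → ∀ T h, HasFT T h → ∀ Z V W : Space → ℝ,
      AEStronglyMeasurable Z → AEStronglyMeasurable V → AEStronglyMeasurable W →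
      (∀ k, 0 ≤ Z k) → (∀ k, 0 ≤ V k) → (∀ k, 0 ≤ W k) →
      (∀ᵐ k, (freq k ≤ 1 → ‖h k‖ ≤ C₀ * ((freq k ^ (b + 1) * Real.exp (-(c * freq k ^ 2 * t)) +
          Real.exp (-(c * t))) * Z k + freq k ^ b * Real.exp (-(c * freq k ^ 2 * t)) * V k)) ∧
        (1 ≤ freq k → ‖h k‖ ≤ C₀ * (Real.exp (-(c * t / freq k ^ 2)) * Z k +
          freq k ^ b * Real.exp (-(c * t)) * W k))) →
      nablaNorm m q T ≤ C * (algDecay t (heatExp p q + ((m + (b + 1) : ℕ) : ℝ) / 2) *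
          eLpNorm Z (cj p) volume + expDecay c t * eLpNorm Z (cj p) volume
        + algDecay t (ℓ / 2) *
          eLpNorm (fun k => freq k ^ (m + plusIndex ℓ r q) * Z k) (cj r) volume
        + expDecay c t *
          eLpNorm (fun k => freq k ^ (m + b + plusIndex 0 r q) * W k) (cj r) volume
        + algDecay t (heatExp p q + ((m + b : ℕ) : ℝ) / 2) * eLpNorm V (cj p) volume) := by
  have hpq : p ≤ q := hp2.trans hq
  obtain ⟨D, hD⟩ := HasFT.nablaNorm_le hq m
  obtain ⟨C1, h1⟩ := low_freq_le hp1 hpq (m + (b + 1)) hc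
  obtain ⟨C2, h2⟩ := low_freq_le hp1 hpq m hc
  obtain ⟨C3, h3⟩ := low_freq_le hp1 hpq (m + b) hc
  obtain ⟨C4, h4⟩ := high_freq_le hr1 hr2 hq m hℓ hc
  obtain ⟨C5, h5⟩ := high_freq_le hr1 hr2 hq (m + b) le_rfl hc
  set A : ℝ≥0 := C1 + C2 + C3 + C4 + C5 with hA
  refine ⟨D * (C₀.toNNReal * A), fun t ht T h hT Z V W hZ hV hW hZ0 hV0 hW0 hb => ?_⟩
  set g1 : Space → ℝ := fun k => if freq k ≤ 1 then
    freq k ^ (m + (b + 1)) * Real.exp (-(c * freq k ^ 2 * t)) * Z k else 0 with hg1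
  -- The factor `e^{-ct}` is taken out of `g2` and `g5`. They are estimated by the frequency lemmas
  -- at time zero, where the algebraic weight is one, and `g5` with `ℓ = 0`.
  set g2 : Space → ℝ := fun k => if freq k ≤ 1 then
    freq k ^ m * Real.exp (-(c * freq k ^ 2 * 0)) * Z k else 0 with hg2
  set g3 : Space → ℝ := fun k => if freq k ≤ 1 then
    freq k ^ (m + b) * Real.exp (-(c * freq k ^ 2 * t)) * V k else 0 with hg3
  set g4 : Space → ℝ := fun k => if freq k ≤ 1 then 0 else
    freq k ^ m * Real.exp (-(c * t / freq k ^ 2)) * Z k with hg4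
  set g5 : Space → ℝ := fun k => if freq k ≤ 1 then 0 else
    freq k ^ (m + b) * Real.exp (-(c * 0 / freq k ^ 2)) * W k with hg5
  have mw : ∀ (N : ℕ) (s : ℝ), AEStronglyMeasurable fun k : Space =>
      freq k ^ N * Real.exp (-(c * freq k ^ 2 * s)) := fun N s =>
    (by fun_prop : Continuous fun k : Space =>
      freq k ^ N * Real.exp (-(c * freq k ^ 2 * s))).aestronglyMeasurable
  have mh : ∀ (N : ℕ) (s : ℝ), AEStronglyMeasurable fun k : Space =>
      freq k ^ N * Real.exp (-(c * s / freq k ^ 2)) := fun N s => by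
    have := continuous_freq.measurable
    exact (by fun_prop : Measurable fun k : Space =>
      freq k ^ N * Real.exp (-(c * s / freq k ^ 2))).aestronglyMeasurable
  have m1 : AEStronglyMeasurable g1 := aestronglyMeasurable_low ((mw _ _).mul hZ)
  have m2 : AEStronglyMeasurable g2 := aestronglyMeasurable_low ((mw _ _).mul hZ)
  have m3 : AEStronglyMeasurable g3 := aestronglyMeasurable_low ((mw _ _).mul hV)
  have m4 : AEStronglyMeasurable g4 := aestronglyMeasurable_high ((mh _ _).mul hZ)
  have m5 : AEStronglyMeasurable g5 := aestronglyMeasurable_high ((mh _ _).mul hW)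
  have hone := one_le_cj q
  have key : eLpNorm (fun k => freq k ^ m * ‖h k‖) (cj q) volume ≤
      ENNReal.ofReal C₀ * (eLpNorm g1 (cj q) volume + expDecay c t * eLpNorm g2 (cj q) volume
        + eLpNorm g3 (cj q) volume + eLpNorm g4 (cj q) volume
        + expDecay c t * eLpNorm g5 (cj q) volume) := by
    calc eLpNorm (fun k => freq k ^ m * ‖h k‖) (cj q) volume
        ≤ eLpNorm (C₀ • (g1 + Real.exp (-(c * t)) • g2 + g3 + g4 + Real.exp (-(c * t)) • g5))
          (cj q) volume := by
          refine eLpNorm_mono_ae_real ?_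
          filter_upwards [hb] with k hk
          have hf := freq_nonneg k
          rw [Real.norm_of_nonneg (by positivity)]
          simp only [Pi.add_apply, Pi.smul_apply, smul_eq_mul, hg1, hg2, hg3, hg4, hg5]
          by_cases hk1 : freq k ≤ 1
          · simp only [hk1, if_true]
            calc freq k ^ m * ‖h k‖ ≤ _ := mul_le_mul_of_nonneg_left (hk.1 hk1) (by positivity)
              _ = _ := by simp only [mul_zero, neg_zero, Real.exp_zero]; ring
          · simp only [hk1, if_false]
            calc freq k ^ m * ‖h k‖ ≤ _ :=
                  mul_le_mul_of_nonneg_left (hk.2 (not_le.1 hk1).le) (by positivity)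
              _ = _ := by simp only [mul_zero, zero_div, neg_zero, Real.exp_zero]; ring
      _ ≤ _ := by
        rw [eLpNorm_const_smul, Real.enorm_of_nonneg hC₀]
        gcongr
        have e2 : eLpNorm (Real.exp (-(c * t)) • g2) (cj q) volume =
            expDecay c t * eLpNorm g2 (cj q) volume := by
          rw [eLpNorm_const_smul, Real.enorm_of_nonneg (Real.exp_nonneg _), expDecay]
        have e5 : eLpNorm (Real.exp (-(c * t)) • g5) (cj q) volume =
            expDecay c t * eLpNorm g5 (cj q) volume := by
          rw [eLpNorm_const_smul, Real.enorm_of_nonneg (Real.exp_nonneg _), expDecay]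
        have n2 := m2.const_smul (Real.exp (-(c * t)))
        have n5 := m5.const_smul (Real.exp (-(c * t)))
        rw [← e2, ← e5]
        refine (eLpNorm_add_le (((m1.add n2).add m3).add m4) n5 hone).trans ?_
        gcongr
        refine (eLpNorm_add_le ((m1.add n2).add m3) m4 hone).trans ?_
        gcongr
        refine (eLpNorm_add_le (m1.add n2) m3 hone).trans ?_
        gcongr
        exact eLpNorm_add_le m1 n2 hone
  have h00 : ∀ x, algDecay 0 x = 1 := fun x => by simp [algDecay]
  have b1 := h1 t ht Z hZ hZ0
  have b2 := h2 0 le_rfl Z hZ hZ0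
  have b3 := h3 t ht V hV hV0
  have b4 := h4 t ht Z hZ hZ0
  have b5 := h5 0 le_rfl W hW hW0
  rw [h00, one_mul] at b2 b5
  have hle : ∀ {x y : ℝ≥0∞} {Ci : ℝ≥0}, x ≤ Ci * y → Ci ≤ A → x ≤ A * y := fun h hC =>
    h.trans (mul_le_mul_left (ENNReal.coe_le_coe.2 hC) _)
  have k1 := hle b1 (by rw [hA]; simp only [add_assoc]; exact le_self_add)
  have k2 := hle b2 (by
    rw [hA, add_comm C1]; simp only [add_assoc]; exact le_self_add)
  have k3 := hle b3 (by
    rw [hA, add_comm (C1 + C2)]; simp only [add_assoc]; exact le_self_add)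
  have k4 := hle b4 (by
    rw [hA, add_comm (C1 + C2 + C3)]; simp only [add_assoc]; exact le_self_add)
  have k5 := hle b5 (by rw [hA]; exact le_add_self)
  calc nablaNorm m q T ≤ _ := hD T h hT
    _ ≤ D * (ENNReal.ofReal C₀ * (eLpNorm g1 (cj q) volume + expDecay c t * eLpNorm g2 (cj q) volume
        + eLpNorm g3 (cj q) volume + eLpNorm g4 (cj q) volume
        + expDecay c t * eLpNorm g5 (cj q) volume)) := by gcongr
    _ ≤ D * (ENNReal.ofReal C₀ * (A * (algDecay t (heatExp p q + ((m + (b + 1) : ℕ) : ℝ) / 2) *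
          eLpNorm Z (cj p) volume) + expDecay c t * (A * eLpNorm Z (cj p) volume)
        + A * (algDecay t (heatExp p q + ((m + b : ℕ) : ℝ) / 2) * eLpNorm V (cj p) volume)
        + A * (algDecay t (ℓ / 2) *
          eLpNorm (fun k => freq k ^ (m + plusIndex ℓ r q) * Z k) (cj r) volume)
        + expDecay c t * (A *
          eLpNorm (fun k => freq k ^ (m + b + plusIndex 0 r q) * W k) (cj r) volume))) := by
      gcongr
    _ = _ := by
      rw [ENNReal.ofReal]
      push_cast
      ring

end EulerMaxwell

end

/-! ### Comparison of a component with its profile -/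

section

open MeasureTheory SchwartzMap LineDeriv
open scoped ENNReal NNReal

namespace EulerMaxwell

/-- The sum of the moduli of the Fourier transforms of some components. -/
noncomputable def partAbs {ι : Type} [Fintype ι] (e : ι → Comp) (V : Fields L2) (k : Space) : ℝ :=
  ∑ i, ‖hats V (e i) k‖

/-- The sum of the norms of the derivatives of some components. -/
noncomputable def partNorm {ι : Type} [Fintype ι] (e : ι → Comp) (N : ℕ) (r : ℝ≥0∞)
    (V : Fields Dist) : ℝ≥0∞ :=
  ∑ i, nablaNorm N r (comps V (e i))

section Part

variable {ι : Type} [Fintype ι]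

theorem partAbs_nonneg (e : ι → Comp) (V : Fields L2) (k : Space) : 0 ≤ partAbs e V k :=
  Finset.sum_nonneg fun _ _ => norm_nonneg _

theorem aestronglyMeasurable_partAbs (e : ι → Comp) (V : Fields L2) :
    AEStronglyMeasurable (partAbs e V) :=
  Finset.aestronglyMeasurable_fun_sum _ fun i _ => (Lp.aestronglyMeasurable (hats V (e i))).norm

theorem partAbs_le (e : ι → Comp) {r : ℝ≥0∞} (hr1 : 1 ≤ r) (hr2 : r ≤ 2) (N : ℕ) :
    ∃ C : ℝ≥0, ∀ V : Fields L2, eLpNorm (fun k => freq k ^ N * partAbs e V k) (cj r) volume ≤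
      C * partNorm e N r V.toDist := by
  obtain ⟨C, hC⟩ := HasFT.weighted_le hr1 hr2 N
  refine ⟨C, fun V => ?_⟩
  have h : (fun k => freq k ^ N * partAbs e V k) =
      ∑ i, fun k => freq k ^ N * ‖hats V (e i) k‖ := by
    ext k
    simp [partAbs, Finset.mul_sum]
  rw [h, partNorm, Finset.mul_sum]
  refine (eLpNorm_sum_le (fun i _ => ?_) (one_le_cj r)).trans
    (Finset.sum_le_sum fun i _ => hC _ _ (hasFT_comps V (e i)))
  exact (continuous_freq.pow N).aestronglyMeasurable.mul
    (Lp.aestronglyMeasurable (hats V (e i))).norm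

theorem partAbs_le_zero (e : ι → Comp) {r : ℝ≥0∞} (hr1 : 1 ≤ r) (hr2 : r ≤ 2) :
    ∃ C : ℝ≥0, ∀ V : Fields L2, eLpNorm (partAbs e V) (cj r) volume ≤
      C * partNorm e 0 r V.toDist := by
  simpa using! partAbs_le e hr1 hr2 0

end Part

theorem partNorm_all (N : ℕ) (r : ℝ≥0∞) (V : Fields Dist) :
    partNorm id N r V = nablaNormAll N r V := by
  simp only [partNorm, sum_comp, nablaNormAll, nablaNormRho, nablaNormVec, id, comps]
  ring

theorem partNorm_rho (N : ℕ) (r : ℝ≥0∞) (V : Fields Dist) :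
    partNorm ![.ρ .ion, .ρ .electron] N r V = nablaNormRho N r V := by
  simp [partNorm, nablaNormRho, comps]

theorem partNorm_B (N : ℕ) (r : ℝ≥0∞) (V : Fields Dist) :
    partNorm .B N r V = nablaNormVec N r V.B := rfl

theorem partNorm_rhoB (N : ℕ) (r : ℝ≥0∞) (V : Fields Dist) :
    partNorm (Sum.elim ![.ρ .ion, .ρ .electron] .B) N r V = nablaNormRhoB N r V := by
  simp [partNorm, nablaNormRhoB, nablaNormRho, nablaNormVec, comps]

/-- Convergence to a diffusive profile, and decay, of a component from pointwise bounds. -/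
theorem profile_le {ι : Type} [Fintype ι] (e : ι → Comp) {p q r : ℝ≥0∞} {ℓ c C₀ : ℝ} (hp1 : 1 ≤ p)
    (hp2 : p ≤ 2) (hr1 : 1 ≤ r) (hr2 : r ≤ 2) (hq : 2 ≤ q) (hℓ : 0 ≤ ℓ) (hc : 0 < c)
    (hC₀ : 0 ≤ C₀) (m b : ℕ) :
    ∃ C : ℝ≥0, ∀ (V : Fields L2) (t : ℝ), 0 ≤ t → ∀ T h, HasFT T h → ∀ T' h', HasFT T' h' →
      (∀ᵐ k, ‖h' k‖ ≤ C₀ * (freq k ^ b * Real.exp (-(c * freq k ^ 2 * t)) * partAbs e V k)) →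
      (∀ᵐ k, (freq k ≤ 1 → ‖h k - h' k‖ ≤ C₀ * ((freq k ^ (b + 1) *
          Real.exp (-(c * freq k ^ 2 * t)) + Real.exp (-(c * t))) * allAbs V k)) ∧
        (1 ≤ freq k → ‖h k‖ ≤ C₀ * (Real.exp (-(c * t / freq k ^ 2)) * allAbs V k))) →
      nablaNorm m q (T - T') ≤ C * (baseBound c m p q r ℓ (m + (b + 1)) V.toDist t +
        expDecay c t * partNorm e (m + b + plusIndex 0 r q) r V.toDist) ∧
      nablaNorm m q T ≤ C * (baseBound c m p q r ℓ (m + (b + 1)) V.toDist t +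
        expDecay c t * partNorm e (m + b + plusIndex 0 r q) r V.toDist +
        algDecay t (heatExp p q + ((m + b : ℕ) : ℝ) / 2) * partNorm e 0 p V.toDist) := by
  obtain ⟨C, hC⟩ := HasFT.frequency_le hp1 hp2 hr1 hr2 hq hℓ hc hC₀ m b
  obtain ⟨C1, h1⟩ := partAbs_le_zero id hp1 hp2
  obtain ⟨C2, h2⟩ := partAbs_le id hr1 hr2 (m + plusIndex ℓ r q)
  obtain ⟨C3, h3⟩ := partAbs_le e hr1 hr2 (m + b + plusIndex 0 r q)
  obtain ⟨C4, h4⟩ := partAbs_le_zero e hp1 hp2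
  set A : ℝ≥0 := C1 + C2 + C3 + C4 with hA
  refine ⟨C * A, fun V t ht T h hT T' h' hT' hpr hb => ?_⟩
  -- Outside the unit ball the profile itself is exponentially small in time. This produces the term
  -- in which the derivatives of only the profile data occur.
  have hexp : ∀ k, 1 ≤ freq k → Real.exp (-(c * freq k ^ 2 * t)) ≤ Real.exp (-(c * t)) := by
    intro k hk
    have := one_le_pow₀ (n := 2) hk
    have := mul_le_mul_of_nonneg_left this (mul_nonneg hc.le ht)
    exact Real.exp_le_exp.2 (neg_le_neg (by linarith))
  have hZ := aestronglyMeasurable_partAbs id V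
  have hW := aestronglyMeasurable_partAbs e V
  have hZ0 := partAbs_nonneg id V
  have hW0 := partAbs_nonneg e V
  -- For the difference the profile contributes nothing at low frequency, so the slot for the slow
  -- diffusive term is zero; for the solution itself that slot holds the profile data.
  have d1 := hC t ht _ _ (hT.sub hT') (partAbs id V) 0 (partAbs e V) hZ
    aestronglyMeasurable_zero hW hZ0 (fun _ => le_rfl) hW0 (by
      filter_upwards [hpr, hb] with k k1 k2
      refine ⟨fun hk => ?_, fun hk => ?_⟩
      · simpa using! k2.1 hk
      · have hf := freq_nonneg k
        calc ‖h k - h' k‖ ≤ ‖h k‖ + ‖h' k‖ := norm_sub_le _ _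
          _ ≤ C₀ * (Real.exp (-(c * t / freq k ^ 2)) * allAbs V k) +
            C₀ * (freq k ^ b * Real.exp (-(c * t)) * partAbs e V k) := by
              refine add_le_add (k2.2 hk) (k1.trans ?_)
              have := hW0 k
              gcongr C₀ * (_ * ?_ * _)
              exact hexp k hk
          _ = _ := by rw [mul_add]; rfl)
  have d2 := hC t ht _ _ hT (partAbs id V) (partAbs e V) (partAbs e V) hZ hW hW hZ0 hW0 hW0 (by
      filter_upwards [hpr, hb] with k k1 k2
      refine ⟨fun hk => ?_, fun hk => ?_⟩
      · calc ‖h k‖ = ‖(h k - h' k) + h' k‖ := by rw [sub_add_cancel]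
          _ ≤ ‖h k - h' k‖ + ‖h' k‖ := norm_add_le _ _
          _ ≤ _ := add_le_add (k2.1 hk) k1
          _ = _ := by rw [← mul_add]; rfl
      · have hf := freq_nonneg k
        have := hW0 k
        refine (k2.2 hk).trans ?_
        rw [mul_add]
        exact le_add_of_nonneg_right (by positivity))
  have hle : ∀ {x y : ℝ≥0∞} {Ci : ℝ≥0}, x ≤ Ci * y → Ci ≤ A → x ≤ A * y := fun h hC =>
    h.trans (mul_le_mul_left (ENNReal.coe_le_coe.2 hC) _)
  have k1 := hle (h1 V) (by rw [hA]; simp only [add_assoc]; exact le_self_add)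
  have k2 := hle (h2 V) (by
    rw [hA, add_comm C1]; simp only [add_assoc]; exact le_self_add)
  have k3 := hle (h3 V) (by
    rw [hA, add_comm (C1 + C2)]; simp only [add_assoc]; exact le_self_add)
  have k4 := hle (h4 V) (by rw [hA]; exact le_add_self)
  rw [partNorm_all] at k1 k2
  constructor
  · refine d1.trans ?_
    rw [eLpNorm_zero, mul_zero, add_zero, ENNReal.coe_mul, mul_assoc (C : ℝ≥0∞)]
    gcongr
    calc _ ≤ algDecay t (heatExp p q + ((m + (b + 1) : ℕ) : ℝ) / 2) *
          (A * nablaNormAll 0 p V.toDist) + expDecay c t * (A * nablaNormAll 0 p V.toDist) +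
          algDecay t (ℓ / 2) * (A * nablaNormAll (m + plusIndex ℓ r q) r V.toDist) +
          expDecay c t * (A * partNorm e (m + b + plusIndex 0 r q) r V.toDist) := by gcongr
      _ = _ := by rw [baseBound]; ring
  · refine d2.trans ?_
    rw [ENNReal.coe_mul, mul_assoc (C : ℝ≥0∞)]
    gcongr
    calc _ ≤ algDecay t (heatExp p q + ((m + (b + 1) : ℕ) : ℝ) / 2) *
          (A * nablaNormAll 0 p V.toDist) + expDecay c t * (A * nablaNormAll 0 p V.toDist) +
          algDecay t (ℓ / 2) * (A * nablaNormAll (m + plusIndex ℓ r q) r V.toDist) +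
          expDecay c t * (A * partNorm e (m + b + plusIndex 0 r q) r V.toDist) +
          algDecay t (heatExp p q + ((m + b : ℕ) : ℝ) / 2) * (A * partNorm e 0 p V.toDist) := by
            gcongr
      _ = _ := by rw [baseBound]; ring

end EulerMaxwell

end

/-! ### Pointwise bounds of the profiles -/

section

open MeasureTheory SchwartzMap LineDeriv
open scoped ENNReal NNReal

namespace EulerMaxwell

variable (P : Plasma)

theorem norm_heat_symbol_le {c μ : ℝ} (h : c ≤ μ) {t : ℝ} (ht : 0 ≤ t) (k : Space) :
    ‖((Real.exp (-(μ * (2 * Real.pi * ‖k‖) ^ 2 * t)) : ℝ) : ℂ)‖ ≤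
      Real.exp (-(c * freq k ^ 2 * t)) := by
  rw [Complex.norm_real, Real.norm_of_nonneg (Real.exp_nonneg _), freq]
  gcongr

theorem norm_rhoBarFT_le {c : ℝ} (h : c ≤ P.μ₁) (V : Fields L2) {t : ℝ} (ht : 0 ≤ t) (k : Space) :
    ‖rhoBarFT P V t k‖ ≤ Real.exp (-(c * freq k ^ 2 * t)) *
      partAbs ![.ρ .ion, .ρ .electron] V k := by
  have hi := P.f_pos .ion
  have he := P.f_pos .electron
  have hF := P.F_pos
  have h1 : ∀ a, ‖((P.f a / P.F : ℝ) : ℂ)‖ ≤ 1 := by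
    intro a
    have := P.f_pos a
    rw [Complex.norm_real, Real.norm_of_nonneg (by positivity), div_le_one hF, Plasma.F]
    cases a <;> linarith
  rw [rhoBarFT, norm_mul]
  have h2 : partAbs ![.ρ .ion, .ρ .electron] V k =
      ‖hats V (.ρ .ion) k‖ + ‖hats V (.ρ .electron) k‖ := by simp [partAbs]
  rw [h2]
  refine mul_le_mul (norm_heat_symbol_le h ht k) ((norm_add_le _ _).trans ?_) (norm_nonneg _)
    (Real.exp_nonneg _)
  rw [norm_mul, norm_mul]
  exact add_le_add (mul_le_of_le_one_left (norm_nonneg _) (h1 _))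
    (mul_le_of_le_one_left (norm_nonneg _) (h1 _))

theorem norm_BBarFT_le {c : ℝ} (h : c ≤ P.μ₂) (V : Fields L2) {t : ℝ} (ht : 0 ≤ t) (j : Fin 3)
    (k : Space) : ‖BBarFT P V t j k‖ ≤ Real.exp (-(c * freq k ^ 2 * t)) * partAbs .B V k := by
  rw [BBarFT, norm_mul]
  refine mul_le_mul (norm_heat_symbol_le h ht k) ?_ (norm_nonneg _) (Real.exp_nonneg _)
  exact Finset.single_le_sum (f := fun j => ‖hats V (.B j) k‖) (fun _ _ => norm_nonneg _)
    (Finset.mem_univ j)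

theorem partAbs_sumElim {ι κ : Type} [Fintype ι] [Fintype κ] (e : ι → Comp) (f : κ → Comp)
    (V : Fields L2) (k : Space) : partAbs (Sum.elim e f) V k = partAbs e V k + partAbs f V k := by
  simp [partAbs]

theorem norm_gradCurlFT_le {c : ℝ} (h₁ : c ≤ P.μ₁) (h₂ : c ≤ P.μ₂) (a b : ℝ) (V : Fields L2)
    {t : ℝ} (ht : 0 ≤ t) (j : Fin 3) (k : Space) :
    ‖gradCurlFT P a b V t j k‖ ≤ (|a| + 2 * |b|) * (freq k ^ 1 * Real.exp (-(c * freq k ^ 2 * t)) *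
      partAbs (Sum.elim ![.ρ .ion, .ρ .electron] .B) V k) := by
  have hf := freq_nonneg k
  set x := Real.exp (-(c * freq k ^ 2 * t))
  have hx : 0 ≤ x := Real.exp_nonneg _
  rw [partAbs_sumElim, gradCurlFT]
  have h1 := norm_rhoBarFT_le P h₁ V ht k
  have h2 := norm_BBarFT_le P h₂ V ht (j + 1) k
  have h3 := norm_BBarFT_le P h₂ V ht (j + 2) k
  have p1 := partAbs_nonneg ![.ρ .ion, .ρ .electron] V k
  have p2 := partAbs_nonneg .B V k
  set R := partAbs ![.ρ .ion, .ρ .electron] V k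
  set M := partAbs .B V k
  have hsub : ‖ik (j + 1) k * BBarFT P V t (j + 2) k - ik (j + 2) k * BBarFT P V t (j + 1) k‖ ≤
      freq k * (x * M) + freq k * (x * M) := by
    refine (norm_sub_le _ _).trans ?_
    rw [norm_mul, norm_mul]
    gcongr
    · exact norm_ik_le _ _
    · exact norm_ik_le _ _
  have hg : ‖ik j k * rhoBarFT P V t k‖ ≤ freq k * (x * R) := by
    rw [norm_mul]
    gcongr
    exact norm_ik_le _ _
  refine (norm_add_le _ _).trans ?_
  rw [norm_mul (a : ℂ), norm_mul (b : ℂ), Complex.norm_real, Complex.norm_real, Real.norm_eq_abs,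
    Real.norm_eq_abs]
  calc |a| * _ + |b| * _ ≤ |a| * (freq k * (x * R)) + |b| * (freq k * (x * M) + freq k * (x * M)) := by
        gcongr
    _ ≤ |a| * (freq k * (x * R)) + |b| * (freq k * (x * M) + freq k * (x * M)) +
        (|a| * (freq k * (x * M)) + 2 * |b| * (freq k * (x * R))) :=
        le_add_of_nonneg_right (by positivity)
    _ = _ := by ring

end EulerMaxwell

end

/-! ### Convergence to the profile and decay -/

section

open MeasureTheory SchwartzMap LineDeriv
open scoped ENNReal NNReal

namespace EulerMaxwell

/-- Convergence of the solutions to the diffusive profile, and decay of the solutions. -/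
theorem convergence_and_decay (P : Plasma) :
    ∃ lam : ℝ, 0 < lam ∧
      ∀ (m : ℕ) (p q r : ℝ≥0∞) (ℓ : ℝ),
        1 ≤ p → p ≤ 2 → 1 ≤ r → r ≤ 2 → 2 ≤ q → 0 ≤ ℓ →
        (∃ C : ℝ≥0, ∀ (U₀ : Fields L2) (U : ℝ → Fields L2), IsSolution P U₀ U →
          ∀ t : ℝ, 0 ≤ t →
          (∀ a : Species,
            nablaNorm m q ((U t).toDist.ρ a - rhoBar P U₀.toDist t)
              ≤ C * (baseBound lam m p q r ℓ (m + 1) U₀.toDist t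
                + expDecay lam t * nablaNormRho (m + plusIndex 0 r q) r U₀.toDist)) ∧
          (∀ a : Species,
            nablaNormVec m q ((U t).toDist.u a - uBar P U₀.toDist a t)
              ≤ C * (baseBound lam m p q r ℓ (m + 2) U₀.toDist t
                + expDecay lam t * nablaNormRhoB (m + 1 + plusIndex 0 r q) r U₀.toDist)) ∧
          (nablaNormVec m q ((U t).toDist.E - EBar P U₀.toDist t)
              ≤ C * (baseBound lam m p q r ℓ (m + 2) U₀.toDist t
                + expDecay lam t * nablaNormRhoB (m + 1 + plusIndex 0 r q) r U₀.toDist)) ∧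
          (nablaNormVec m q ((U t).toDist.B - BBar P U₀.toDist t)
              ≤ C * (baseBound lam m p q r ℓ (m + 1) U₀.toDist t
                + expDecay lam t * nablaNormVec (m + plusIndex 0 r q) r U₀.toDist.B)) ∧
          (∀ a : Species,
            nablaNorm m q ((U t).toDist.ρ a)
              ≤ C * (baseBound lam m p q r ℓ (m + 1) U₀.toDist t
                + expDecay lam t * nablaNormRho (m + plusIndex 0 r q) r U₀.toDist
                + algDecay t (heatExp p q + m / 2) * nablaNormRho 0 p U₀.toDist)) ∧
          (∀ a : Species,
            nablaNormVec m q ((U t).toDist.u a)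
              ≤ C * (baseBound lam m p q r ℓ (m + 2) U₀.toDist t
                + expDecay lam t * nablaNormRhoB (m + 1 + plusIndex 0 r q) r U₀.toDist
                + algDecay t (heatExp p q + (m + 1) / 2) * nablaNormRhoB 0 p U₀.toDist)) ∧
          (nablaNormVec m q (U t).toDist.E
              ≤ C * (baseBound lam m p q r ℓ (m + 2) U₀.toDist t
                + expDecay lam t * nablaNormRhoB (m + 1 + plusIndex 0 r q) r U₀.toDist
                + algDecay t (heatExp p q + (m + 1) / 2) * nablaNormRhoB 0 p U₀.toDist)) ∧
          (nablaNormVec m q (U t).toDist.B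
              ≤ C * (baseBound lam m p q r ℓ (m + 1) U₀.toDist t
                + expDecay lam t * nablaNormVec (m + plusIndex 0 r q) r U₀.toDist.B
                + algDecay t (heatExp p q + m / 2) * nablaNormVec 0 p U₀.toDist.B))) := by
  obtain ⟨c, C₁, hc, hC₁, hμ₁, hμ₂, hpt⟩ := IsSolution.pointwise P
  refine ⟨c, hc, fun m p q r ℓ hp1 hp2 hr1 hr2 hq hℓ => ?_⟩
  set D : ℝ → ℝ → ℝ := fun a b => |a| + 2 * |b| with hD
  have hD0 : ∀ a b, 0 ≤ D a b := fun a b => by positivity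
  set C₀ : ℝ := C₁ + 1 + D (-P.μ₁) (P.κ .ion) + D (-P.μ₁) (P.κ .electron) + D P.γ₁ P.γ₂ with hC₀
  have d1 := hD0 (-P.μ₁) (P.κ .ion)
  have d2 := hD0 (-P.μ₁) (P.κ .electron)
  have d3 := hD0 P.γ₁ P.γ₂
  have hC₀0 : 0 ≤ C₀ := by linarith
  have hC₁₀ : C₁ ≤ C₀ := by linarith
  have h1C₀ : 1 ≤ C₀ := by linarith
  have huC₀ : ∀ a, D (-P.μ₁) (P.κ a) ≤ C₀ := fun a => by cases a <;> linarith
  have hEC₀ : D P.γ₁ P.γ₂ ≤ C₀ := by linarith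
  -- The last argument is the order of the profile in the frequency: zero for densities and magnetic
  -- field, one for velocities and electric field, whose profiles are first derivatives.
  obtain ⟨K₁, h₁⟩ := profile_le ![.ρ .ion, .ρ .electron] hp1 hp2 hr1 hr2 hq hℓ hc hC₀0 m 0
  obtain ⟨K₂, h₂⟩ := profile_le .B hp1 hp2 hr1 hr2 hq hℓ hc hC₀0 m 0
  obtain ⟨K₃, h₃⟩ := profile_le (Sum.elim ![.ρ .ion, .ρ .electron] .B) hp1 hp2 hr1 hr2 hq hℓ hc
    hC₀0 m 1
  simp only [partNorm_rho] at h₁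
  simp only [partNorm_B] at h₂
  simp only [partNorm_rhoB] at h₃
  -- The factors three come from summing over the components of a vector field.
  set K : ℝ≥0 := K₁ + 3 * K₂ + 3 * K₃ with hK
  refine ⟨K, fun U₀ U hU t ht => ?_⟩
  have hU := hpt U₀ U hU t ht
  have hT := hasFT_comps (U t)
  have hZ : ∀ k, 0 ≤ allAbs U₀ k := fun k => Finset.sum_nonneg fun _ _ => norm_nonneg _
  have hhigh : ∀ b, ∀ᵐ k, 1 ≤ freq k → ‖hats (U t) b k‖ ≤
      C₀ * (Real.exp (-(c * t / freq k ^ 2)) * allAbs U₀ k) := fun b => by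
    filter_upwards [hU] with k hk h1
    have := hZ k
    exact (hk.2 h1 b).trans (by gcongr)
  have weak : ∀ {x C D e1 e2 Z : ℝ}, x ≤ C * e1 * Z → C ≤ D → 0 ≤ Z → 0 ≤ D → 0 ≤ e1 → e1 ≤ e2 →
      x ≤ D * (e2 * Z) := fun hx hCD hZ hD he1 he => by
    refine hx.trans ?_
    rw [← mul_assoc]
    gcongr
  have low0 : ∀ k : Space, freq k * Real.exp (-(c * freq k ^ 2 * t)) ≤ freq k ^ (0 + 1) *
      Real.exp (-(c * freq k ^ 2 * t)) + Real.exp (-(c * t)) := fun k => by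
    rw [zero_add, pow_one]
    exact le_add_of_nonneg_right (Real.exp_nonneg _)
  have nn := freq_nonneg
  have eρ : ∀ a, _ ∧ _ := fun a => h₁ U₀ t ht _ _ (hT (.ρ a)) _ _ (hasFT_rhoBar U₀ ht)
    (.of_forall fun k => by
      have := partAbs_nonneg ![.ρ .ion, .ρ .electron] U₀ k
      have := norm_rhoBarFT_le P hμ₁ U₀ ht k
      rw [pow_zero, one_mul]
      exact this.trans (le_mul_of_one_le_left (by positivity) h1C₀)) (by
      filter_upwards [hU, hhigh (.ρ a)] with k k1 k2
      exact ⟨fun h => weak ((k1.1 h).1 a) hC₁₀ (hZ k) hC₀0 (by have := nn k; positivity) (low0 k),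
        k2⟩)
  have eB : ∀ j, _ ∧ _ := fun j => h₂ U₀ t ht _ _ (hT (.B j)) _ _ (hasFT_BBar U₀ ht j)
    (.of_forall fun k => by
      have := partAbs_nonneg .B U₀ k
      have := norm_BBarFT_le P hμ₂ U₀ ht j k
      rw [pow_zero, one_mul]
      exact this.trans (le_mul_of_one_le_left (by positivity) h1C₀)) (by
      filter_upwards [hU, hhigh (.B j)] with k k1 k2
      exact ⟨fun h => weak ((k1.1 h).2.2.2 j) hC₁₀ (hZ k) hC₀0 (by have := nn k; positivity)
        (low0 k), k2⟩)
  have gc : ∀ (a b : ℝ) (j : Fin 3), D a b ≤ C₀ → ∀ᵐ k, ‖gradCurlFT P a b U₀ t j k‖ ≤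
      C₀ * (freq k ^ 1 * Real.exp (-(c * freq k ^ 2 * t)) *
        partAbs (Sum.elim ![.ρ .ion, .ρ .electron] .B) U₀ k) := fun a b j h =>
    .of_forall fun k => by
      have := partAbs_nonneg (Sum.elim ![.ρ .ion, .ρ .electron] .B) U₀ k
      have := nn k
      exact (norm_gradCurlFT_le P hμ₁ hμ₂ a b U₀ ht j k).trans (by gcongr)
  have eu : ∀ a j, _ ∧ _ := fun a j => h₃ U₀ t ht _ _ (hT (.u a j)) _ _ (hasFT_uBar U₀ ht a j)
    (gc _ _ j (huC₀ a)) (by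
      filter_upwards [hU, hhigh (.u a j)] with k k1 k2
      exact ⟨fun h => weak ((k1.1 h).2.1 a j) hC₁₀ (hZ k) hC₀0 (by have := nn k; positivity) le_rfl,
        k2⟩)
  have eE : ∀ j, _ ∧ _ := fun j => h₃ U₀ t ht _ _ (hT (.E j)) _ _ (hasFT_EBar U₀ ht j)
    (gc _ _ j hEC₀) (by
      filter_upwards [hU, hhigh (.E j)] with k k1 k2
      exact ⟨fun h => weak ((k1.1 h).2.2.1 j) hC₁₀ (hZ k) hC₀0 (by have := nn k; positivity) le_rfl,
        k2⟩)
  have hle₁ : ∀ {x y : ℝ≥0∞}, x ≤ K₁ * y → x ≤ K * y := fun h =>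
    h.trans (mul_le_mul_left (ENNReal.coe_le_coe.2 (by rw [hK, add_assoc]; exact le_self_add)) _)
  have hle₂ : ∀ {x : Fin 3 → ℝ≥0∞} {y : ℝ≥0∞}, (∀ j, x j ≤ K₂ * y) → ∑ j, x j ≤ K * y := fun h => by
    refine (Finset.sum_le_sum fun j _ => h j).trans ?_
    rw [Finset.sum_const, Finset.card_univ, Fintype.card_fin, nsmul_eq_mul, ← mul_assoc]
    refine mul_le_mul_left ?_ _
    have : (3 * K₂ : ℝ≥0) ≤ K := by rw [hK, add_comm K₁, add_assoc]; exact le_self_add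
    exact_mod_cast this
  have hle₃ : ∀ {x : Fin 3 → ℝ≥0∞} {y : ℝ≥0∞}, (∀ j, x j ≤ K₃ * y) → ∑ j, x j ≤ K * y := fun h => by
    refine (Finset.sum_le_sum fun j _ => h j).trans ?_
    rw [Finset.sum_const, Finset.card_univ, Fintype.card_fin, nsmul_eq_mul, ← mul_assoc]
    refine mul_le_mul_left ?_ _
    have : (3 * K₃ : ℝ≥0) ≤ K := by rw [hK]; exact le_add_self
    exact_mod_cast this
  have hm1 : ((m + 1 : ℕ) : ℝ) = (m : ℝ) + 1 := by push_cast; rfl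
  refine ⟨fun a => hle₁ (eρ a).1, fun a => hle₃ fun j => (eu a j).1, hle₃ fun j => (eE j).1,
    hle₂ fun j => (eB j).1, fun a => hle₁ (eρ a).2, fun a => hle₃ fun j => ?_, hle₃ fun j => ?_,
    hle₂ fun j => (eB j).2⟩
  · rw [← hm1]; exact (eu a j).2
  · rw [← hm1]; exact (eE j).2

end EulerMaxwell

end

/-! ### Real fields from Hermitian transforms -/

section

open MeasureTheory SchwartzMap LineDeriv
open scoped ENNReal NNReal BoundedContinuousFunction ComplexConjugate

namespace EulerMaxwell

theorem exp_smul_mul_comm {R : Type*} [NormedRing R] [NormedAlgebra ℂ R] [CompleteSpace R] (a : R)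
    (τ : ℂ) : NormedSpace.exp (τ • a) * a = a * NormedSpace.exp (τ • a) :=
  (hasDerivAt_exp_smul_const a τ).unique (hasDerivAt_exp_smul_const' a τ)

theorem exp_smul_apply_comm {ι : Type} [Fintype ι] (A : (ι → ℂ) →L[ℂ] (ι → ℂ)) (τ : ℂ) (v : ι → ℂ) :
    NormedSpace.exp (τ • A) (A v) = A (NormedSpace.exp (τ • A) v) :=
  congrArg (fun B : (ι → ℂ) →L[ℂ] (ι → ℂ) => B v)
    (exp_smul_mul_comm (R := (ι → ℂ) →L[ℂ] (ι → ℂ)) A τ)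

/-- Real parts of inverse Fourier transforms. -/
noncomputable def realField (W : CL2) : L2 :=
  Complex.reCLM.compLp (FourierTransformInv.fourierInv W : CL2)

theorem continuous_realField : Continuous realField := by
  have h1 : Continuous fun f : CL2 => (Complex.reCLM.compLp f : L2) :=
    (Complex.reCLM.compLpL 2 (volume : Measure Space)).continuous
  have h2 : Continuous fun f : CL2 => (FourierTransformInv.fourierInv f : CL2) :=
    (Lp.fourierTransformₗᵢ Space ℂ).symm.continuous
  exact h1.comp h2

theorem conj_fourierInv {g : Space → ℂ} (hg : ∀ k, g (-k) = conj (g k)) (x : Space) :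
    conj (FourierTransformInv.fourierInv g x) = FourierTransformInv.fourierInv g x := by
  rw [Real.fourierInv_eq', ← integral_conj, ← integral_neg_eq_self]
  refine integral_congr_ae (.of_forall fun k => ?_)
  simp only [smul_eq_mul, map_mul, hg, Complex.conj_conj, ← Complex.exp_conj, inner_neg_left]
  congr 2
  simp only [Complex.conj_ofReal, Complex.conj_I]
  push_cast
  ring

/-- Hermitian symmetry makes the inverse transform real valued, so taking the real part loses
nothing. -/
theorem hasFT_realField {W : CL2} {g : 𝓢(Space, ℂ)} (hW : W =ᵐ[volume] g)
    (hg : ∀ k, g (-k) = conj (g k)) : HasFT (toDist (realField W)) g := by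
  have hW' : W = g.toLp 2 volume := Lp.ext (hW.trans (g.coeFn_toLp 2 volume).symm)
  have h1 : (FourierTransformInv.fourierInv W : CL2) =
      (FourierTransformInv.fourierInv g : 𝓢(Space, ℂ)).toLp 2 volume := by
    rw [hW', SchwartzMap.toLp_fourierInv_eq]
  have h2 : (Complex.ofRealCLM.compLp (realField W) : CL2) = FourierTransformInv.fourierInv W := by
    refine Lp.ext ?_
    rw [realField]
    filter_upwards [Complex.ofRealCLM.coeFn_compLp (Complex.reCLM.compLp
      (FourierTransformInv.fourierInv W : CL2)), Complex.reCLM.coeFn_compLp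
      (FourierTransformInv.fourierInv W : CL2),
      (FourierTransformInv.fourierInv g : 𝓢(Space, ℂ)).coeFn_toLp 2 volume] with x k1 k2 k3
    rw [k1, k2, h1, k3]
    refine Complex.conj_eq_iff_re.1 ?_
    rw [SchwartzMap.fourierInv_coe]
    exact conj_fourierInv hg x
  have h3 : hat (realField W) = W := by
    rw [hat, h2]
    exact FourierTransform.fourier_fourierInv_eq W
  have := hasFT_toDist (realField W)
  rw [h3] at this
  exact this.congr hW

end EulerMaxwell

end

/-! ### Existence of solutions with smooth compactly supported transforms -/

section

open MeasureTheory SchwartzMap LineDeriv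
open scoped ENNReal NNReal BoundedContinuousFunction ComplexConjugate

namespace EulerMaxwell

variable {P : Plasma}

theorem ik_neg (j : Fin 3) (k : Space) : ik j (-k) = conj (ik j k) := by
  rw [ik_eq, ik_eq, map_mul, Complex.conj_I, Complex.conj_ofReal, PiLp.neg_apply]
  push_cast
  ring

theorem symbolFun_conj (k : Space) (y : Comp → ℂ) (b : Comp) :
    symbolFun P (-k) (fun d => conj (y d)) b = conj (symbolFun P k y b) := by
  rcases b with a | ⟨a, j⟩ | j | j <;>
    simp only [symbolFun, ik_neg, map_neg, map_sum, map_mul, map_sub, map_add, Complex.conj_ofReal]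

/-- Evolved Hermitian data are Hermitian. -/
theorem exp_symbol_conj (k : Space) (v : Comp → ℂ) (t : ℝ) :
    NormedSpace.exp ((t : ℂ) • symbol P (-k)) (fun d => conj (v d)) =
      fun d => conj (NormedSpace.exp ((t : ℂ) • symbol P k) v d) := by
  have h1 := hasDerivAt_exp_smul_apply (symbol P (-k)) (fun d => conj (v d))
  have h2 : ∀ t : ℝ, HasDerivAt (fun (t : ℝ) d => conj (NormedSpace.exp ((t : ℂ) • symbol P k) v d))
      (symbol P (-k) (fun d => conj (NormedSpace.exp ((t : ℂ) • symbol P k) v d))) t := by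
    intro t
    rw [hasDerivAt_pi]
    intro b
    have := hasDerivAt_pi.1 (hasDerivAt_exp_smul_apply (symbol P k) v t) b
    have h3 := (Complex.conjCLE : ℂ →L[ℝ] ℂ).hasFDerivAt.comp_hasDerivAt t this
    convert! h3 using 1
    exact symbolFun_conj _ _ _
  -- Both sides solve the same linear ODE, since conjugation turns the symbol at `k` into the symbol
  -- at `-k`.
  refine congrFun (ODE_solution_unique_univ (v := fun _ y => symbol P (-k) y)
    (s := fun _ => Set.univ) (K := ‖symbol P (-k)‖₊) (t₀ := 0) ?_ (fun t => ⟨h1 t, trivial⟩)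
    (fun t => ⟨h2 t, trivial⟩) ?_) t
  · exact fun t => (symbol P (-k)).lipschitz.lipschitzOnWith
  · simp only [exp_zero_smul_clm]
    rfl

/-- The tuple of fields with given components. -/
def fieldsOf {X : Type} (f : Comp → X) : Fields X where
  ρ a := f (.ρ a)
  u a j := f (.u a j)
  E j := f (.E j)
  B j := f (.B j)

theorem comps_fieldsOf (f : Comp → L2) (b : Comp) : comps (fieldsOf f).toDist b = toDist (f b) := by
  cases b <;> rfl

/-- A time dependent distribution is differentiable if its Fourier transform is. -/
theorem hasTimeDeriv_of_hasFT {T T' : ℝ → Dist} {h h' : ℝ → Space → ℂ}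
    (hT : ∀ t, 0 ≤ t → HasFT (T t) (h t)) (hT' : ∀ t, 0 ≤ t → HasFT (T' t) (h' t))
    (hd : ∀ (φ : 𝓢(Space, ℂ)) t, 0 ≤ t →
      HasDerivAt (fun s => ∫ k, φ k * h s k) (∫ k, φ k * h' t k) t) : HasTimeDeriv T T' := by
  intro ψ t ht
  have e : ψ = FourierTransform.fourier (FourierTransformInv.fourierInv ψ) :=
    (FourierTransform.fourier_fourierInv_eq ψ).symm
  rw [e, (hT' t ht).apply_fourier]
  exact (hd _ t ht).hasDerivWithinAt.congr (fun s hs => (hT s hs).apply_fourier _)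
    ((hT t ht).apply_fourier _)

theorem coeFn_sum_Lp {ι : Type*} (s : Finset ι) (f : ι → CL2) :
    (↑↑(∑ i ∈ s, f i) : Space → ℂ) =ᵐ[volume] fun k => ∑ i ∈ s, f i k := by
  classical
  induction s using Finset.induction_on with
  | empty =>
    simp only [Finset.sum_empty]
    exact Lp.coeFn_zero _ _ _
  | insert a s ha ih =>
    simp only [Finset.sum_insert ha]
    filter_upwards [Lp.coeFn_add (f a) (∑ i ∈ s, f i), ih] with k k1 k2
    rw [k1, Pi.add_apply, k2]

/-- The evolution of smooth and compactly supported data in frequency space. -/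
theorem exists_evolution (P : Plasma) {w : Comp → Space → ℂ} (hw : ∀ b, ContDiff ℝ (⊤ : ℕ∞) (w b))
    (hwc : ∀ b, HasCompactSupport (w b)) :
    ∃ (W : ℝ → Comp → CL2) (G : ℝ → Comp → 𝓢(Space, ℂ)),
      (∀ t b k, G t b k = NormedSpace.exp ((t : ℂ) • symbol P k) (fun d => w d k) b) ∧
      (∀ t b, W t b =ᵐ[volume] G t b) ∧ (∀ b, Continuous fun t => W t b) ∧
      ∀ b (φ : 𝓢(Space, ℂ)) t, HasDerivAt (fun s => ∫ k, φ k * G s b k)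
        (∫ k, φ k * symbolFun P k (fun d => G t d k) b) t := by
  classical
  have hs : IsCompact (⋃ b, tsupport (w b)) := isCompact_iUnion fun b => (hwc b).isCompact
  obtain ⟨A₁, M, N, h1, hM, hN, hMN, hMs⟩ := exists_cutoff_exp (contDiff_symbol P) hs
  choose φ hφ using fun b => exists_schwartz (hw b) (hwc b)
  set x : Comp → CL2 := fun b => (φ b).toLp 2 volume with hx
  have hxae : ∀ᵐ k, ∀ b, x b k = w b k := by
    refine ae_all_iff.2 fun b => ?_
    filter_upwards [(φ b).coeFn_toLp 2 volume] with k hk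
    rw [hx, hk, hφ]
  set act : (Space →ᵇ ((Comp → ℂ) →L[ℂ] (Comp → ℂ))) → Comp → CL2 :=
    fun K b => ∑ d, bcfMul (entry b d K) (x d) with hact
  have hactae : ∀ K b, ∀ᵐ k, act K b k = K k (fun d => w d k) b := by
    intro K b
    have h := coeFn_sum_Lp Finset.univ fun d => bcfMul (entry b d K) (x d)
    filter_upwards [h, hxae, ae_all_iff.2 fun d => coeFn_bcfMul (entry b d K) (x d)] with k k1 k2 k3
    rw [hact, k1, ← sum_entry]
    exact Finset.sum_congr rfl fun d _ => by rw [k3, k2, entry_apply]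
  set g : ℝ → Comp → Space → ℂ :=
    fun t b k => NormedSpace.exp ((t : ℂ) • symbol P k) (fun d => w d k) b with hg
  -- The cut-off is invisible: where it alters the symbol, all data vanish.
  have hcut : ∀ (f : ((Comp → ℂ) →L[ℂ] (Comp → ℂ)) → (Comp → ℂ) →L[ℂ] (Comp → ℂ)) k,
      f (A₁ k) (fun d => w d k) = f (symbol P k) (fun d => w d k) := by
    intro f k
    by_cases hk : ∃ b, w b k ≠ 0
    · obtain ⟨b, hb⟩ := hk
      rw [h1 k (Set.mem_iUnion.2 ⟨b, subset_tsupport _ hb⟩)]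
    · push Not at hk
      have : (fun d => w d k) = 0 := funext hk
      rw [this, map_zero, map_zero]
  have hgM : ∀ t b k, M t k (fun d => w d k) b = g t b k := fun t b k => by
    rw [hM, hcut fun A => NormedSpace.exp ((t : ℂ) • A)]
  have hgN : ∀ t b k, N t k (fun d => w d k) b = symbolFun P k (fun d => g t d k) b := by
    intro t b k
    rw [hN, hcut fun A => NormedSpace.exp ((t : ℂ) • A) * A]
    exact congrFun (exp_smul_apply_comm (symbol P k) (t : ℂ) (fun d => w d k)) b
  have hgs : ∀ t b, ∃ G : 𝓢(Space, ℂ), ∀ k, G k = g t b k := by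
    intro t b
    have hsum : g t b = fun k => ∑ d, M t k (Pi.single d 1) b * w d k := by
      ext k
      rw [← hgM, ← sum_entry]
    refine exists_schwartz ?_ ?_
    · rw [hsum]
      exact ContDiff.sum fun d _ => (contDiff_entry (hMs t) b d).mul (hw d)
    · rw [hsum]
      refine HasCompactSupport.intro hs fun k hk => Finset.sum_eq_zero fun d _ => ?_
      rw [image_eq_zero_of_notMem_tsupport fun h => hk (Set.mem_iUnion.2 ⟨d, h⟩), mul_zero]
  choose G hG using hgs
  have hWae : ∀ t b, act (M t) b =ᵐ[volume] g t b := fun t b => by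
    filter_upwards [hactae (M t) b] with k hk
    rw [hk, hgM]
  have hW'ae : ∀ t b, act (N t) b =ᵐ[volume] fun k => symbolFun P k (fun d => g t d k) b :=
    fun t b => by
      filter_upwards [hactae (N t) b] with k hk
      rw [hk, hgN]
  have hWd : ∀ t b, HasDerivAt (fun t => act (M t) b) (act (N t) b) t := by
    intro t b
    refine HasDerivAt.fun_sum fun d _ => ?_
    let L : (Space →ᵇ ((Comp → ℂ) →L[ℂ] (Comp → ℂ))) →L[ℂ] CL2 :=
      (bcfMul.flip (x d)).comp (entry b d)
    exact (L.restrictScalars ℝ).hasFDerivAt.comp_hasDerivAt t (hMN t)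
  refine ⟨fun t => act (M t), G, hG, fun t b => ?_, fun b => ?_, ?_⟩
  · filter_upwards [hWae t b] with k hk
    rw [hk, hG]
  · exact continuous_iff_continuousAt.2 fun t => (hWd t b).continuousAt
  simp only [hG]
  have hweak : ∀ b (φ : 𝓢(Space, ℂ)) t, HasDerivAt (fun s => ∫ k, φ k * g s b k)
      (∫ k, φ k * symbolFun P k (fun d => g t d k) b) t := by
    intro b φ t
    have h := ((schwartzPairing φ).restrictScalars ℝ).hasFDerivAt.comp_hasDerivAt t (hWd t b)
    convert! h using 1
    · ext s
      change _ = schwartzPairing φ _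
      rw [schwartzPairing_apply]
      refine integral_congr_ae ?_
      filter_upwards [hWae s b] with k hk
      rw [hk]
    · change _ = schwartzPairing φ _
      rw [schwartzPairing_apply]
      refine integral_congr_ae ?_
      filter_upwards [hW'ae t b] with k hk
      rw [hk]
  exact hweak

/-- Existence of solutions for data with smooth and compactly supported Fourier transforms. -/
theorem exists_isSolution {w : Comp → Space → ℂ} (hw : ∀ b, ContDiff ℝ (⊤ : ℕ∞) (w b))
    (hwc : ∀ b, HasCompactSupport (w b)) (hwh : ∀ b k, w b (-k) = conj (w b k))
    (hE : ∀ k, ∑ j, ik j k * w (.E j) k = ((4 * Real.pi * P.e : ℝ) : ℂ) *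
      (w (.ρ .ion) k - w (.ρ .electron) k))
    (hB : ∀ k, ∑ j, ik j k * w (.B j) k = 0) :
    ∃ U₀ U, IsSolution P U₀ U ∧ ∀ b, HasFT (comps U₀.toDist b) (w b) := by
  obtain ⟨W, G, hG, hWae, hWc, hweak⟩ := exists_evolution P hw hwc
  have hgh : ∀ t b k, G t b (-k) = conj (G t b k) := by
    intro t b k
    have := congrFun (exp_symbol_conj (P := P) k (fun d => w d k) t) b
    simp only [hG, hwh]
    exact this
  set U : ℝ → Fields L2 := fun t => fieldsOf fun b => realField (W t b) with hU
  have hft : ∀ t b, HasFT (comps (U t).toDist b) (G t b) := by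
    intro t b
    rw [hU, comps_fieldsOf]
    exact hasFT_realField (hWae t b) (hgh t b)
  have hg0 : ∀ b, ⇑(G 0 b) = w b := fun b => by
    ext k
    rw [hG, exp_zero_smul_clm]
    rfl
  have hcont : ∀ b, Continuous fun t => realField (W t b) := fun b =>
    continuous_realField.comp (hWc b)
  refine ⟨U 0, U, ?_, fun b => hg0 b ▸ hft 0 b⟩
  refine ⟨fun a => (hcont (.ρ a)).continuousOn, fun a j => (hcont (.u a j)).continuousOn,
    fun j => (hcont (.E j)).continuousOn, fun j => (hcont (.B j)).continuousOn, rfl,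
    fun t _ => ?_, fun a => ?_, fun a j => ?_, fun j => ?_, fun j => ?_⟩
  · have hGd : ∀ k t, HasDerivAt (fun t b => G t b k) (symbolFun P k fun b => G t b k) t := by
      intro k t
      simp only [hG]
      exact hasDerivAt_exp_smul_apply (symbol P k) (fun d => w d k) t
    have ho : ∀ k, Orbit P (symbols k) _ _ _ _ := fun k =>
      orbit_of_symbol (y := fun t b => G t b k) (hGd k)
      (by simp only [hg0]; exact hE k) (by simp only [hg0]; exact hB k)
    constructor
    · refine (HasFT.div fun j => hft t (.E j)).dist_eq ?_
      refine ((((hft t (.ρ .ion)).rsmul (P.q .ion)).add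
        ((hft t (.ρ .electron)).rsmul (P.q .electron))).rsmul (4 * Real.pi)).congr
        (.of_forall fun k => ?_)
      have := (ho k).divE t
      simp only [symbols_X, collect_apply, Complex.real_smul] at this
      refine Eq.trans ?_ this.symm
      simp [Plasma.q]
      ring
    · refine (HasFT.div fun j => hft t (.B j)).dist_eq (HasFT.zero.congr (.of_forall fun k => ?_))
      exact ((ho k).divB t).symm
  · exact hasTimeDeriv_of_hasFT (fun t _ => hft t (.ρ a))
      (fun t _ => (HasFT.div fun j => hft t (.u a j)).neg) fun φ t _ => hweak (.ρ a) φ t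
  · refine hasTimeDeriv_of_hasFT (fun t _ => (hft t (.u a j)).rsmul (P.m a))
      (fun t _ => ((((hft t (.ρ a)).pderiv j).rsmul (P.T a)).neg.add
        ((hft t (.E j)).rsmul (P.q a))).sub ((hft t (.u a j)).rsmul (P.m a * P.ν a)))
      fun φ t _ => ?_
    have hm : ((P.m a : ℝ) : ℂ) ≠ 0 := by exact_mod_cast (P.m_pos a).ne'
    convert! (hweak (.u a j) φ t).const_mul ((P.m a : ℝ) : ℂ) using 1
    · ext s
      rw [← integral_const_mul]
      congr 1; ext k; ring
    · rw [← integral_const_mul]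
      congr 1; ext k
      simp only [symbolFun, Plasma.f]
      push_cast
      field_simp
  · exact hasTimeDeriv_of_hasFT (fun t _ => hft t (.E j))
      (fun t _ => ((HasFT.curl (fun j => hft t (.B j)) j).rsmul P.c).sub
        ((((hft t (.u .ion j)).rsmul (P.q .ion)).add
          ((hft t (.u .electron j)).rsmul (P.q .electron))).rsmul (4 * Real.pi)))
      fun φ t _ => hweak (.E j) φ t
  · exact hasTimeDeriv_of_hasFT (fun t _ => hft t (.B j))
      (fun t _ => ((HasFT.curl (fun j => hft t (.E j)) j).rsmul P.c).neg)
      fun φ t _ => hweak (.B j) φ t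

end EulerMaxwell

end

/-! ### Norms of distributions under dilation -/

section

open MeasureTheory SchwartzMap LineDeriv
open scoped ENNReal NNReal

namespace EulerMaxwell

/-- The representing function is unique almost everywhere, so the infimum runs over a single class.
-/
theorem distNorm_eq {s : ℝ≥0∞} (hs : 1 ≤ s) {T : Dist} {g : Space → ℂ} (hg : MemLp g s)
    (hT : ∀ φ : 𝓢(Space, ℂ), T φ = ∫ x, φ x * g x) : distNorm s T = eLpNorm g s volume := by
  refine le_antisymm (iInf₂_le g ⟨hg, hT⟩) (le_iInf₂ fun f ⟨hf, hTf⟩ => le_of_eq ?_)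
  refine eLpNorm_congr_ae (ae_eq_of_integral_contDiff_smul_eq (hg.locallyIntegrable hs)
    (hf.locallyIntegrable hs) fun χ hχ hχc => ?_)
  have h1 : HasCompactSupport (Complex.ofRealCLM ∘ χ) := hχc.comp_left rfl
  have h2 : ContDiff ℝ (⊤ : ℕ∞) (Complex.ofRealCLM ∘ χ) := Complex.ofRealCLM.contDiff.comp hχ
  have e := (hT (h1.toSchwartzMap h2)).symm.trans (hTf (h1.toSchwartzMap h2))
  simpa using e

theorem distNorm_sub_le {s : ℝ≥0∞} (hs : 1 ≤ s) (S T : Dist) :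
    distNorm s (S - T) ≤ distNorm s S + distNorm s T := by
  have h : ∀ T : Dist, distNorm s T = ∞ ∨
      ∃ g : Space → ℂ, MemLp g s ∧ ∀ φ : 𝓢(Space, ℂ), T φ = ∫ x, φ x * g x := by
    intro T
    by_cases h : ∃ g : Space → ℂ, MemLp g s ∧ ∀ φ : 𝓢(Space, ℂ), T φ = ∫ x, φ x * g x
    · exact .inr h
    · exact .inl (iInf₂_eq_top.2 fun g hg => (h ⟨g, hg⟩).elim)
  rcases h S with h | ⟨g, hg, hSg⟩
  · rw [h, top_add]; exact le_top
  rcases h T with h | ⟨f, hf, hTf⟩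
  · rw [h, add_top]; exact le_top
  rw [distNorm_eq hs hg hSg, distNorm_eq hs hf hTf]
  refine (iInf₂_le (g - f) ⟨hg.sub hf, fun φ => ?_⟩).trans (eLpNorm_sub_le hg.1 hf.1 hs)
  simp only [Pi.sub_apply, mul_sub]
  rw [integral_sub (memLp_integrable hs hg φ) (memLp_integrable hs hf φ), ← hSg,
    ← hTf]
  rfl

theorem nablaNorm_sub_le {s : ℝ≥0∞} (hs : 1 ≤ s) (m : ℕ) (S T : Dist) :
    nablaNorm m s (S - T) ≤ nablaNorm m s S + nablaNorm m s T := by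
  rw [nablaNorm, nablaNorm, nablaNorm, ← Finset.sum_add_distrib]
  refine Finset.sum_le_sum fun J _ => ?_
  have h : ∂^{fun i => basisVec (J i)} (S - T) =
      ∂^{fun i => basisVec (J i)} S - ∂^{fun i => basisVec (J i)} T := by
    exact map_sub (iteratedLineDerivOpCLM ℂ Dist fun i => basisVec (J i)) S T
  rw [h]
  exact distNorm_sub_le hs _ _

theorem distNorm_of_hasFT {s : ℝ≥0∞} (hs : 1 ≤ s) {T : Dist} {K : 𝓢(Space, ℂ)} (hT : HasFT T K) :
    distNorm s T = eLpNorm (FourierTransformInv.fourierInv K : 𝓢(Space, ℂ)) s volume := by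
  refine distNorm_eq hs (SchwartzMap.memLp _ _ _) fun φ => ?_
  have h : HasFT (Lp.toTemperedDistribution
      ((FourierTransformInv.fourierInv K : 𝓢(Space, ℂ)).toLp 2 volume)) K := by
    refine (hasFT_Lp _).congr ?_
    rw [SchwartzMap.toLp_fourier_eq, FourierTransform.fourier_fourierInv_eq]
    exact K.coeFn_toLp 2 volume
  rw [hT.dist_eq h, Lp.toTemperedDistribution_apply]
  refine integral_congr_ae ?_
  filter_upwards [(FourierTransformInv.fourierInv K : 𝓢(Space, ℂ)).coeFn_toLp 2 volume] with x hx
  rw [hx, smul_eq_mul]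

/-- Stretching by `1/ε` multiplies the measure by `ε⁻³`, hence the norm by `ε^(-3/s)`; this includes
`s = ∞`. -/
theorem eLpNorm_comp_dilation (s : ℝ≥0∞) {g : Space → ℂ} (hg : Continuous g) {ε : ℝ}
    (hε : 0 < ε) : eLpNorm (fun x => g (ε • x)) s volume =
      ENNReal.ofReal (ε ^ (-(3 * (s⁻¹).toReal))) * eLpNorm g s volume := by
  have hm : Measurable fun x : Space => ε • x := measurable_const_smul ε
  have h1 : eLpNorm (fun x => g (ε • x)) s volume =
      eLpNorm g s (Measure.map (fun x : Space => ε • x) volume) :=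
    (eLpNorm_map_measure hg.aestronglyMeasurable hm.aemeasurable).symm
  rw [h1, Measure.map_addHaar_smul _ hε.ne', eLpNorm_smul_measure_of_ne_zero
    (by rw [Ne, ENNReal.ofReal_eq_zero, not_le]; positivity), smul_eq_mul, one_div,
    finrank_euclideanSpace_fin, abs_of_nonneg (by positivity),
    ENNReal.ofReal_rpow_of_pos (by positivity)]
  congr 2
  rw [← Real.rpow_natCast, ← Real.rpow_neg hε.le, ← Real.rpow_mul hε.le]
  congr 1
  push_cast
  ring

theorem fourierInv_dilation (K : Space → ℂ) (c : ℂ) {ε : ℝ} (hε : 0 < ε) (x : Space) :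
    FourierTransformInv.fourierInv (fun k => c * K (ε⁻¹ • k)) x =
      c * (ε : ℂ) ^ 3 * FourierTransformInv.fourierInv K (ε • x) := by
  rw [Real.fourierInv_eq', Real.fourierInv_eq']
  have h := Measure.integral_comp_smul (volume : Measure Space) (fun v =>
    Complex.exp (↑(2 * Real.pi * inner ℝ v (ε • x)) * Complex.I) • (c * K v)) ε⁻¹
  have e : ∀ v : Space, inner ℝ (ε⁻¹ • v) (ε • x) = inner ℝ v x := fun v => by
    rw [inner_smul_left, inner_smul_right]
    simp [hε.ne']
  simp only [e] at h
  rw [h, finrank_euclideanSpace_fin, abs_of_nonneg (by positivity)]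
  simp only [smul_eq_mul, mul_left_comm _ c]
  rw [integral_const_mul, Complex.real_smul]
  push_cast
  rw [inv_pow, inv_inv]
  ring

/-- The norms of distributions with dilated Fourier transforms. -/
theorem distNorm_dilation {s : ℝ≥0∞} (hs : 1 ≤ s) {T : Dist} (K : 𝓢(Space, ℂ)) (c : ℂ) {ε : ℝ}
    (hε : 0 < ε) (hT : HasFT T fun k => c * K (ε⁻¹ • k)) :
    distNorm s T = ‖c‖ₑ * ENNReal.ofReal (ε ^ (3 - 3 * (s⁻¹).toReal)) *
      eLpNorm (FourierTransformInv.fourierInv K : 𝓢(Space, ℂ)) s volume := by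
  obtain ⟨K', hK'⟩ : ∃ K' : 𝓢(Space, ℂ), ∀ k, K' k = c * K (ε⁻¹ • k) :=
    ⟨c • SchwartzMap.compCLMOfContinuousLinearEquiv ℂ
      (ContinuousLinearEquiv.smulLeft (Units.mk0 ε⁻¹ (inv_ne_zero hε.ne'))) K, fun k => rfl⟩
  have hT' : HasFT T K' := hT.congr (.of_forall fun k => (hK' k).symm)
  rw [distNorm_of_hasFT hs hT']
  have h1 : ((FourierTransformInv.fourierInv K' : 𝓢(Space, ℂ)) : Space → ℂ) = fun x =>
      (c * (ε : ℂ) ^ 3) • (FourierTransformInv.fourierInv K : 𝓢(Space, ℂ)) (ε • x) := by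
    ext x
    rw [SchwartzMap.fourierInv_coe, SchwartzMap.fourierInv_coe, smul_eq_mul,
      ← fourierInv_dilation K c hε]
    exact congrArg (fun f : Space → ℂ => (FourierTransformInv.fourierInv f : Space → ℂ) x) (funext hK')
  have h2 := eLpNorm_const_smul (c * (ε : ℂ) ^ 3)
    (fun x => (FourierTransformInv.fourierInv K : 𝓢(Space, ℂ)) (ε • x)) s volume
  rw [h1]
  refine h2.trans ?_
  rw [eLpNorm_comp_dilation s (SchwartzMap.continuous _) hε, enorm_mul, ← mul_assoc, mul_assoc ‖c‖ₑ]
  congr 2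
  have h3 : ‖(ε : ℂ) ^ 3‖ₑ = ENNReal.ofReal (ε ^ (3 : ℝ)) := by
    rw [← ofReal_norm, norm_pow, Complex.norm_real, Real.norm_of_nonneg hε.le]
    norm_cast
  rw [h3, ← ENNReal.ofReal_mul (by positivity), ← Real.rpow_add hε, sub_eq_add_neg]

end EulerMaxwell

end

/-! ### Bounds by powers of the dilation parameter -/

section

open MeasureTheory SchwartzMap LineDeriv
open scoped ENNReal NNReal

namespace EulerMaxwell

/-- Bounds by a power of the small parameter. -/
def PowBound (x : ℝ) (f : ℝ → ℝ≥0∞) : Prop :=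
  ∃ C : ℝ≥0, ∀ ε : ℝ, 0 < ε → ε ≤ 1 → f ε ≤ C * ENNReal.ofReal (ε ^ x)

namespace PowBound

variable {x y : ℝ} {f g : ℝ → ℝ≥0∞}

theorem mono (h : PowBound x f) (hyx : y ≤ x) : PowBound y f := by
  obtain ⟨C, hC⟩ := h
  refine ⟨C, fun ε h0 h1 => (hC ε h0 h1).trans ?_⟩
  exact mul_le_mul_right (ENNReal.ofReal_le_ofReal
    (Real.rpow_le_rpow_of_exponent_ge h0 h1 hyx)) _

theorem of_le (h : PowBound x g) (hfg : ∀ ε, 0 < ε → ε ≤ 1 → f ε ≤ g ε) : PowBound x f := by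
  obtain ⟨C, hC⟩ := h
  exact ⟨C, fun ε h0 h1 => (hfg ε h0 h1).trans (hC ε h0 h1)⟩

theorem add (hf : PowBound x f) (hg : PowBound x g) : PowBound x (fun ε => f ε + g ε) := by
  obtain ⟨C, hC⟩ := hf
  obtain ⟨D, hD⟩ := hg
  refine ⟨C + D, fun ε h0 h1 => ?_⟩
  rw [ENNReal.coe_add, add_mul]
  exact add_le_add (hC ε h0 h1) (hD ε h0 h1)

theorem mul (hf : PowBound x f) (hg : PowBound y g) : PowBound (x + y) (fun ε => f ε * g ε) := by
  obtain ⟨C, hC⟩ := hf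
  obtain ⟨D, hD⟩ := hg
  refine ⟨C * D, fun ε h0 h1 => ?_⟩
  rw [Real.rpow_add h0, ENNReal.ofReal_mul (by positivity), ENNReal.coe_mul, mul_mul_mul_comm]
  exact mul_le_mul' (hC ε h0 h1) (hD ε h0 h1)

theorem const_mul (C : ℝ≥0) (hf : PowBound x f) : PowBound x (fun ε => C * f ε) := by
  obtain ⟨D, hD⟩ := hf
  refine ⟨C * D, fun ε h0 h1 => ?_⟩
  rw [ENNReal.coe_mul, mul_assoc]
  exact mul_le_mul_right (hD ε h0 h1) _

theorem sum {ι : Type*} (s : Finset ι) {f : ι → ℝ → ℝ≥0∞} (hf : ∀ i ∈ s, PowBound x (f i)) :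
    PowBound x (fun ε => ∑ i ∈ s, f i ε) := by
  classical
  induction s using Finset.induction_on with
  | empty => exact ⟨0, fun ε _ _ => by simp⟩
  | insert a s ha ih =>
    simp only [Finset.sum_insert ha]
    exact (hf a (by simp)).add (ih fun i hi => hf i (by simp [hi]))

/-- A power is not bounded by higher powers. -/
theorem not_lt {c : ℝ≥0∞} (hc : c ≠ 0) (hf : PowBound x f)
    (hle : ∀ ε, 0 < ε → ε ≤ 1 → c * ENNReal.ofReal (ε ^ y) ≤ f ε) : x ≤ y := by
  by_contra! hyx
  obtain ⟨C, hC⟩ := hf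
  have h1 : ∀ ε, 0 < ε → ε ≤ 1 → c ≤ C * ENNReal.ofReal (ε ^ (x - y)) := by
    intro ε h0 h1
    have hpos : 0 < ε ^ y := Real.rpow_pos_of_pos h0 y
    have h2 := (hle ε h0 h1).trans (hC ε h0 h1)
    have h3 : ε ^ x = ε ^ (x - y) * ε ^ y := by rw [← Real.rpow_add h0, sub_add_cancel]
    rw [h3, ENNReal.ofReal_mul (by positivity), ← mul_assoc] at h2
    exact (ENNReal.mul_le_mul_iff_left (ENNReal.ofReal_pos.2 hpos).ne' ENNReal.ofReal_ne_top).1 h2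
  have h2 : Filter.Tendsto (fun ε : ℝ => (C : ℝ≥0∞) * ENNReal.ofReal (ε ^ (x - y)))
      (nhdsWithin 0 (Set.Ioi 0)) (nhds (C * ENNReal.ofReal 0)) := by
    refine ENNReal.Tendsto.const_mul (ENNReal.tendsto_ofReal ?_) (.inr ENNReal.coe_ne_top)
    have := (Real.continuousAt_rpow_const 0 (x - y) (.inr (by linarith))).tendsto
    rw [Real.zero_rpow (by linarith)] at this
    exact this.mono_left nhdsWithin_le_nhds
  rw [ENNReal.ofReal_zero, mul_zero] at h2
  refine hc (le_zero_iff.1 (ge_of_tendsto h2 ?_))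
  filter_upwards [Ioo_mem_nhdsGT (zero_lt_one' ℝ)] with ε hε
  exact h1 ε hε.1 hε.2.le

/-- Algebraic decay at the diffusive time scale. -/
theorem of_algDecay {s : ℝ} (hs : 0 ≤ s) :
    PowBound (2 * s) (fun ε => algDecay (ε ^ 2)⁻¹ s) := by
  refine ⟨1, fun ε h0 h1 => ?_⟩
  rw [ENNReal.coe_one, one_mul]
  change ENNReal.ofReal ((1 + (ε ^ 2)⁻¹) ^ (-s)) ≤ _
  refine ENNReal.ofReal_le_ofReal ?_
  calc (1 + (ε ^ 2)⁻¹) ^ (-s) ≤ ((ε ^ 2)⁻¹) ^ (-s) :=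
        Real.rpow_le_rpow_of_nonpos (by positivity) (by linarith) (by linarith)
    _ = ε ^ (2 * s) := by
        rw [Real.inv_rpow (by positivity), ← Real.rpow_neg (by positivity), neg_neg,
          Real.rpow_mul h0.le]
        norm_cast

/-- Exponential decay at the diffusive time scale. -/
theorem of_expDecay {lam : ℝ} (hlam : 0 < lam) (x : ℝ) :
    PowBound x (fun ε => expDecay lam (ε ^ 2)⁻¹) := by
  -- At time `ε⁻²` the exponential is smaller than any power; an even exponent `2n ≥ x` is used
  -- because the estimate is in powers of `ε²`.
  obtain ⟨n, hn⟩ := exists_nat_ge x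
  have hx : x ≤ ((2 * n : ℕ) : ℝ) := by push_cast; linarith [Nat.cast_nonneg (α := ℝ) n]
  refine PowBound.mono ⟨(n.factorial / lam ^ n).toNNReal, fun ε h0 h1 => ?_⟩ hx
  change ENNReal.ofReal _ ≤ ENNReal.ofReal _ * _
  rw [← ENNReal.ofReal_mul (by positivity)]
  refine ENNReal.ofReal_le_ofReal ?_
  have h2 := Real.pow_div_factorial_le_exp (lam * (ε ^ 2)⁻¹) (by positivity) n
  rw [Real.exp_neg, Real.rpow_natCast, pow_mul]
  have h3 : (n.factorial / lam ^ n * (ε ^ 2) ^ n : ℝ) =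
      ((lam * (ε ^ 2)⁻¹) ^ n / n.factorial)⁻¹ := by
    rw [mul_pow, inv_pow, inv_div]
    field_simp
  rw [h3]
  exact inv_anti₀ (by positivity) h2

end PowBound

theorem plusIndex_ge {r q : ℝ≥0∞} (hr1 : 1 ≤ r) (hr2 : r ≤ 2) (hq : 2 ≤ q) {ℓ : ℝ} (hℓ : 0 ≤ ℓ) :
    ℓ + 3 * ((r⁻¹).toReal - (q⁻¹).toReal) ≤ plusIndex ℓ r q := by
  obtain ⟨h1, h2⟩ := plusIndex_spec hr1 hr2 hq hℓ
  rw [← toReal_sub hr1 (hr2.trans hq)]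
  by_cases h : r⁻¹ - q⁻¹ = 0
  · simpa [h] using h1
  · exact (h2 h).le

theorem ik_dilation (j : Fin 3) {ε : ℝ} (hε : 0 < ε) (k : Space) :
    ik j k = (ε : ℂ) * ik j (ε⁻¹ • k) := by
  have : (ε : ℂ) ≠ 0 := by exact_mod_cast hε.ne'
  rw [ik_eq, ik_eq, PiLp.smul_apply, smul_eq_mul]
  push_cast
  field_simp

section Dilation

variable {s : ℝ≥0∞} {K : Space → ℂ} {N : ℕ}

/-- The symbol of a derivative is homogeneous, so `N` derivatives yield `ε^N`; the Jacobian and the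
`L^s` norm give `ε^(3-3/s)`. The constant is a fixed norm independent of ε. -/
theorem distNorm_iterated_dilation (hs : 1 ≤ s) (hK : ContDiff ℝ (⊤ : ℕ∞) K)
    (hKc : HasCompactSupport K) (J : Fin N → Fin 3) :
    ∃ L : 𝓢(Space, ℂ), (∀ k, L k = (∏ i, ik (J i) k) * K k) ∧ ∀ ε : ℝ, 0 < ε → ∀ T : Dist,
      HasFT T (fun k => K (ε⁻¹ • k)) → distNorm s (∂^{fun i => basisVec (J i)} T) =
        eLpNorm (FourierTransformInv.fourierInv L : 𝓢(Space, ℂ)) s volume *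
          ENNReal.ofReal (ε ^ (N + (3 - 3 * (s⁻¹).toReal))) := by
  obtain ⟨L, hL⟩ := exists_schwartz ((contDiff_prod fun i _ => contDiff_ik (J i)).mul hK)
    (hKc.mul_left (f := fun k => ∏ i, ik (J i) k))
  refine ⟨L, hL, fun ε hε T hT => ?_⟩
  have h : HasFT (∂^{fun i => basisVec (J i)} T) fun k => (ε : ℂ) ^ N * L (ε⁻¹ • k) := by
    refine (hT.iterated J).congr (.of_forall fun k => ?_)
    change (∏ i, ik (J i) k) * K (ε⁻¹ • k) = _ * L (ε⁻¹ • k)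
    rw [hL, ← mul_assoc]
    congr 1
    rw [Finset.prod_congr rfl fun i _ => ik_dilation (J i) hε k, Finset.prod_mul_distrib]
    simp
  rw [distNorm_dilation hs L _ hε h, mul_comm]
  congr 1
  have h3 : ‖(ε : ℂ) ^ N‖ₑ = ENNReal.ofReal (ε ^ (N : ℝ)) := by
    rw [← ofReal_norm, norm_pow, Complex.norm_real, Real.norm_of_nonneg hε.le]
    norm_cast
  rw [h3, ← ENNReal.ofReal_mul (by positivity), ← Real.rpow_add hε]

theorem powBound_nablaNorm (hs : 1 ≤ s) (hK : ContDiff ℝ (⊤ : ℕ∞) K) (hKc : HasCompactSupport K)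
    (N : ℕ) {T : ℝ → Dist} (hT : ∀ ε, 0 < ε → HasFT (T ε) (fun k => K (ε⁻¹ • k))) :
    PowBound (N + (3 - 3 * (s⁻¹).toReal)) (fun ε => nablaNorm N s (T ε)) := by
  refine PowBound.sum _ fun J _ => ?_
  obtain ⟨L, -, h⟩ := distNorm_iterated_dilation hs hK hKc J
  refine ⟨(eLpNorm (FourierTransformInv.fourierInv L : 𝓢(Space, ℂ)) s volume).toNNReal,
    fun ε h0 _ => ?_⟩
  refine le_of_eq ((h ε h0 _ (hT ε h0)).trans ?_)
  rw [ENNReal.coe_toNNReal (SchwartzMap.memLp _ _ _).2.ne]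

/-- The single derivative `∂_j^N` suffices: its transform does not vanish at `k`, so its norm is
nonzero. -/
theorem nablaNorm_dilation_ge (hs : 1 ≤ s) (hK : ContDiff ℝ (⊤ : ℕ∞) K) (hKc : HasCompactSupport K)
    (N : ℕ) {k : Space} {j : Fin 3} (hk : K k ≠ 0) (hj : ik j k ≠ 0) {T : ℝ → Dist}
    (hT : ∀ ε, 0 < ε → HasFT (T ε) (fun k => K (ε⁻¹ • k))) :
    ∃ c : ℝ≥0∞, c ≠ 0 ∧ ∀ ε, 0 < ε →
      c * ENNReal.ofReal (ε ^ (N + (3 - 3 * (s⁻¹).toReal))) ≤ nablaNorm N s (T ε) := by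
  obtain ⟨L, hL, h⟩ := distNorm_iterated_dilation hs hK hKc (fun _ : Fin N => j)
  refine ⟨_, ?_, fun ε h0 => (h ε h0 _ (hT ε h0)).symm.le.trans
    (Finset.single_le_sum (f := fun J : Fin N → Fin 3 => distNorm s (∂^{fun i => basisVec (J i)} (T ε)))
      (fun _ _ => zero_le) (Finset.mem_univ _))⟩
  rw [Ne, eLpNorm_eq_zero_iff (SchwartzMap.continuous _).aestronglyMeasurable
    (zero_lt_one.trans_le hs).ne', Continuous.ae_eq_iff_eq volume (SchwartzMap.continuous _)
    continuous_zero]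
  intro h0
  have h1 : (FourierTransformInv.fourierInv L : 𝓢(Space, ℂ)) = 0 := DFunLike.coe_injective h0
  have h2 : L = 0 := by
    rw [← FourierTransform.fourier_fourierInv_eq (F := 𝓢(Space, ℂ)) L, h1]
    exact map_zero (SchwartzMap.fourierTransformCLM ℂ)
  have h3 := hL k
  rw [h2] at h3
  refine mul_ne_zero (Finset.prod_ne_zero_iff.2 fun _ _ => hj) hk h3.symm

end Dilation

end EulerMaxwell

end

/-! ### Optimality of the heat rate -/

section

open MeasureTheory SchwartzMap LineDeriv
open scoped ENNReal NNReal ComplexConjugate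

namespace EulerMaxwell

section Family

variable {w : Comp → Space → ℂ} {V : ℝ → Fields L2} {p q r : ℝ≥0∞}

theorem powBound_nablaNormAll (hw : ∀ b, ContDiff ℝ (⊤ : ℕ∞) (w b))
    (hwc : ∀ b, HasCompactSupport (w b))
    (hV : ∀ ε, 0 < ε → ∀ b, HasFT (comps (V ε).toDist b) (fun k => w b (ε⁻¹ • k)))
    {s : ℝ≥0∞} (hs : 1 ≤ s) (N : ℕ) :
    PowBound (N + (3 - 3 * (s⁻¹).toReal)) (fun ε => nablaNormAll N s (V ε).toDist) := by
  simp only [← partNorm_all]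
  exact PowBound.sum _ fun b _ => powBound_nablaNorm hs (hw b) (hwc b) N fun ε hε => hV ε hε b

theorem nablaNormRhoB_le_all (N : ℕ) (s : ℝ≥0∞) (U : Fields Dist) :
    nablaNormRhoB N s U ≤ nablaNormAll N s U := by
  rw [nablaNormAll, nablaNormRhoB]
  gcongr
  simp only [add_assoc]
  exact le_self_add

theorem inv_toReal_le {p q : ℝ≥0∞} (hp1 : 1 ≤ p) (hpq : p ≤ q) :
    (q⁻¹).toReal ≤ (p⁻¹).toReal :=
  ENNReal.toReal_mono (ENNReal.inv_ne_top.2 (zero_lt_one.trans_le hp1).ne')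
    (ENNReal.inv_le_inv.2 hpq)

/-- The `L^p` norm dominates as ε tends to zero. The derivative terms have exponents at least `m + 3
- 3/q`, because the index compensates `3/r - 3/q`, and this is at least `3 - 3/p`. -/
theorem powBound_dataNorm (hw : ∀ b, ContDiff ℝ (⊤ : ℕ∞) (w b))
    (hwc : ∀ b, HasCompactSupport (w b))
    (hV : ∀ ε, 0 < ε → ∀ b, HasFT (comps (V ε).toDist b) (fun k => w b (ε⁻¹ • k)))
    (hp1 : 1 ≤ p) (hp2 : p ≤ 2) (hr1 : 1 ≤ r) (hr2 : r ≤ 2) (hq : 2 ≤ q) {ℓ : ℝ} (hℓ : 0 ≤ ℓ)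
    (m : ℕ) :
    PowBound (3 - 3 * (p⁻¹).toReal) (fun ε => dataNorm m p q r ℓ (V ε).toDist) := by
  have hqp := inv_toReal_le hp1 (hp2.trans hq)
  have hm : (0 : ℝ) ≤ m := Nat.cast_nonneg m
  have h := fun {s : ℝ≥0∞} (hs : 1 ≤ s) N => powBound_nablaNormAll hw hwc hV hs N
  have i1 := plusIndex_ge hr1 hr2 hq hℓ
  have i0 := plusIndex_ge hr1 hr2 hq le_rfl
  refine (((h hp1 0).mono ?_).add ((h hr1 (m + plusIndex ℓ r q)).mono ?_)).add
    (((h hr1 (m + plusIndex 0 r q)).of_le fun ε _ _ => nablaNormRhoB_le_all _ _ _).mono ?_)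
  · simp
  · push_cast; linarith
  · push_cast; linarith

/-- The exponent is one larger than that of the profile. With `ℓ = 1` the regularity term also
qualifies: it gains one power of ε from the time weight and one from the additional derivative. -/
theorem powBound_error (hw : ∀ b, ContDiff ℝ (⊤ : ℕ∞) (w b))
    (hwc : ∀ b, HasCompactSupport (w b))
    (hV : ∀ ε, 0 < ε → ∀ b, HasFT (comps (V ε).toDist b) (fun k => w b (ε⁻¹ • k)))
    (hp1 : 1 ≤ p) (hp2 : p ≤ 2) (hr1 : 1 ≤ r) (hr2 : r ≤ 2) (hq : 2 ≤ q) {lam : ℝ} (hlam : 0 < lam)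
    (m : ℕ) :
    PowBound (m + 1 + (3 - 3 * (q⁻¹).toReal)) (fun ε =>
      baseBound lam m p q r 1 (m + 1) (V ε).toDist (ε ^ 2)⁻¹ +
        expDecay lam (ε ^ 2)⁻¹ * nablaNormAll (m + plusIndex 0 r q) r (V ε).toDist) := by
  have hqp := inv_toReal_le hp1 (hp2.trans hq)
  have hm : (0 : ℝ) ≤ m := Nat.cast_nonneg m
  have h := fun {s : ℝ≥0∞} (hs : 1 ≤ s) N => powBound_nablaNormAll hw hwc hV hs N
  have i1 := plusIndex_ge hr1 hr2 hq zero_le_one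
  set y : ℝ := m + 1 + (3 - 3 * (q⁻¹).toReal) with hy
  have he : ∀ {s : ℝ≥0∞} (hs : 1 ≤ s) N, PowBound y (fun ε => expDecay lam (ε ^ 2)⁻¹ *
      nablaNormAll N s (V ε).toDist) := fun {s} hs N =>
    ((PowBound.of_expDecay hlam (y - (N + (3 - 3 * (s⁻¹).toReal)))).mul (h hs N)).mono (by simp)
  refine PowBound.add (PowBound.add (PowBound.add ?_ (he hp1 0)) ?_) (he hr1 _)
  · refine ((PowBound.of_algDecay ?_).mul (h hp1 0)).mono ?_
    · unfold heatExp; push_cast; linarith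
    · unfold heatExp; push_cast; linarith
  · refine ((PowBound.of_algDecay (by norm_num)).mul (h hr1 _)).mono ?_
    push_cast
    linarith

/-- The rate of a family of solutions that is close to a family of diffusion waves. -/
theorem rate_le (hw : ∀ b, ContDiff ℝ (⊤ : ℕ∞) (w b))
    (hwc : ∀ b, HasCompactSupport (w b))
    (hV : ∀ ε, 0 < ε → ∀ b, HasFT (comps (V ε).toDist b) (fun k => w b (ε⁻¹ • k)))
    (hp1 : 1 ≤ p) (hp2 : p ≤ 2) (hr1 : 1 ≤ r) (hr2 : r ≤ 2) (hq : 2 ≤ q) {lam : ℝ} (hlam : 0 < lam)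
    {ℓ σ : ℝ} (hℓ : 0 ≤ ℓ) {m : ℕ} {T T' : ℝ → Dist} {K : Space → ℂ}
    (hK : ContDiff ℝ (⊤ : ℕ∞) K) (hKc : HasCompactSupport K)
    (hT' : ∀ ε, 0 < ε → HasFT (T' ε) (fun k => K (ε⁻¹ • k))) {k : Space} {j : Fin 3}
    (hk : K k ≠ 0) (hj : ik j k ≠ 0) {C C' : ℝ≥0}
    (h₁ : ∀ ε, 0 < ε → nablaNorm m q (T ε) ≤
      C * (algDecay (ε ^ 2)⁻¹ σ * dataNorm m p q r ℓ (V ε).toDist))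
    (h₂ : ∀ ε, 0 < ε → nablaNorm m q (T ε - T' ε) ≤
      C' * (baseBound lam m p q r 1 (m + 1) (V ε).toDist (ε ^ 2)⁻¹ +
        expDecay lam (ε ^ 2)⁻¹ * nablaNormAll (m + plusIndex 0 r q) r (V ε).toDist)) :
    σ ≤ heatExp p q + m / 2 := by
  have hqp := inv_toReal_le hp1 (hp2.trans hq)
  have hm : (0 : ℝ) ≤ m := Nat.cast_nonneg m
  have hq1 : 1 ≤ q := one_le_two.trans hq
  by_contra! hσ
  unfold heatExp at hσ
  have b1 := ((PowBound.of_algDecay (s := σ) (by linarith)).mul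
    (powBound_dataNorm hw hwc hV hp1 hp2 hr1 hr2 hq hℓ m)).const_mul C
  have b2 := (powBound_error hw hwc hV hp1 hp2 hr1 hr2 hq hlam m).const_mul C'
  -- If σ exceeded the heat rate, both exponents would be larger than `m + 3 - 3/q`, the exact power
  -- of the profile.
  set x := min (2 * σ + (3 - 3 * (p⁻¹).toReal)) (m + 1 + (3 - 3 * (q⁻¹).toReal)) with hx
  have b := (b1.mono (min_le_left _ _ : x ≤ _)).add (b2.mono (min_le_right _ _ : x ≤ _))
  obtain ⟨c, hc, hlow⟩ := nablaNorm_dilation_ge hq1 hK hKc m hk hj hT'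
  have := b.not_lt hc fun ε h0 _ => (hlow ε h0).trans (by
    calc nablaNorm m q (T' ε) = nablaNorm m q (T ε - (T ε - T' ε)) := by rw [sub_sub_cancel]
      _ ≤ nablaNorm m q (T ε) + nablaNorm m q (T ε - T' ε) := nablaNorm_sub_le hq1 m _ _
      _ ≤ _ := add_le_add (h₁ ε h0) (h₂ ε h0))
  rcases min_le_iff.1 this with h | h <;> linarith

end Family

/-- Existence of solutions for a family of dilated data. -/
theorem exists_family (P : Plasma) {w : Comp → Space → ℂ} (hw : ∀ b, ContDiff ℝ (⊤ : ℕ∞) (w b))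
    (hwc : ∀ b, HasCompactSupport (w b)) (hwh : ∀ b k, w b (-k) = conj (w b k))
    (hE : ∀ j k, w (.E j) k = 0) (hρ : ∀ k, w (.ρ .ion) k = w (.ρ .electron) k)
    (hB : ∀ k, ∑ j, ik j k * w (.B j) k = 0) :
    ∃ (V : ℝ → Fields L2) (U : ℝ → ℝ → Fields L2), ∀ ε, 0 < ε → IsSolution P (V ε) (U ε) ∧
      ∀ b, HasFT (comps (V ε).toDist b) (fun k => w b (ε⁻¹ • k)) := by
  have h : ∀ ε : ℝ, ∃ (V : Fields L2) (U : ℝ → Fields L2), 0 < ε → IsSolution P V U ∧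
      ∀ b, HasFT (comps V.toDist b) (fun k => w b (ε⁻¹ • k)) := by
    intro ε
    by_cases hε : 0 < ε
    · obtain ⟨V, U, h⟩ := exists_isSolution (P := P) (w := fun b k => w b (ε⁻¹ • k))
        (fun b => (hw b).comp (contDiff_const_smul _))
        (fun b => (hwc b).comp_smul (inv_ne_zero hε.ne'))
        (fun b k => by rw [smul_neg, hwh]) (fun k => by simp [hE, hρ])
        (fun k => by
          simp only [fun j => ik_dilation j hε k, mul_assoc]
          rw [← Finset.mul_sum, hB, mul_zero])
      exact ⟨V, U, fun _ => h⟩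
    · exact ⟨fieldsOf 0, fun _ => fieldsOf 0, fun h => absurd h hε⟩
  choose V U h using h
  exact ⟨V, U, h⟩

/-- A radial cutoff function in frequency space. -/
theorem exists_even_bump : ∃ G : Space → ℂ, ContDiff ℝ (⊤ : ℕ∞) G ∧ HasCompactSupport G ∧
    (∀ k, G (-k) = conj (G k)) ∧ ∀ j, G (basisVec j) ≠ 0 := by
  let χ : ContDiffBump (0 : Space) := ⟨1, 2, one_pos, one_lt_two⟩
  refine ⟨fun k => (χ k : ℂ), Complex.ofRealCLM.contDiff.comp χ.contDiff,
    χ.hasCompactSupport.comp_left (g := Complex.ofRealCLM) rfl, fun k => ?_, fun j => ?_⟩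
  · change ((χ (-k) : ℝ) : ℂ) = conj ((χ k : ℝ) : ℂ)
    rw [χ.neg, Complex.conj_ofReal]
  · have : χ (basisVec j) = 1 := χ.one_of_mem_closedBall (by simp [χ, basisVec])
    simp [this]

/-- The symbol of the heat semigroup at time one. -/
noncomputable def heatSymbol (μ : ℝ) (k : Space) : ℂ :=
  ((Real.exp (-(μ * (2 * Real.pi * ‖k‖) ^ 2 * 1)) : ℝ) : ℂ)

theorem contDiff_heatSymbol (μ : ℝ) : ContDiff ℝ (⊤ : ℕ∞) (heatSymbol μ) := by
  have h : ContDiff ℝ (⊤ : ℕ∞) fun k : Space => ‖k‖ ^ 2 := contDiff_norm_sq ℝ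
  refine Complex.ofRealCLM.contDiff.comp (Real.contDiff_exp.comp ?_)
  simp only [mul_pow]
  fun_prop

theorem heatSymbol_ne_zero (μ : ℝ) (k : Space) : heatSymbol μ k ≠ 0 := by
  rw [heatSymbol]
  exact_mod_cast (Real.exp_pos _).ne'

theorem hasFT_heat_dilation {μ ε : ℝ} (hμ : 0 ≤ μ) (hε : 0 < ε) {T : Dist} {g : Space → ℂ}
    (hT : HasFT T (fun k => g (ε⁻¹ • k))) :
    HasFT (heat μ (ε ^ 2)⁻¹ T) (fun k => (heatSymbol μ * g) (ε⁻¹ • k)) := by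
  refine (hT.heat hμ (by positivity)).congr (.of_forall fun k => ?_)
  simp only [Pi.mul_apply, heatSymbol, norm_smul, norm_inv, Real.norm_of_nonneg hε.le]
  congr 4
  ring

theorem ik_basisVec (j : Fin 3) : ik j (basisVec j) ≠ 0 := by
  simp [ik, basisVec]

variable {p q r : ℝ≥0∞} {m : ℕ} {ℓ σ : ℝ}

/-- Optimality of the heat rate for the densities. -/
theorem density_rate_le (P : Plasma) (hp1 : 1 ≤ p) (hp2 : p ≤ 2) (hr1 : 1 ≤ r) (hr2 : r ≤ 2)
    (hq : 2 ≤ q) (hℓ : 0 ≤ ℓ) {lam : ℝ} (hlam : 0 < lam) (a : Species) {C C' : ℝ≥0}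
    (h₁ : ∀ U₀ U, IsSolution P U₀ U → ∀ t : ℝ, 0 ≤ t → nablaNorm m q ((U t).toDist.ρ a) ≤
      C * (algDecay t σ * dataNorm m p q r ℓ U₀.toDist))
    (h₂ : ∀ U₀ U, IsSolution P U₀ U → ∀ t : ℝ, 0 ≤ t →
      nablaNorm m q ((U t).toDist.ρ a - rhoBar P U₀.toDist t) ≤
        C' * (baseBound lam m p q r 1 (m + 1) U₀.toDist t
          + expDecay lam t * nablaNormRho (m + plusIndex 0 r q) r U₀.toDist)) :
    σ ≤ heatExp p q + m / 2 := by
  obtain ⟨G, hG, hGc, hGh, hG0⟩ := exists_even_bump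
  -- Equal densities carry no charge, so they satisfy Gauss's law with vanishing electric field, and
  -- their friction weighted mean is the bump itself.
  set w : Comp → Space → ℂ := fun b => match b with
    | .ρ _ => G
    | _ => 0 with hwdef
  have hw : ∀ b, ContDiff ℝ (⊤ : ℕ∞) (w b) := by
    rintro (a | ⟨a, j⟩ | j | j)
    exacts [hG, contDiff_const, contDiff_const, contDiff_const]
  have hwc : ∀ b, HasCompactSupport (w b) := by
    rintro (a | ⟨a, j⟩ | j | j)
    exacts [hGc, .zero, .zero, .zero]
  have hwh : ∀ b k, w b (-k) = conj (w b k) := by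
    rintro (a | ⟨a, j⟩ | j | j) k
    exacts [hGh k, (map_zero _).symm, (map_zero _).symm, (map_zero _).symm]
  obtain ⟨V, U, hVU⟩ := exists_family P hw hwc hwh (fun _ _ => rfl) (fun _ => rfl)
    (fun k => by simp [hwdef])
  have hF := P.F_pos.ne'
  refine rate_le (C' := C') hw hwc (fun ε hε => (hVU ε hε).2) hp1 hp2 hr1 hr2 hq hlam hℓ
    (T := fun ε => (U ε (ε ^ 2)⁻¹).toDist.ρ a) (T' := fun ε => rhoBar P (V ε).toDist (ε ^ 2)⁻¹)
    (K := heatSymbol P.μ₁ * G) ((contDiff_heatSymbol _).mul hG) hGc.mul_left (fun ε hε => ?_)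
    (k := basisVec 0) (mul_ne_zero (heatSymbol_ne_zero _ _) (hG0 0)) (ik_basisVec 0)
    (fun ε hε => h₁ _ _ (hVU ε hε).1 _ (by positivity))
    (fun ε hε => (h₂ _ _ (hVU ε hε).1 _ (by positivity)).trans ?_)
  · refine hasFT_heat_dilation P.μ₁_pos.le hε ?_
    have h := (hVU ε hε).2
    refine (((h (.ρ .ion)).rsmul (P.f .ion / P.F)).add
      ((h (.ρ .electron)).rsmul (P.f .electron / P.F))).congr (.of_forall fun k => ?_)
    simp only [hwdef]
    rw [← add_mul, ← Complex.ofReal_add, ← add_div, ← Plasma.F, div_self hF, Complex.ofReal_one,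
      one_mul]
  · gcongr
    exact le_self_add.trans (nablaNormRhoB_le_all _ _ _)

/-- Optimality of the heat rate for the magnetic field. -/
theorem magnetic_rate_le (P : Plasma) (hp1 : 1 ≤ p) (hp2 : p ≤ 2) (hr1 : 1 ≤ r) (hr2 : r ≤ 2)
    (hq : 2 ≤ q) (hℓ : 0 ≤ ℓ) {lam : ℝ} (hlam : 0 < lam) {C C' : ℝ≥0}
    (h₁ : ∀ U₀ U, IsSolution P U₀ U → ∀ t : ℝ, 0 ≤ t → nablaNormVec m q (U t).toDist.B ≤
      C * (algDecay t σ * dataNorm m p q r ℓ U₀.toDist))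
    (h₂ : ∀ U₀ U, IsSolution P U₀ U → ∀ t : ℝ, 0 ≤ t →
      nablaNormVec m q ((U t).toDist.B - BBar P U₀.toDist t) ≤
        C' * (baseBound lam m p q r 1 (m + 1) U₀.toDist t
          + expDecay lam t * nablaNormVec (m + plusIndex 0 r q) r U₀.toDist.B)) :
    σ ≤ heatExp p q + m / 2 := by
  obtain ⟨G, hG, hGc, hGh, hG0⟩ := exists_even_bump
  -- The rotated gradient `(∂₁G, -∂₀G, 0)`, on the Fourier side, is a divergence free magnetic
  -- field; the other components vanish.
  set w : Comp → Space → ℂ := fun b => match b with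
    | .B j => ![ik 1 * G, -(ik 0 * G), 0] j
    | _ => 0 with hwdef
  have hw : ∀ b, ContDiff ℝ (⊤ : ℕ∞) (w b) := by
    rintro (a | ⟨a, j⟩ | j | j)
    · exact contDiff_const
    · exact contDiff_const
    · exact contDiff_const
    · fin_cases j
      exacts [(contDiff_ik 1).mul hG, ((contDiff_ik 0).mul hG).neg, contDiff_const]
  have hwc : ∀ b, HasCompactSupport (w b) := by
    rintro (a | ⟨a, j⟩ | j | j)
    · exact .zero
    · exact .zero
    · exact .zero
    · fin_cases j
      exacts [hGc.mul_left, hGc.mul_left.neg, .zero]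
  have hwh : ∀ b k, w b (-k) = conj (w b k) := by
    rintro (a | ⟨a, j⟩ | j | j) k
    · exact (map_zero _).symm
    · exact (map_zero _).symm
    · exact (map_zero _).symm
    · fin_cases j <;> simp [hwdef, ik_neg, hGh]
  obtain ⟨V, U, hVU⟩ := exists_family P hw hwc hwh (fun _ _ => rfl) (fun _ => rfl)
    (fun k => by simp [hwdef, Fin.sum_univ_three]; ring)
  have hle : ∀ v : Fin 3 → Dist, nablaNorm m q (v 0) ≤ nablaNormVec m q v := fun v =>
    Finset.single_le_sum (f := fun j => nablaNorm m q (v j)) (fun _ _ => zero_le) (Finset.mem_univ 0)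
  -- One component of the magnetic field is enough for the lower bound; its transform is nonzero at
  -- the unit vector in direction `1`.
  refine rate_le (C' := C') hw hwc (fun ε hε => (hVU ε hε).2) hp1 hp2 hr1 hr2 hq hlam hℓ
    (T := fun ε => (U ε (ε ^ 2)⁻¹).toDist.B 0) (T' := fun ε => BBar P (V ε).toDist (ε ^ 2)⁻¹ 0)
    (K := heatSymbol P.μ₂ * (ik 1 * G)) ((contDiff_heatSymbol _).mul ((contDiff_ik 1).mul hG))
    hGc.mul_left.mul_left (fun ε hε => ?_)
    (k := basisVec 1) (mul_ne_zero (heatSymbol_ne_zero _ _) (mul_ne_zero (ik_basisVec 1) (hG0 1)))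
    (ik_basisVec 1) (fun ε hε => (hle _).trans (h₁ _ _ (hVU ε hε).1 _ (by positivity)))
    (fun ε hε => ((hle _).trans (h₂ _ _ (hVU ε hε).1 _ (by positivity))).trans ?_)
  · exact hasFT_heat_dilation P.μ₂_pos.le hε ((hVU ε hε).2 (.B 0))
  · gcongr
    exact le_add_self.trans (nablaNormRhoB_le_all _ _ _)

end EulerMaxwell

end

open EulerMaxwell in
theorem corollary4p1 (P : Plasma) (hP : P.disc ≠ 0) :
    ∃ lam : ℝ, 0 < lam ∧
      ∀ (m : ℕ) (p q r : ℝ≥0∞) (ℓ : ℝ),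
        1 ≤ p → p ≤ 2 → 1 ≤ r → r ≤ 2 → 2 ≤ q → 0 ≤ ℓ →
        -- convergence to the profile, and decay
        (∃ C : ℝ≥0, ∀ (U₀ : Fields L2) (U : ℝ → Fields L2), IsSolution P U₀ U →
          ∀ t : ℝ, 0 ≤ t →
          (∀ a : Species,
            nablaNorm m q ((U t).toDist.ρ a - rhoBar P U₀.toDist t)
              ≤ C * (baseBound lam m p q r ℓ (m + 1) U₀.toDist t
                + expDecay lam t * nablaNormRho (m + plusIndex 0 r q) r U₀.toDist)) ∧
          (∀ a : Species,
            nablaNormVec m q ((U t).toDist.u a - uBar P U₀.toDist a t)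
              ≤ C * (baseBound lam m p q r ℓ (m + 2) U₀.toDist t
                + expDecay lam t * nablaNormRhoB (m + 1 + plusIndex 0 r q) r U₀.toDist)) ∧
          (nablaNormVec m q ((U t).toDist.E - EBar P U₀.toDist t)
              ≤ C * (baseBound lam m p q r ℓ (m + 2) U₀.toDist t
                + expDecay lam t * nablaNormRhoB (m + 1 + plusIndex 0 r q) r U₀.toDist)) ∧
          (nablaNormVec m q ((U t).toDist.B - BBar P U₀.toDist t)
              ≤ C * (baseBound lam m p q r ℓ (m + 1) U₀.toDist t
                + expDecay lam t * nablaNormVec (m + plusIndex 0 r q) r U₀.toDist.B)) ∧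
          (∀ a : Species,
            nablaNorm m q ((U t).toDist.ρ a)
              ≤ C * (baseBound lam m p q r ℓ (m + 1) U₀.toDist t
                + expDecay lam t * nablaNormRho (m + plusIndex 0 r q) r U₀.toDist
                + algDecay t (heatExp p q + m / 2) * nablaNormRho 0 p U₀.toDist)) ∧
          (∀ a : Species,
            nablaNormVec m q ((U t).toDist.u a)
              ≤ C * (baseBound lam m p q r ℓ (m + 2) U₀.toDist t
                + expDecay lam t * nablaNormRhoB (m + 1 + plusIndex 0 r q) r U₀.toDist
                + algDecay t (heatExp p q + (m + 1) / 2) * nablaNormRhoB 0 p U₀.toDist)) ∧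
          (nablaNormVec m q (U t).toDist.E
              ≤ C * (baseBound lam m p q r ℓ (m + 2) U₀.toDist t
                + expDecay lam t * nablaNormRhoB (m + 1 + plusIndex 0 r q) r U₀.toDist
                + algDecay t (heatExp p q + (m + 1) / 2) * nablaNormRhoB 0 p U₀.toDist)) ∧
          (nablaNormVec m q (U t).toDist.B
              ≤ C * (baseBound lam m p q r ℓ (m + 1) U₀.toDist t
                + expDecay lam t * nablaNormVec (m + plusIndex 0 r q) r U₀.toDist.B
                + algDecay t (heatExp p q + m / 2) * nablaNormVec 0 p U₀.toDist.B))) ∧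
        -- optimality of the heat rate for `ρ_α` and for `B`
        (∀ (a : Species) (σ : ℝ),
          (∃ C : ℝ≥0, ∀ (U₀ : Fields L2) (U : ℝ → Fields L2), IsSolution P U₀ U →
            ∀ t : ℝ, 0 ≤ t →
              nablaNorm m q ((U t).toDist.ρ a)
                ≤ C * (algDecay t σ * dataNorm m p q r ℓ U₀.toDist)) →
          σ ≤ heatExp p q + m / 2) ∧
        (∀ σ : ℝ,
          (∃ C : ℝ≥0, ∀ (U₀ : Fields L2) (U : ℝ → Fields L2), IsSolution P U₀ U →
            ∀ t : ℝ, 0 ≤ t →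
              nablaNormVec m q (U t).toDist.B
                ≤ C * (algDecay t σ * dataNorm m p q r ℓ U₀.toDist)) →
          σ ≤ heatExp p q + m / 2) := by
  obtain ⟨lam, hlam, h⟩ := convergence_and_decay P
  refine ⟨lam, hlam, fun m p q r ℓ hp1 hp2 hr1 hr2 hq hℓ =>
    ⟨h m p q r ℓ hp1 hp2 hr1 hr2 hq hℓ, fun a σ ⟨C, hC⟩ => ?_, fun σ ⟨C, hC⟩ => ?_⟩⟩
  -- The comparison with the profile uses `ℓ = 1` regardless of the ℓ in the assumed bound, so that
  -- the error is of higher order even for `ℓ = 0`.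
  · obtain ⟨C', hC'⟩ := h m p q r 1 hp1 hp2 hr1 hr2 hq zero_le_one
    exact density_rate_le P hp1 hp2 hr1 hr2 hq hℓ hlam a hC
      fun U₀ U hU t ht => (hC' U₀ U hU t ht).1 a
  · obtain ⟨C', hC'⟩ := h m p q r 1 hp1 hp2 hr1 hr2 hq zero_le_one
    exact magnetic_rate_le P hp1 hp2 hr1 hr2 hq hℓ hlam hC
      fun U₀ U hU t ht => (hC' U₀ U hU t ht).2.2.2.1
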